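/- Throughout, $n\ge 3$ and $M^n$ is one of the model spaces $\mathbb R^n$, $\mathbb S^n\subset\mathbb R^{n+1}$, or $\mathbb H^n=\{y=(\underline y,y_0)\in\mathbb R^n\times\mathbb R:\langle y,y\rangle_1=-1,\ y_0>0\}$, where $\langle x,y\rangle_1=\langle\underline x,\underline y\rangle-x_0y_0$; vectors of $\mathbb R^{n+1}$ are written $\xi=(\underline\xi,\xi_0)$. **Definitions.** A generalized $q$-partition ($2\le q\le\infty$) of $M^n$ is a family $\Omega=(\Omega_i)$ of pairwise disjoint Borel sets of locally finite perimeter that cover $M^n$ up to a null set; it is a partition if every compact set meets only finitely many cells. Put $\Sigma_{ij}=\partial^*\Omega_i\cap\partial^*\Omega_j$ ($i\ne j$), where $\partial^*$ is the reduced boundary, $\Sigma=\bigcup_i\partial\Omega_i$ and $\Sigma^1=\bigcup_{i<j}\Sigma_{ij}$; $\mathbf n_{ij}$ is the unit normal to $\Sigma_{ij}$ pointing from $\Omega_i$ to $\Omega_j$. A partition is regular if: its cells are open with $\overline{\partial^*\Omega_i}=\partial\Omega_i$ and $\mathcal H^{n-1}(\partial\Omega_i\setminus\partial^*\Omega_i)=0$;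 $\Sigma$ is the disjoint union of $\Sigma^1,\Sigma^2,\Sigma^3,\Sigma^4$, where near the points of $\Sigma^1,\Sigma^2$ it is $C^\infty$-diffeomorphic to $\{0\}\times\mathbb R^{n-1}$, $\mathbf Y\times\mathbb R^{n-2}$ respectively, near the points of $\Sigma^3$ it is $C^{1,\alpha}$-diffeomorphic to $\mathbf T\times\mathbb R^{n-3}$ (for some $\alpha>0$), and $\Sigma^4$ is closed with locally finite $\mathcal H^{n-4}$-measure (here $\mathbf Y$, $\mathbf T$ consist of the points of the hyperplane $\sum_i x_i=0$ in $\mathbb R^3$, resp. $\mathbb R^4$, whose maximal coordinate is attained at least twice); for each compact $K$ there are $\Lambda_K,r_K>0$ with $\mathcal H^{n-1}(\Sigma\cap B(x,r))\le\Lambda_K r^{n-1}$ for $x\in\Sigma\cap K$, $r<r_K$; and there is $\epsilon>0$ such that whenever a connected component of a cell has lower density less than $\epsilon$ at a point $p$, then $p$ is not in its closure. $\Sigma_{ijk}$ is the set of points of $\Sigma^2$ in $\overline{\Omega_i}\cap\overline{\Omega_j}\cap\overline{\Omega_k}$, and $\mathbf n_{\partial ij}$ is the outer unit conormal of $\Sigma_{ij}$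 along $\Sigma_{ijk}$. A spherical Voronoi generalized partition of $\mathbb S^n$ has non-empty cells and parameters $\mathfrak c_i\in\mathbb R^{n+1}$, $\kappa_i\in\mathbb R$ such that, with $\mathfrak c_{ij}=\mathfrak c_i-\mathfrak c_j$, $\kappa_{ij}=\kappa_i-\kappa_j$, one has $\Omega_i=\{p\in\mathbb S^n:\langle\mathfrak c_{ij},p\rangle+\kappa_{ij}<0\ \ \forall j\ne i\}$, and each non-empty $\Sigma_{ij}$ is a relatively open subset of the geodesic sphere with quasi-center $\mathfrak c_{ij}$ and curvature $\kappa_{ij}$ (i.e. with unit normal $\mathfrak c_{ij}+\kappa_{ij}p$). In $\mathbb H^n$ a spherical Voronoi partition is defined in the same way with generalized spheres and $\Omega_i=\{y\in\mathbb H^n:\langle\mathfrak c_{ij},y\rangle_1-\kappa_{ij}<0\ \ \forall j\neq i\}$. In $\mathbb R^n$ it is a partition of the form $\pi_{\mathbb R}^{-1}(\Omega^{\mathbb S})$, with $\Omega^{\mathbb S}$ a spherical Voronoi generalized partition of $\mathbb S^n$ and $\pi_{\mathbb R}$ the stereographic projection. It is Möbius-flat if a single Möbius automorphism of $\mathbb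 S^n$ maps all non-empty interfaces $\Sigma_{ij}$ (of $\Omega^{\mathbb S}$ in the case of $\mathbb R^n$; $\pi_{\mathbb H}(\Sigma_{ij})$, $\pi_{\mathbb H}(y)=(\underline y,1)/y_0$, in the case of $\mathbb H^n$) to relatively open subsets of great spheres. A standard $q$-partition, $2\le q\le n+2$, of $\mathbb S^n$ is a Möbius image of $\Omega_i=\{p:\langle p,c_i\rangle<\langle p,c_j\rangle\ \forall j\ne i\}$, where $c_1,\dots,c_q$ are equidistant points on a sphere about the origin; in $\mathbb R^n$ and $\mathbb H^n$ it is the preimage of such a partition under $\pi_{\mathbb R}$, $\pi_{\mathbb H}$ (all $q$ cells being non-empty). A conformally flattening boundary potential for a regular $\Omega$ is a smooth $V:M^n\to(0,\infty)$ with $\mathrm{II}_{\Sigma_{ijk}\subset\partial\Sigma_{ij}}=\nabla_{\mathbf n_{\partial ij}}\log V\; g_{\Sigma_{ijk}}$ on every non-empty $\Sigma_{ijk}$. On $\Sigma^1$ set $$L_{Jac}V=\Delta_{\Sigma^1}V+(\mathrm{Ric}_M(\mathbf n,\mathbf n)+\|\mathrm{II}\|^2)V,\qquad \mathrm{Ric}^V_{\Sigma^1}=\mathrm{Ric}_{\Sigma^1}-\frac{\nabla^2_{\Sigma^1}V}{V}+\frac{\Delta_{\Sigma^1}V}{V}\,g_{\Sigma^1}.$$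 **Theorem.** (1) Let $\Omega$ be a regular, Möbius-flat, spherical Voronoi $q$-partition of $\mathbb S^n$ or $\mathbb R^n$, $2\le q\le\infty$, and let $\mathfrak c_i,\kappa_i$ be the parameters of $\Omega$, respectively of $\Omega^{\mathbb S}$. There is $\xi\in\mathbb R^{n+1}$ with $|\xi|<1$ and $\langle\mathfrak c_{ij},\xi\rangle+\kappa_{ij}=0$ for all non-empty $\Sigma_{ij}$ (respectively $\Sigma_{ij}^{\mathbb S}$). For every such $\xi$, the function $$V(p)=1-\langle p,\xi\rangle\ \text{ on }\mathbb S^n,\qquad V(x)=\frac{|x|^2}2-\Big\langle x,\frac{\underline\xi}{1-\xi_0}\Big\rangle+\frac12\cdot\frac{1+\xi_0}{1-\xi_0}\ \text{ on }\mathbb R^n$$ is a conformally flattening boundary potential for $\Omega$ with $$L_{Jac}V=n-1\quad\text{and}\quad V\,\mathrm{Ric}^V_{\Sigma^1}=(n-2)\,g_{\Sigma^1}.\tag{$*$}$$ (2) Let $\Omega$ be a regular, Möbius-flat, spherical Voronoi $q$-partition of $\mathbb H^n$, $2\le q\le\infty$, with parameters $\mathfrak c_i,\kappa_i$. There is $\xi$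 with $|\xi|<1$ and $\langle\mathfrak c_{ij},(\underline\xi,1)\rangle_1-\kappa_{ij}\xi_0=0$ for all non-empty $\Sigma_{ij}$. For every such $\xi$, $V(y)=-\xi_0-\langle y,(\underline\xi,1)\rangle_1$ is a conformally flattening boundary potential with $L_{Jac}V=(n-1)\xi_0$ and $V\,\mathrm{Ric}^V_{\Sigma^1}=(n-2)\xi_0\,g_{\Sigma^1}$. Hence if $\xi_0>0$ then $V/\xi_0$ is a conformally flattening boundary potential satisfying $(*)$, and if $\xi_0\le0$ then $L_{Jac}V\le0$. In particular there is a conformally flattening boundary potential which satisfies either $(*)$ or $L_{Jac}V\le0$. (3) This applies to all standard $q$-partitions of $\mathbb R^n$, $\mathbb S^n$ and $\mathbb H^n$, $2\le q\le n+2$: they are regular, Möbius-flat, spherical Voronoi partitions, and so have conformally flattening boundary potentials with $(*)$ in $\mathbb R^n$ and $\mathbb S^n$, and with $(*)$ or $L_{Jac}V\le0$ in $\mathbb H^n$. -/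

import Mathlib

open MeasureTheory Set Filter Topology
open scoped ContDiff NNReal

noncomputable section

namespace Bubble

/-- Euclidean `m`-space. -/
abbrev Eu (m : ℕ) := EuclideanSpace ℝ (Fin m)

/-! ### Model spaces -/

/-- An `n`-dimensional Riemannian manifold, presented as a closed submanifold of `ℝ^N` whose metric
is induced by a constant symmetric bilinear form `form` of the ambient space (positive definite on
the tangent spaces). Only the three instances below are used. -/
structure ModelSpace (n N : ℕ) where
  carrier : Set (Eu N)
  form : Eu N → Eu N → ℝ
  tangent : Eu N → Set (Eu N)

/-- The Minkowski form `⟨x, y⟩₁ = ∑_{i ≤ n} x_i y_i - x_0 y_0`, where the coordinate `x_0` is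
the last one. -/
def mink {n : ℕ} (x y : Eu (n + 1)) : ℝ :=
  (∑ i : Fin n, x i.castSucc * y i.castSucc) - x (Fin.last n) * y (Fin.last n)

/-- `ℝ^n`. -/
def euclid (n : ℕ) : ModelSpace n n where
  carrier := univ
  form := fun x y => inner ℝ x y
  tangent := fun _ => univ

/-- `𝕊^n`, the unit sphere of `ℝ^(n+1)`. -/
def sphere (n : ℕ) : ModelSpace n (n + 1) where
  carrier := {p | ‖p‖ = 1}
  form := fun x y => inner ℝ x y
  tangent := fun p => {v | inner ℝ p v = 0}

/-- `ℍ^n`, the hyperboloid model in Minkowski space. -/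
def hyperbolic (n : ℕ) : ModelSpace n (n + 1) where
  carrier := {y | mink y y = -1 ∧ 0 < y (Fin.last n)}
  form := mink
  tangent := fun p => {v | mink p v = 0}

/-- The first `n` coordinates of a vector of `ℝ^n × ℝ`. -/
def lowerPart {n : ℕ} (y : Eu (n + 1)) : Eu n := WithLp.toLp 2 (fun i => y i.castSucc)

/-- The vector `(u, t)` of `ℝ^n × ℝ`. -/
def pairVec {n : ℕ} (u : Eu n) (t : ℝ) : Eu (n + 1) :=
  WithLp.toLp 2 (Fin.snoc (α := fun _ => ℝ) (fun i => u i) t)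

/-- Stereographic projection of `ℝ^n` onto the sphere minus the North pole. -/
def stereoR {n : ℕ} (x : Eu n) : Eu (n + 1) :=
  pairVec ((2 / (‖x‖ ^ 2 + 1)) • x) ((‖x‖ ^ 2 - 1) / (‖x‖ ^ 2 + 1))

/-- Stereographic projection of `ℍ^n` onto the open Northern hemisphere, `y ↦ (y̲, 1) / y_0`. -/
def stereoH {n : ℕ} (y : Eu (n + 1)) : Eu (n + 1) :=
  (y (Fin.last n))⁻¹ • pairVec (lowerPart y) 1

section Measures

variable {n N : ℕ} (M : ModelSpace n N)

/-- The chord `√⟨x - y, x - y⟩`. On `ℝ^n` it is the geodesic distance `d`, on `𝕊^n` it is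
`2 sin (d / 2)`, and on `ℍ^n` it is `2 sinh (d / 2)`. -/
def ModelSpace.chord (x y : Eu N) : ℝ := √(M.form (x - y) (x - y))

/-- Open geodesic ball about `p`, labelled by its chordal radius. -/
def ModelSpace.ball (p : Eu N) (r : ℝ) : Set (Eu N) := {x ∈ M.carrier | M.chord x p < r}

/-- The `k`-dimensional Hausdorff measure of the Riemannian metric (up to normalization):
Caratheodory's construction from `s ↦ (diam s)^k`. Diameters are measured by chords, which agree with
geodesic distances to first order at small scales; on `ℝ^n` and `𝕊^n` this is the usual `μH[k]`. -/
def ModelSpace.hausdorff (k : ℝ) : Measure (Eu N) :=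
  Measure.mkMetric' fun s => (⨆ x ∈ s, ⨆ y ∈ s, ENNReal.ofReal (M.chord x y)) ^ k

end Measures

/-! ### Local parametrizations -/

/-- `φ` restricted to the open set `O` is a `C^1` immersion and a homeomorphism onto a relatively
open subset of `S`. -/
structure IsParam {F : Type*} [NormedAddCommGroup F] [NormedSpace ℝ F] {N : ℕ}
    (O : Set F) (φ : F → Eu N) (S : Set (Eu N)) : Prop where
  isOpen_dom : IsOpen O
  contDiffOn : ContDiffOn ℝ 1 φ O
  immersion : ∀ x ∈ O, Function.Injective (fderiv ℝ φ x)
  embedding : IsEmbedding (O.domRestrict φ)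
  open_image : ∃ W : Set (Eu N), IsOpen W ∧ φ '' O = S ∩ W

/-- A `C^∞` local parametrization of `S`. -/
def IsSmoothParam {F : Type*} [NormedAddCommGroup F] [NormedSpace ℝ F] {N : ℕ}
    (O : Set F) (φ : F → Eu N) (S : Set (Eu N)) : Prop :=
  IsParam O φ S ∧ ContDiffOn ℝ ∞ φ O

/-- A `C^{1,α}` local parametrization of `S`. -/
def IsHolderParam {F : Type*} [NormedAddCommGroup F] [NormedSpace ℝ F] {N : ℕ} (α : ℝ≥0)
    (O : Set F) (φ : F → Eu N) (S : Set (Eu N)) : Prop :=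
  IsParam O φ S ∧ ∀ K ⊆ O, IsCompact K → ∃ C : ℝ≥0, HolderOnWith C α (fderiv ℝ φ) K

/-! ### Riemannian geometry in a local parametrization -/

section Charts

/-- Partial derivative `∂_a f`. -/
def pd {m : ℕ} {F : Type*} [NormedAddCommGroup F] [NormedSpace ℝ F]
    (a : Fin m) (f : Eu m → F) (x : Eu m) : F :=
  fderiv ℝ f x (EuclideanSpace.single a 1)

variable {n N m : ℕ} (M : ModelSpace n N) (φ : Eu m → Eu N)

/-- The induced metric `g_ab = ⟨∂_a φ, ∂_b φ⟩`. -/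
def gram (x : Eu m) : Matrix (Fin m) (Fin m) ℝ :=
  fun a b => M.form (pd a φ x) (pd b φ x)

/-- Christoffel symbols `Γ^c_ab` of the Levi-Civita connection of `g`. -/
def christoffel (c a b : Fin m) (x : Eu m) : ℝ :=
  (1 / 2) * ∑ d, (gram M φ x)⁻¹ c d *
    (pd a (fun z => gram M φ z b d) x + pd b (fun z => gram M φ z a d) x
      - pd d (fun z => gram M φ z a b) x)

/-- The Ricci tensor `Ric_ab` of `g`. -/
def ricci (a b : Fin m) (x : Eu m) : ℝ :=
  ∑ c, (pd c (christoffel M φ c a b) x - pd b (christoffel M φ c a c) x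
    + ∑ d, (christoffel M φ c c d x * christoffel M φ d a b x
      - christoffel M φ c b d x * christoffel M φ d a c x))

/-- The Hessian `∇²_ab f` with respect to `g`. -/
def hess (f : Eu m → ℝ) (a b : Fin m) (x : Eu m) : ℝ :=
  pd a (fun z => pd b f z) x - ∑ c, christoffel M φ c a b x * pd c f x

/-- The Laplace-Beltrami operator of `g`. -/
def lap (f : Eu m → ℝ) (x : Eu m) : ℝ :=
  ∑ a, ∑ b, (gram M φ x)⁻¹ a b * hess M φ f a b x

/-- The coordinates `v^a` of a vector `v` tangent to the image of `φ` at `φ x`. -/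
def coord (v : Eu N) (a : Fin m) (x : Eu m) : ℝ :=
  ∑ b, (gram M φ x)⁻¹ a b * M.form v (pd b φ x)

/-- `Ric(v, w)` for vectors `v`, `w` tangent to the image of `φ` at `φ x`. -/
def ricciForm (v w : Eu N) (x : Eu m) : ℝ :=
  ∑ a, ∑ b, coord M φ v a x * coord M φ w b x * ricci M φ a b x

/-- The second fundamental form `II_ab = ⟨∇_{∂_a φ} ν, ∂_b φ⟩` with respect to the unit normal
field `ν`. -/
def secondForm (ν : Eu m → Eu N) (a b : Fin m) (x : Eu m) : ℝ :=
  M.form (pd a ν x) (pd b φ x)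

/-- The squared Hilbert-Schmidt norm of the second fundamental form. -/
def secondFormSq (ν : Eu m → Eu N) (x : Eu m) : ℝ :=
  ∑ a, ∑ b, ∑ c, ∑ d, (gram M φ x)⁻¹ a c * (gram M φ x)⁻¹ b d *
    secondForm M φ ν a b x * secondForm M φ ν c d x

/-- The Jacobi operator `L_Jac V = Δ_Σ V + (Ric_M(ν, ν) + ‖II‖²) V` at `φ x`, where `φ`
parametrizes the hypersurface `Σ` with unit normal `ν`, and `Φ` parametrizes `M`, `Φ y = φ x`. -/
def jacobi (ν : Eu m → Eu N) (Φ : Eu n → Eu N) (V : Eu N → ℝ) (x : Eu m) (y : Eu n) : ℝ :=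
  lap M φ (fun z => V (φ z)) x
    + (ricciForm M Φ (ν x) (ν x) y + secondFormSq M φ ν x) * V (φ x)

/-- The tensor `Ric^V = Ric - ∇²V / V + (ΔV / V) g` of the image of `φ`. -/
def ricciV (V : Eu N → ℝ) (a b : Fin m) (x : Eu m) : ℝ :=
  ricci M φ a b x - hess M φ (fun z => V (φ z)) a b x / V (φ x)
    + lap M φ (fun z => V (φ z)) x / V (φ x) * gram M φ x a b

end Charts

/-! ### Partitions, interfaces, regularity -/

section Partitions

variable {n N : ℕ} (M : ModelSpace n N)

/-- `ν` is the measure-theoretic outer unit normal to `U ⊆ M` at `p`: up to a set of density zero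
at `p`, `U` is the half-space `⟨x - p, ν⟩ < 0`. -/
def IsOuterNormal (U : Set (Eu N)) (p ν : Eu N) : Prop :=
  p ∈ M.carrier ∧ ν ∈ M.tangent p ∧ M.form ν ν = 1 ∧
  Tendsto (fun r : ℝ => M.hausdorff n
      {x ∈ M.ball p r | (x ∈ U ∧ 0 < M.form (x - p) ν) ∨ (x ∉ U ∧ M.form (x - p) ν < 0)}
        / ENNReal.ofReal (r ^ n)) (𝓝[>] 0) (𝓝 0)

/-- The reduced boundary `∂^* U`: the points at which `U` has an outer unit normal in the
measure-theoretic sense. -/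
def reducedBoundary (U : Set (Eu N)) : Set (Eu N) := {p | ∃ ν, IsOuterNormal M U p ν}

/-- `U ⊆ M` has locally finite perimeter: in local charts, the distributional gradient of its
indicator has finite total variation on compact sets. -/
def LocallyFinitePerimeter (U : Set (Eu N)) : Prop :=
  ∀ p ∈ M.carrier, ∃ (O : Set (Eu n)) (φ : Eu n → Eu N),
    IsSmoothParam O φ M.carrier ∧ p ∈ φ '' O ∧
    ∀ K ⊆ O, IsCompact K → ∃ C : ℝ, ∀ X : Eu n → Eu n, ContDiff ℝ 1 X → tsupport X ⊆ K →
      (∀ x, ‖X x‖ ≤ 1) → ∫ x in {x ∈ O | φ x ∈ U}, ∑ i, (pd i X x) i ≤ C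

variable {ι : Type*} (Ω : ι → Set (Eu N))

/-- Generalized partition. -/
structure IsGeneralizedPartition : Prop where
  subset : ∀ i, Ω i ⊆ M.carrier
  measurable : ∀ i, MeasurableSet (Ω i)
  perimeter : ∀ i, LocallyFinitePerimeter M (Ω i)
  disjoint : Pairwise fun i j => Disjoint (Ω i) (Ω j)
  null : M.hausdorff n (M.carrier \ ⋃ i, Ω i) = 0

/-- Partition: a locally finite generalized partition. -/
structure IsPartition : Prop extends IsGeneralizedPartition M Ω where
  locallyFinite : ∀ K ⊆ M.carrier, IsCompact K → {i | (Ω i ∩ K).Nonempty}.Finite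

/-- The interface `Σ_ij`, for `i ≠ j`. -/
def interface (i j : ι) : Set (Eu N) := reducedBoundary M (Ω i) ∩ reducedBoundary M (Ω j)

/-- The topological boundary in `M`. -/
def bdry (U : Set (Eu N)) : Set (Eu N) := closure U ∩ closure (M.carrier \ U)

/-- `Σ`, the union of the boundaries of the cells. -/
def sigma : Set (Eu N) := ⋃ i, bdry M (Ω i)

/-- `Σ^1`, the union of the interfaces. -/
def sigmaOne : Set (Eu N) := {p | ∃ i j, i ≠ j ∧ p ∈ interface M Ω i j}

/-- The hyperplane `∑ x_i = 0` of `ℝ^k`. -/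
def sumZero (k : ℕ) : Submodule ℝ (Eu k) where
  carrier := {x | ∑ i, x i = 0}
  add_mem' := by
    intro a b ha hb
    simp only [mem_ofPred_eq, PiLp.add_apply, Finset.sum_add_distrib] at *
    rw [ha, hb, add_zero]
  zero_mem' := by simp
  smul_mem' := by
    intro c x hx
    simp only [mem_ofPred_eq, PiLp.smul_apply, smul_eq_mul, ← Finset.mul_sum] at *
    rw [hx, mul_zero]

/-- The points of `sumZero k` whose maximal coordinate is attained at least twice: the origin for
`k = 2`, the cone `𝐘` for `k = 3`, the cone `𝐓` for `k = 4`. -/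
def plateauCone (k : ℕ) : Set (sumZero k) :=
  {x | ∃ i j : Fin k, i ≠ j ∧ x.1 i = x.1 j ∧ ∀ l, x.1 l ≤ x.1 i}

/-- `S ⊆ M` is near `p` the image of `plateauCone k × ℝ^(n+1-k)` under the diffeomorphism `Ψ` from a
neighbourhood `O` of the origin onto a neighbourhood of `p` in `M`, with `Ψ 0 = p`. -/
def IsPlateauChart (S : Set (Eu N)) (k : ℕ) (p : Eu N) (O : Set (sumZero k × Eu (n + 1 - k)))
    (Ψ : sumZero k × Eu (n + 1 - k) → Eu N) : Prop :=
  0 ∈ O ∧ Ψ 0 = p ∧ ∀ x ∈ O, (Ψ x ∈ S ↔ x.1 ∈ plateauCone k)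

/-- The points near which `S` is `C^∞` diffeomorphic to `plateauCone k × ℝ^(n+1-k)`. -/
def smoothPlateau (S : Set (Eu N)) (k : ℕ) : Set (Eu N) :=
  {p | ∃ O Ψ, IsSmoothParam O Ψ M.carrier ∧ IsPlateauChart (n := n) S k p O Ψ}

/-- The points near which `S` is `C^{1,α}` diffeomorphic to `plateauCone k × ℝ^(n+1-k)`. -/
def holderPlateau (α : ℝ≥0) (S : Set (Eu N)) (k : ℕ) : Set (Eu N) :=
  {p | ∃ O Ψ, IsHolderParam α O Ψ M.carrier ∧ IsPlateauChart (n := n) S k p O Ψ}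

/-- `Σ^2`, the triple points: `Σ` is locally `C^∞` diffeomorphic to `𝐘 × ℝ^(n-2)`. -/
def sigmaTwo : Set (Eu N) := smoothPlateau M (sigma M Ω) 3

/-- `Σ^3`, the quadruple points: `Σ` is locally `C^{1,α}` diffeomorphic to `𝐓 × ℝ^(n-3)`. -/
def sigmaThree (α : ℝ≥0) : Set (Eu N) := holderPlateau M α (sigma M Ω) 4

/-- `Σ^4`, the remaining points of `Σ`. -/
def sigmaFour (α : ℝ≥0) : Set (Eu N) :=
  sigma M Ω \ (sigmaOne M Ω ∪ sigmaTwo M Ω ∪ sigmaThree M Ω α)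

/-- `Σ_ijk`, the triple points in the closure of the cells `i`, `j` and `k`. -/
def tripleSet (i j k : ι) : Set (Eu N) :=
  sigmaTwo M Ω ∩ (closure (Ω i) ∩ closure (Ω j) ∩ closure (Ω k))

/-- Regular partition. The local models below make `Σ^1`, `Σ^2`, `Σ^3` mutually disjoint embedded
submanifolds of the asserted dimension and smoothness. -/
structure IsRegular : Prop extends IsPartition M Ω where
  isOpen : ∀ i, ∃ W, IsOpen W ∧ Ω i = M.carrier ∩ W
  closure_reduced : ∀ i, closure (reducedBoundary M (Ω i)) = bdry M (Ω i)
  null_bdry : ∀ i, M.hausdorff ((n : ℝ) - 1) (bdry M (Ω i) \ reducedBoundary M (Ω i)) = 0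
  flat : sigmaOne M Ω ⊆ smoothPlateau M (sigma M Ω) 2
  strata : ∃ α : ℝ≥0, 0 < α ∧ IsClosed (sigmaFour M Ω α) ∧
    ∀ K ⊆ M.carrier, IsCompact K → M.hausdorff ((n : ℝ) - 4) (sigmaFour M Ω α ∩ K) < ⊤
  density : ∀ K ⊆ M.carrier, IsCompact K → ∃ Λ > (0 : ℝ), ∃ R > (0 : ℝ),
    ∀ x ∈ sigma M Ω ∩ K, ∀ r ∈ Ioo 0 R,
      M.hausdorff ((n : ℝ) - 1) (sigma M Ω ∩ M.ball x r) ≤ ENNReal.ofReal (Λ * r ^ (n - 1))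
  infiltration : ∃ ε > (0 : ENNReal), ∀ p ∈ M.carrier, ∀ i, ∀ x ∈ Ω i,
    liminf (fun r : ℝ => M.hausdorff n (connectedComponentIn (Ω i) x ∩ M.ball p r)
        / M.hausdorff n (M.ball p r)) (𝓝[>] 0) < ε →
      p ∉ closure (connectedComponentIn (Ω i) x)

end Partitions

/-! ### Conformally flattening boundary potentials -/

section Potentials

variable {n N : ℕ} (M : ModelSpace n N) {ι : Type*} (Ω : ι → Set (Eu N))

/-- `η` is the outer unit conormal `n_∂ij` to `Σ_ijk` in `Σ_ij` at `φ x`, where `φ` parametrizes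
`Σ_ijk`: a unit vector orthogonal to `Σ_ijk` such that `-η` is tangent to `Σ_ij`, pointing into
it. -/
def IsOuterConormal {m : ℕ} (φ : Eu m → Eu N) (i j : ι) (x : Eu m) (η : Eu N) : Prop :=
  M.form η η = 1 ∧ (∀ a, M.form η (pd a φ x) = 0) ∧
    -η ∈ posTangentConeAt (interface M Ω i j) (φ x)

/-- `V` is a conformally flattening boundary potential: a smooth function, positive on `M`, with
`II_{Σ_ijk ⊂ ∂Σ_ij} = (∇_{n_∂ij} log V) g` on every `Σ_ijk`. (A smooth function on the closed
submanifold `M` is the same as the restriction of a smooth function of the ambient space.) -/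
structure IsFlattening (V : Eu N → ℝ) : Prop where
  smooth : ContDiff ℝ ∞ V
  pos : ∀ p ∈ M.carrier, 0 < V p
  flat : ∀ i j k, i ≠ j → j ≠ k → i ≠ k → ∀ (O : Set (Eu (n - 2))) (φ η : Eu (n - 2) → Eu N),
    IsSmoothParam O φ (tripleSet M Ω i j k) →
    (∀ x ∈ O, IsOuterConormal M Ω φ i j x (η x)) →
    ∀ x ∈ O, ∀ a b, secondForm M φ η a b x
      - fderiv ℝ (fun p => Real.log (V p)) (φ x) (η x) * gram M φ x a b = 0

/-- The value of `L_Jac V` at every point of `Σ^1` satisfies `P`. -/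
def JacobiSatisfies (V : Eu N → ℝ) (P : ℝ → Prop) : Prop :=
  ∀ i j, i ≠ j → ∀ (O : Set (Eu (n - 1))) (φ ν : Eu (n - 1) → Eu N),
    IsSmoothParam O φ (interface M Ω i j) →
    (∀ x ∈ O, IsOuterNormal M (Ω i) (φ x) (ν x)) →
    ∀ (O₁ : Set (Eu n)) (Φ : Eu n → Eu N), IsSmoothParam O₁ Φ M.carrier →
    ∀ x ∈ O, ∀ y ∈ O₁, Φ y = φ x → P (jacobi M φ ν Φ V x y)

/-- `V Ric^V_{Σ^1} = t g_{Σ^1}`. -/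
def RicciVEq (V : Eu N → ℝ) (t : ℝ) : Prop :=
  ∀ i j, i ≠ j → ∀ (O : Set (Eu (n - 1))) (φ : Eu (n - 1) → Eu N),
    IsSmoothParam O φ (interface M Ω i j) →
    ∀ x ∈ O, ∀ a b, V (φ x) * ricciV M φ V a b x = t * gram M φ x a b

/-- `L_Jac V = n - 1` and `V Ric^V_{Σ^1} = (n - 2) g_{Σ^1}`. -/
def IsGood (V : Eu N → ℝ) : Prop :=
  JacobiSatisfies M Ω V (fun l => l = (n : ℝ) - 1) ∧ RicciVEq M Ω V ((n : ℝ) - 2)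

end Potentials

/-! ### Spherical Voronoi and Möbius-flat partitions -/

section Voronoi

/-- `A` is a relatively open subset of `S`. -/
def IsRelOpen {N : ℕ} (A S : Set (Eu N)) : Prop := ∃ W, IsOpen W ∧ A = S ∩ W

/-- The generalized sphere of `M` with quasi-center `c` and curvature `κ`: its unit normal at `p` is
`c + κ p`. -/
def genSphere {n N : ℕ} (M : ModelSpace n N) (c : Eu N) (κ : ℝ) : Set (Eu N) :=
  {p ∈ M.carrier | c + κ • p ∈ M.tangent p ∧ M.form (c + κ • p) (c + κ • p) = 1}

/-- Möbius automorphisms of `𝕊^n`: compositions of orthogonal maps and of inversions in spheres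
orthogonal to `𝕊^n`. -/
inductive IsMobius {n : ℕ} : (Eu (n + 1) → Eu (n + 1)) → Prop
  | isometry (L : Eu (n + 1) ≃ₗᵢ[ℝ] Eu (n + 1)) : IsMobius L
  | inversion (a : Eu (n + 1)) (ha : 1 < ‖a‖) :
      IsMobius (EuclideanGeometry.inversion a (√(‖a‖ ^ 2 - 1)))
  | comp {S T : Eu (n + 1) → Eu (n + 1)} : IsMobius S → IsMobius T → IsMobius (S ∘ T)

/-- A family of relatively open subsets of geodesic spheres of `𝕊^n` is Möbius-flat if one Möbius
automorphism maps all of them to relatively open subsets of great spheres. -/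
def IsMobiusFlat {n : ℕ} (F : Set (Set (Eu (n + 1)))) : Prop :=
  ∃ T : Eu (n + 1) → Eu (n + 1), IsMobius T ∧
    ∀ A ∈ F, ∃ v, IsRelOpen (T '' A) (genSphere (sphere n) v 0)

/-- The family of non-empty interfaces. -/
def interfaces {n N : ℕ} (M : ModelSpace n N) {ι : Type*} (Ω : ι → Set (Eu N)) :
    Set (Set (Eu N)) :=
  {A | A.Nonempty ∧ ∃ i j, i ≠ j ∧ A = interface M Ω i j}

variable {n : ℕ} {ι : Type*}

/-- Spherical Voronoi generalized partition of `𝕊^n` with quasi-center parameters `c_i` and curvature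
parameters `κ_i`. -/
structure IsVoronoiS (Ω : ι → Set (Eu (n + 1))) (c : ι → Eu (n + 1)) (κ : ι → ℝ) : Prop
    extends IsGeneralizedPartition (sphere n) Ω where
  nonempty : ∀ i, (Ω i).Nonempty
  spherical : ∀ i j, i ≠ j → (interface (sphere n) Ω i j).Nonempty →
    IsRelOpen (interface (sphere n) Ω i j) (genSphere (sphere n) (c i - c j) (κ i - κ j))
  voronoi : ∀ i, Ω i = {p ∈ (sphere n).carrier |
    ∀ j, j ≠ i → inner ℝ (c i) p + κ i < inner ℝ (c j) p + κ j}

/-- Spherical Voronoi partition of `ℝ^n`, the pull-back of the spherical Voronoi generalized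
partition `ΩS` of `𝕊^n` by stereographic projection. -/
structure IsVoronoiR (Ω : ι → Set (Eu n)) (ΩS : ι → Set (Eu (n + 1))) (c : ι → Eu (n + 1))
    (κ : ι → ℝ) : Prop extends IsPartition (euclid n) Ω where
  voronoi : IsVoronoiS ΩS c κ
  pull_back : ∀ i, Ω i = stereoR ⁻¹' ΩS i

/-- Spherical Voronoi partition of `ℍ^n` with quasi-center parameters `c_i` and curvature
parameters `κ_i`. -/
structure IsVoronoiH (Ω : ι → Set (Eu (n + 1))) (c : ι → Eu (n + 1)) (κ : ι → ℝ) : Prop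
    extends IsPartition (hyperbolic n) Ω where
  nonempty : ∀ i, (Ω i).Nonempty
  spherical : ∀ i j, i ≠ j → (interface (hyperbolic n) Ω i j).Nonempty →
    IsRelOpen (interface (hyperbolic n) Ω i j)
      (genSphere (hyperbolic n) (c i - c j) (κ i - κ j))
  voronoi : ∀ i, Ω i = {y ∈ (hyperbolic n).carrier |
    ∀ j, j ≠ i → mink (c i) y - κ i < mink (c j) y - κ j}

/-- Möbius-flatness in `𝕊^n`. -/
def IsMobiusFlatS (Ω : ι → Set (Eu (n + 1))) : Prop := IsMobiusFlat (interfaces (sphere n) Ω)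

/-- Möbius-flatness in `ℍ^n`: the stereographic projections of the non-empty interfaces are
Möbius-flat. -/
def IsMobiusFlatH (Ω : ι → Set (Eu (n + 1))) : Prop :=
  IsMobiusFlat ((fun A => stereoH '' A) '' interfaces (hyperbolic n) Ω)

/-- `|ξ| < 1` and `⟨c_i - c_j, ξ⟩ + κ_i - κ_j = 0` for all non-empty interfaces of the partition
of `𝕊^n`. -/
def IsFlatVectorS (Ω : ι → Set (Eu (n + 1))) (c : ι → Eu (n + 1)) (κ : ι → ℝ)
    (ξ : Eu (n + 1)) : Prop :=
  ‖ξ‖ < 1 ∧ ∀ i j, i ≠ j → (interface (sphere n) Ω i j).Nonempty →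
    inner ℝ (c i - c j) ξ + (κ i - κ j) = 0

/-- `|ξ| < 1` and `⟨c_i - c_j, (ξ̲, 1)⟩₁ - (κ_i - κ_j) ξ_0 = 0` for all non-empty interfaces of the
partition of `ℍ^n`. -/
def IsFlatVectorH (Ω : ι → Set (Eu (n + 1))) (c : ι → Eu (n + 1)) (κ : ι → ℝ)
    (ξ : Eu (n + 1)) : Prop :=
  ‖ξ‖ < 1 ∧ ∀ i j, i ≠ j → (interface (hyperbolic n) Ω i j).Nonempty →
    mink (c i - c j) (pairVec (lowerPart ξ) 1) - (κ i - κ j) * ξ (Fin.last n) = 0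

/-- `V(p) = 1 - ⟨p, ξ⟩`. -/
def potentialS (ξ p : Eu (n + 1)) : ℝ := 1 - inner ℝ p ξ

/-- `V(x) = |x|²/2 - ⟨x, θ⟩ + η`, `θ = ξ̲ / (1 - ξ_0)`, `η = (1 + ξ_0) / (2 (1 - ξ_0))`. -/
def potentialR (ξ : Eu (n + 1)) (x : Eu n) : ℝ :=
  ‖x‖ ^ 2 / 2 - inner ℝ x ((1 - ξ (Fin.last n))⁻¹ • lowerPart ξ)
    + (1 / 2) * ((1 + ξ (Fin.last n)) / (1 - ξ (Fin.last n)))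

/-- `V(y) = -ξ_0 - ⟨y, (ξ̲, 1)⟩₁`. -/
def potentialH (ξ y : Eu (n + 1)) : ℝ := -ξ (Fin.last n) - mink y (pairVec (lowerPart ξ) 1)

/-- Standard `q`-partition of `𝕊^n`: a Möbius image of the standard flat one, whose cells are the
Voronoi cells of `q` equidistant points on a sphere about the origin. -/
def IsStandardS {q : ℕ} (Ω : Fin q → Set (Eu (n + 1))) : Prop :=
  ∃ (T : Eu (n + 1) → Eu (n + 1)) (c : Fin q → Eu (n + 1)) (R d : ℝ),
    IsMobius T ∧ 0 < R ∧ 0 < d ∧ (∀ i, ‖c i‖ = R) ∧ (∀ i j, i ≠ j → dist (c i) (c j) = d) ∧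
    ∀ i, Ω i = T '' {p ∈ (sphere n).carrier | ∀ j, j ≠ i → inner ℝ p (c i) < inner ℝ p (c j)}

/-- Standard `q`-partition of `ℝ^n`. -/
def IsStandardR {q : ℕ} (Ω : Fin q → Set (Eu n)) : Prop :=
  ∃ ΩS : Fin q → Set (Eu (n + 1)), IsStandardS ΩS ∧ ∀ i, Ω i = stereoR ⁻¹' ΩS i

/-- Standard `q`-partition of `ℍ^n`; all `q` cells are required to be non-empty. -/
def IsStandardH {q : ℕ} (Ω : Fin q → Set (Eu (n + 1))) : Prop :=
  ∃ ΩS : Fin q → Set (Eu (n + 1)), IsStandardS ΩS ∧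
    ∀ i, Ω i = (hyperbolic n).carrier ∩ stereoH ⁻¹' ΩS i ∧ (Ω i).Nonempty

end Voronoi

end Bubble

end

/-! Curvature identities. Each model space has curvature K ∈ {-1, 0, 1} and sits in a linear space
with bilinear form b, as a level set of b if K ≠ 0. An interface lies in a hypersurface `L i = L j`
whose unit normal is ν = a + k p with constant a and k. Hence dν = k dp, II = k g, and the Gauss
formula of a parametrization φ has normal part -g (Kφ + kν). The field H = Kφ + kν satisfies dH = (K
+ k²) dφ, so the interface has constant curvature l = K + k² (`IsUmbilic.curvature`).

The potentials satisfy ∇²V = (t - K V) g on M, with t = 1 on the sphere and on Euclidean space and t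
= ξ_0 on hyperbolic space. If moreover ∂_ν V = k V (`IsAdapted`), the Hessian of V along the
interface is (t - l V) g. The zeroth order terms then cancel: L_Jac V = (n - 1) t and V Ric^V = (n -
2) t g (`IsGeometry.jacobi_eq`, `IsGeometry.mul_ricciV_eq`). On the sphere ∂_ν V = k V says exactly
⟨c_ij, ξ⟩ + κ_ij = 0, and the other two cases translate to this one by stereographic projection.

Triple points. The three unit normals sum to zero cyclically, so they meet at 120 degrees, and the
conormal of Σ_ij is (2 n_ir - n_ij)/√3. This again has the form a + k p, so II = k g, and ∂_η V = k
V follows by linearity (`IsVoronoiLike.isFlattening`). Two inputs come from geometric measure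
theory: cells meeting at a triple point share an interface (`interface_nonempty_of_plateauChart`),
and the measure-theoretic normal is the algebraic one (`HasBlowUps`, proved by blow-up in conformal
charts).

Existence of ξ. Möbius maps act by Lorentz transformations of ℝ^(n+1) × ℝ. A sphere corresponds to
the spacelike vector (c, -κ), and great spheres are those orthogonal to (0, 1). Pulling (0, 1) back
gives a timelike vector orthogonal to all (c_ij, -κ_ij), and ξ is its projectivization
(`IsMobius.exists_flatVector`).

Standard partitions. All of them are cells `cell M τ c` of a conformal map τ of M into the sphere,
decided by which ⟨τ x, c i⟩ is minimal. In the central projection about a point the cells become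
polyhedral cones, and the stratum of a point is given by the number of tied indices (`minSet`).
Regularity follows from linear algebra of the simplex and from bilipschitz charts
(`IsConformal.isRegular_cell`). -/

open MeasureTheory Set Filter Topology
open scoped ContDiff NNReal

noncomputable section

namespace Bubble

/-! ### Partial derivatives and inverse matrices. -/

section Derivatives

variable {m : ℕ} {F : Type*} [NormedAddCommGroup F] [NormedSpace ℝ F]

theorem contDiffOn_pd {O : Set (Eu m)} (hO : IsOpen O) {f : Eu m → F} (hf : ContDiffOn ℝ ∞ f O)
    (a : Fin m) : ContDiffOn ℝ ∞ (fun z => pd a f z) O := by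
  have := hf.fderiv_of_isOpen (m := ∞) hO (by simp)
  exact this.clm_apply contDiffOn_const

theorem pd_congr {O : Set (Eu m)} (hO : IsOpen O) {f g : Eu m → F} (h : ∀ z ∈ O, f z = g z)
    {x : Eu m} (hx : x ∈ O) (a : Fin m) : pd a f x = pd a g x := by
  have : f =ᶠ[𝓝 x] g := Filter.eventually_of_mem (hO.mem_nhds hx) h
  simp only [pd, this.fderiv_eq]

theorem pd_comm {O : Set (Eu m)} (hO : IsOpen O) {f : Eu m → F} (hf : ContDiffOn ℝ ∞ f O)
    {x : Eu m} (hx : x ∈ O) (a b : Fin m) :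
    pd a (fun z => pd b f z) x = pd b (fun z => pd a f z) x := by
  have hfx : ContDiffAt ℝ ∞ f x := hf.contDiffAt (hO.mem_nhds hx)
  have hs := hfx.isSymmSndFDerivAt (by simpa using WithTop.coe_le_coe.2 (le_top (a := (2 : ℕ∞))))
  have hd : DifferentiableAt ℝ (fderiv ℝ f) x :=
    (hfx.fderiv_right (m := 1) (by simpa using WithTop.coe_le_coe.2 (le_top (a := ((1 : ℕ∞) + 1))))).differentiableAt (by simp)
  have key : ∀ a b : Fin m, pd a (fun z => pd b f z) x
      = fderiv ℝ (fderiv ℝ f) x (EuclideanSpace.single a 1) (EuclideanSpace.single b 1) := by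
    intro a b
    simp only [pd]
    rw [fderiv_clm_apply hd (differentiableAt_const _)]
    simp
  rw [key, key]
  exact hs _ _

theorem fderiv_eq_sum_pd (f : Eu m → F) (x v : Eu m) :
    fderiv ℝ f x v = ∑ a, v a • pd a f x := by
  conv_lhs => rw [← (EuclideanSpace.basisFun (Fin m) ℝ).sum_repr v]
  simp [pd, map_sum]

end Derivatives

section MatrixInverse

variable {m : ℕ} {E : Type*} [NormedAddCommGroup E] [NormedSpace ℝ E]

theorem contDiffAt_det {A : E → Matrix (Fin m) (Fin m) ℝ} {x : E}
    (hA : ∀ i j, ContDiffAt ℝ ∞ (fun z => A z i j) x) : ContDiffAt ℝ ∞ (fun z => (A z).det) x := by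
  simp only [Matrix.det_apply]
  refine ContDiffAt.sum fun σ _ => ContDiffAt.const_smul _ ?_
  exact contDiffAt_prod fun i _ => hA _ _

theorem contDiffAt_matrix_inv {A : E → Matrix (Fin m) (Fin m) ℝ} {x : E}
    (hA : ∀ i j, ContDiffAt ℝ ∞ (fun z => A z i j) x) (hx : (A x).det ≠ 0) (i j : Fin m) :
    ContDiffAt ℝ ∞ (fun z => (A z)⁻¹ i j) x := by
  simp only [Matrix.inv_def, Ring.inverse_eq_inv', Matrix.smul_apply, Matrix.adjugate_apply,
    smul_eq_mul]
  refine ((contDiffAt_det hA).inv hx).mul (contDiffAt_det fun k l => ?_)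
  by_cases h : k = j
  · subst h
    simpa using contDiffAt_const
  · simpa [Matrix.updateRow_ne h] using hA k l

end MatrixInverse

/-! ### Intrinsic geometry of umbilic immersions. -/

section SpaceForms

variable {n N m : ℕ} {M : ModelSpace n N}

/-- The image of `φ` is a submanifold whose Gauss formula reads `∂_a ∂_b φ = Γ^c_ab ∂_c φ - g_ab H`
with a normal field `H` such that `∂_a H = l ∂_a φ`. -/
structure IsUmbilic (M : ModelSpace n N) (b : Eu N →L[ℝ] Eu N →L[ℝ] ℝ) (O : Set (Eu m))
    (φ H : Eu m → Eu N) (l : ℝ) : Prop where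
  form_eq : ∀ x y, M.form x y = b x y
  symm : ∀ x y, b x y = b y x
  isOpen : IsOpen O
  smooth : ContDiffOn ℝ ∞ φ O
  hasFDerivAt : ∀ x ∈ O, HasFDerivAt H (l • fderiv ℝ φ x) x
  det_ne : ∀ x ∈ O, (gram M φ x).det ≠ 0
  orth : ∀ x ∈ O, ∀ a, b (H x) (pd a φ x) = 0
  gauss : ∀ x ∈ O, ∀ i j, ∃ γ : Fin m → ℝ,
    pd i (fun z => pd j φ z) x = (∑ c, γ c • pd c φ x) - gram M φ x i j • H x

variable {b : Eu N →L[ℝ] Eu N →L[ℝ] ℝ} {O : Set (Eu m)} {φ H : Eu m → Eu N} {l : ℝ}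

namespace IsUmbilic

variable (h : IsUmbilic M b O φ H l)
include h

theorem gram_eq (x : Eu m) (i j : Fin m) : gram M φ x i j = b (pd i φ x) (pd j φ x) :=
  h.form_eq _ _

theorem gram_symm (x : Eu m) (i j : Fin m) : gram M φ x i j = gram M φ x j i := by
  rw [h.gram_eq, h.gram_eq, h.symm]

theorem contDiffOn_gram (i j : Fin m) : ContDiffOn ℝ ∞ (fun z => gram M φ z i j) O := by
  simp only [h.gram_eq]
  have h1 := contDiffOn_pd h.isOpen h.smooth i
  have h2 := contDiffOn_pd h.isOpen h.smooth j
  exact (b.contDiff.comp_contDiffOn h1).clm_apply h2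

theorem pd_gram {x : Eu m} (hx : x ∈ O) (c i j : Fin m) :
    pd c (fun z => gram M φ z i j) x = b (pd c (fun z => pd i φ z) x) (pd j φ x)
      + b (pd i φ x) (pd c (fun z => pd j φ z) x) := by
  simp only [h.gram_eq]
  have hd : ∀ i, DifferentiableAt ℝ (fun z => pd i φ z) x := fun i =>
    ((contDiffOn_pd h.isOpen h.smooth i).contDiffAt (h.isOpen.mem_nhds hx)).differentiableAt
      (by simp)
  have h1 : HasFDerivAt (fun z => b (pd i φ z)) (b ∘L fderiv ℝ (fun z => pd i φ z) x) x :=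
    b.hasFDerivAt.comp x (hd i).hasFDerivAt
  have h2 := h1.clm_apply (hd j).hasFDerivAt
  simp only [pd] at *
  rw [h2.fderiv]
  simp [add_comm]

/-- The index form of g⁻¹ g = 1, by which coefficients of a tangent vector are recovered from its
products with the coordinate fields. -/
theorem inv_mul_gram {x : Eu m} (hx : x ∈ O) (γ : Fin m → ℝ) (c : Fin m) :
    ∑ d, (gram M φ x)⁻¹ c d * ∑ e, γ e * gram M φ x e d = γ c := by
  have h1 : (gram M φ x)⁻¹ * gram M φ x = 1 :=
    Matrix.nonsing_inv_mul _ (isUnit_iff_ne_zero.2 (h.det_ne x hx))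
  calc ∑ d, (gram M φ x)⁻¹ c d * ∑ e, γ e * gram M φ x e d
      = ∑ d, (gram M φ x)⁻¹ c d * ∑ e, gram M φ x d e * γ e := by
        refine Finset.sum_congr rfl fun d _ => ?_
        congr 1
        refine Finset.sum_congr rfl fun e _ => ?_
        rw [h.gram_symm x e d, mul_comm]
    _ = ((gram M φ x)⁻¹.mulVec ((gram M φ x).mulVec γ)) c := rfl
    _ = γ c := by rw [Matrix.mulVec_mulVec, h1, Matrix.one_mulVec]

theorem eq_zero_of_sum_gram {x : Eu m} (hx : x ∈ O) {γ : Fin m → ℝ}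
    (hγ : ∀ d, ∑ e, γ e * gram M φ x e d = 0) (c : Fin m) : γ c = 0 := by
  rw [← h.inv_mul_gram hx γ c]
  simp [hγ]

/-- Of the six terms obtained by differentiating the metric, four cancel by symmetry of the second
derivatives of φ and the other two coincide. -/
theorem christoffel_eq {x : Eu m} (hx : x ∈ O) (c i j : Fin m) :
    christoffel M φ c i j x
      = ∑ d, (gram M φ x)⁻¹ c d * b (pd i (fun z => pd j φ z) x) (pd d φ x) := by
  rw [christoffel, Finset.mul_sum]
  refine Finset.sum_congr rfl fun d _ => ?_
  rw [h.pd_gram hx, h.pd_gram hx, h.pd_gram hx, pd_comm h.isOpen h.smooth hx d j,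
    pd_comm h.isOpen h.smooth hx d i, pd_comm h.isOpen h.smooth hx j i,
    h.symm (pd j φ x), h.symm (pd i φ x)]
  ring

/-- The field `gauss` only provides some coefficients. Pairing with the coordinate fields removes
the normal H and identifies them with the Christoffel symbols. -/
theorem pd_pd {x : Eu m} (hx : x ∈ O) (i j : Fin m) :
    pd i (fun z => pd j φ z) x
      = (∑ c, christoffel M φ c i j x • pd c φ x) - gram M φ x i j • H x := by
  obtain ⟨γ, hγ⟩ := h.gauss x hx i j
  have : ∀ c, christoffel M φ c i j x = γ c := by
    intro c
    rw [h.christoffel_eq hx, ← h.inv_mul_gram hx γ c]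
    refine Finset.sum_congr rfl fun d _ => ?_
    congr 1
    rw [hγ]
    simp [h.orth x hx, h.gram_eq, map_sum]
  rw [hγ]
  simp [this]

theorem contDiffOn_christoffel (c i j : Fin m) :
    ContDiffOn ℝ ∞ (fun z => christoffel M φ c i j z) O := by
  have : ContDiffOn ℝ ∞ (fun x => ∑ d, (gram M φ x)⁻¹ c d *
      b (pd i (fun z => pd j φ z) x) (pd d φ x)) O := by
    refine ContDiffOn.sum fun d _ => ContDiffOn.mul ?_ ?_
    · intro x hx
      refine (contDiffAt_matrix_inv (fun i j => ?_) (h.det_ne x hx) c d).contDiffWithinAt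
      exact (h.contDiffOn_gram i j).contDiffAt (h.isOpen.mem_nhds hx)
    · have h1 := contDiffOn_pd h.isOpen (contDiffOn_pd h.isOpen h.smooth j) i
      exact (b.contDiff.comp_contDiffOn h1).clm_apply (contDiffOn_pd h.isOpen h.smooth d)
  exact this.congr fun x hx => h.christoffel_eq hx c i j

/-- The tangential part of the differentiated Gauss formula. The derivative of the metric is
multiplied by H and drops out, while the derivative of H contributes -l g_ij ∂_k φ. -/
theorem pd_pd_pd {x : Eu m} (hx : x ∈ O) (k i j f : Fin m) :
    b (pd k (fun y => pd i (fun z => pd j φ z) y) x) (pd f φ x)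
      = ∑ e, (pd k (christoffel M φ e i j) x + ∑ d, christoffel M φ e k d x *
          christoffel M φ d i j x - l * gram M φ x i j * if e = k then 1 else 0)
        * gram M φ x e f := by
  have hd : ∀ i, DifferentiableAt ℝ (fun z => pd i φ z) x := fun i =>
    ((contDiffOn_pd h.isOpen h.smooth i).contDiffAt (h.isOpen.mem_nhds hx)).differentiableAt
      (by simp)
  have hc : ∀ c, HasFDerivAt (christoffel M φ c i j) (fderiv ℝ (christoffel M φ c i j) x) x :=
    fun c => (((h.contDiffOn_christoffel c i j).contDiffAt
      (h.isOpen.mem_nhds hx)).differentiableAt (by simp)).hasFDerivAt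
  have hg : HasFDerivAt (fun z => gram M φ z i j) (fderiv ℝ (fun z => gram M φ z i j) x) x :=
    (((h.contDiffOn_gram i j).contDiffAt
      (h.isOpen.mem_nhds hx)).differentiableAt (by simp)).hasFDerivAt
  have h1 : pd k (fun y => pd i (fun z => pd j φ z) y) x
      = (∑ c, (christoffel M φ c i j x • pd k (fun z => pd c φ z) x
          + pd k (christoffel M φ c i j) x • pd c φ x))
        - (gram M φ x i j • l • pd k φ x + pd k (fun z => gram M φ z i j) x • H x) := by
    rw [pd_congr h.isOpen (fun z hz => h.pd_pd hz i j) hx]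
    have h2 := (HasFDerivAt.fun_sum (u := Finset.univ) fun c _ =>
      (hc c).smul (hd c).hasFDerivAt).sub (hg.smul (h.hasFDerivAt x hx))
    conv_lhs => rw [pd]
    have h4 : fderiv ℝ (fun z => ∑ c, christoffel M φ c i j z • pd c φ z
        - gram M φ z i j • H z) x = _ := HasFDerivAt.fderiv h2
    rw [h4]
    simp [pd, sum_apply]
  have h3 : ∀ c, b (pd k (fun z => pd c φ z) x) (pd f φ x)
      = ∑ e, christoffel M φ e k c x * gram M φ x e f := by
    intro c
    rw [h.pd_pd hx]
    simp [h.orth x hx, h.gram_eq, map_sum]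
  rw [h1]
  simp only [map_sub, map_sum, map_add, map_smul, sub_apply,
    sum_apply, add_apply, smul_apply,
    smul_eq_mul, h.orth x hx, mul_zero, add_zero, h3, ← h.gram_eq]
  simp only [sub_mul, add_mul, Finset.sum_add_distrib, Finset.sum_sub_distrib, mul_ite, mul_one,
    mul_zero, ite_mul, zero_mul, Finset.sum_ite_eq', Finset.mem_univ, if_true]
  rw [add_comm]
  congr 1
  · congr 1
    simp only [Finset.mul_sum, Finset.sum_mul]
    rw [Finset.sum_comm]
    refine Finset.sum_congr rfl fun e _ => Finset.sum_congr rfl fun d _ => ?_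
    ring
  · ring

/-- The Gauss equation of a hypersurface of constant curvature l: third derivatives of φ commute, so
their tangential parts computed in two orders agree. -/
theorem curvature {x : Eu m} (hx : x ∈ O) (e k i j : Fin m) :
    pd k (christoffel M φ e i j) x - pd j (christoffel M φ e i k) x
      + ∑ d, (christoffel M φ e k d x * christoffel M φ d i j x
        - christoffel M φ e j d x * christoffel M φ d i k x)
      = l * gram M φ x i j * (if e = k then 1 else 0)
        - l * gram M φ x i k * (if e = j then 1 else 0) := by
  have hsymm : pd k (fun y => pd i (fun z => pd j φ z) y) x
      = pd j (fun y => pd i (fun z => pd k φ z) y) x := by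
    rw [pd_congr h.isOpen (fun z hz => pd_comm h.isOpen h.smooth hz i j) hx,
      pd_comm h.isOpen (contDiffOn_pd h.isOpen h.smooth i) hx k j,
      pd_congr h.isOpen (fun z hz => pd_comm h.isOpen h.smooth hz k i) hx]
  have key := h.eq_zero_of_sum_gram hx (γ := fun e =>
    (pd k (christoffel M φ e i j) x + ∑ d, christoffel M φ e k d x *
          christoffel M φ d i j x - l * gram M φ x i j * if e = k then 1 else 0)
    - (pd j (christoffel M φ e i k) x + ∑ d, christoffel M φ e j d x *
          christoffel M φ d i k x - l * gram M φ x i k * if e = j then 1 else 0)) (fun f => by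
      have h1 := h.pd_pd_pd hx k i j f
      have h2 := h.pd_pd_pd hx j i k f
      rw [hsymm, h2] at h1
      simp only [sub_mul _ (_ - _) _, Finset.sum_sub_distrib (f := fun e => _ * _) ]
      rw [h1, sub_self]) e
  rw [Finset.sum_sub_distrib]
  linarith

theorem ricci_eq {x : Eu m} (hx : x ∈ O) (i j : Fin m) :
    ricci M φ i j x = ((m : ℝ) - 1) * l * gram M φ x i j := by
  rw [ricci, Finset.sum_congr rfl fun c _ => h.curvature hx c c i j]
  simp [Finset.sum_sub_distrib]
  ring

theorem trace_gram {x : Eu m} (hx : x ∈ O) :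
    ∑ i, ∑ j, (gram M φ x)⁻¹ i j * gram M φ x i j = m := by
  have h1 : (gram M φ x)⁻¹ * gram M φ x = 1 :=
    Matrix.nonsing_inv_mul _ (isUnit_iff_ne_zero.2 (h.det_ne x hx))
  have : ∀ i, ∑ j, (gram M φ x)⁻¹ i j * gram M φ x i j = ((gram M φ x)⁻¹ * gram M φ x) i i := by
    intro i
    rw [Matrix.mul_apply]
    exact Finset.sum_congr rfl fun j _ => by rw [h.gram_symm x i j]
  simp [this, h1]

theorem lap_eq {f : Eu m → ℝ} {x : Eu m} (hx : x ∈ O) {t : ℝ}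
    (hf : ∀ i j, hess M φ f i j x = t * gram M φ x i j) : lap M φ f x = m * t := by
  simp only [lap, hf]
  rw [← h.trace_gram hx, Finset.sum_mul]
  refine Finset.sum_congr rfl fun i _ => ?_
  rw [Finset.sum_mul]
  exact Finset.sum_congr rfl fun j _ => by ring

theorem gram_inv_symm (x : Eu m) (i j : Fin m) : (gram M φ x)⁻¹ i j = (gram M φ x)⁻¹ j i := by
  have : (gram M φ x).transpose = gram M φ x := by
    ext i j; exact h.gram_symm x j i
  conv_lhs => rw [← this, ← Matrix.transpose_nonsing_inv]
  rfl

theorem secondFormSq_eq {ν : Eu m → Eu N} {x : Eu m} (hx : x ∈ O) {κ : ℝ}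
    (hν : ∀ i j, secondForm M φ ν i j x = κ * gram M φ x i j) :
    secondFormSq M φ ν x = m * κ ^ 2 := by
  simp only [secondFormSq, hν]
  rw [← h.trace_gram hx, Finset.sum_mul]
  refine Finset.sum_congr rfl fun i _ => ?_
  rw [Finset.sum_mul]
  refine Finset.sum_congr rfl fun j _ => ?_
  have h1 : (gram M φ x) * (gram M φ x)⁻¹ = 1 :=
    Matrix.mul_nonsing_inv _ (isUnit_iff_ne_zero.2 (h.det_ne x hx))
  have h2 : ∑ c, ∑ d, (gram M φ x)⁻¹ i c * (gram M φ x)⁻¹ j d * (κ * gram M φ x i j)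
      * (κ * gram M φ x c d)
      = κ ^ 2 * gram M φ x i j * ∑ c, (gram M φ x)⁻¹ i c *
        ((gram M φ x) * (gram M φ x)⁻¹) c j := by
    simp only [Matrix.mul_apply, Finset.mul_sum]
    refine Finset.sum_congr rfl fun c _ => Finset.sum_congr rfl fun d _ => ?_
    rw [h.gram_inv_symm x j d]
    ring
  rw [h2, h1]
  simp [Matrix.one_apply]
  ring

theorem ricciForm_eq {x : Eu m} (hx : x ∈ O) {v : Eu N} {γ : Fin m → ℝ}
    (hv : v = ∑ c, γ c • pd c φ x) :
    ricciForm M φ v v x = ((m : ℝ) - 1) * l * b v v := by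
  have hc : ∀ a, coord M φ v a x = γ a := by
    intro a
    rw [coord, ← h.inv_mul_gram hx γ a]
    refine Finset.sum_congr rfl fun d _ => ?_
    rw [h.form_eq, hv]
    simp [h.gram_eq]
  have hb : b v v = ∑ i, ∑ j, γ i * γ j * gram M φ x i j := by
    rw [hv]
    simp only [map_sum, map_smul, sum_apply, smul_apply,
      smul_eq_mul, ← h.gram_eq, Finset.mul_sum]
    rw [Finset.sum_comm]
    exact Finset.sum_congr rfl fun i _ => Finset.sum_congr rfl fun j _ => by ring
  simp only [ricciForm, hc, h.ricci_eq hx, hb, Finset.mul_sum]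
  exact Finset.sum_congr rfl fun i _ => Finset.sum_congr rfl fun j _ => by ring

/-- The Christoffel terms cancel against the tangential part of ∂_i ∂_j φ, and the normal part -g_ij
H leaves -dV(H) g_ij. -/
theorem hess_eq {V : Eu N → ℝ} {x : Eu m} (hx : x ∈ O) {t₀ : ℝ} {i j : Fin m}
    (hV : DifferentiableAt ℝ V (φ x))
    (h2 : pd i (fun z => pd j (fun w => V (φ w)) z) x = t₀ * gram M φ x i j
      + fderiv ℝ V (φ x) (pd i (fun z => pd j φ z) x)) :
    hess M φ (fun z => V (φ z)) i j x
      = (t₀ - fderiv ℝ V (φ x) (H x)) * gram M φ x i j := by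
  have hφ : DifferentiableAt ℝ φ x :=
    (h.smooth.contDiffAt (h.isOpen.mem_nhds hx)).differentiableAt (by simp)
  have h1 : ∀ c, pd c (fun w => V (φ w)) x = fderiv ℝ V (φ x) (pd c φ x) := by
    intro c
    have := (hV.hasFDerivAt.comp x hφ.hasFDerivAt).fderiv
    simp only [pd]
    rw [show (fun w => V (φ w)) = V ∘ φ from rfl, this]
    rfl
  rw [hess, h2, h.pd_pd hx]
  simp only [h1, map_sub, map_sum, map_smul, smul_eq_mul]
  ring

end IsUmbilic

end SpaceForms

/-! ### Space forms, generalized spheres, and the operators of the potential on them. -/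

/-- `M` is a space form of curvature `K ∈ {-1, 0, 1}`, sitting in its ambient space as a level set of
the bilinear form `b` if `K ≠ 0`, and as the whole space if `K = 0`. -/
structure IsGeometry {n N : ℕ} (M : ModelSpace n N) (b : Eu N →L[ℝ] Eu N →L[ℝ] ℝ) (K : ℝ) :
    Prop where
  form_eq : ∀ x y, M.form x y = b x y
  symm : ∀ x y, b x y = b y x
  abs_le : ∀ v, |b v v| ≤ ‖v‖ ^ 2
  isClosed : IsClosed M.carrier
  -- A polynomial form of K ∈ {-1, 0, 1}, so that the three geometries go through the same linear
  -- combinations.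
  cube : K ^ 3 = K
  tangent_iff : ∀ p v, v ∈ M.tangent p ↔ K * b p v = 0
  -- This says b p p = K if K = ±1 and is void if K = 0.
  level : ∀ p ∈ M.carrier, K * b p p = K ^ 2
  pos : ∀ p ∈ M.carrier, ∀ v ∈ M.tangent p, v ≠ 0 → 0 < b v v
  finrank_ker : ∀ p ∈ M.carrier, Module.finrank ℝ (K • b p).ker = n

/-- A smooth immersion of an open set with values in `S`. -/
structure IsImmersionInto {m N : ℕ} (O : Set (Eu m)) (φ : Eu m → Eu N) (S : Set (Eu N)) :
    Prop where
  isOpen : IsOpen O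
  smooth : ContDiffOn ℝ ∞ φ O
  injective : ∀ x ∈ O, Function.Injective (fderiv ℝ φ x)
  mapsTo : ∀ x ∈ O, φ x ∈ S

theorem IsSmoothParam.isImmersionInto {m N : ℕ} {O : Set (Eu m)} {φ : Eu m → Eu N}
    {S : Set (Eu N)} (h : IsSmoothParam O φ S) : IsImmersionInto O φ S where
  isOpen := h.1.isOpen_dom
  smooth := h.2
  injective := h.1.immersion
  mapsTo x hx := by
    obtain ⟨W, -, hW⟩ := h.1.open_image
    exact (hW.subset (mem_image_of_mem φ hx)).1

/-- `S` is part of a generalized sphere of `M` with unit normal `c + κ p`. -/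
structure IsQuasiSphere {n N : ℕ} (M : ModelSpace n N) (b : Eu N →L[ℝ] Eu N →L[ℝ] ℝ)
    (S : Set (Eu N)) (c : Eu N) (κ : ℝ) : Prop where
  subset : S ⊆ M.carrier
  tangent : ∀ p ∈ S, c + κ • p ∈ M.tangent p
  unit : ∀ p ∈ S, b (c + κ • p) (c + κ • p) = 1
  -- The equation of the sphere expanded about one of its points p. In this form it reads the same
  -- for every K.
  eq_zero : ∀ x ∈ S, ∀ p ∈ S, 2 * b (x - p) (c + κ • p) + κ * b (x - p) (x - p) = 0

/-- `V` restricts to a function on `M` with `∇²V = (t - K V) g`. -/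
structure IsPotential {n N : ℕ} (M : ModelSpace n N) (b : Eu N →L[ℝ] Eu N →L[ℝ] ℝ) (K : ℝ)
    (V : Eu N → ℝ) (t : ℝ) : Prop where
  smooth : ContDiff ℝ ∞ V
  -- The ambient Hessian is t₀ b, and the normal K p of M subtracts dV(K p) g from it. The condition
  -- makes the result (t - K V) g.
  second : ∃ t₀, (∀ p u v, fderiv ℝ (fderiv ℝ V) p u v = t₀ * b u v) ∧
    ∀ p ∈ M.carrier, fderiv ℝ V p (K • p) = K * V p - t + t₀

section Calculus

variable {E F : Type*} [NormedAddCommGroup E] [NormedSpace ℝ E] [NormedAddCommGroup F]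
  [NormedSpace ℝ F]

theorem fderiv_bilin (b : F →L[ℝ] F →L[ℝ] ℝ) {f g : E → F} {x : E}
    (hf : DifferentiableAt ℝ f x) (hg : DifferentiableAt ℝ g x) (v : E) :
    fderiv ℝ (fun z => b (f z) (g z)) x v = b (fderiv ℝ f x v) (g x) + b (f x) (fderiv ℝ g x v) := by
  have h1 : HasFDerivAt (fun z => b (f z)) (b ∘L fderiv ℝ f x) x :=
    b.hasFDerivAt.comp x hf.hasFDerivAt
  have h2 := h1.clm_apply hg.hasFDerivAt
  rw [h2.fderiv]
  simp [add_comm]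

theorem fderiv_eq_zero_of_eq_const {O : Set E} (hO : IsOpen O) {f : E → F} {c : F}
    (h : ∀ z ∈ O, f z = c) {x : E} (hx : x ∈ O) : fderiv ℝ f x = 0 := by
  have : f =ᶠ[𝓝 x] fun _ => c := Filter.eventually_of_mem (hO.mem_nhds hx) h
  rw [this.fderiv_eq]
  simp

end Calculus

/-! ### Immersions into a space form and into its generalized spheres. -/

section Immersions

variable {n N m : ℕ} {M : ModelSpace n N} {b : Eu N →L[ℝ] Eu N →L[ℝ] ℝ} {K : ℝ}
  {O : Set (Eu m)} {φ : Eu m → Eu N} {S : Set (Eu N)}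

theorem IsImmersionInto.differentiableAt (h : IsImmersionInto O φ S) {x : Eu m} (hx : x ∈ O) :
    DifferentiableAt ℝ φ x :=
  (h.smooth.contDiffAt (h.isOpen.mem_nhds hx)).differentiableAt (by simp)

theorem IsImmersionInto.differentiableAt_pd (h : IsImmersionInto O φ S) {x : Eu m} (hx : x ∈ O)
    (a : Fin m) : DifferentiableAt ℝ (fun z => pd a φ z) x :=
  ((contDiffOn_pd h.isOpen h.smooth a).contDiffAt (h.isOpen.mem_nhds hx)).differentiableAt
    (by simp)

theorem IsImmersionInto.mono (h : IsImmersionInto O φ S) {S' : Set (Eu N)} (hS : S ⊆ S') :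
    IsImmersionInto O φ S' :=
  { h with mapsTo := fun x hx => hS (h.mapsTo x hx) }

namespace IsGeometry

variable (G : IsGeometry M b K)
include G

theorem mem_ker_iff (p v : Eu N) : v ∈ (K • b p).ker ↔ v ∈ M.tangent p := by
  rw [G.tangent_iff]; simp

theorem fderiv_mem_tangent (h : IsImmersionInto O φ M.carrier) {x : Eu m} (hx : x ∈ O)
    (v : Eu m) : fderiv ℝ φ x v ∈ M.tangent (φ x) := by
  rw [G.tangent_iff]
  have hd := h.differentiableAt hx
  have h1 := fderiv_eq_zero_of_eq_const (f := fun z => (K • b) (φ z) (φ z)) (c := K ^ 2) h.isOpen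
    (fun z hz => by simpa using G.level _ (h.mapsTo z hz)) hx
  have h2 := fderiv_bilin (K • b) hd hd v
  rw [h1] at h2
  simp only [smul_apply, smul_eq_mul, zero_apply] at h2
  rw [G.symm (fderiv ℝ φ x v)] at h2
  linarith

/-- A dimension count in the tangent space: an injective m-dimensional part and r orthonormal
vectors orthogonal to it fill it if m + r = n. It serves charts of M (r = 0), hypersurfaces (r = 1)
and triple sets (r = 2). -/
theorem exists_decomposition {p : Eu N} (hp : p ∈ M.carrier) {r : ℕ} (hr : m + r = n)
    {A : Eu m →ₗ[ℝ] Eu N} (hA : Function.Injective A) (hAT : ∀ v, A v ∈ M.tangent p)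
    {u : Fin r → Eu N} (huT : ∀ s, u s ∈ M.tangent p)
    (hu : ∀ s t, b (u s) (u t) = if s = t then 1 else 0) (huA : ∀ s v, b (u s) (A v) = 0)
    {w : Eu N} (hw : w ∈ M.tangent p) : ∃ v, w = A v + ∑ s, b (u s) w • u s := by
  let L₀ : (Eu m × (Fin r → ℝ)) →ₗ[ℝ] Eu N :=
    A.coprod (Fintype.linearCombination ℝ u)
  have hL₀ : ∀ z, L₀ z = A z.1 + ∑ s, z.2 s • u s := fun z => rfl
  have hbL : ∀ s z, b (u s) (L₀ z) = z.2 s := by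
    intro s z
    simp [hL₀, huA, hu, map_sum]
  have hmem : ∀ z, L₀ z ∈ (K • b p).ker := by
    intro z
    rw [hL₀]
    refine Submodule.add_mem _ ((G.mem_ker_iff _ _).2 (hAT _)) (Submodule.sum_mem _ fun s _ =>
      Submodule.smul_mem _ _ ((G.mem_ker_iff _ _).2 (huT s)))
  let L : (Eu m × (Fin r → ℝ)) →ₗ[ℝ] (K • b p).ker := L₀.codRestrict _ hmem
  have hinj : Function.Injective L := by
    rw [← LinearMap.ker_eq_bot, LinearMap.ker_eq_bot']
    intro z hz
    have hz0 : L₀ z = 0 := congrArg Subtype.val hz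
    have h2 : z.2 = 0 := by
      ext s
      rw [← hbL s z, hz0]; simp
    have h1 : A z.1 = 0 := by
      rw [hL₀] at hz0
      simpa [h2] using hz0
    exact Prod.ext (hA (h1.trans (map_zero A).symm)) h2
  have hdim : Module.finrank ℝ (Eu m × (Fin r → ℝ)) = Module.finrank ℝ (K • b p).ker := by
    rw [G.finrank_ker p hp]; simp [hr]
  obtain ⟨z, hz⟩ := (LinearMap.injective_iff_surjective_of_finrank_eq_finrank hdim).1 hinj
    ⟨w, (G.mem_ker_iff _ _).2 hw⟩
  have hz' : L₀ z = w := congrArg Subtype.val hz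
  refine ⟨z.1, ?_⟩
  conv_lhs => rw [← hz', hL₀]
  congr 1
  refine Finset.sum_congr rfl fun s _ => ?_
  rw [← hbL s z, hz']

theorem det_gram_ne_zero (h : IsImmersionInto O φ M.carrier) {x : Eu m} (hx : x ∈ O) :
    (gram M φ x).det ≠ 0 := by
  intro h0
  obtain ⟨γ, hγ, hγ0⟩ := Matrix.exists_mulVec_eq_zero_iff.2 h0
  set v : Eu m := WithLp.toLp 2 γ with hv
  have hb : b (fderiv ℝ φ x v) (fderiv ℝ φ x v) = 0 := by
    have : b (fderiv ℝ φ x v) (fderiv ℝ φ x v) = ∑ i, γ i * ((gram M φ x).mulVec γ) i := by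
      simp only [fderiv_eq_sum_pd, map_sum, map_smul, sum_apply, smul_apply, smul_eq_mul,
        Matrix.mulVec, dotProduct, gram, G.form_eq, Finset.mul_sum, hv]
      rw [Finset.sum_comm]
      exact Finset.sum_congr rfl fun i _ => Finset.sum_congr rfl fun j _ => by ring
    rw [this, hγ0]; simp
  have hne : fderiv ℝ φ x v ≠ 0 := by
    intro h1
    have : v = 0 := h.injective x hx (h1.trans (map_zero _).symm)
    apply hγ
    have h2 := congrArg (WithLp.ofLp) this
    simpa [hv] using h2
  exact (G.pos _ (h.mapsTo x hx) _ (G.fderiv_mem_tangent h hx v) hne).ne' hb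

theorem radial_pd_pd (h : IsImmersionInto O φ M.carrier) {x : Eu m} (hx : x ∈ O) (i j : Fin m) :
    K * b (φ x) (pd i (fun z => pd j φ z) x) = -(K * b (pd i φ x) (pd j φ x)) := by
  have h1 := fderiv_eq_zero_of_eq_const (f := fun z => (K • b) (φ z) (pd j φ z)) (c := 0) h.isOpen
    (fun z hz => by simpa [pd] using (G.tangent_iff _ _).1 (G.fderiv_mem_tangent h hz _)) hx
  have h2 := fderiv_bilin (K • b) (h.differentiableAt hx) (h.differentiableAt_pd hx j)
    (EuclideanSpace.single i 1)
  rw [h1] at h2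
  simp only [smul_apply, smul_eq_mul, zero_apply] at h2
  simp only [pd] at *
  linarith

/-- A parametrization of `M` itself is umbilic. -/
theorem isUmbilic_carrier (hm : m = n) (h : IsImmersionInto O φ M.carrier) :
    IsUmbilic M b O φ (fun x => K • φ x) K where
  form_eq := G.form_eq
  symm := G.symm
  isOpen := h.isOpen
  smooth := h.smooth
  hasFDerivAt x hx := (h.differentiableAt hx).hasFDerivAt.const_smul K
  det_ne x hx := G.det_gram_ne_zero h hx
  orth x hx a := by
    simpa [pd] using
      (G.tangent_iff _ _).1 (G.fderiv_mem_tangent h hx (EuclideanSpace.single a 1))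
  gauss x hx i j := by
    have hw : pd i (fun z => pd j φ z) x + gram M φ x i j • K • φ x ∈ M.tangent (φ x) := by
      rw [G.tangent_iff]
      have h1 := G.radial_pd_pd h hx i j
      have h2 := G.level _ (h.mapsTo x hx)
      simp only [map_add, map_smul, smul_eq_mul, gram, G.form_eq]
      have h3 := G.cube
      linear_combination h1 + b (pd i φ x) (pd j φ x) * K * h2 + b (pd i φ x) (pd j φ x) * h3
    obtain ⟨v, hv⟩ := G.exists_decomposition (r := 0) (h.mapsTo x hx) (by simpa using hm)
      (A := (fderiv ℝ φ x).toLinearMap) (u := Fin.elim0)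
      (h.injective x hx) (fun v => G.fderiv_mem_tangent h hx v) (fun s => s.elim0)
      (fun s => s.elim0) (fun s => s.elim0) hw
    refine ⟨fun c => v c, ?_⟩
    rw [← fderiv_eq_sum_pd]
    simp only [Finset.univ_eq_empty, Finset.sum_empty, add_zero] at hv
    exact eq_sub_of_add_eq hv

variable {c : Eu N} {κ : ℝ} (Q : IsQuasiSphere M b S c κ)
include Q

/-- Differentiation of the expanded sphere equation at its base point φ x, where the quadratic term
has zero derivative. -/
theorem normal_fderiv (h : IsImmersionInto O φ S) {x : Eu m} (hx : x ∈ O) (v : Eu m) :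
    b (c + κ • φ x) (fderiv ℝ φ x v) = 0 := by
  have hd : DifferentiableAt ℝ (fun z => φ z - φ x) x := (h.differentiableAt hx).sub_const _
  have h1 := fderiv_eq_zero_of_eq_const (f := fun z => b ((2 : ℝ) • (φ z - φ x)) (c + κ • φ x)
    + (κ • b) (φ z - φ x) (φ z - φ x)) (c := 0) h.isOpen
    (fun z hz => by simpa using Q.eq_zero _ (h.mapsTo z hz) _ (h.mapsTo x hx)) hx
  have hd1 : DifferentiableAt ℝ (fun z => (2 : ℝ) • (φ z - φ x)) x := hd.fun_const_smul 2
  have hd2 : DifferentiableAt ℝ (fun _ : Eu m => c + κ • φ x) x := differentiableAt_const _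
  have h2 := fderiv_bilin b hd1 hd2 v
  have h3 := fderiv_bilin (κ • b) hd hd v
  have hD1 : DifferentiableAt ℝ (fun z => b ((2 : ℝ) • (φ z - φ x)) (c + κ • φ x)) x :=
    (b.differentiableAt.comp x hd1).clm_apply hd2
  have hD2 : DifferentiableAt ℝ (fun z => (κ • b) (φ z - φ x) (φ z - φ x)) x :=
    ((κ • b).differentiableAt.comp x hd).clm_apply hd
  have h4 := congrArg (fun A => A v) ((fderiv_fun_add hD1 hD2).symm.trans h1)
  simp only [add_apply, zero_apply] at h4
  rw [h2, h3, fderiv_fun_const_smul hd] at h4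
  simp only [fderiv_sub_const, smul_apply, map_smul, smul_eq_mul, sub_self, map_zero,
    zero_apply, Pi.zero_apply, add_zero, fderiv_fun_const] at h4
  rw [G.symm]
  linarith

/-- Differentiation of b(ν, ∂_j φ) = 0, using dν = κ dφ. -/
theorem normal_pd_pd (h : IsImmersionInto O φ S) {x : Eu m} (hx : x ∈ O) (i j : Fin m) :
    b (c + κ • φ x) (pd i (fun z => pd j φ z) x) = -(κ * b (pd i φ x) (pd j φ x)) := by
  have hd := h.differentiableAt hx
  have hn : DifferentiableAt ℝ (fun z => c + κ • φ z) x := (hd.const_smul κ).const_add c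
  have h1 := fderiv_eq_zero_of_eq_const (f := fun z => b (c + κ • φ z) (pd j φ z)) (c := 0)
    h.isOpen (fun z hz => G.normal_fderiv Q h hz _) hx
  have h2 := fderiv_bilin b hn (h.differentiableAt_pd hx j) (EuclideanSpace.single i 1)
  rw [h1, fderiv_const_add, fderiv_fun_const_smul hd] at h2
  simp only [smul_apply, zero_apply, map_smul, smul_eq_mul] at h2
  simp only [pd] at *
  linarith

/-- A parametrization of a generalized sphere is umbilic. -/
theorem isUmbilic_quasiSphere (hm : m + 1 = n) (h : IsImmersionInto O φ S) :
    IsUmbilic M b O φ (fun x => K • φ x + κ • (c + κ • φ x)) (K + κ ^ 2) where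
  form_eq := G.form_eq
  symm := G.symm
  isOpen := h.isOpen
  smooth := h.smooth
  hasFDerivAt x hx := by
    have hd := (h.differentiableAt hx).hasFDerivAt
    refine ((hd.const_smul K).add (((hd.const_smul κ).const_add c).const_smul κ)).congr_fderiv ?_
    rw [smul_smul, ← add_smul, pow_two]
  det_ne x hx := G.det_gram_ne_zero (h.mono Q.subset) hx
  orth x hx a := by
    have h1 := (G.tangent_iff _ _).1
      (G.fderiv_mem_tangent (h.mono Q.subset) hx (EuclideanSpace.single a 1))
    have h2 := G.normal_fderiv Q h hx (EuclideanSpace.single a 1)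
    rw [map_add, map_smul, map_smul, add_apply, smul_apply, smul_apply, smul_eq_mul, smul_eq_mul]
    simp only [pd]
    rw [h1, h2]; simp
  gauss x hx i j := by
    have hM := h.mono Q.subset
    have hxS := h.mapsTo x hx
    set ν := c + κ • φ x with hν
    have hνT := (G.tangent_iff _ _).1 (Q.tangent _ hxS)
    have hν1 := Q.unit _ hxS
    rw [← hν] at hνT hν1
    -- The second derivative with its components along the two normals removed. It is tangent to M
    -- and orthogonal to ν, hence tangent to the hypersurface.
    set w := pd i (fun z => pd j φ z) x + gram M φ x i j • (K • φ x + κ • ν) with hw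
    have h1 := G.radial_pd_pd hM hx i j
    have h2 := G.level _ (Q.subset hxS)
    have h3 := G.cube
    have h4 := G.normal_pd_pd Q h hx i j
    rw [← hν] at h4
    have hwT : w ∈ M.tangent (φ x) := by
      rw [G.tangent_iff]
      simp only [hw, map_add, map_smul, smul_eq_mul, gram, G.form_eq]
      linear_combination h1 + b (pd i φ x) (pd j φ x) * K * h2 + b (pd i φ x) (pd j φ x) * h3
        + b (pd i φ x) (pd j φ x) * κ * hνT
    have hwν : b ν w = 0 := by
      simp only [hw, map_add, map_smul, smul_eq_mul, gram, G.form_eq]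
      rw [G.symm ν (φ x)]
      linear_combination h4 + b (pd i φ x) (pd j φ x) * hνT + b (pd i φ x) (pd j φ x) * κ * hν1
    obtain ⟨v, hv⟩ := G.exists_decomposition (r := 1) (Q.subset hxS) hm
      (A := (fderiv ℝ φ x).toLinearMap) (u := fun _ => ν)
      (h.injective x hx) (fun v => G.fderiv_mem_tangent hM hx v)
      (fun s => (G.tangent_iff _ _).2 hνT)
      (fun s t => by rw [hν1, if_pos (Subsingleton.elim s t)])
      (fun s v => G.normal_fderiv Q h hx v) hwT
    refine ⟨fun a => v a, ?_⟩
    rw [← fderiv_eq_sum_pd]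
    simp only [hwν, zero_smul, Finset.sum_const_zero, add_zero] at hv
    exact eq_sub_of_add_eq hv

variable {V : Eu N → ℝ} {t : ℝ} (P : IsPotential M b K V t)
include P

/-- In `IsUmbilic.hess_eq` the normal field is Kφ + κν. Here dV(Kφ) = K V - t + t₀ by `IsPotential`,
and dV(κν) = κ² V by the hypothesis on the normal derivative. -/
theorem hess_potential (hm : m + 1 = n) (h : IsImmersionInto O φ S) {x : Eu m} (hx : x ∈ O)
    (hV : fderiv ℝ V (φ x) (c + κ • φ x) = κ * V (φ x)) (i j : Fin m) :
    hess M φ (fun z => V (φ z)) i j x = (t - (K + κ ^ 2) * V (φ x)) * gram M φ x i j := by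
  obtain ⟨t₀, ht₀, hrad⟩ := P.second
  have hVd : ∀ p, DifferentiableAt ℝ V p := fun p => (P.smooth.differentiable (by simp)) p
  have hV2 : ContDiff ℝ ∞ (fderiv ℝ V) := P.smooth.fderiv_right (by simp)
  have hVd2 : ∀ p, DifferentiableAt ℝ (fderiv ℝ V) p := fun p => (hV2.differentiable (by simp)) p
  have U := G.isUmbilic_quasiSphere Q hm h
  rw [U.hess_eq hx (t₀ := t₀) (hVd _)]
  · rw [map_add, map_smul _ κ, hV, hrad _ (Q.subset (h.mapsTo x hx)), smul_eq_mul]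
    ring
  · have h1 : ∀ z ∈ O, pd j (fun w => V (φ w)) z = fderiv ℝ V (φ z) (pd j φ z) := by
      intro z hz
      have := ((hVd _).hasFDerivAt.comp z (h.differentiableAt hz).hasFDerivAt).fderiv
      simp only [pd]
      rw [show (fun w => V (φ w)) = V ∘ φ from rfl, this]
      rfl
    rw [pd_congr h.isOpen h1 hx]
    have h2 : HasFDerivAt (fun z => fderiv ℝ V (φ z)) (fderiv ℝ (fderiv ℝ V) (φ x) ∘L fderiv ℝ φ x) x :=
      (hVd2 _).hasFDerivAt.comp x (h.differentiableAt hx).hasFDerivAt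
    have h3 := (h2.clm_apply (h.differentiableAt_pd hx j).hasFDerivAt).fderiv
    conv_lhs => rw [pd]
    rw [h3]
    simp only [add_apply, ContinuousLinearMap.comp_apply, ContinuousLinearMap.flip_apply, ht₀, gram, G.form_eq]
    simp only [pd]
    ring

/-- With m = n - 1 the Laplacian is m (t - (K + κ²) V), while Ric_M(ν, ν) + ‖II‖² = m K + m κ². The
terms in V cancel. -/
theorem jacobi_eq (hm : m + 1 = n) (h : IsImmersionInto O φ S) {x : Eu m} (hx : x ∈ O)
    (hV : fderiv ℝ V (φ x) (c + κ • φ x) = κ * V (φ x)) {ν : Eu m → Eu N}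
    (hν : ∀ z ∈ O, ν z = c + κ • φ z) {O₁ : Set (Eu n)} {Φ : Eu n → Eu N}
    (hΦ : IsImmersionInto O₁ Φ M.carrier) {y : Eu n} (hy : y ∈ O₁) (hxy : Φ y = φ x) :
    jacobi M φ ν Φ V x y = ((n : ℝ) - 1) * t := by
  have U := G.isUmbilic_quasiSphere Q hm h
  have UM := G.isUmbilic_carrier rfl hΦ
  have hxS := h.mapsTo x hx
  have hII : ∀ i j, secondForm M φ ν i j x = κ * gram M φ x i j := by
    intro i j
    rw [secondForm, pd_congr h.isOpen hν hx, pd, fderiv_const_add,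
      fderiv_fun_const_smul (h.differentiableAt hx)]
    simp [gram, G.form_eq, pd]
  have hνT : ν x ∈ M.tangent (Φ y) := by
    rw [hν x hx, hxy]; exact Q.tangent _ hxS
  obtain ⟨v, hv⟩ := G.exists_decomposition (r := 0) (hΦ.mapsTo y hy) (by simp)
      (A := (fderiv ℝ Φ y).toLinearMap) (u := Fin.elim0)
      (hΦ.injective y hy) (fun v => G.fderiv_mem_tangent hΦ hy v) (fun s => s.elim0)
      (fun s => s.elim0) (fun s => s.elim0) hνT
  have hv' : ν x = ∑ a, v a • pd a Φ y := by
    rw [← fderiv_eq_sum_pd]; simpa using hv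
  rw [jacobi, U.lap_eq hx (G.hess_potential Q P hm h hx hV), UM.ricciForm_eq hy hv',
    U.secondFormSq_eq hx hII, hν x hx, Q.unit _ hxS]
  have : (m : ℝ) + 1 = n := by exact_mod_cast hm
  rw [← this]; ring

/-- With l = K + κ² and m = n - 1, the three terms times V are (m - 1) l V, -(t - l V) and m (t - l
V), with sum (m - 1) t. -/
theorem mul_ricciV_eq (hm : m + 1 = n) (h : IsImmersionInto O φ S) {x : Eu m} (hx : x ∈ O)
    (hV : fderiv ℝ V (φ x) (c + κ • φ x) = κ * V (φ x)) (hV0 : V (φ x) ≠ 0) (i j : Fin m) :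
    V (φ x) * ricciV M φ V i j x = (((n : ℝ) - 2) * t) * gram M φ x i j := by
  have U := G.isUmbilic_quasiSphere Q hm h
  rw [ricciV, U.ricci_eq hx, U.lap_eq hx (G.hess_potential Q P hm h hx hV),
    G.hess_potential Q P hm h hx hV]
  have : (m : ℝ) + 1 = n := by exact_mod_cast hm
  rw [← this]; field_simp; ring

end IsGeometry

end Immersions

/-! ### Cells near a point with a plateau chart. -/

section Chambers

variable {n N k : ℕ} {M : ModelSpace n N} {ι : Type*} {Ω : ι → Set (Eu N)}

/-- The vector `e_l - (1/k) ∑ e_m` of `sumZero k`. -/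
def sumZeroVec {k : ℕ} (l : Fin k) : sumZero k :=
  ⟨EuclideanSpace.single l 1 - WithLp.toLp 2 (fun _ => (k : ℝ)⁻¹), by
    have hk : (k : ℝ) ≠ 0 := by
      have := l.pos
      positivity
    change ∑ i, _ = (0 : ℝ)
    simp [Finset.sum_sub_distrib, hk]⟩

theorem sumZeroVec_apply {k : ℕ} (l m : Fin k) :
    (sumZeroVec l).1 m = (if m = l then 1 else 0) - (k : ℝ)⁻¹ := by
  simp [sumZeroVec]

theorem bdry_disjoint_cell (hopen : ∀ i, ∃ W, IsOpen W ∧ Ω i = M.carrier ∩ W)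
    (hdisj : Pairwise fun i j => Disjoint (Ω i) (Ω j)) (i j : ι) :
    Disjoint (bdry M (Ω i)) (Ω j) := by
  rw [Set.disjoint_left]
  rintro y ⟨h1, h2⟩ hy
  obtain ⟨W, hW, hWj⟩ := hopen j
  have hyW : y ∈ W := (hWj.subset hy).2
  by_cases hij : i = j
  · subst hij
    obtain ⟨z, hzW, hz⟩ := mem_closure_iff.1 h2 W hW hyW
    exact hz.2 (hWj.symm.subset ⟨hz.1, hzW⟩)
  · obtain ⟨z, hzW, hz⟩ := mem_closure_iff.1 h1 W hW hyW
    obtain ⟨W', -, hW'⟩ := hopen i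
    exact Set.disjoint_left.1 (hdisj hij) hz (hWj.symm.subset ⟨(hW'.subset hz).1, hzW⟩)

theorem sigma_disjoint_cell (hopen : ∀ i, ∃ W, IsOpen W ∧ Ω i = M.carrier ∩ W)
    (hdisj : Pairwise fun i j => Disjoint (Ω i) (Ω j)) (j : ι) :
    Disjoint (sigma M Ω) (Ω j) :=
  Set.disjoint_iUnion_left.2 fun i => bdry_disjoint_cell hopen hdisj i j

theorem IsParam.image_open {F : Type*} [NormedAddCommGroup F] [NormedSpace ℝ F] {O : Set F}
    {φ : F → Eu N} {S : Set (Eu N)} (h : IsParam O φ S) {U : Set F} (hU : IsOpen U)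
    (hUO : U ⊆ O) : ∃ W, IsOpen W ∧ φ '' U = S ∩ W := by
  obtain ⟨W₀, hW₀, hS⟩ := h.open_image
  have h1 : IsOpen ((↑) ⁻¹' U : Set O) := hU.preimage continuous_subtype_val
  obtain ⟨W₁, hW₁, h2⟩ := h.embedding.isInducing.isOpen_iff.1 h1
  refine ⟨W₀ ∩ W₁, hW₀.inter hW₁, ?_⟩
  rw [← inter_assoc, ← hS]
  ext y
  constructor
  · rintro ⟨x, hx, rfl⟩
    refine ⟨mem_image_of_mem _ (hUO hx), ?_⟩
    have : (⟨x, hUO hx⟩ : O) ∈ O.domRestrict φ ⁻¹' W₁ := by rw [h2]; exact hx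
    exact this
  · rintro ⟨⟨x, hx, rfl⟩, hy⟩
    have : (⟨x, hx⟩ : O) ∈ O.domRestrict φ ⁻¹' W₁ := hy
    rw [h2] at this
    exact ⟨x, this, rfl⟩

theorem IsParam.continuousOn {F : Type*} [NormedAddCommGroup F] [NormedSpace ℝ F] {O : Set F}
    {φ : F → Eu N} {S : Set (Eu N)} (h : IsParam O φ S) : ContinuousOn φ O :=
  h.contDiffOn.continuousOn

/-- A chamber, where one coordinate is strictly the largest, is convex and its image avoids Σ. By
connectedness it lies in Ω i as soon as it meets Ω i. Some chamber meets Ω i because Ω i is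
relatively open and accumulates at p. -/
theorem exists_chamber {p : Eu N} {O : Set (sumZero k × Eu (n + 1 - k))}
    {Ψ : sumZero k × Eu (n + 1 - k) → Eu N} (hk : 0 < k) (hΨ : IsParam O Ψ M.carrier)
    (hS : IsPlateauChart (n := n) (sigma M Ω) k p O Ψ)
    (hopen : ∀ i, ∃ W, IsOpen W ∧ Ω i = M.carrier ∩ W) :
    ∃ ε > 0, Metric.ball 0 ε ⊆ O ∧ ∀ i, p ∈ closure (Ω i) →
      ∃ l : Fin k, ∀ x ∈ Metric.ball (0 : sumZero k × Eu (n + 1 - k)) ε,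
        (∀ m, m ≠ l → x.1.1 m < x.1.1 l) → Ψ x ∈ Ω i := by
  obtain ⟨h0, hp, hS⟩ := hS
  obtain ⟨ε, hε, hεO⟩ := Metric.isOpen_iff.1 hΨ.isOpen_dom 0 h0
  refine ⟨ε, hε, hεO, fun i hi => ?_⟩
  set B := Metric.ball (0 : sumZero k × Eu (n + 1 - k)) ε with hB
  obtain ⟨W, hW, hWB⟩ := hΨ.image_open Metric.isOpen_ball hεO
  obtain ⟨Wi, hWi, hΩi⟩ := hopen i
  have hpW : p ∈ W := (hWB.subset ⟨0, Metric.mem_ball_self hε, hp⟩).2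
  obtain ⟨y, hyW, hyΩ⟩ := mem_closure_iff.1 hi W hW hpW
  have hyM := (hΩi.subset hyΩ).1
  obtain ⟨x₀, hx₀, rfl⟩ := hWB.symm.subset ⟨hyM, hyW⟩
  have hcont : ContinuousOn Ψ B := hΨ.continuousOn.mono hεO
  have hU : IsOpen (B ∩ Ψ ⁻¹' Wi) := hcont.isOpen_inter_preimage Metric.isOpen_ball hWi
  have : Nonempty (Fin k) := ⟨⟨0, hk⟩⟩
  -- The maximal coordinate of x₀ may be tied. A small push along `sumZeroVec l` makes it strictly
  -- maximal without leaving the open preimage of Ω i.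
  obtain ⟨l, hl⟩ := Finite.exists_max (fun m : Fin k => x₀.1.1 m)
  have hlim : Tendsto (fun t : ℝ => x₀ + t • ((sumZeroVec l, 0) : sumZero k × Eu (n + 1 - k)))
      (𝓝[>] 0) (𝓝 x₀) := by
    have : Tendsto (fun t : ℝ => x₀ + t • ((sumZeroVec l, 0) : sumZero k × Eu (n + 1 - k)))
      (𝓝 0) (𝓝 (x₀ + (0 : ℝ) • ((sumZeroVec l, 0) : sumZero k × Eu (n + 1 - k)))) :=
      (continuous_const.add (continuous_id.smul continuous_const)).tendsto 0
    rw [zero_smul, add_zero] at this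
    exact this.mono_left nhdsWithin_le_nhds
  obtain ⟨t, ht0, htU⟩ := ((eventually_mem_nhdsWithin (a := (0 : ℝ)) (s := Ioi 0)).and
    (hlim.eventually (hU.mem_nhds ⟨hx₀, (hΩi.subset hyΩ).2⟩))).exists
  set x₁ := x₀ + t • ((sumZeroVec l, 0) : sumZero k × Eu (n + 1 - k)) with hx₁
  set C := {x ∈ B | ∀ m, m ≠ l → x.1.1 m < x.1.1 l} with hC
  have hx₁C : x₁ ∈ C := by
    refine ⟨htU.1, fun m hm => ?_⟩
    have h1 : ∀ m, x₁.1.1 m = x₀.1.1 m + t * (sumZeroVec l).1 m := fun m => by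
      simp [hx₁]
    rw [h1, h1, sumZeroVec_apply, sumZeroVec_apply, if_neg hm, if_pos rfl]
    have := hl m
    simp only [mem_Ioi] at ht0
    nlinarith
  have hconv : Convex ℝ C := by
    have : C = B ∩ ⋂ m, ⋂ (_ : m ≠ l), {x | x.1.1 m < x.1.1 l} := by
      ext x; simp [hC]
    rw [this]
    refine (convex_ball _ _).inter (convex_iInter₂ fun m _ => ?_)
    intro x hx y hy a b ha hb hab
    simp only [mem_ofPred_eq] at *
    simp only [Prod.fst_add, Prod.smul_fst, Submodule.coe_add, Submodule.coe_smul, PiLp.add_apply,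
      PiLp.smul_apply, smul_eq_mul]
    rcases ha.eq_or_lt with rfl | ha
    · have : b = 1 := by linarith
      subst this; simpa using hy
    · nlinarith [mul_lt_mul_of_pos_left hx ha, mul_le_mul_of_nonneg_left hy.le hb]
  have hpre : IsPreconnected (Ψ '' C) :=
    hconv.isPreconnected.image _ (hcont.mono fun x hx => hx.1)
  have hsub : ∀ y ∈ Ψ '' C, y ∈ M.carrier ∧ y ∉ bdry M (Ω i) := by
    rintro _ ⟨x, hx, rfl⟩
    refine ⟨(hWB.subset (mem_image_of_mem _ hx.1)).1, fun hb => ?_⟩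
    obtain ⟨a, c, hac, h1, h2⟩ := (hS x (hεO hx.1)).1 (mem_iUnion.2 ⟨i, hb⟩)
    by_cases hal : a = l
    · have := hx.2 c (fun h => hac (hal.trans h.symm))
      rw [← hal, h1] at this
      exact lt_irrefl _ this
    · exact absurd (hx.2 a hal) (not_lt.2 (h2 l))
  refine ⟨l, fun x hx hxl => ?_⟩
  by_contra hcon
  have hyC : Ψ x ∈ Ψ '' C := mem_image_of_mem _ ⟨hx, hxl⟩
  obtain ⟨hyM', hyb⟩ := hsub _ hyC
  have key : ∀ z ∈ Ψ '' C, z ∉ Ω i → z ∈ (closure (Ω i))ᶜ := by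
    intro z hz hzΩ hzc
    exact (hsub z hz).2 ⟨hzc, subset_closure ⟨(hsub z hz).1, hzΩ⟩⟩
  -- A point of the chamber outside Ω i would separate its connected image into Ω i and the
  -- complement of the closure of Ω i.
  obtain ⟨z, hz, hz1, hz2⟩ := hpre Wi (closure (Ω i))ᶜ hWi isClosed_closure.isOpen_compl (by
      intro z hz
      by_cases h : z ∈ Ω i
      · exact Or.inl (hΩi.subset h).2
      · exact Or.inr (key z hz h))
    ⟨Ψ x₁, mem_image_of_mem _ hx₁C, htU.2⟩ ⟨Ψ x, hyC, key _ hyC hcon⟩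
  exact hz2 (subset_closure (hΩi.symm.subset ⟨(hsub z hz).1, hz1⟩))

/-- At a point with a plateau chart over `plateauCone k` at most `k` cells meet. -/
theorem exists_chamber_injective {p : Eu N} {O : Set (sumZero k × Eu (n + 1 - k))}
    {Ψ : sumZero k × Eu (n + 1 - k) → Eu N} (hk : 0 < k) (hΨ : IsParam O Ψ M.carrier)
    (hS : IsPlateauChart (n := n) (sigma M Ω) k p O Ψ)
    (hopen : ∀ i, ∃ W, IsOpen W ∧ Ω i = M.carrier ∩ W)
    (hdisj : Pairwise fun i j => Disjoint (Ω i) (Ω j)) :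
    ∃ ε > 0, Metric.ball 0 ε ⊆ O ∧ ∃ f : {i // p ∈ closure (Ω i)} → Fin k,
      Function.Injective f ∧ ∀ i, ∀ x ∈ Metric.ball (0 : sumZero k × Eu (n + 1 - k)) ε,
        (∀ m, m ≠ f i → x.1.1 m < x.1.1 (f i)) → Ψ x ∈ Ω i := by
  obtain ⟨ε, hε, hεO, h⟩ := exists_chamber hk hΨ hS hopen
  choose f hf using fun i : {i // p ∈ closure (Ω i)} => h i i.2
  refine ⟨ε, hε, hεO, f, fun i j hij => ?_, hf⟩
  by_contra hne
  have hlim : Tendsto (fun t : ℝ => t • ((sumZeroVec (f i), 0) : sumZero k × Eu (n + 1 - k)))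
      (𝓝[>] 0) (𝓝 0) := by
    have : Tendsto (fun t : ℝ => t • ((sumZeroVec (f i), 0) : sumZero k × Eu (n + 1 - k)))
      (𝓝 0) (𝓝 ((0 : ℝ) • ((sumZeroVec (f i), 0) : sumZero k × Eu (n + 1 - k)))) :=
      (continuous_id.smul continuous_const).tendsto 0
    rw [zero_smul] at this
    exact this.mono_left nhdsWithin_le_nhds
  obtain ⟨t, ht0, htU⟩ := ((eventually_mem_nhdsWithin (a := (0 : ℝ)) (s := Ioi 0)).and
    (hlim.eventually (Metric.ball_mem_nhds _ hε))).exists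
  have hch : ∀ m, m ≠ f i → (t • ((sumZeroVec (f i), 0) : sumZero k × Eu (n + 1 - k))).1.1 m
      < (t • ((sumZeroVec (f i), 0) : sumZero k × Eu (n + 1 - k))).1.1 (f i) := by
    intro m hm
    simp only [Prod.smul_fst, Submodule.coe_smul, PiLp.smul_apply, smul_eq_mul, sumZeroVec_apply,
      if_neg hm, if_true]
    simp only [mem_Ioi] at ht0
    nlinarith
  refine Set.disjoint_left.1 (hdisj fun h => hne (Subtype.ext h)) (hf i _ htU hch)
    (hf j _ htU (fun m hm => ?_))
  rw [← hij] at hm ⊢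
  exact hch m hm

/-- Two cells whose closures meet at a point with a plateau chart have a common interface. -/
theorem interface_nonempty_of_plateauChart (R : IsRegular M Ω) {p : Eu N}
    {O : Set (sumZero k × Eu (n + 1 - k))}
    {Ψ : sumZero k × Eu (n + 1 - k) → Eu N} (hk : 0 < k) (hΨ : IsParam O Ψ M.carrier)
    (hS : IsPlateauChart (n := n) (sigma M Ω) k p O Ψ) {i j : ι} (hij : i ≠ j)
    (hi : p ∈ closure (Ω i)) (hj : p ∈ closure (Ω j))
    (hsymm : ∀ x y, M.form x (-y) = - M.form x y) (hneg : ∀ p v, v ∈ M.tangent p → -v ∈ M.tangent p)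
    (hunit : ∀ x, M.form (-x) (-x) = M.form x x)
    (hball : ∀ p ∈ M.carrier, ∀ W, IsOpen W → p ∈ W → ∃ r > 0, M.ball p r ⊆ W) :
    (interface M Ω i j).Nonempty := by
  obtain ⟨ε, hε, hεO, f, hf, hfΩ⟩ :=
    exists_chamber_injective hk hΨ hS R.isOpen R.disjoint
  set l := f ⟨i, hi⟩ with hl
  set m := f ⟨j, hj⟩ with hm
  have hlm : l ≠ m := fun h => hij (congrArg Subtype.val (hf h))
  -- Along e the coordinates l and m tie and exceed all others, so a neighbourhood of t • e sees
  -- only the two chambers of Ω i and Ω j and the wall between them.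
  set e : sumZero k × Eu (n + 1 - k) := (sumZeroVec l + sumZeroVec m, 0) with he
  have he1 : ∀ r, e.1.1 r = (if r = l then 1 else 0) + (if r = m then 1 else 0) - 2 * (k : ℝ)⁻¹ := by
    intro r
    simp [he, sumZeroVec_apply]; ring
  have hlim : Tendsto (fun t : ℝ => t • e) (𝓝[>] 0) (𝓝 0) := by
    have : Tendsto (fun t : ℝ => t • e) (𝓝 0) (𝓝 ((0 : ℝ) • e)) :=
      (continuous_id.smul continuous_const).tendsto 0
    rw [zero_smul] at this
    exact this.mono_left nhdsWithin_le_nhds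
  obtain ⟨t, ht0, htU⟩ := ((eventually_mem_nhdsWithin (a := (0 : ℝ)) (s := Ioi 0)).and
    (hlim.eventually (Metric.ball_mem_nhds _ hε))).exists
  simp only [mem_Ioi] at ht0
  set B := Metric.ball (0 : sumZero k × Eu (n + 1 - k)) ε with hB
  have hcoord : ∀ r : Fin k, Continuous fun x : sumZero k × Eu (n + 1 - k) => x.1.1 r := by
    intro r; fun_prop
  set U := B ∩ ⋂ r, {x | r ≠ l → r ≠ m → x.1.1 r < x.1.1 l ∧ x.1.1 r < x.1.1 m} with hU
  have hUo : IsOpen U := by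
    refine Metric.isOpen_ball.inter (isOpen_iInter_of_finite fun r => ?_)
    by_cases h1 : r = l
    · simp [h1]
    by_cases h2 : r = m
    · simp [h2]
    simp only [ne_eq, h1, h2, not_false_eq_true, forall_true_left]
    exact (isOpen_lt (hcoord r) (hcoord l)).inter (isOpen_lt (hcoord r) (hcoord m))
  have hte : t • e ∈ U := by
    refine ⟨htU, mem_iInter.2 fun r h1 h2 => ?_⟩
    simp only [Prod.smul_fst, Submodule.coe_smul, PiLp.smul_apply, smul_eq_mul, he1, if_neg h1,
      if_neg h2, if_true, if_neg hlm, if_neg hlm.symm]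
    constructor <;> nlinarith
  have hte_eq : (t • e).1.1 l = (t • e).1.1 m := by
    simp only [Prod.smul_fst, Submodule.coe_smul, PiLp.smul_apply, smul_eq_mul, he1,
      if_true, if_neg hlm, if_neg hlm.symm]
    ring
  have hUl : ∀ x ∈ U, x.1.1 m < x.1.1 l → Ψ x ∈ Ω i := by
    intro x hx hxl
    refine hfΩ ⟨i, hi⟩ x hx.1 fun r hr => ?_
    by_cases h2 : r = m
    · rw [h2]; exact hxl
    · exact (mem_iInter.1 hx.2 r hr h2).1
  have hUm : ∀ x ∈ U, x.1.1 l < x.1.1 m → Ψ x ∈ Ω j := by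
    intro x hx hxl
    refine hfΩ ⟨j, hj⟩ x hx.1 fun r hr => ?_
    by_cases h2 : r = l
    · rw [h2]; exact hxl
    · exact (mem_iInter.1 hx.2 r h2 hr).2
  have hUS : ∀ x ∈ U, x.1.1 l = x.1.1 m → Ψ x ∈ sigma M Ω := by
    intro x hx hxl
    refine (hS.2.2 x (hεO hx.1)).2 ⟨l, m, hlm, hxl, fun r => ?_⟩
    by_cases h1 : r = l
    · rw [h1]
    by_cases h2 : r = m
    · rw [h2, hxl]
    exact (mem_iInter.1 hx.2 r h1 h2).1.le
  obtain ⟨W, hW, hWU⟩ := hΨ.image_open hUo (fun x hx => hεO hx.1)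
  have hq0 : Ψ (t • e) ∈ M.carrier ∩ W := hWU.subset (mem_image_of_mem _ hte)
  have hcont : ContinuousOn Ψ U := hΨ.continuousOn.mono fun x hx => hεO hx.1
  have hcl : Ψ (t • e) ∈ closure (Ω i) := by
    have h1 : Tendsto (fun s : ℝ => t • e + s • ((sumZeroVec l, 0) : sumZero k × Eu (n + 1 - k)))
        (𝓝[>] 0) (𝓝 (t • e)) := by
      have : Tendsto (fun s : ℝ => t • e + s • ((sumZeroVec l, 0) : sumZero k × Eu (n + 1 - k)))
        (𝓝 0) (𝓝 (t • e + (0 : ℝ) • ((sumZeroVec l, 0) : sumZero k × Eu (n + 1 - k)))) :=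
        (continuous_const.add (continuous_id.smul continuous_const)).tendsto 0
      rw [zero_smul, add_zero] at this
      exact this.mono_left nhdsWithin_le_nhds
    have h2 := ((hcont.continuousAt (hUo.mem_nhds hte)).tendsto.comp h1)
    refine mem_closure_of_tendsto h2 ?_
    filter_upwards [eventually_mem_nhdsWithin, h1.eventually (hUo.mem_nhds hte)] with s hs0 hsU
    refine hUl _ hsU ?_
    have : ∀ r, (t • e + s • ((sumZeroVec l, 0) : sumZero k × Eu (n + 1 - k))).1.1 r
      = (t • e).1.1 r + s * (sumZeroVec l).1 r := by intro r; simp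
    rw [this, this, hte_eq, sumZeroVec_apply, sumZeroVec_apply, if_neg hlm.symm, if_pos rfl]
    simp only [mem_Ioi] at hs0
    nlinarith
  have hnot : Ψ (t • e) ∉ Ω i := fun h =>
    Set.disjoint_left.1 (sigma_disjoint_cell R.isOpen R.disjoint i) (hUS _ hte hte_eq) h
  have hb : Ψ (t • e) ∈ bdry M (Ω i) := ⟨hcl, subset_closure ⟨hq0.1, hnot⟩⟩
  -- The wall point is only known to be in the topological boundary. Density of the reduced boundary
  -- supplies a nearby q with a normal, still inside the two-chamber neighbourhood.
  rw [← R.closure_reduced] at hb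
  obtain ⟨q, hqW, ν, hqM, hνT, hν1, hlimq⟩ := mem_closure_iff.1 hb W hW hq0.2
  refine ⟨q, ⟨ν, hqM, hνT, hν1, hlimq⟩, -ν, hqM, hneg _ _ hνT, by rw [hunit, hν1], ?_⟩
  obtain ⟨r₀, hr₀, hrW⟩ := hball q hqM W hW hqW
  refine tendsto_of_tendsto_of_tendsto_of_le_of_le' tendsto_const_nhds hlimq
    (Eventually.of_forall fun _ => zero_le) ?_
  filter_upwards [Ioo_mem_nhdsGT hr₀] with r hr
  refine ENNReal.div_le_div_right ?_ _
  -- Near q the cells Ω i and Ω j are complementary up to points in no cell. So -ν is a normal of Ω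
  -- j, its exceptional set exceeding that of Ω i by a null set at most.
  calc _ ≤ M.hausdorff n ({x ∈ M.ball q r | (x ∈ Ω i ∧ 0 < M.form (x - q) ν) ∨
          (x ∉ Ω i ∧ M.form (x - q) ν < 0)} ∪ (M.carrier \ ⋃ i, Ω i)) := measure_mono ?_
    _ ≤ _ + M.hausdorff n (M.carrier \ ⋃ i, Ω i) := measure_union_le _ _
    _ = _ := by rw [R.null, add_zero]
  rintro x ⟨hxr, hx⟩
  simp only [hsymm] at hx
  rcases hx with ⟨hxj, hx⟩ | ⟨hxj, hx⟩
  · exact Or.inl ⟨hxr, Or.inr ⟨fun h => Set.disjoint_left.1 (R.disjoint hij) h hxj, by linarith⟩⟩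
  · by_cases hxi : x ∈ Ω i
    · exact Or.inl ⟨hxr, Or.inl ⟨hxi, by linarith⟩⟩
    · have hxB : x ∈ M.ball q r₀ := ⟨hxr.1, hxr.2.trans hr.2⟩
      obtain ⟨z, hz, rfl⟩ := hWU.symm.subset ⟨hxr.1, hrW hxB⟩
      have hzS : Ψ z ∈ sigma M Ω := by
        rcases lt_trichotomy (z.1.1 l) (z.1.1 m) with h | h | h
        · exact absurd (hUm z hz h) hxj
        · exact hUS z hz h
        · exact absurd (hUl z hz h) hxi
      refine Or.inr ⟨hxr.1, fun h => ?_⟩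
      obtain ⟨s, hs⟩ := mem_iUnion.1 h
      exact Set.disjoint_left.1 (sigma_disjoint_cell R.isOpen R.disjoint s) hzS hs

end Chambers

/-! ### Voronoi partitions of the three geometries treated at once. -/

section VoronoiLike

/-- The common features of spherical Voronoi partitions of the three model spaces: the cell `Ω i` lies
where `L i` is minimal, and the interface between `Ω i` and `Ω j`, if non-empty, has the unit normal
`(a i - a j) + (k i - k j) p`. -/
structure IsVoronoiLike {n N : ℕ} (M : ModelSpace n N) (b : Eu N →L[ℝ] Eu N →L[ℝ] ℝ) {ι : Type*}
    (Ω : ι → Set (Eu N)) (a : ι → Eu N) (k : ι → ℝ) (L : ι → Eu N → ℝ) : Prop where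
  continuousOn : ∀ i, ContinuousOn (L i) M.carrier
  expand : ∀ i, ∀ x ∈ M.carrier, ∀ p ∈ M.carrier,
    L i x - L i p = b (x - p) (a i + k i • p) + k i / 2 * b (x - p) (x - p)
  subset : ∀ i, Ω i ⊆ M.carrier
  lt : ∀ i, ∀ x ∈ Ω i, ∀ j, j ≠ i → L i x < L j x
  normal : ∀ i j, i ≠ j → (interface M Ω i j).Nonempty → ∀ p ∈ M.carrier, L i p = L j p →
    (a i - a j) + (k i - k j) • p ∈ M.tangent p ∧
      b ((a i - a j) + (k i - k j) • p) ((a i - a j) + (k i - k j) • p) = 1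

/-- Blow-up properties of reduced boundaries in `M`. -/
structure HasBlowUps {n N : ℕ} (M : ModelSpace n N) : Prop where
  ball_subset : ∀ p ∈ M.carrier, ∀ W, IsOpen W → p ∈ W → ∃ r > 0, M.ball p r ⊆ W
  subset_closure : ∀ U ⊆ M.carrier, reducedBoundary M U ⊆ closure U
  normal_eq : ∀ U p ν ν', IsOuterNormal M U p ν → ν' ∈ M.tangent p → M.form ν' ν' = 1 →
    (∃ C, ∀ x ∈ U, M.form (x - p) ν' ≤ C * M.form (x - p) (x - p)) → ν = ν'

variable {n N : ℕ} {M : ModelSpace n N} {b : Eu N →L[ℝ] Eu N →L[ℝ] ℝ} {K : ℝ} {ι : Type*}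
  {Ω : ι → Set (Eu N)} {a : ι → Eu N} {k : ι → ℝ} {L : ι → Eu N → ℝ}

/-- `∇V = κ V` along the normals of the interfaces. -/
def IsAdapted (M : ModelSpace n N) (Ω : ι → Set (Eu N)) (a : ι → Eu N) (k : ι → ℝ)
    (L : ι → Eu N → ℝ) (V : Eu N → ℝ) : Prop :=
  ∀ i j, i ≠ j → (interface M Ω i j).Nonempty → ∀ p ∈ M.carrier, L i p = L j p →
    fderiv ℝ V p ((a i - a j) + (k i - k j) • p) = (k i - k j) * V p

namespace IsVoronoiLike

variable (VL : IsVoronoiLike M b Ω a k L)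
include VL

theorem closure_subset (hc : IsClosed M.carrier) (i : ι) :
    closure (Ω i) ⊆ M.carrier :=
  hc.closure_subset_iff.2 (VL.subset i)

theorem le_of_mem_closure (hc : IsClosed M.carrier) {i : ι} {p : Eu N} (hp : p ∈ closure (Ω i))
    (j : ι) : L i p ≤ L j p := by
  have hpM := VL.closure_subset hc i hp
  refine le_on_closure (s := Ω i) (f := L i) (g := L j) (fun x hx => ?_) ?_ ?_ hp
  · by_cases h : j = i
    · rw [h]
    · exact (VL.lt i x hx j h).le
  · exact (VL.continuousOn i).mono (VL.closure_subset hc i)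
  · exact (VL.continuousOn j).mono (VL.closure_subset hc i)

theorem expand_sub {i j : ι} {x p : Eu N} (hx : x ∈ M.carrier) (hp : p ∈ M.carrier) :
    (L i x - L j x) - (L i p - L j p) = b (x - p) ((a i - a j) + (k i - k j) • p)
      + (k i - k j) / 2 * b (x - p) (x - p) := by
  have h1 := VL.expand i x hx p hp
  have h2 := VL.expand j x hx p hp
  simp only [map_add, map_sub, map_smul, smul_eq_mul] at *
  linarith

theorem isQuasiSphere_eq {i j : ι} (hij : i ≠ j) (hne : (interface M Ω i j).Nonempty) :
    IsQuasiSphere M b {p ∈ M.carrier | L i p = L j p} (a i - a j) (k i - k j) where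
  subset p hp := hp.1
  tangent p hp := (VL.normal i j hij hne p hp.1 hp.2).1
  unit p hp := (VL.normal i j hij hne p hp.1 hp.2).2
  eq_zero x hx p hp := by
    have := VL.expand_sub (i := i) (j := j) hx.1 hp.1
    rw [hp.2, hx.2] at this
    linarith

variable (B : HasBlowUps M)

include B in
theorem interface_subset_closure {i j : ι} :
    interface M Ω i j ⊆ closure (Ω i) ∩ closure (Ω j) := fun _ hp =>
  ⟨B.subset_closure _ (VL.subset i) hp.1, B.subset_closure _ (VL.subset j) hp.2⟩

variable (G : IsGeometry M b K)
include G

theorem eq_of_mem_closure {i j : ι} {p : Eu N} (hi : p ∈ closure (Ω i))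
    (hj : p ∈ closure (Ω j)) : L i p = L j p :=
  le_antisymm (VL.le_of_mem_closure G.isClosed hi j) (VL.le_of_mem_closure G.isClosed hj i)

include B

theorem eq_of_mem_interface {i j : ι} {p : Eu N} (hp : p ∈ interface M Ω i j) :
    p ∈ M.carrier ∧ L i p = L j p :=
  have h := VL.interface_subset_closure B hp
  ⟨VL.closure_subset G.isClosed i h.1, VL.eq_of_mem_closure G h.1 h.2⟩

theorem isQuasiSphere_interface {i j : ι} (hij : i ≠ j) :
    IsQuasiSphere M b (interface M Ω i j) (a i - a j) (k i - k j) := by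
  rcases (interface M Ω i j).eq_empty_or_nonempty with h | h
  · rw [h]
    exact ⟨empty_subset _, fun _ h => h.elim, fun _ h => h.elim, fun _ h => h.elim⟩
  · have Q := VL.isQuasiSphere_eq hij h
    have hsub : interface M Ω i j ⊆ {p ∈ M.carrier | L i p = L j p} :=
      fun p hp => VL.eq_of_mem_interface B G hp
    exact ⟨hsub.trans Q.subset, fun p hp => Q.tangent p (hsub hp), fun p hp => Q.unit p (hsub hp),
      fun x hx p hp => Q.eq_zero x (hsub hx) p (hsub hp)⟩

/-- On Ω i one has L i < L j, and the expansion about p turns this into a half-space condition for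
the algebraic normal with a quadratic error. The uniqueness in `HasBlowUps.normal_eq` tolerates such
an error. -/
theorem outerNormal_eq {i j : ι} (hij : i ≠ j) {p ν : Eu N} (hp : p ∈ interface M Ω i j)
    (hν : IsOuterNormal M (Ω i) p ν) : ν = (a i - a j) + (k i - k j) • p := by
  have h := VL.eq_of_mem_interface B G hp
  have hn := VL.normal i j hij ⟨p, hp⟩ p h.1 h.2
  refine B.normal_eq _ _ _ _ hν hn.1 (by rw [G.form_eq]; exact hn.2) ⟨-((k i - k j) / 2),
    fun x hx => ?_⟩
  have := VL.expand_sub (i := i) (j := j) (VL.subset i hx) h.1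
  rw [h.2] at this
  have h2 := VL.lt i x hx j hij.symm
  rw [G.form_eq, G.form_eq]
  linarith

variable {V : Eu N → ℝ} {t : ℝ} (P : IsPotential M b K V t) (A : IsAdapted M Ω a k L V)
include P A

theorem jacobiSatisfies (hn : 1 ≤ n) {C : ℝ → Prop} (hC : C (((n : ℝ) - 1) * t)) :
    JacobiSatisfies M Ω V C := by
  intro i j hij O φ ν hφ hν O₁ Φ hΦ x hx y hy hxy
  have hI := hφ.isImmersionInto
  have hxI := hI.mapsTo x hx
  have h := VL.eq_of_mem_interface B G hxI
  rw [G.jacobi_eq (VL.isQuasiSphere_interface B G hij) P (by omega) hI hx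
    (A i j hij ⟨_, hxI⟩ _ h.1 h.2)
    (fun z hz => VL.outerNormal_eq B G hij (hI.mapsTo z hz) (hν z hz)) hΦ.isImmersionInto hy hxy]
  exact hC

theorem ricciVEq (hn : 1 ≤ n) (hV : ∀ p ∈ M.carrier, 0 < V p) :
    RicciVEq M Ω V (((n : ℝ) - 2) * t) := by
  intro i j hij O φ hφ x hx c d
  have hI := hφ.isImmersionInto
  have hxI := hI.mapsTo x hx
  have h := VL.eq_of_mem_interface B G hxI
  exact G.mul_ricciV_eq (VL.isQuasiSphere_interface B G hij) P (by omega) hI hx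
    (A i j hij ⟨_, hxI⟩ _ h.1 h.2) (hV _ h.1).ne' c d

/-- The conormal is identified as (2w - u)/√3, where u and w are the unit normals of the pairs (i,
j) and (i, r). It is thus affine in the point with constant coefficients, and both sides of the
equation equal its coefficient of the point times g. -/
theorem isFlattening (hn : 2 ≤ n) (R : IsRegular M Ω) (hV : ∀ p ∈ M.carrier, 0 < V p) :
    IsFlattening M Ω V where
  smooth := P.smooth
  pos := hV
  flat := by
    intro i j r hij hjr hir O φ η hφ hη x hx c d
    have hI := hφ.isImmersionInto
    have hsymm : ∀ x y, M.form x (-y) = - M.form x y := fun x y => by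
      rw [G.form_eq, G.form_eq, map_neg]
    have hneg : ∀ p v, v ∈ M.tangent p → -v ∈ M.tangent p := fun p v hv => by
      rw [G.tangent_iff] at *
      rw [map_neg, mul_neg, hv, neg_zero]
    have hunit : ∀ x, M.form (-x) (-x) = M.form x x := fun x => by
      rw [G.form_eq, G.form_eq]; simp
    have htriple : ∀ p ∈ tripleSet M Ω i j r, p ∈ M.carrier ∧ L i p = L j p ∧ L i p = L r p ∧
        L j p = L r p ∧ (interface M Ω i j).Nonempty ∧ (interface M Ω i r).Nonempty ∧
        (interface M Ω j r).Nonempty := by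
      rintro p ⟨⟨O', Ψ, hΨ, hS⟩, ⟨hpi, hpj⟩, hpr⟩
      refine ⟨VL.closure_subset G.isClosed i hpi, VL.eq_of_mem_closure G hpi hpj,
        VL.eq_of_mem_closure G hpi hpr, VL.eq_of_mem_closure G hpj hpr,
        ?_, ?_, ?_⟩
      exacts [interface_nonempty_of_plateauChart R (by norm_num) hΨ.1 hS hij hpi hpj hsymm hneg
          hunit B.ball_subset,
        interface_nonempty_of_plateauChart R (by norm_num) hΨ.1 hS hir hpi hpr hsymm hneg
          hunit B.ball_subset,
        interface_nonempty_of_plateauChart R (by norm_num) hΨ.1 hS hjr hpj hpr hsymm hneg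
          hunit B.ball_subset]
    have hIM : IsImmersionInto O φ M.carrier := hI.mono fun p hp => (htriple p hp).1
    -- From b(u, w) = 1/2 one gets |2w - u|² = 4 - 2 + 1 = 3.
    set s : ℝ := (√3)⁻¹ with hs
    have hs3 : s ^ 2 * 3 = 1 := by
      rw [hs, inv_pow, Real.sq_sqrt (by norm_num)]; norm_num
    have hs0 : 0 < s := by positivity
    have key : ∀ z ∈ O, η z = (s • ((2 : ℝ) • (a i - a r) - (a i - a j)))
        + (s * (2 * (k i - k r) - (k i - k j))) • φ z := by
      intro z hz
      obtain ⟨hpM, h1, h2, h3, n1, n2, n3⟩ := htriple _ (hI.mapsTo z hz)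
      obtain ⟨e1, e2, e3⟩ := hη z hz
      set p := φ z with hp
      set u := (a i - a j) + (k i - k j) • p with hu
      set w := (a i - a r) + (k i - k r) • p with hw
      obtain ⟨uT, u1⟩ := VL.normal i j hij n1 p hpM h1
      obtain ⟨wT, w1⟩ := VL.normal i r hir n2 p hpM h2
      obtain ⟨-, v1⟩ := VL.normal j r hjr n3 p hpM h3
      have hv : (a j - a r) + (k j - k r) • p = w - u := by rw [hw, hu]; module
      rw [hv] at v1
      rw [← hu] at uT u1
      rw [← hw] at wT w1
      -- The third normal is w - u and has length one too, which is the 120 degree condition.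
      have huw : b u w = 1 / 2 := by
        simp only [map_sub, sub_apply] at v1
        rw [G.symm w u] at v1
        linarith
      set ζ := s • ((2 : ℝ) • w - u) with hζ
      have hζu : b u ζ = 0 := by
        simp only [hζ, map_sub, map_smul, smul_eq_mul]; rw [huw, u1]; ring
      have hζ1 : b ζ ζ = 1 := by
        simp only [hζ, map_sub, map_smul, smul_eq_mul, sub_apply, smul_apply]
        rw [G.symm w u, huw, u1, w1]; linarith
      have hζT : ζ ∈ M.tangent p := by
        rw [G.tangent_iff] at *
        simp only [hζ, map_sub, map_smul, smul_eq_mul]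
        linear_combination s * 2 * wT - s * uT
      have hder : ∀ (u' : Eu N) (κ : ℝ), HasFDerivAt (fun y => b (y - p) u' + κ / 2 * b (y - p) (y - p))
          (b.flip u') p := by
        intro u' κ
        have hd : HasFDerivAt (fun y : Eu N => y - p) (ContinuousLinearMap.id ℝ (Eu N)) p :=
          (hasFDerivAt_id p).sub_const p
        have hb : HasFDerivAt (fun y : Eu N => b (y - p)) (b ∘L ContinuousLinearMap.id ℝ (Eu N)) p :=
          b.hasFDerivAt.comp p hd
        have h4 := (hb.clm_apply (hasFDerivAt_const u' p)).add ((hb.clm_apply hd).const_mul (κ / 2))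
        refine h4.congr_fderiv ?_
        ext y
        simp
      -- A function with differential b(·, u') at p and nonpositive on Σ_ij has a maximum at p along
      -- Σ_ij. Its derivative in the direction -η of the tangent cone is therefore nonpositive.
      have hcone : ∀ (u' : Eu N) (κ : ℝ), (∀ y ∈ interface M Ω i j,
          b (y - p) u' + κ / 2 * b (y - p) (y - p) ≤ 0) → 0 ≤ b (η z) u' := by
        intro u' κ h4
        have h5 : IsLocalMaxOn (fun y => b (y - p) u' + κ / 2 * b (y - p) (y - p))
            (interface M Ω i j) p := by
          filter_upwards [self_mem_nhdsWithin] with y hy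
          simpa using h4 y hy
        have h6 := h5.hasFDerivWithinAt_nonpos (hder u' κ).hasFDerivWithinAt e3
        simpa using h6
      have hz0 : ∀ (u' : Eu N) (κ : ℝ), (∀ y ∈ interface M Ω i j,
          b (y - p) u' + κ / 2 * b (y - p) (y - p) = 0) → b (η z) u' = 0 := by
        intro u' κ h4
        refine le_antisymm ?_ (hcone u' κ fun y hy => (h4 y hy).le)
        have := hcone (-u') (-κ) fun y hy => by
          have := h4 y hy
          rw [map_neg]; linarith
        rw [map_neg] at this; linarith
      -- The vanishing case is applied to the defining function of M here, and to L i - L j for the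
      -- orthogonality to u. The one-sided case for L i - L r, nonpositive on Σ_ij, fixes the side.
      have hηT : η z ∈ M.tangent p := by
        rw [G.tangent_iff, G.symm]
        have := hz0 (K • p) K fun y hy => by
          have l1 := G.level _ (VL.eq_of_mem_interface B G hy).1
          have l2 := G.level _ hpM
          simp only [map_sub, map_smul, smul_eq_mul, sub_apply]
          rw [G.symm p y]
          linear_combination (1 / 2) * l1 - (1 / 2) * l2
        simpa using this
      have hηu : b (η z) u = 0 := hz0 u (k i - k j) fun y hy => by
        have l1 := VL.eq_of_mem_interface B G hy
        rw [← VL.expand_sub l1.1 hpM, l1.2, h1]; ring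
      have hηw : 0 ≤ b (η z) w := hcone w (k i - k r) fun y hy => by
        have l1 := VL.interface_subset_closure B hy
        rw [← VL.expand_sub (VL.closure_subset G.isClosed i l1.1) hpM, h2]
        have := VL.le_of_mem_closure G.isClosed l1.1 r
        linarith
      have hηφ : ∀ v, b (η z) (fderiv ℝ φ z v) = 0 := by
        intro v
        rw [fderiv_eq_sum_pd, map_sum]
        refine Finset.sum_eq_zero fun e _ => ?_
        rw [map_smul, ← G.form_eq, e2 e, smul_zero]
      have hφT := fun v => G.fderiv_mem_tangent hIM hz v
      have hφu : ∀ v, b u (fderiv ℝ φ z v) = 0 := fun v =>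
        G.normal_fderiv (VL.isQuasiSphere_eq hij n1) (hI.mono fun q hq => by
          have := htriple q hq; exact ⟨this.1, this.2.1⟩) hz v
      have hφw : ∀ v, b w (fderiv ℝ φ z v) = 0 := fun v =>
        G.normal_fderiv (VL.isQuasiSphere_eq hir n2) (hI.mono fun q hq => by
          have := htriple q hq; exact ⟨this.1, this.2.2.1⟩) hz v
      have hφζ : ∀ v, b ζ (fderiv ℝ φ z v) = 0 := fun v => by
        simp [hζ, hφu, hφw]
      -- The triple set together with u and ζ spans the tangent space, so η, orthogonal to the
      -- triple set and to u, is a multiple β of ζ.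
      obtain ⟨v, hv'⟩ := G.exists_decomposition (r := 2) hpM (by omega)
        (A := (fderiv ℝ φ z).toLinearMap) (u := ![u, ζ]) (hI.injective z hz) hφT
        (by rw [Fin.forall_fin_two]; exact ⟨uT, hζT⟩)
        (by simp [Fin.forall_fin_two, u1, hζ1, hζu, G.symm ζ u])
        (by rw [Fin.forall_fin_two]; exact ⟨hφu, hφζ⟩) hηT
      rw [Fin.sum_univ_two] at hv'
      simp only [Matrix.cons_val_zero, Matrix.cons_val_one, G.symm u, hηu, zero_smul,
        zero_add, ContinuousLinearMap.coe_coe] at hv'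
      have hv0 : fderiv ℝ φ z v = 0 := by
        by_contra hne
        refine (G.pos p hpM _ (hφT v) hne).ne' ?_
        have : fderiv ℝ φ z v = η z - b ζ (η z) • ζ := by rw [eq_sub_iff_add_eq, ← hv']
        conv_lhs => enter [1]; rw [this]
        simp [hηφ, hφζ]
      rw [hv0, zero_add] at hv'
      set β := b ζ (η z) with hβ
      have hβ2 : β ^ 2 = 1 := by
        rw [G.form_eq, hv'] at e1
        simp only [map_smul, smul_apply, smul_eq_mul, hζ1] at e1
        linarith
      -- Since b(ζ, w) = 3s/2 > 0, the inequality b(η, w) ≥ 0 rules out β = -1.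
      have hβ0 : 0 ≤ β := by
        rw [hv'] at hηw
        simp only [hζ, map_sub, map_smul, sub_apply, smul_apply, smul_eq_mul, w1, huw] at hηw
        by_contra hneg'
        have : β * s < 0 := mul_neg_of_neg_of_pos (not_le.1 hneg') hs0
        linarith
      have hβ1 : β = 1 := by nlinarith
      rw [hv', hβ1, hζ, hw, hu]
      module
    obtain ⟨hpM, h1, h2, h3, n1, n2, n3⟩ := htriple _ (hI.mapsTo x hx)
    have hVx := (hV _ hpM).ne'
    have hII : secondForm M φ η c d x
        = (s * (2 * (k i - k r) - (k i - k j))) * gram M φ x c d := by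
      rw [secondForm, pd_congr hI.isOpen key hx, pd, fderiv_const_add,
        fderiv_fun_const_smul (hI.differentiableAt hx)]
      simp [gram, G.form_eq, pd]
    have hlog : fderiv ℝ (fun p => Real.log (V p)) (φ x) (η x)
        = s * (2 * (k i - k r) - (k i - k j)) := by
      rw [fderiv.log ((P.smooth.differentiable (by simp)) _) hVx, key x hx]
      have e1 := A i j hij n1 _ hpM h1
      have e2 := A i r hir n2 _ hpM h2
      have : (s • ((2 : ℝ) • (a i - a r) - (a i - a j)))
        + (s * (2 * (k i - k r) - (k i - k j))) • φ x
        = s • ((2 : ℝ) • ((a i - a r) + (k i - k r) • φ x)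
          - ((a i - a j) + (k i - k j) • φ x)) := by module
      rw [this, smul_apply, map_smul, map_sub, map_smul, e1, e2]
      simp only [smul_eq_mul]
      field_simp
    rw [hII, hlog, sub_self]

end IsVoronoiLike

end VoronoiLike

/-! ### Carathéodory measures under Lipschitz maps. -/

section Comparison

variable {X Y : Type*} [MetricSpace X] [MetricSpace Y]

/-- The premeasure `pre m₂ r`, pulled back by f, restricted to A and divided by C, is dominated by
m₁ on sets of diameter at most r'. By maximality of `pre m₁ r'` it is dominated by that outer
measure. The Lipschitz condition only serves to control the mesh of coverings; the constant comes
from `hm`. -/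
theorem mkMetric'_image_le {m₁ : Set X → ENNReal} {m₂ : Set Y → ENNReal} {f : X → Y} {A : Set X}
    {C : ENNReal} {K : ℝ≥0} (hC0 : C ≠ 0) (hC : C ≠ ⊤)
    (hm : ∀ s, (s ∩ A).Nonempty → m₂ (f '' (s ∩ A)) ≤ C * m₁ s) (hf : LipschitzOnWith K f A) :
    OuterMeasure.mkMetric' m₂ (f '' A) ≤ C * OuterMeasure.mkMetric' m₁ A := by
  have key : ∀ r > (0 : ENNReal), OuterMeasure.mkMetric'.pre m₂ r (f '' A)
      ≤ C * OuterMeasure.mkMetric' m₁ A := by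
    intro r hr
    -- A mesh r' that f maps into mesh r; the case K = 0 avoids division by zero.
    obtain ⟨r', hr', hKr⟩ : ∃ r' > (0 : ENNReal), (K : ENNReal) * r' ≤ r := by
      rcases eq_or_ne K 0 with rfl | hK
      · exact ⟨1, by simp, by simp⟩
      · refine ⟨r / K, ENNReal.div_pos hr.ne' (by simp), ?_⟩
        exact ENNReal.mul_div_le
    set μ : OuterMeasure X := C⁻¹ • OuterMeasure.restrict A
      (OuterMeasure.comap f (OuterMeasure.mkMetric'.pre m₂ r)) with hμ
    have hμs : ∀ s, μ s = C⁻¹ * OuterMeasure.mkMetric'.pre m₂ r (f '' (s ∩ A)) := by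
      intro s
      simp [hμ]
    have hle : μ ≤ OuterMeasure.mkMetric'.pre m₁ r' := by
      rw [OuterMeasure.mkMetric'.le_pre]
      intro s hs
      rw [hμs]
      rcases (s ∩ A).eq_empty_or_nonempty with h | h
      · simp [h]
      · have hd : Metric.ediam (f '' (s ∩ A)) ≤ r := by
          refine Metric.ediam_le ?_
          rintro _ ⟨x, hx, rfl⟩ _ ⟨y, hy, rfl⟩
          calc edist (f x) (f y) ≤ K * edist x y := hf hx.2 hy.2
            _ ≤ K * r' := by
              gcongr
              exact (Metric.edist_le_ediam_of_mem hx.1 hy.1).trans hs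
            _ ≤ r := hKr
        calc C⁻¹ * OuterMeasure.mkMetric'.pre m₂ r (f '' (s ∩ A))
            ≤ C⁻¹ * (C * m₁ s) := by
              gcongr
              exact (OuterMeasure.mkMetric'.pre_le hd).trans (hm s h)
          _ = m₁ s := by rw [← mul_assoc, ENNReal.inv_mul_cancel hC0 hC, one_mul]
    have h1 : μ A ≤ OuterMeasure.mkMetric' m₁ A :=
      (hle A).trans (by
        simp only [OuterMeasure.mkMetric', OuterMeasure.iSup_apply]
        exact le_iSup₂_of_le r' hr' le_rfl)
    rw [hμs, inter_self] at h1
    calc _ = C * (C⁻¹ * OuterMeasure.mkMetric'.pre m₂ r (f '' A)) := by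
          rw [← mul_assoc, ENNReal.mul_inv_cancel hC0 hC, one_mul]
      _ ≤ _ := by gcongr
  simp only [OuterMeasure.mkMetric', OuterMeasure.iSup_apply]
  refine iSup₂_le fun r hr => (key r hr).trans ?_
  simp only [OuterMeasure.mkMetric', OuterMeasure.iSup_apply]
  exact le_rfl

/-- If the size of a set equals that of its closure, coverings may be taken closed, hence
measurable, and trimming changes nothing. So the measure is given by coverings on arbitrary sets. -/
theorem mkMetric'_measure_apply [MeasurableSpace X] [BorelSpace X] {m : Set X → ENNReal}
    (hcl : ∀ s, m (closure s) = m s) (s : Set X) :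
    Measure.mkMetric' m s = OuterMeasure.mkMetric' m s := by
  have : (OuterMeasure.mkMetric' m).trim = OuterMeasure.mkMetric' m := by
    simp only [OuterMeasure.mkMetric'.eq_iSup_nat, OuterMeasure.trim_iSup]
    congr 1 with k : 1
    rw [OuterMeasure.mkMetric'.trim_pre _ hcl]
  rw [← Measure.coe_toOuterMeasure, Measure.mkMetric'_toOuterMeasure, this]

end Comparison

/-! ### The chordal Hausdorff measure of a model space. -/

section HausdorffOfModel

variable {n N : ℕ} {M : ModelSpace n N} {b : Eu N →L[ℝ] Eu N →L[ℝ] ℝ} {K : ℝ}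
  {X : Type*} [MetricSpace X] [MeasurableSpace X] [BorelSpace X]

theorem IsGeometry.continuous_chord (G : IsGeometry M b K) :
    Continuous fun z : Eu N × Eu N => M.chord z.1 z.2 := by
  simp only [ModelSpace.chord, G.form_eq]
  fun_prop

theorem IsGeometry.chord_le (G : IsGeometry M b K) (x y : Eu N) : M.chord x y ≤ dist x y := by
  rw [ModelSpace.chord, G.form_eq, dist_eq_norm]
  exact Real.sqrt_le_iff.2 ⟨norm_nonneg _, (le_abs_self _).trans (G.abs_le _)⟩

/-- The diameter with respect to chords. -/
def ModelSpace.chordDiam (M : ModelSpace n N) (s : Set (Eu N)) : ENNReal :=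
  ⨆ x ∈ s, ⨆ y ∈ s, ENNReal.ofReal (M.chord x y)

theorem IsGeometry.chordDiam_closure (G : IsGeometry M b K) (s : Set (Eu N)) :
    M.chordDiam (closure s) = M.chordDiam s := by
  refine le_antisymm (iSup₂_le fun x hx => iSup₂_le fun y hy => ?_) ?_
  · have hcont : Continuous fun z : Eu N × Eu N => ENNReal.ofReal (M.chord z.1 z.2) :=
      ENNReal.continuous_ofReal.comp G.continuous_chord
    have hxy : (x, y) ∈ closure (s ×ˢ s) := by rw [closure_prod_eq]; exact ⟨hx, hy⟩
    refine le_on_closure (s := s ×ˢ s) (f := fun z : Eu N × Eu N => ENNReal.ofReal (M.chord z.1 z.2))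
      (g := fun _ => M.chordDiam s) ?_ hcont.continuousOn continuousOn_const hxy
    rintro ⟨u, v⟩ ⟨hu, hv⟩
    exact le_iSup₂_of_le u hu (le_iSup₂_of_le v hv le_rfl)
  · exact biSup_mono subset_closure |>.trans
      (iSup₂_mono fun x hx => biSup_mono subset_closure)

theorem IsGeometry.hausdorff_apply (G : IsGeometry M b K) (k : ℝ) (s : Set (Eu N)) :
    M.hausdorff k s = OuterMeasure.mkMetric' (fun s => M.chordDiam s ^ k) s :=
  mkMetric'_measure_apply (fun s => by
    change M.chordDiam (closure s) ^ k = M.chordDiam s ^ k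
    rw [G.chordDiam_closure]) s

theorem hausdorffMeasure_apply' (k : ℝ) (s : Set X) :
    μH[k] s = OuterMeasure.mkMetric' (fun s => Metric.ediam s ^ k) s := by
  rw [Measure.hausdorffMeasure, ← OuterMeasure.coe_mkMetric]
  rfl

/-- Images under maps which are Lipschitz for the chord. -/
theorem IsGeometry.hausdorff_image_le (G : IsGeometry M b K) {k : ℝ} (hk : 0 ≤ k) {f : X → Eu N}
    {A : Set X} {L : ℝ} (hL : 0 < L) {K' : ℝ≥0} (hf : LipschitzOnWith K' f A)
    (hc : ∀ x ∈ A, ∀ y ∈ A, M.chord (f x) (f y) ≤ L * dist x y) :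
    M.hausdorff k (f '' A) ≤ ENNReal.ofReal L ^ k * μH[k] A := by
  rw [G.hausdorff_apply, hausdorffMeasure_apply']
  have hL0 : ENNReal.ofReal L ≠ 0 := by simpa using hL
  refine mkMetric'_image_le (by simp [hL0]) (ENNReal.rpow_ne_top_of_nonneg hk ENNReal.ofReal_ne_top)
    (fun s _ => ?_) hf
  rw [← ENNReal.mul_rpow_of_nonneg _ _ hk]
  refine ENNReal.rpow_le_rpow ?_ hk
  refine iSup₂_le ?_
  rintro _ ⟨x, hx, rfl⟩
  refine iSup₂_le ?_
  rintro _ ⟨y, hy, rfl⟩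
  calc ENNReal.ofReal (M.chord (f x) (f y)) ≤ ENNReal.ofReal (L * dist x y) :=
        ENNReal.ofReal_le_ofReal (hc x hx.2 y hy.2)
    _ = ENNReal.ofReal L * edist x y := by rw [ENNReal.ofReal_mul hL.le, edist_dist]
    _ ≤ _ := by gcongr; exact Metric.edist_le_ediam_of_mem hx.1 hy.1

/-- Images under maps which are expanded by the chord at most by a factor. -/
theorem IsGeometry.hausdorffMeasure_image_le (G : IsGeometry M b K) {k : ℝ} (hk : 0 ≤ k)
    {g : Eu N → X} {A : Set (Eu N)} {L : ℝ} (hL : 0 < L)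
    (hc : ∀ x ∈ A, ∀ y ∈ A, dist (g x) (g y) ≤ L * M.chord x y) :
    μH[k] (g '' A) ≤ ENNReal.ofReal L ^ k * M.hausdorff k A := by
  rw [G.hausdorff_apply, hausdorffMeasure_apply']
  have hL0 : ENNReal.ofReal L ≠ 0 := by simpa using hL
  refine mkMetric'_image_le (K := L.toNNReal) (by simp [hL0])
    (ENNReal.rpow_ne_top_of_nonneg hk ENNReal.ofReal_ne_top) (fun s _ => ?_) ?_
  · rw [← ENNReal.mul_rpow_of_nonneg _ _ hk]
    refine ENNReal.rpow_le_rpow ?_ hk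
    refine Metric.ediam_le ?_
    rintro _ ⟨x, hx, rfl⟩ _ ⟨y, hy, rfl⟩
    calc edist (g x) (g y) ≤ ENNReal.ofReal (L * M.chord x y) := by
          rw [edist_dist]; exact ENNReal.ofReal_le_ofReal (hc x hx.2 y hy.2)
      _ = ENNReal.ofReal L * ENNReal.ofReal (M.chord x y) := ENNReal.ofReal_mul hL.le
      _ ≤ _ := by
        gcongr
        exact le_iSup₂_of_le x hx.1 (le_iSup₂_of_le y hy.1 le_rfl)
  · refine LipschitzOnWith.of_dist_le_mul fun x hx y hy => (hc x hx y hy).trans ?_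
    rw [Real.coe_toNNReal _ hL.le]
    gcongr
    exact G.chord_le x y

end HausdorffOfModel

/-! ### Half-space densities in Euclidean space. -/

section HalfSpaceDensity

open scoped Pointwise

variable {n : ℕ}

/-- Hausdorff measure of Euclidean space, a Haar measure. -/
abbrev haus (n : ℕ) : Measure (Eu n) := μH[(n : ℝ)]

instance isAddHaarMeasure_haus (n : ℕ) : (haus n).IsAddHaarMeasure := by
  have := MeasureTheory.isAddHaarMeasure_hausdorffMeasure (E := Eu n)
  simpa using this

/-- Up to a set of density zero at the origin, `A` is the half-space `⟨x, e⟩ < 0`. -/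
def HalfDens (A : Set (Eu n)) (e : Eu n) : Prop :=
  Tendsto (fun r : ℝ => haus n {x ∈ Metric.ball 0 r | (x ∈ A ∧ 0 < inner ℝ x e) ∨
    (x ∉ A ∧ inner ℝ x e < 0)} / ENNReal.ofReal (r ^ n)) (𝓝[>] 0) (𝓝 0)

theorem haus_ball (x : Eu n) {r : ℝ} (hr : 0 < r) :
    haus n (Metric.ball x r) = ENNReal.ofReal (r ^ n) * haus n (Metric.ball 0 1) := by
  simpa using Measure.addHaar_ball_of_pos (haus n) x hr

theorem haus_ball_pos {r : ℝ} (hr : 0 < r) (x : Eu n) : 0 < haus n (Metric.ball x r) :=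
  Metric.measure_ball_pos _ _ hr

theorem haus_ball_lt_top (r : ℝ) (x : Eu n) : haus n (Metric.ball x r) < ⊤ :=
  measure_ball_lt_top

/-- Balls of radius proportional to r fill a fixed proportion of r^n, so sets containing them cannot
have density zero. -/
theorem not_tendsto_div_of_ball_subset {B : ℝ → Set (Eu n)} {x : Eu n} {β : ℝ} (hβ : 0 < β)
    (h : ∀ᶠ r : ℝ in 𝓝[>] 0, Metric.ball (r • x) (r * β) ⊆ B r) :
    ¬ Tendsto (fun r : ℝ => haus n (B r) / ENNReal.ofReal (r ^ n)) (𝓝[>] 0) (𝓝 0) := by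
  intro hlim
  have hc : 0 < haus n (Metric.ball 0 β) := haus_ball_pos hβ 0
  obtain ⟨r, ⟨h1, h2⟩, h3⟩ := ((h.and (hlim.eventually (gt_mem_nhds hc))).and
    (eventually_mem_nhdsWithin (a := (0 : ℝ)) (s := Ioi 0))).exists
  simp only [mem_Ioi] at h3
  have h4 : haus n (Metric.ball (r • x) (r * β)) / ENNReal.ofReal (r ^ n)
      = haus n (Metric.ball 0 β) := by
    have h0 : ENNReal.ofReal (r ^ n) ≠ 0 := by simpa using pow_pos h3 n
    rw [Measure.addHaar_ball_mul_of_pos (haus n) _ h3, finrank_euclideanSpace, Fintype.card_fin,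
      ENNReal.mul_div_right_comm, ENNReal.div_self h0 ENNReal.ofReal_ne_top, one_mul]
  have h5 : haus n (Metric.ball (r • x) (r * β)) / ENNReal.ofReal (r ^ n)
      ≤ haus n (B r) / ENNReal.ofReal (r ^ n) := by gcongr
  rw [h4] at h5
  exact absurd h2 (not_lt.2 h5)

/-- The normal of a half-space of full density is unique, in a strong sense. -/
theorem HalfDens.eq_of_subset {A : Set (Eu n)} {e e' : Eu n} (h : HalfDens A e) (he : ‖e‖ = 1)
    (he' : ‖e'‖ = 1)
    (hA : ∀ ε > 0, ∀ᶠ x in 𝓝 (0 : Eu n), x ∈ A → inner ℝ x e' ≤ ε * ‖x‖) : e = e' := by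
  by_contra hne
  -- If e ≠ e', then ⟨w, e⟩ < 0 < ⟨w, e'⟩. Near small multiples of w, points are in the half-space
  -- of e but too far on the positive side of e' to belong to A, and they fill a ball of comparable
  -- radius.
  set w := e' - e with hw
  have hlt : inner ℝ e e' < 1 := by
    have := inner_lt_one_iff_real_of_norm_eq_one he he'
    exact this.2 hne
  set δ := 1 - inner ℝ e e' with hδ
  have hδ0 : 0 < δ := by rw [hδ]; linarith
  have hw1 : inner ℝ w e = -δ := by
    rw [hw, inner_sub_left, real_inner_self_eq_norm_sq, he, real_inner_comm]; ring
  have hw2 : inner ℝ w e' = δ := by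
    rw [hw, inner_sub_left, real_inner_self_eq_norm_sq, he']; ring
  have hw3 : ‖w‖ ≤ 2 := by
    rw [hw]; exact (norm_sub_le _ _).trans (by rw [he, he']; norm_num)
  obtain ⟨β, hβ0, hβδ, hβ1⟩ : ∃ β > 0, β < δ / 2 ∧ β ≤ 1 :=
    ⟨min (δ / 4) 1, by positivity, (min_le_left _ _).trans_lt (by linarith), min_le_right _ _⟩
  -- scaled copy of the bad cone
  refine not_tendsto_div_of_ball_subset (n := n) (x := (1 / 4 : ℝ) • w) (β := β / 4)
    (by positivity) ?_ h
  have hev := hA (δ / 12) (by positivity)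
  obtain ⟨ρ, hρ, hball⟩ := Metric.eventually_nhds_iff_ball.1 hev
  filter_upwards [Ioo_mem_nhdsGT hρ] with r hr
  intro x hx
  have hr0 := hr.1
  rw [mem_ball_iff_norm] at hx
  have hxn : ‖x‖ < r := by
    calc ‖x‖ = ‖(x - r • (1 / 4 : ℝ) • w) + r • (1 / 4 : ℝ) • w‖ := by rw [sub_add_cancel]
      _ ≤ ‖x - r • (1 / 4 : ℝ) • w‖ + ‖r • (1 / 4 : ℝ) • w‖ := norm_add_le _ _
      _ < r * (β / 4) + r * (1 / 4 * 2) := by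
        refine add_lt_add_of_lt_of_le hx ?_
        rw [norm_smul, norm_smul, Real.norm_of_nonneg hr0.le, Real.norm_of_nonneg (by norm_num)]
        gcongr
      _ ≤ r := by nlinarith
  have hin : ∀ u : Eu n, ‖u‖ = 1 → |inner ℝ x u - r * (1 / 4) * inner ℝ w u| < r * (δ / 8) := by
    intro u hu
    have : inner ℝ x u - r * (1 / 4) * inner ℝ w u = inner ℝ (x - r • (1 / 4 : ℝ) • w) u := by
      rw [inner_sub_left (x := x), real_inner_smul_left, real_inner_smul_left]; ring
    rw [this]
    calc _ ≤ ‖x - r • (1 / 4 : ℝ) • w‖ * ‖u‖ := abs_real_inner_le_norm _ _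
      _ < r * (β / 4) := by rw [hu, mul_one]; exact hx
      _ ≤ _ := by nlinarith
  have h1 := abs_lt.1 (hin e he)
  have h2 := abs_lt.1 (hin e' he')
  rw [hw1] at h1
  rw [hw2] at h2
  refine ⟨by simpa using hxn, Or.inr ⟨fun hxA => ?_, by nlinarith⟩⟩
  have := hball x (by simpa using hxn.trans hr.2) hxA
  nlinarith [norm_nonneg x]

theorem HalfDens.congr {A A' : Set (Eu n)} {e : Eu n} (h : HalfDens A e)
    (hA : ∀ᶠ x in 𝓝 (0 : Eu n), x ∈ A ↔ x ∈ A') : HalfDens A' e := by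
  refine h.congr' ?_
  obtain ⟨ρ, hρ, hball⟩ := Metric.eventually_nhds_iff_ball.1 hA
  filter_upwards [Ioo_mem_nhdsGT hρ] with r hr
  congr 2
  ext x
  refine and_congr_right fun hx => ?_
  rw [hball x (Metric.ball_subset_ball hr.2.le hx)]

/-- A thin slab about a hyperplane has small measure. -/
theorem exists_slab_lt {e : Eu n} (he : ‖e‖ = 1) {η : ENNReal} (hη : 0 < η) :
    ∃ ε > 0, haus n {x ∈ Metric.ball 0 1 | |inner ℝ x e| ≤ ε} < η := by
  have hanti : Antitone fun k : ℕ => {x ∈ Metric.ball (0 : Eu n) 1 | |inner ℝ x e| ≤ 1 / ((k : ℝ) + 1)} := by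
    intro k l hkl x hx
    exact ⟨hx.1, hx.2.trans (by gcongr)⟩
  have hmeas : ∀ k : ℕ, MeasurableSet {x ∈ Metric.ball (0 : Eu n) 1 | |inner ℝ x e| ≤ 1 / ((k : ℝ) + 1)} := by
    intro k
    have h1 : IsClosed {x : Eu n | |inner ℝ x e| ≤ 1 / ((k : ℝ) + 1)} :=
      isClosed_le (by fun_prop) continuous_const
    exact Metric.isOpen_ball.measurableSet.inter h1.measurableSet
  have hlim := tendsto_measure_iInter_atTop (μ := haus n) (fun k => (hmeas k).nullMeasurableSet)
    hanti ⟨0, ((measure_mono (fun x hx => hx.1)).trans_lt (haus_ball_lt_top 1 0)).ne⟩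
  have hzero : haus n (⋂ k : ℕ, {x ∈ Metric.ball (0 : Eu n) 1 | |inner ℝ x e| ≤ 1 / ((k : ℝ) + 1)}) = 0 := by
    have hsub : (⋂ k : ℕ, {x ∈ Metric.ball (0 : Eu n) 1 | |inner ℝ x e| ≤ 1 / ((k : ℝ) + 1)})
        ⊆ (LinearMap.ker (innerSL ℝ e : Eu n →ₗ[ℝ] ℝ) : Set (Eu n)) := by
      intro x hx
      have h1 : |inner ℝ x e| ≤ 0 :=
        ge_of_tendsto' tendsto_one_div_add_atTop_nhds_zero_nat fun k => (mem_iInter.1 hx k).2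
      have h2 := abs_nonpos_iff.1 h1
      simpa [real_inner_comm] using h2
    refine measure_mono_null hsub (Measure.addHaar_submodule _ _ fun htop => ?_)
    have : e ∈ LinearMap.ker (innerSL ℝ e : Eu n →ₗ[ℝ] ℝ) := by rw [htop]; trivial
    simp at this
    rw [this] at he; simp at he
  rw [hzero] at hlim
  obtain ⟨k, hk⟩ := (hlim.eventually (gt_mem_nhds hη)).exists
  exact ⟨1 / ((k : ℝ) + 1), by positivity, hk⟩

theorem haus_slab (e : Eu n) (ε : ℝ) {r : ℝ} (hr : 0 < r) :
    haus n {x ∈ Metric.ball 0 r | |inner ℝ x e| ≤ ε * r}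
      = ENNReal.ofReal (r ^ n) * haus n {x ∈ Metric.ball 0 1 | |inner ℝ x e| ≤ ε} := by
  have h1 : {x ∈ Metric.ball (0 : Eu n) r | |inner ℝ x e| ≤ ε * r}
      = r • {x ∈ Metric.ball (0 : Eu n) 1 | |inner ℝ x e| ≤ ε} := by
    ext x
    rw [mem_smul_set_iff_inv_smul_mem₀ hr.ne']
    simp only [mem_ofPred_eq, mem_ball_zero_iff, norm_smul, inner_smul_left, norm_inv,
      Real.norm_of_nonneg hr.le, abs_mul]
    rw [inv_mul_lt_iff₀ hr, mul_one]
    simp only [map_inv₀, conj_trivial, abs_inv, abs_of_pos hr]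
    rw [inv_mul_le_iff₀ hr, mul_comm r ε]
  rw [h1, Measure.addHaar_smul_of_nonneg _ hr.le]
  simp

end HalfSpaceDensity

/-! ### Conformal maps to the sphere and central projection charts. -/

/-- `τ` is a conformal diffeomorphism of `M` onto the open subset `D` of the unit sphere, with inverse
`θ` and conformal factor `ρ`. -/
structure IsConformal {n N : ℕ} (M : ModelSpace n N) (τ : Eu N → Eu (n + 1))
    (θ : Eu (n + 1) → Eu N) (D : Set (Eu (n + 1))) (ρ : Eu N → ℝ) : Prop where
  isOpen : IsOpen D
  norm_eq : ∀ x ∈ M.carrier, ‖τ x‖ = 1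
  mem : ∀ x ∈ M.carrier, τ x ∈ D
  smooth : ∀ x ∈ M.carrier, ContDiffAt ℝ ∞ τ x
  inv_mem : ∀ P ∈ D, ‖P‖ = 1 → θ P ∈ M.carrier
  inv_smooth : ∀ P ∈ D, ‖P‖ = 1 → ContDiffAt ℝ ∞ θ P
  left_inv : ∀ x ∈ M.carrier, θ (τ x) = x
  right_inv : ∀ P ∈ D, ‖P‖ = 1 → τ (θ P) = P
  factor : ∀ x ∈ M.carrier, ∀ y ∈ M.carrier,
    ‖τ x - τ y‖ ^ 2 = ρ x * ρ y * M.form (x - y) (x - y)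
  factor_pos : ∀ x ∈ M.carrier, 0 < ρ x
  factor_continuousOn : ContinuousOn ρ M.carrier
  factor_bounded : ∃ C, ∀ x ∈ M.carrier, ρ x ≤ C

section SphereChart

variable {N' : ℕ} {F : Type*} [NormedAddCommGroup F] [NormedSpace ℝ F]

/-- The central projection of the affine subspace `P + Λ F` to the unit sphere. -/
def sphChart (P : Eu N') (Λ : F →L[ℝ] Eu N') (x : F) : Eu N' :=
  (√(1 + ‖Λ x‖ ^ 2))⁻¹ • (P + Λ x)

theorem sphFactor_pos (Λ : F →L[ℝ] Eu N') (x : F) : 0 < (√(1 + ‖Λ x‖ ^ 2))⁻¹ := by positivity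

theorem contDiff_sphFactor (Λ : F →L[ℝ] Eu N') :
    ContDiff ℝ ∞ fun x : F => (√(1 + ‖Λ x‖ ^ 2))⁻¹ := by
  have h1 : ContDiff ℝ ∞ fun x : F => 1 + ‖Λ x‖ ^ 2 :=
    contDiff_const.add (Λ.contDiff.norm_sq ℝ)
  exact (h1.sqrt fun x => by positivity).inv fun x => by positivity

theorem contDiff_sphChart (P : Eu N') (Λ : F →L[ℝ] Eu N') : ContDiff ℝ ∞ (sphChart P Λ) :=
  (contDiff_sphFactor Λ).smul (contDiff_const.add Λ.contDiff)

theorem sphChart_zero (P : Eu N') (Λ : F →L[ℝ] Eu N') : sphChart P Λ 0 = P := by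
  simp [sphChart]

/-- The scalar factor is maximal at the origin, so its derivative vanishes there and only that of
the affine map remains. -/
theorem hasStrictFDerivAt_sphChart (P : Eu N') (Λ : F →L[ℝ] Eu N') :
    HasStrictFDerivAt (sphChart P Λ) Λ 0 := by
  have h1 : HasStrictFDerivAt (fun x : F => (√(1 + ‖Λ x‖ ^ 2))⁻¹)
      (0 : F →L[ℝ] ℝ) 0 := by
    have h2 := (contDiff_sphFactor Λ).contDiffAt (x := 0) |>.hasStrictFDerivAt (by simp)
    have h3 : IsLocalMax (fun x : F => (√(1 + ‖Λ x‖ ^ 2))⁻¹) 0 := by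
      refine Eventually.of_forall fun x => ?_
      simp only [map_zero, norm_zero, ne_eq, OfNat.ofNat_ne_zero, not_false_eq_true, zero_pow,
        add_zero, Real.sqrt_one, inv_one]
      exact inv_le_one_of_one_le₀ (Real.one_le_sqrt.2 (by nlinarith [sq_nonneg ‖Λ x‖]))
    rwa [h3.fderiv_eq_zero] at h2
  have h2 := h1.smul (Λ.hasStrictFDerivAt.const_add P (x := 0))
  refine h2.congr_fderiv ?_
  ext1 v
  simp

variable {P : Eu N'} {Λ : F →L[ℝ] Eu N'} (hP : ‖P‖ = 1) (hΛ : ∀ v, inner ℝ P (Λ v) = 0)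
include hP hΛ

theorem norm_add_sq_of_orth (x : F) : ‖P + Λ x‖ ^ 2 = 1 + ‖Λ x‖ ^ 2 := by
  rw [norm_add_sq_real, hΛ, hP]; ring

theorem norm_sphChart (x : F) : ‖sphChart P Λ x‖ = 1 := by
  have h1 : ‖P + Λ x‖ = √(1 + ‖Λ x‖ ^ 2) := by
    rw [← norm_add_sq_of_orth hP hΛ, Real.sqrt_sq (norm_nonneg _)]
  rw [sphChart, norm_smul, h1, Real.norm_of_nonneg (by positivity)]
  exact inv_mul_cancel₀ (by positivity)

theorem inner_sphChart (x : F) : inner ℝ P (sphChart P Λ x) = (√(1 + ‖Λ x‖ ^ 2))⁻¹ := by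
  rw [sphChart, real_inner_smul_right, inner_add_right, hΛ, real_inner_self_eq_norm_sq, hP]
  simp

theorem inner_sphChart_pos (x : F) : 0 < inner ℝ P (sphChart P Λ x) := by
  rw [inner_sphChart hP hΛ]; exact sphFactor_pos Λ x

theorem inv_inner_smul_sphChart (x : F) :
    (inner ℝ P (sphChart P Λ x))⁻¹ • sphChart P Λ x - P = Λ x := by
  rw [inner_sphChart hP hΛ, sphChart, smul_smul, inv_mul_cancel₀ (sphFactor_pos Λ x).ne', one_smul,
    add_sub_cancel_left]

/-- Central projection is inverted on the hemisphere ⟨P, Q⟩ > 0 by Q ↦ Q / ⟨P, Q⟩ - P. -/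
theorem sphChart_eq {x : F} {Q : Eu N'} (hQ : ‖Q‖ = 1) (hPQ : 0 < inner ℝ P Q)
    (hx : (inner ℝ P Q)⁻¹ • Q - P = Λ x) : sphChart P Λ x = Q := by
  have h1 : P + Λ x = (inner ℝ P Q)⁻¹ • Q := by rw [← hx]; abel
  have h2 : √(1 + ‖Λ x‖ ^ 2) = (inner ℝ P Q)⁻¹ := by
    rw [← norm_add_sq_of_orth hP hΛ, Real.sqrt_sq (norm_nonneg _), h1, norm_smul, hQ, mul_one,
      Real.norm_of_nonneg (by positivity)]
  rw [sphChart, h2, h1, smul_smul, inv_inv, mul_inv_cancel₀ hPQ.ne', one_smul]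

end SphereChart

theorem exists_isometry_range {N' m : ℕ} (L : Submodule ℝ (Eu N')) (hL : Module.finrank ℝ L = m) :
    ∃ Λ : Eu m →ₗᵢ[ℝ] Eu N', LinearMap.range Λ.toLinearMap = L := by
  let B := (stdOrthonormalBasis ℝ L).reindex (finCongr hL)
  refine ⟨L.subtypeₗᵢ.comp B.repr.symm.toLinearIsometry, ?_⟩
  ext x
  constructor
  · rintro ⟨y, rfl⟩
    exact (B.repr.symm y).2
  · intro hx
    exact ⟨B.repr ⟨x, hx⟩, by simp⟩

theorem exists_isometry_orth {n : ℕ} {P : Eu (n + 1)} (hP : ‖P‖ = 1) :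
    ∃ Λ : Eu n →ₗᵢ[ℝ] Eu (n + 1), (∀ v, inner ℝ P (Λ v) = 0) ∧
      ∀ w, inner ℝ P w = 0 → ∃ v, Λ v = w := by
  have hP0 : P ≠ 0 := by rintro rfl; simp at hP
  have : Fact (Module.finrank ℝ (Eu (n + 1)) = n + 1) := ⟨by simp⟩
  obtain ⟨Λ, hΛ⟩ := exists_isometry_range (ℝ ∙ P)ᗮ
    (Submodule.finrank_orthogonal_span_singleton (n := n) hP0)
  refine ⟨Λ, fun v => ?_, fun w hw => ?_⟩
  · have : Λ v ∈ (ℝ ∙ P)ᗮ := by rw [← hΛ]; exact ⟨v, rfl⟩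
    exact Submodule.mem_orthogonal_singleton_iff_inner_right.1 this
  · have : w ∈ (ℝ ∙ P)ᗮ := Submodule.mem_orthogonal_singleton_iff_inner_right.2 hw
    rw [← hΛ] at this
    exact this

section ConformalCharts

variable {n N : ℕ} {M : ModelSpace n N} {τ : Eu N → Eu (n + 1)} {θ : Eu (n + 1) → Eu N}
  {D : Set (Eu (n + 1))} {ρ : Eu N → ℝ} (T : IsConformal M τ θ D ρ)
include T

namespace IsConformal

theorem continuousOn : ContinuousOn τ M.carrier := fun x hx =>
  (T.smooth x hx).continuousAt.continuousWithinAt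

theorem contDiffAt_chart {F : Type*} [NormedAddCommGroup F] [NormedSpace ℝ F] {P : Eu (n + 1)}
    {Λ : F →L[ℝ] Eu (n + 1)} (hP : ‖P‖ = 1) (hΛ : ∀ v, inner ℝ P (Λ v) = 0) {x : F}
    (hx : sphChart P Λ x ∈ D) : ContDiffAt ℝ ∞ (fun z => θ (sphChart P Λ z)) x :=
  (T.inv_smooth _ hx (norm_sphChart hP hΛ x)).comp x (contDiff_sphChart P Λ).contDiffAt

/-- The chart has the smooth left inverse g, defined on the points of M with ⟨P, τ y⟩ > 0. The chain
rule makes it an immersion, continuity of g an embedding, and the preimage of O under g describes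
its image. -/
theorem isSmoothParam {F : Type*} [NormedAddCommGroup F] [NormedSpace ℝ F] {P : Eu (n + 1)}
    {Λ : F →L[ℝ] Eu (n + 1)} {Γ : Eu (n + 1) →L[ℝ] F} (hP : ‖P‖ = 1)
    (hΛ : ∀ v, inner ℝ P (Λ v) = 0) (hΓ : ∀ v, Γ (Λ v) = v)
    (hΛΓ : ∀ w, inner ℝ P w = 0 → Λ (Γ w) = w) {O : Set F} (hO : IsOpen O)
    (hOD : ∀ x ∈ O, sphChart P Λ x ∈ D) :
    IsSmoothParam O (fun x => θ (sphChart P Λ x)) M.carrier := by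
  set f := fun x => θ (sphChart P Λ x) with hf
  set g : Eu N → F := fun y => Γ ((inner ℝ P (τ y))⁻¹ • τ y - P) with hg
  have hfM : ∀ x ∈ O, f x ∈ M.carrier := fun x hx => T.inv_mem _ (hOD x hx) (norm_sphChart hP hΛ x)
  have hτf : ∀ x ∈ O, τ (f x) = sphChart P Λ x := fun x hx =>
    T.right_inv _ (hOD x hx) (norm_sphChart hP hΛ x)
  have hgf : ∀ x ∈ O, g (f x) = x := fun x hx => by
    simp only [hg, hτf x hx, inv_inner_smul_sphChart hP hΛ, hΓ]
  have hsm : ContDiffOn ℝ ∞ f O := fun x hx =>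
    (T.contDiffAt_chart hP hΛ (hOD x hx)).contDiffWithinAt
  have hgsm : ∀ y ∈ M.carrier, 0 < inner ℝ P (τ y) → ContDiffAt ℝ ∞ g y := by
    intro y hy hpos
    have h1 : ContDiffAt ℝ ∞ (fun y => inner ℝ P (τ y)) y :=
      contDiffAt_const.inner ℝ (T.smooth y hy)
    exact Γ.contDiff.contDiffAt.comp y
      (((h1.inv hpos.ne').smul (T.smooth y hy)).sub contDiffAt_const)
  have hpos : ∀ x ∈ O, 0 < inner ℝ P (τ (f x)) := fun x hx => by
    rw [hτf x hx]; exact inner_sphChart_pos hP hΛ x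
  refine ⟨⟨hO, hsm.of_le (by exact_mod_cast le_top), fun x hx => ?_, ?_, ?_⟩, hsm⟩
  · have h1 : HasFDerivAt f (fderiv ℝ f x) x :=
      ((hsm.contDiffAt (hO.mem_nhds hx)).differentiableAt (by simp)).hasFDerivAt
    have h2 : HasFDerivAt g (fderiv ℝ g (f x)) (f x) :=
      ((hgsm _ (hfM x hx) (hpos x hx)).differentiableAt (by simp)).hasFDerivAt
    have h3 : HasFDerivAt (g ∘ f) (ContinuousLinearMap.id ℝ F) x :=
      (hasFDerivAt_id x).congr_of_eventuallyEq
        (Filter.eventually_of_mem (hO.mem_nhds hx) fun z hz => hgf z hz)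
    have h4 := (h2.comp x h1).unique h3
    intro v w hvw
    have h5 : ∀ v, fderiv ℝ g (f x) (fderiv ℝ f x v) = v := fun v => by
      rw [← ContinuousLinearMap.comp_apply, h4]; rfl
    rw [← h5 v, hvw, h5 w]
  · refine ⟨isInducing_iff_nhds.2 fun x => ?_, fun x y hxy => Subtype.ext ?_⟩
    · refine le_antisymm ?_ ?_
      · have : ContinuousAt (O.domRestrict f) x :=
          (continuousOn_iff_continuous_domRestrict.1 hsm.continuousOn).continuousAt
        exact this.tendsto.le_comap
      · rw [nhds_subtype_eq_comap, ← Filter.tendsto_iff_comap]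
        have h1 : Tendsto (fun z : O => g (f z)) (comap (O.domRestrict f) (𝓝 (O.domRestrict f x)))
            (𝓝 (g (f x))) :=
          ((hgsm _ (hfM x x.2) (hpos x x.2)).continuousAt.tendsto).comp tendsto_comap
        rw [hgf x x.2] at h1
        refine h1.congr fun z => hgf z z.2
    · have : f x = f y := hxy
      rw [← hgf x x.2, this, hgf y y.2]
  · have hc : ContinuousOn (fun y => inner ℝ P (τ y)) M.carrier :=
      continuousOn_const.inner T.continuousOn
    obtain ⟨W₁, hW₁, h1⟩ := continuousOn_iff'.1 hc (Ioi 0) isOpen_Ioi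
    have hc2 : ContinuousOn g (M.carrier ∩ W₁) := fun y hy => by
      have : y ∈ (fun y => inner ℝ P (τ y)) ⁻¹' Ioi 0 ∩ M.carrier := by rw [h1]; exact ⟨hy.2, hy.1⟩
      exact (hgsm y hy.1 this.1).continuousAt.continuousWithinAt
    obtain ⟨W₂, hW₂, h2⟩ := continuousOn_iff'.1 hc2 O hO
    refine ⟨W₁ ∩ W₂, hW₁.inter hW₂, ?_⟩
    ext y
    constructor
    · rintro ⟨x, hx, rfl⟩
      have a1 : f x ∈ W₁ ∩ M.carrier := by rw [← h1]; exact ⟨hpos x hx, hfM x hx⟩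
      have a2 : f x ∈ W₂ ∩ (M.carrier ∩ W₁) := by
        rw [← h2]; exact ⟨by rw [mem_preimage, hgf x hx]; exact hx, a1.2, a1.1⟩
      exact ⟨a1.2, a1.1, a2.1⟩
    · rintro ⟨hyM, hy1, hy2⟩
      have a1 : y ∈ (fun y => inner ℝ P (τ y)) ⁻¹' Ioi 0 ∩ M.carrier := by rw [h1]; exact ⟨hy1, hyM⟩
      have a2 : y ∈ g ⁻¹' O ∩ (M.carrier ∩ W₁) := by rw [h2]; exact ⟨hy2, hyM, hy1⟩
      have hpos' : 0 < inner ℝ P (τ y) := a1.1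
      refine ⟨g y, a2.1, ?_⟩
      have : sphChart P Λ (g y) = τ y := by
        refine sphChart_eq hP hΛ (T.norm_eq y hyM) hpos' ?_
        rw [hg]
        refine (hΛΓ _ ?_).symm
        rw [inner_sub_right, real_inner_smul_right, inv_mul_cancel₀ hpos'.ne',
          real_inner_self_eq_norm_sq, hP]
        norm_num
      simp only [hf, this, T.left_inv y hyM]

theorem form_eq {x y : Eu N} (hx : x ∈ M.carrier) (hy : y ∈ M.carrier) :
    M.form (x - y) (x - y) = ‖τ x - τ y‖ ^ 2 / (ρ x * ρ y) := by
  have h1 := T.factor_pos x hx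
  have h2 := T.factor_pos y hy
  rw [T.factor x hx y hy]
  field_simp

theorem chord_eq {x y : Eu N} (hx : x ∈ M.carrier) (hy : y ∈ M.carrier) :
    M.chord x y = ‖τ x - τ y‖ / √(ρ x * ρ y) := by
  rw [ModelSpace.chord, T.form_eq hx hy, Real.sqrt_div' _
    (mul_pos (T.factor_pos x hx) (T.factor_pos y hy)).le, Real.sqrt_sq (norm_nonneg _)]

/-- Boundedness of the conformal factor makes τ globally Lipschitz for the chord. This is how small
chordal balls are seen to be small in the sphere. -/
theorem exists_norm_sub_le : ∃ C > 0, ∀ x ∈ M.carrier, ∀ y ∈ M.carrier,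
    ‖τ x - τ y‖ ≤ C * M.chord x y := by
  obtain ⟨C, hC⟩ := T.factor_bounded
  refine ⟨max C 1, by positivity, fun x hx y hy => ?_⟩
  have h1 := T.factor_pos x hx
  have h2 := T.factor_pos y hy
  have h3 : √(ρ x * ρ y) ≤ max C 1 := by
    rw [Real.sqrt_le_left (by positivity), pow_two]
    exact mul_le_mul ((hC x hx).trans (le_max_left _ _)) ((hC y hy).trans (le_max_left _ _)) h2.le
      (by positivity)
  rw [T.chord_eq hx hy, mul_div_assoc']
  rw [le_div_iff₀ (by positivity), mul_comm]
  gcongr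

end IsConformal

end ConformalCharts

/-! ### Bilipschitz charts. -/

/-- On the ball of radius `δ` about the origin, `f` is bilipschitz for the chord of `M`, with
constants close to `s`. -/
structure IsMetricChart {n N m : ℕ} (M : ModelSpace n N) (f : Eu m → Eu N) (δ s : ℝ) : Prop where
  radius_pos : 0 < δ
  scale_pos : 0 < s
  mapsTo : ∀ x ∈ Metric.ball 0 δ, f x ∈ M.carrier
  lipschitz : ∃ K, LipschitzOnWith K f (Metric.ball 0 δ)
  le_chord : ∀ x ∈ Metric.ball 0 δ, ∀ y ∈ Metric.ball 0 δ, s / 4 * dist x y ≤ M.chord (f x) (f y)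
  chord_le : ∀ x ∈ Metric.ball 0 δ, ∀ y ∈ Metric.ball 0 δ, M.chord (f x) (f y) ≤ 4 * s * dist x y

section

variable {n N m : ℕ} {M : ModelSpace n N} {τ : Eu N → Eu (n + 1)} {θ : Eu (n + 1) → Eu N}
  {D : Set (Eu (n + 1))} {ρ : Eu N → ℝ} {b : Eu N →L[ℝ] Eu N →L[ℝ] ℝ} {K : ℝ}

theorem IsMetricChart.mono {f : Eu m → Eu N} {δ s : ℝ} (h : IsMetricChart M f δ s) {δ' : ℝ}
    (h0 : 0 < δ') (hδ : δ' ≤ δ) : IsMetricChart M f δ' s := by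
  have hsub : Metric.ball (0 : Eu m) δ' ⊆ Metric.ball 0 δ := Metric.ball_subset_ball hδ
  exact ⟨h0, h.scale_pos, fun x hx => h.mapsTo x (hsub hx),
    h.lipschitz.imp fun _ hK => hK.mono hsub,
    fun x hx y hy => h.le_chord x (hsub hx) y (hsub hy),
    fun x hx y hy => h.chord_le x (hsub hx) y (hsub hy)⟩

theorem IsMetricChart.injOn {f : Eu m → Eu N} {δ s : ℝ} (h : IsMetricChart M f δ s)
    (hM : ∀ x, M.chord x x = 0) : InjOn f (Metric.ball 0 δ) := by
  intro x hx y hy hxy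
  have h1 := h.le_chord x hx y hy
  rw [hxy, hM] at h1
  have := h.scale_pos
  exact dist_le_zero.1 (by nlinarith [dist_nonneg (x := x) (y := y)])

theorem IsGeometry.chord_self (G : IsGeometry M b K) (x : Eu N) : M.chord x x = 0 := by
  simp [ModelSpace.chord, G.form_eq]

theorem IsMetricChart.hausdorff_image_le (G : IsGeometry M b K) {f : Eu m → Eu N} {δ s : ℝ}
    (h : IsMetricChart M f δ s) {k : ℝ} (hk : 0 ≤ k) {A : Set (Eu m)} (hA : A ⊆ Metric.ball 0 δ) :
    M.hausdorff k (f '' A) ≤ ENNReal.ofReal (4 * s) ^ k * μH[k] A := by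
  obtain ⟨K', hK'⟩ := h.lipschitz
  exact G.hausdorff_image_le hk (by have := h.scale_pos; positivity) (hK'.mono hA)
    fun x hx y hy => h.chord_le x (hA hx) y (hA hy)

theorem IsMetricChart.le_hausdorff_image (G : IsGeometry M b K) {f : Eu m → Eu N} {δ s : ℝ}
    (h : IsMetricChart M f δ s) {k : ℝ} (hk : 0 ≤ k) {A : Set (Eu m)} (hA : A ⊆ Metric.ball 0 δ) :
    μH[k] A ≤ ENNReal.ofReal (4 / s) ^ k * M.hausdorff k (f '' A) := by
  have hinj := h.injOn G.chord_self
  set g := Function.invFunOn f (Metric.ball 0 δ) with hg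
  have hgf : ∀ x ∈ Metric.ball 0 δ, g (f x) = x := fun x hx => hinj.leftInvOn_invFunOn hx
  have h1 : g '' (f '' A) = A := by
    rw [image_image]
    refine (image_congr fun x hx => hgf x (hA hx)).trans (image_id' A)
  have hs := h.scale_pos
  conv_lhs => rw [← h1]
  refine G.hausdorffMeasure_image_le hk (by positivity) ?_
  rintro _ ⟨x, hx, rfl⟩ _ ⟨y, hy, rfl⟩
  rw [hgf x (hA hx), hgf y (hA hy)]
  have := h.le_chord x (hA hx) y (hA hy)
  rw [div_mul_eq_mul_div, le_div_iff₀ hs]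
  linarith

namespace IsConformal

variable (T : IsConformal M τ θ D ρ)
include T

theorem eventually_mem {P : Eu (n + 1)} (hP : P ∈ D) {F : Type*} [NormedAddCommGroup F]
    [NormedSpace ℝ F] (Λ : F →L[ℝ] Eu (n + 1)) : ∀ᶠ x in 𝓝 (0 : F), sphChart P Λ x ∈ D := by
  have h : ContinuousAt (sphChart P Λ) 0 := (contDiff_sphChart P Λ).continuous.continuousAt
  refine h.eventually ?_
  rw [sphChart_zero]
  exact T.isOpen.mem_nhds hP

/-- At the origin the central projection has the isometry Λ as strict derivative, so it distorts
distances by factors between 1/2 and 3/2 nearby. The mean of the conformal factors is between half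
and twice ρ p, and the chord is the quotient. The dimension m is free, so that charts of linear
slices are covered. -/
theorem exists_isMetricChart {p : Eu N} (hp : p ∈ M.carrier) {Λ : Eu m →ₗᵢ[ℝ] Eu (n + 1)}
    (hΛ : ∀ v, inner ℝ (τ p) (Λ v) = 0) :
    ∃ δ, IsMetricChart M (fun x => θ (sphChart (τ p) Λ.toContinuousLinearMap x)) δ (ρ p)⁻¹ ∧
      ∀ x ∈ Metric.ball 0 δ, sphChart (τ p) Λ.toContinuousLinearMap x ∈ D := by
  set P := τ p with hPdef
  set Λ' := Λ.toContinuousLinearMap with hΛ'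
  have hP : ‖P‖ = 1 := T.norm_eq p hp
  have hPD : P ∈ D := T.mem p hp
  have hρ := T.factor_pos p hp
  have hΛ'' : ∀ v, inner ℝ P (Λ' v) = 0 := hΛ
  set f := fun x => θ (sphChart P Λ' x) with hf
  have hf0 : f 0 = p := by simp only [hf, sphChart_zero]; exact T.left_inv p hp
  have hD0 : sphChart P Λ' 0 ∈ D := by rw [sphChart_zero]; exact hPD
  have hfs : ContDiffAt ℝ ∞ f 0 := T.contDiffAt_chart hP hΛ'' hD0
  obtain ⟨K', S, hS, hlip⟩ := (hfs.of_le (m := 1) (by exact_mod_cast le_top)).exists_lipschitzOnWith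
  obtain ⟨S₂, hS₂, happ⟩ := (hasStrictFDerivAt_sphChart P Λ').approximates_deriv_on_nhds
    (c := 1 / 2) (Or.inr (by norm_num))
  have hev := T.eventually_mem hPD Λ'
  have hMf : ∀ x, sphChart P Λ' x ∈ D → f x ∈ M.carrier := fun x hx =>
    T.inv_mem _ hx (norm_sphChart hP hΛ'' x)
  have hρf : ∀ᶠ x in 𝓝 (0 : Eu m), ρ (f x) ∈ Ioo (ρ p / 2) (2 * ρ p) := by
    have h1 : Tendsto f (𝓝 0) (𝓝[M.carrier] p) := by
      refine tendsto_nhdsWithin_iff.2 ⟨?_, hev.mono hMf⟩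
      have := hfs.continuousAt.tendsto
      rwa [hf0] at this
    exact ((T.factor_continuousOn p hp).tendsto.comp h1).eventually
      (Ioo_mem_nhds (by linarith) (by linarith))
  obtain ⟨δ, hδ, hball⟩ := Metric.eventually_nhds_iff_ball.1
    ((hev.and hρf).and ((eventually_mem_set.2 hS).and (eventually_mem_set.2 hS₂)))
  have hτf : ∀ x ∈ Metric.ball 0 δ, τ (f x) = sphChart P Λ' x := fun x hx =>
    T.right_inv _ (hball x hx).1.1 (norm_sphChart hP hΛ'' x)
  have hG : ∀ x ∈ Metric.ball 0 δ, ∀ y ∈ Metric.ball 0 δ,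
      |‖sphChart P Λ' x - sphChart P Λ' y‖ - dist x y| ≤ 1 / 2 * dist x y := by
    intro x hx y hy
    have h1 := happ x (hball x hx).2.2 y (hball y hy).2.2
    have h2 : ‖Λ' (x - y)‖ = dist x y := by rw [dist_eq_norm]; exact Λ.norm_map _
    rw [← h2]
    refine (abs_norm_sub_norm_le _ _).trans (h1.trans ?_)
    rw [h2, dist_eq_norm]
    norm_num
  have hchord : ∀ x ∈ Metric.ball 0 δ, ∀ y ∈ Metric.ball 0 δ,
      (ρ p)⁻¹ / 4 * dist x y ≤ M.chord (f x) (f y) ∧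
      M.chord (f x) (f y) ≤ 4 * (ρ p)⁻¹ * dist x y := by
    intro x hx y hy
    have h1 := abs_le.1 (hG x hx y hy)
    obtain ⟨⟨hx1, hx2, hx3⟩, -⟩ := hball x hx
    obtain ⟨⟨hy1, hy2, hy3⟩, -⟩ := hball y hy
    rw [T.chord_eq (hMf x hx1) (hMf y hy1), hτf x hx, hτf y hy]
    have hd := dist_nonneg (x := x) (y := y)
    have h2 : ρ p / 2 ≤ √(ρ (f x) * ρ (f y)) := by
      refine Real.le_sqrt_of_sq_le ?_
      rw [pow_two]
      exact mul_le_mul hx2.le hy2.le (by linarith) (by linarith)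
    have h3 : √(ρ (f x) * ρ (f y)) ≤ 2 * ρ p := by
      rw [Real.sqrt_le_left (by positivity), pow_two]
      have : 0 < ρ (f y) := by linarith
      have : 0 < ρ (f x) := by linarith
      gcongr
    have h4 : 0 < √(ρ (f x) * ρ (f y)) := by linarith
    constructor
    · rw [le_div_iff₀ h4]
      calc (ρ p)⁻¹ / 4 * dist x y * √(ρ (f x) * ρ (f y))
          ≤ (ρ p)⁻¹ / 4 * dist x y * (2 * ρ p) := by gcongr
        _ = 1 / 2 * dist x y := by field_simp; ring
        _ ≤ _ := by linarith
    · rw [div_le_iff₀ h4]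
      calc ‖sphChart P Λ' x - sphChart P Λ' y‖ ≤ 2 * dist x y := by linarith
        _ = 4 * (ρ p)⁻¹ * dist x y * (ρ p / 2) := by field_simp; ring
        _ ≤ _ := by gcongr
  exact ⟨δ, ⟨hδ, by positivity, fun x hx => hMf x (hball x hx).1.1,
    ⟨K', hlip.mono fun x hx => (hball x hx).2.1⟩, fun x hx y hy => (hchord x hx y hy).1,
    fun x hx y hy => (hchord x hx y hy).2⟩, fun x hx => (hball x hx).1.1⟩

/-- Points near `p` whose image in the sphere lies in the range of the chart are in the chart. -/
theorem exists_chart_preimage {p : Eu N} (hp : p ∈ M.carrier) {Λ : Eu m →ₗᵢ[ℝ] Eu (n + 1)}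
    (hΛ : ∀ v, inner ℝ (τ p) (Λ v) = 0) {δ : ℝ} (hδ : 0 < δ) :
    ∃ r > 0, ∀ y ∈ M.carrier, ‖τ y - τ p‖ < r →
      (0 < inner ℝ (τ p) (τ y) → ∃ v, (inner ℝ (τ p) (τ y))⁻¹ • τ y - τ p = Λ v) →
      ∃ x ∈ Metric.ball 0 δ, sphChart (τ p) Λ.toContinuousLinearMap x = τ y ∧
        θ (sphChart (τ p) Λ.toContinuousLinearMap x) = y := by
  set P := τ p with hPdef
  have hP : ‖P‖ = 1 := T.norm_eq p hp
  have hc : ContinuousAt (fun Q : Eu (n + 1) => (inner ℝ P Q)⁻¹ • Q - P) P := by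
    have h1 : ContinuousAt (fun Q : Eu (n + 1) => inner ℝ P Q) P := by fun_prop
    have h2 : inner ℝ P P ≠ 0 := by rw [real_inner_self_eq_norm_sq, hP]; norm_num
    exact ((h1.inv₀ h2).smul continuousAt_id).sub continuousAt_const
  have h0 : (inner ℝ P P)⁻¹ • P - P = 0 := by
    rw [real_inner_self_eq_norm_sq, hP]; simp
  have hpos : ∀ᶠ Q in 𝓝 P, 0 < inner ℝ P Q := by
    have h1 : ContinuousAt (fun Q : Eu (n + 1) => inner ℝ P Q) P := by fun_prop
    refine h1.eventually (lt_mem_nhds ?_)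
    beta_reduce
    rw [real_inner_self_eq_norm_sq, hP]; norm_num
  have hsmall : ∀ᶠ Q in 𝓝 P, (inner ℝ P Q)⁻¹ • Q - P ∈ Metric.ball 0 δ := by
    refine hc.eventually ?_
    beta_reduce
    rw [h0]
    exact Metric.ball_mem_nhds _ hδ
  obtain ⟨r, hr, hball⟩ := Metric.eventually_nhds_iff_ball.1 (hpos.and hsmall)
  refine ⟨r, hr, fun y hy hyr hyv => ?_⟩
  obtain ⟨h1, h2⟩ := hball (τ y) (by rwa [mem_ball_iff_norm])
  obtain ⟨v, hv⟩ := hyv h1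
  have h3 : sphChart P Λ.toContinuousLinearMap v = τ y :=
    sphChart_eq hP hΛ (T.norm_eq y hy) h1 hv
  refine ⟨v, ?_, h3, by rw [h3, T.left_inv y hy]⟩
  rw [hv] at h2
  simpa using h2

end IsConformal

end

/-- A chart of `M` centred at `p`, with a conformal derivative at the origin. -/
structure IsPointedChart {n N : ℕ} (M : ModelSpace n N) (p : Eu N) (f : Eu n → Eu N) (δ s : ℝ) :
    Prop extends IsMetricChart M f δ s where
  map_zero : f 0 = p
  ball_subset : ∀ ε > 0, ∃ r > 0, M.ball p r ⊆ f '' Metric.ball 0 ε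
  differentiableAt : DifferentiableAt ℝ f 0
  form_fderiv : ∀ v w, M.form (fderiv ℝ f 0 v) (fderiv ℝ f 0 w) = s ^ 2 * inner ℝ v w
  fderiv_mem : ∀ v, fderiv ℝ f 0 v ∈ M.tangent p
  surj : ∀ ν ∈ M.tangent p, ∃ v, fderiv ℝ f 0 v = ν

/-! ### Conformal derivatives of charts and blow-ups of sets in M. -/

section BlowUp

variable {n N : ℕ} {M : ModelSpace n N} {b : Eu N →L[ℝ] Eu N →L[ℝ] ℝ} {K : ℝ}
  {τ : Eu N → Eu (n + 1)} {θ : Eu (n + 1) → Eu N} {D : Set (Eu (n + 1))} {ρ : Eu N → ℝ}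

/-- Beyond the bilipschitz estimate, the derivative at the origin must be exactly conformal. This
comes from the chordal identity `IsConformal.form_eq` in the limit. -/
theorem IsConformal.exists_isPointedChart (G : IsGeometry M b K) (T : IsConformal M τ θ D ρ)
    {p : Eu N} (hp : p ∈ M.carrier) {Λ : Eu n →ₗᵢ[ℝ] Eu (n + 1)}
    (hΛ : ∀ v, inner ℝ (τ p) (Λ v) = 0) (hΛs : ∀ w, inner ℝ (τ p) w = 0 → ∃ v, Λ v = w) :
    ∃ δ, IsPointedChart M p (fun x => θ (sphChart (τ p) Λ.toContinuousLinearMap x)) δ (ρ p)⁻¹ ∧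
      ∀ x ∈ Metric.ball 0 δ, sphChart (τ p) Λ.toContinuousLinearMap x ∈ D := by
  obtain ⟨δ, hδ, hδD⟩ := T.exists_isMetricChart hp hΛ
  set P := τ p with hPdef
  set Λ' := Λ.toContinuousLinearMap with hΛ'
  have hP : ‖P‖ = 1 := T.norm_eq p hp
  have hΛ'' : ∀ v, inner ℝ P (Λ' v) = 0 := hΛ
  set f := fun x => θ (sphChart P Λ' x) with hf
  have hf0 : f 0 = p := by simp only [hf, sphChart_zero]; exact T.left_inv p hp
  have hδ0 := hδ.radius_pos
  have h0 : (0 : Eu n) ∈ Metric.ball 0 δ := Metric.mem_ball_self hδ0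
  have hfs : ContDiffAt ℝ ∞ f 0 := T.contDiffAt_chart hP hΛ'' (hδD 0 h0)
  have hfd : DifferentiableAt ℝ f 0 := hfs.differentiableAt (by simp)
  have hρ := T.factor_pos p hp
  -- the inverse of Λ
  have hΛΓ : ∃ Γ : Eu (n + 1) →L[ℝ] Eu n, (∀ v, Γ (Λ' v) = v) ∧ ∀ w, inner ℝ P w = 0 → Λ' (Γ w) = w := by
    refine ⟨ContinuousLinearMap.adjoint Λ', fun v => ?_, fun w hw => ?_⟩
    · refine ext_inner_left ℝ fun u : Eu n => ?_
      rw [ContinuousLinearMap.adjoint_inner_right]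
      exact Λ.inner_map_map u v
    · obtain ⟨v, rfl⟩ := hΛs w hw
      refine congrArg Λ' (ext_inner_left ℝ fun u : Eu n => ?_)
      rw [ContinuousLinearMap.adjoint_inner_right]
      exact Λ.inner_map_map u v
  obtain ⟨Γ, hΓ, hΛΓ⟩ := hΛΓ
  have hparam : IsSmoothParam (Metric.ball 0 δ) f M.carrier :=
    T.isSmoothParam hP hΛ'' hΓ hΛΓ Metric.isOpen_ball hδD
  have himm := hparam.isImmersionInto
  have hmem : ∀ v, fderiv ℝ f 0 v ∈ M.tangent p := fun v => by
    have := G.fderiv_mem_tangent himm h0 v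
    rwa [hf0] at this
  -- Both sides of the chordal identity are divided by t² along the ray t • v and compared in the
  -- limit t → 0.
  have hsq : ∀ v, b (fderiv ℝ f 0 v) (fderiv ℝ f 0 v) = (ρ p)⁻¹ ^ 2 * ‖v‖ ^ 2 := by
    intro v
    have hline : Tendsto (fun t : ℝ => t • v) (𝓝[≠] 0) (𝓝 (0 : Eu n)) := by
      have : Tendsto (fun t : ℝ => t • v) (𝓝 0) (𝓝 ((0 : ℝ) • v)) :=
        (continuous_id.smul continuous_const).tendsto 0
      rw [zero_smul] at this
      exact this.mono_left nhdsWithin_le_nhds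
    have hd1 : Tendsto (fun t : ℝ => t⁻¹ • (f (t • v) - p)) (𝓝[≠] 0) (𝓝 (fderiv ℝ f 0 v)) := by
      have h1 : HasFDerivAt f (fderiv ℝ f 0) (0 + (0 : ℝ) • v) := by
        simpa using hfd.hasFDerivAt
      have h2 : HasDerivAt (fun t : ℝ => f (0 + t • v)) (fderiv ℝ f 0 v) 0 := by
        have h3 : HasDerivAt (fun t : ℝ => 0 + t • v) v 0 := by
          simpa using ((hasDerivAt_id (0 : ℝ)).smul_const v).const_add 0
        exact h1.comp_hasDerivAt 0 h3
      have h4 := hasDerivAt_iff_tendsto_slope_zero.1 h2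
      simpa [hf0] using h4
    have hd2 : Tendsto (fun t : ℝ => t⁻¹ • (sphChart P Λ' (t • v) - P)) (𝓝[≠] 0) (𝓝 (Λ' v)) := by
      have h1 : HasFDerivAt (sphChart P Λ') Λ' (0 + (0 : ℝ) • v) := by
        simpa using (hasStrictFDerivAt_sphChart P Λ').hasFDerivAt
      have h2 : HasDerivAt (fun t : ℝ => sphChart P Λ' (0 + t • v)) (Λ' v) 0 := by
        have h3 : HasDerivAt (fun t : ℝ => 0 + t • v) v 0 := by
          simpa using ((hasDerivAt_id (0 : ℝ)).smul_const v).const_add 0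
        exact h1.comp_hasDerivAt 0 h3
      have h4 := hasDerivAt_iff_tendsto_slope_zero.1 h2
      simpa [sphChart_zero] using h4
    have hl1 : Tendsto (fun t : ℝ => b (t⁻¹ • (f (t • v) - p)) (t⁻¹ • (f (t • v) - p))) (𝓝[≠] 0)
        (𝓝 (b (fderiv ℝ f 0 v) (fderiv ℝ f 0 v))) := by
      have hb : Continuous fun u : Eu N => b u u := by fun_prop
      exact (hb.tendsto _).comp hd1
    have hρf : Tendsto (fun t : ℝ => ρ (f (t • v))) (𝓝[≠] 0) (𝓝 (ρ p)) := by
      have h1 : Tendsto (fun t : ℝ => f (t • v)) (𝓝[≠] 0) (𝓝[M.carrier] p) := by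
        refine tendsto_nhdsWithin_iff.2 ⟨?_, ?_⟩
        · have := hfd.continuousAt.tendsto.comp hline
          rwa [hf0] at this
        · filter_upwards [hline.eventually (Metric.ball_mem_nhds _ hδ0)] with t ht
          exact hδ.mapsTo _ ht
      exact (T.factor_continuousOn p hp).tendsto.comp h1
    have hl2 : Tendsto (fun t : ℝ => ‖t⁻¹ • (sphChart P Λ' (t • v) - P)‖ ^ 2 / (ρ (f (t • v)) * ρ p))
        (𝓝[≠] 0) (𝓝 (‖Λ' v‖ ^ 2 / (ρ p * ρ p))) :=
      (hd2.norm.pow 2).div (hρf.mul tendsto_const_nhds) (by positivity)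
    have heq : (fun t : ℝ => b (t⁻¹ • (f (t • v) - p)) (t⁻¹ • (f (t • v) - p))) =ᶠ[𝓝[≠] 0]
        fun t : ℝ => ‖t⁻¹ • (sphChart P Λ' (t • v) - P)‖ ^ 2 / (ρ (f (t • v)) * ρ p) := by
      filter_upwards [hline.eventually (Metric.ball_mem_nhds _ hδ0)] with t ht
      have h1 := T.form_eq (hδ.mapsTo _ ht) hp
      rw [G.form_eq, T.right_inv _ (hδD _ ht) (norm_sphChart hP hΛ'' _)] at h1
      simp only [map_smul, smul_apply, smul_eq_mul, norm_smul, mul_pow]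
      change t⁻¹ * (t⁻¹ * b (θ (sphChart P Λ' (t • v)) - p) (θ (sphChart P Λ' (t • v)) - p)) = _
      rw [h1, Real.norm_eq_abs, sq_abs]
      ring
    have h1 := tendsto_nhds_unique (hl1.congr' heq) hl2
    have h2 : ‖Λ' v‖ = ‖v‖ := Λ.norm_map v
    rw [h1, h2]
    field_simp
  refine ⟨δ, ⟨hδ, hf0, fun ε hε => ?_, hfd, fun v w => ?_, hmem, fun ν hν => ?_⟩, hδD⟩
  · obtain ⟨r, hr, h⟩ := T.exists_chart_preimage hp hΛ hε
    obtain ⟨C, hC, hCle⟩ := T.exists_norm_sub_le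
    refine ⟨r / C, by positivity, fun y hy => ?_⟩
    obtain ⟨x, hx, -, hxy⟩ := h y hy.1 ((hCle y hy.1 p hp).trans_lt (by
      have := (lt_div_iff₀ hC).1 hy.2
      linarith)) fun h0 => by
        obtain ⟨v, hv⟩ := hΛs ((inner ℝ P (τ y))⁻¹ • τ y - P) (by
          rw [inner_sub_right, real_inner_smul_right, inv_mul_cancel₀ h0.ne',
            real_inner_self_eq_norm_sq, hP]; norm_num)
        exact ⟨v, hv.symm⟩
    exact ⟨x, hx, hxy⟩
  -- Polarization of the identity for v + w.
  · rw [G.form_eq]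
    have h1 := hsq (v + w)
    rw [norm_add_sq_real] at h1
    simp only [map_add, add_apply, hsq] at h1
    rw [G.symm (fderiv ℝ f 0 w)] at h1
    linarith
  · obtain ⟨v, hv⟩ := G.exists_decomposition (r := 0) hp (by simp)
      (A := (fderiv ℝ f 0).toLinearMap) (u := Fin.elim0)
      (himm.injective 0 h0) hmem (fun s => s.elim0)
      (fun s => s.elim0) (fun s => s.elim0) hν
    exact ⟨v, by simpa using hv.symm⟩

end BlowUp

/-- Density zero passes to sets that are controlled at a proportional scale c r, up to an error of
arbitrarily small density. -/
theorem tendsto_div_zero_of_le {n : ℕ} {A B : ℝ → ENNReal} {c : ℝ} (hc : 0 < c) {C : ENNReal}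
    (hC : C ≠ ⊤) (hA : Tendsto (fun r => A r / ENNReal.ofReal (r ^ n)) (𝓝[>] 0) (𝓝 0))
    (h : ∀ η : ENNReal, 0 < η → ∀ᶠ r in 𝓝[>] (0 : ℝ),
      B r ≤ C * A (c * r) + η * ENNReal.ofReal (r ^ n)) :
    Tendsto (fun r => B r / ENNReal.ofReal (r ^ n)) (𝓝[>] 0) (𝓝 0) := by
  have hcr : Tendsto (fun r : ℝ => c * r) (𝓝[>] 0) (𝓝[>] 0) := by
    refine tendsto_nhdsWithin_iff.2 ⟨?_, ?_⟩
    · have : Tendsto (fun r : ℝ => c * r) (𝓝 0) (𝓝 (c * 0)) :=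
        (continuous_const.mul continuous_id).tendsto 0
      rw [mul_zero] at this
      exact this.mono_left nhdsWithin_le_nhds
    · filter_upwards [self_mem_nhdsWithin] with r hr
      exact mul_pos hc hr
  have hlim : Tendsto (fun r => C * ENNReal.ofReal (c ^ n) *
      (A (c * r) / ENNReal.ofReal ((c * r) ^ n))) (𝓝[>] 0) (𝓝 0) := by
    have h1 := ENNReal.Tendsto.const_mul (hA.comp hcr)
      (Or.inr (ENNReal.mul_ne_top hC (ENNReal.ofReal_ne_top (r := c ^ n))))
    simpa using h1
  rw [ENNReal.tendsto_nhds_zero] at hlim ⊢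
  intro η hη
  have hη2 : 0 < η / 2 := ENNReal.half_pos hη.ne'
  filter_upwards [hlim _ hη2, h _ hη2, self_mem_nhdsWithin] with r h1 h2 hr
  have hr0 : ENNReal.ofReal (r ^ n) ≠ 0 := by simpa using pow_pos hr n
  have hc0 : ENNReal.ofReal (c ^ n) ≠ 0 := by simpa using pow_pos hc n
  calc B r / ENNReal.ofReal (r ^ n)
      ≤ (C * A (c * r) + η / 2 * ENNReal.ofReal (r ^ n)) / ENNReal.ofReal (r ^ n) := by gcongr
    _ = C * A (c * r) / ENNReal.ofReal (r ^ n) + η / 2 := by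
        rw [ENNReal.add_div, mul_div_assoc (η / 2), ENNReal.div_self hr0 ENNReal.ofReal_ne_top,
          mul_one]
    _ = C * ENNReal.ofReal (c ^ n) * (A (c * r) / ENNReal.ofReal ((c * r) ^ n)) + η / 2 := by
        congr 1
        rw [mul_pow, ENNReal.ofReal_mul (by positivity), mul_assoc, ← mul_div_assoc,
          ENNReal.mul_div_mul_left _ _ hc0 ENNReal.ofReal_ne_top, mul_div_assoc]
    _ ≤ η / 2 + η / 2 := by gcongr
    _ = η := ENNReal.add_halves η

section BlowUp

variable {n N : ℕ} {M : ModelSpace n N} {b : Eu N →L[ℝ] Eu N →L[ℝ] ℝ} {K : ℝ} {p : Eu N}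
  {f : Eu n → Eu N} {δ s : ℝ}

namespace IsPointedChart

variable (C : IsPointedChart M p f δ s) (G : IsGeometry M b K)
include C G

theorem eventually_form_sub (v : Eu n) {ε : ℝ} (hε : 0 < ε) :
    ∀ᶠ x in 𝓝 (0 : Eu n), |M.form (f x - p) (fderiv ℝ f 0 v) - s ^ 2 * inner ℝ x v| ≤ ε * ‖x‖ := by
  set w := fderiv ℝ f 0 v
  have h1 := C.differentiableAt.hasFDerivAt.isLittleO
  have hc : 0 < ε / (‖b.flip w‖ + 1) := by positivity
  filter_upwards [h1.def hc] with x hx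
  rw [C.map_zero, sub_zero] at hx
  rw [← C.form_fderiv, G.form_eq, G.form_eq, ← sub_apply, ← map_sub]
  calc |b (f x - p - fderiv ℝ f 0 x) w| = ‖b.flip w (f x - p - fderiv ℝ f 0 x)‖ := rfl
    _ ≤ ‖b.flip w‖ * ‖f x - p - fderiv ℝ f 0 x‖ := (b.flip w).le_opNorm _
    _ ≤ (‖b.flip w‖ + 1) * (ε / (‖b.flip w‖ + 1) * ‖x‖) := by gcongr; linarith
    _ = ε * ‖x‖ := by field_simp

theorem form_unit {e : Eu n} (he : ‖e‖ = 1) :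
    M.form (s⁻¹ • fderiv ℝ f 0 e) (s⁻¹ • fderiv ℝ f 0 e) = 1 := by
  have hs := C.scale_pos
  have h := C.form_fderiv e e
  rw [G.form_eq] at h ⊢
  simp only [map_smul, smul_apply, smul_eq_mul]
  rw [h, real_inner_self_eq_norm_sq, he]
  field_simp

omit G in
theorem exists_unit {ν : Eu N} (hν : ν ∈ M.tangent p) (h1 : M.form ν ν = 1) :
    ∃ e, ‖e‖ = 1 ∧ s⁻¹ • fderiv ℝ f 0 e = ν := by
  have hs := C.scale_pos
  obtain ⟨v, rfl⟩ := C.surj ν hν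
  refine ⟨s • v, ?_, ?_⟩
  · rw [C.form_fderiv, real_inner_self_eq_norm_sq, ← mul_pow] at h1
    rw [norm_smul, Real.norm_of_nonneg hs.le]
    exact (pow_eq_one_iff_of_nonneg (by positivity) (by norm_num)).1 h1
  · rw [map_smul, smul_smul, inv_mul_cancel₀ hs.ne', one_smul]

theorem eventually_unit (e : Eu n) {ε : ℝ} (hε : 0 < ε) :
    ∀ᶠ x in 𝓝 (0 : Eu n),
      |s⁻¹ * M.form (f x - p) (s⁻¹ • fderiv ℝ f 0 e) - inner ℝ x e| ≤ ε * ‖x‖ := by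
  have hs := C.scale_pos
  filter_upwards [C.eventually_form_sub G e (ε := s ^ 2 * ε) (by positivity)] with x hx
  rw [G.form_eq] at hx ⊢
  rw [map_smul, smul_eq_mul]
  have h1 : s⁻¹ * (s⁻¹ * b (f x - p) (fderiv ℝ f 0 e)) - inner ℝ x e
      = (s ^ 2)⁻¹ * (b (f x - p) (fderiv ℝ f 0 e) - s ^ 2 * inner ℝ x e) := by
    field_simp
  rw [h1, abs_mul, abs_of_pos (by positivity)]
  calc (s ^ 2)⁻¹ * |b (f x - p) (fderiv ℝ f 0 e) - s ^ 2 * inner ℝ x e|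
      ≤ (s ^ 2)⁻¹ * (s ^ 2 * ε * ‖x‖) := by gcongr
    _ = ε * ‖x‖ := by field_simp

/-- The chart changes measures by bounded factors and scales balls by bounded factors. It replaces
the half-space in M by a Euclidean one up to an error o(|x|), which matters only in a thin slab
about the hyperplane, of arbitrarily small density by `exists_slab_lt`. -/
theorem halfDens_of_isOuterNormal {U : Set (Eu N)} {e : Eu n} (he : ‖e‖ = 1)
    (h : IsOuterNormal M U p (s⁻¹ • fderiv ℝ f 0 e)) : HalfDens (f ⁻¹' U) e := by
  have hs := C.scale_pos
  set ν := s⁻¹ • fderiv ℝ f 0 e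
  refine tendsto_div_zero_of_le (c := 4 * s) (by positivity)
    (C := ENNReal.ofReal (4 / s) ^ (n : ℝ))
    (ENNReal.rpow_ne_top_of_nonneg (by positivity) ENNReal.ofReal_ne_top) h.2.2.2 fun η hη => ?_
  obtain ⟨ε, hε, hslab⟩ := exists_slab_lt he hη
  obtain ⟨δ', hδ', hball⟩ := Metric.eventually_nhds_iff_ball.1
    (C.eventually_unit G e (half_pos hε))
  filter_upwards [Ioo_mem_nhdsGT (lt_min hδ' C.radius_pos)] with r hr
  have hr0 := hr.1
  have hrδ : r < δ' := hr.2.trans_le (min_le_left _ _)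
  have hrδ2 : r < δ := hr.2.trans_le (min_le_right _ _)
  set A := {x ∈ Metric.ball (0 : Eu n) r | f x ∈ M.ball p (4 * s * r) ∧
    ((f x ∈ U ∧ 0 < M.form (f x - p) ν) ∨ (f x ∉ U ∧ M.form (f x - p) ν < 0))} with hA
  calc haus n _ ≤ haus n (A ∪ {x ∈ Metric.ball 0 r | |inner ℝ x e| ≤ ε * r}) := measure_mono ?_
    _ ≤ haus n A + haus n {x ∈ Metric.ball 0 r | |inner ℝ x e| ≤ ε * r} := measure_union_le _ _
    _ ≤ _ := by
      gcongr
      · refine (C.le_hausdorff_image G (by positivity) (A := A) fun x hx =>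
          Metric.ball_subset_ball hrδ2.le hx.1).trans ?_
        gcongr
        rintro _ ⟨x, hx, rfl⟩
        exact hx.2
      · rw [haus_slab _ _ hr0, mul_comm]
        gcongr
  rintro x ⟨hxr, hx⟩
  have hxδ := Metric.ball_subset_ball hrδ2.le hxr
  have hxb := hball x (Metric.ball_subset_ball hrδ.le hxr)
  rw [mem_ball_zero_iff] at hxr
  by_cases hsl : |inner ℝ x e| ≤ ε * r
  · exact Or.inr ⟨by simpa using hxr, hsl⟩
  · left
    have hd : M.chord (f x) p ≤ 4 * s * ‖x‖ := by
      have := C.chord_le x hxδ 0 (Metric.mem_ball_self C.radius_pos)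
      rwa [C.map_zero, dist_zero_right] at this
    have hlt : |s⁻¹ * M.form (f x - p) ν - inner ℝ x e| < |inner ℝ x e| := by
      refine hxb.trans_lt (lt_of_le_of_lt ?_ (not_le.1 hsl))
      nlinarith [norm_nonneg x]
    refine ⟨by simpa using hxr, ⟨C.mapsTo x hxδ, hd.trans_lt (by gcongr)⟩, ?_⟩
    rcases hx with ⟨hxU, hx⟩ | ⟨hxU, hx⟩
    · rw [abs_of_pos hx] at hlt
      have h1 := (abs_lt.1 hlt).1
      refine Or.inl ⟨hxU, ?_⟩
      have h2 : 0 < s⁻¹ * M.form (f x - p) ν := by linarith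
      exact (pos_iff_pos_of_mul_pos h2).1 (inv_pos.2 hs)
    · rw [abs_of_neg hx] at hlt
      have h1 := (abs_lt.1 hlt).2
      refine Or.inr ⟨hxU, ?_⟩
      have h2 : s⁻¹ * M.form (f x - p) ν < 0 := by linarith
      by_contra hcon
      have := mul_nonneg (inv_pos.2 hs).le (not_lt.1 hcon)
      linarith

theorem isOuterNormal_of_halfDens (hp : p ∈ M.carrier) {U : Set (Eu N)} {e : Eu n} (he : ‖e‖ = 1)
    (h : HalfDens (f ⁻¹' U) e) : IsOuterNormal M U p (s⁻¹ • fderiv ℝ f 0 e) := by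
  have hs := C.scale_pos
  refine ⟨hp, ?_, C.form_unit G he, ?_⟩
  · rw [← map_smul]; exact C.fderiv_mem _
  set ν := s⁻¹ • fderiv ℝ f 0 e with hν
  refine tendsto_div_zero_of_le (c := 4 / s) (by positivity)
    (C := ENNReal.ofReal (4 * s) ^ (n : ℝ))
    (ENNReal.rpow_ne_top_of_nonneg (by positivity) ENNReal.ofReal_ne_top) h fun η hη => ?_
  -- The factor by which the chart and the change of scale can enlarge the slab. The slab is chosen
  -- of measure below η / B to compensate.
  set B := ENNReal.ofReal (4 * s) ^ (n : ℝ) * ENNReal.ofReal ((4 / s) ^ n) with hB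
  have hBtop : B ≠ ⊤ := ENNReal.mul_ne_top
    (ENNReal.rpow_ne_top_of_nonneg (by positivity) ENNReal.ofReal_ne_top) ENNReal.ofReal_ne_top
  have hB0 : B ≠ 0 := by
    have h1 : 0 < 4 * s := by positivity
    have h2 : 0 < (4 / s) ^ n := by positivity
    refine mul_ne_zero ?_ (by simpa using h2)
    rw [ENNReal.rpow_natCast]
    exact pow_ne_zero _ (by simpa using hs)
  obtain ⟨ε, hε, hslab⟩ := exists_slab_lt he (ENNReal.div_pos hη.ne' hBtop)
  obtain ⟨δ', hδ', hball⟩ := Metric.eventually_nhds_iff_ball.1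
    (C.eventually_unit G e (half_pos hε))
  obtain ⟨r₀, hr₀, hsub⟩ := C.ball_subset (min δ' δ) (lt_min hδ' C.radius_pos)
  have hr₁ : 0 < min r₀ (s / 4 * δ) := lt_min hr₀ (by have := C.radius_pos; positivity)
  filter_upwards [Ioo_mem_nhdsGT hr₁] with r hr
  have hr0 := hr.1
  have hrr : r < r₀ := hr.2.trans_le (min_le_left _ _)
  set R := 4 / s * r with hR
  have hR0 : 0 < R := by positivity
  have hRδ : R < δ := by
    have : r < s / 4 * δ := hr.2.trans_le (min_le_right _ _)
    calc R < 4 / s * (s / 4 * δ) := by rw [hR]; gcongr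
      _ = δ := by field_simp
  set A := {x ∈ Metric.ball (0 : Eu n) R | (x ∈ f ⁻¹' U ∧ 0 < inner ℝ x e) ∨
    (x ∉ f ⁻¹' U ∧ inner ℝ x e < 0)} with hA
  set S := {x ∈ Metric.ball (0 : Eu n) R | |inner ℝ x e| ≤ ε * R} with hS
  calc M.hausdorff n _ ≤ M.hausdorff n (f '' (A ∪ S)) := measure_mono ?_
    _ ≤ ENNReal.ofReal (4 * s) ^ (n : ℝ) * haus n (A ∪ S) :=
      C.hausdorff_image_le G (by positivity) (by
        rintro x (hx | hx) <;> exact Metric.ball_subset_ball hRδ.le hx.1)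
    _ ≤ ENNReal.ofReal (4 * s) ^ (n : ℝ) * (haus n A + haus n S) := by
      gcongr; exact measure_union_le _ _
    _ = ENNReal.ofReal (4 * s) ^ (n : ℝ) * haus n A
        + B * haus n {x ∈ Metric.ball 0 1 | |inner ℝ x e| ≤ ε} * ENNReal.ofReal (r ^ n) := by
      rw [mul_add, hS, haus_slab _ _ hR0]
      congr 1
      rw [hR, mul_pow, ENNReal.ofReal_mul (p := (4 / s) ^ n) (by positivity), hB]
      generalize ENNReal.ofReal ((4 / s) ^ n) = x
      generalize ENNReal.ofReal (4 * s) ^ (n : ℝ) = y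
      ring
    _ ≤ _ := by
      gcongr
      calc B * _ ≤ B * (η / B) := by gcongr
        _ = η := ENNReal.mul_div_cancel hB0 hBtop
  rintro y ⟨hyr, hy⟩
  obtain ⟨x, hx, rfl⟩ := hsub ⟨hyr.1, hyr.2.trans hrr⟩
  have hxδ : x ∈ Metric.ball 0 δ := Metric.ball_subset_ball (min_le_right _ _) hx
  have hxb := hball x (Metric.ball_subset_ball (min_le_left _ _) hx)
  have hxR : ‖x‖ < R := by
    have h1 := C.le_chord x hxδ 0 (Metric.mem_ball_self C.radius_pos)
    rw [C.map_zero, dist_zero_right] at h1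
    have h2 : s / 4 * ‖x‖ < r := h1.trans_lt hyr.2
    calc ‖x‖ = 4 / s * (s / 4 * ‖x‖) := by field_simp
      _ < R := by rw [hR]; gcongr
  refine mem_image_of_mem f ?_
  by_cases hsl : |inner ℝ x e| ≤ ε * R
  · exact Or.inr ⟨by simpa using hxR, hsl⟩
  · left
    have hlt : |s⁻¹ * M.form (f x - p) ν - inner ℝ x e| < |inner ℝ x e| := by
      refine hxb.trans_lt (lt_of_le_of_lt ?_ (not_le.1 hsl))
      nlinarith [norm_nonneg x]
    have hne : inner ℝ x e ≠ 0 := by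
      intro h0
      rw [h0, abs_zero] at hsl
      exact hsl (by positivity)
    refine ⟨by simpa using hxR, ?_⟩
    rcases hy with ⟨hxU, hy⟩ | ⟨hxU, hy⟩
    · refine Or.inl ⟨hxU, ?_⟩
      have h2 : 0 < s⁻¹ * M.form (f x - p) ν := mul_pos (inv_pos.2 hs) hy
      by_contra hcon
      rw [abs_of_nonpos (not_lt.1 hcon)] at hlt
      linarith [(abs_lt.1 hlt).2]
    · refine Or.inr ⟨hxU, ?_⟩
      have h2 : s⁻¹ * M.form (f x - p) ν < 0 := mul_neg_of_pos_of_neg (inv_pos.2 hs) hy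
      by_contra hcon
      rw [abs_of_nonneg (not_lt.1 hcon)] at hlt
      linarith [(abs_lt.1 hlt).1]

theorem mem_reducedBoundary_iff (hp : p ∈ M.carrier) {U : Set (Eu N)} :
    p ∈ reducedBoundary M U ↔ ∃ e, ‖e‖ = 1 ∧ HalfDens (f ⁻¹' U) e := by
  constructor
  · rintro ⟨ν, hν⟩
    obtain ⟨e, he, rfl⟩ := C.exists_unit hν.2.1 hν.2.2.1
    exact ⟨e, he, C.halfDens_of_isOuterNormal G he hν⟩
  · rintro ⟨e, he, h⟩
    exact ⟨_, C.isOuterNormal_of_halfDens G hp he h⟩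

end IsPointedChart

variable {τ : Eu N → Eu (n + 1)} {θ : Eu (n + 1) → Eu N} {D : Set (Eu (n + 1))} {ρ : Eu N → ℝ}

/-- A set that is empty near the origin satisfies any half-space bound, so e = -e by the uniqueness
of normals. -/
theorem HalfDens.not_eventually_notMem {A : Set (Eu n)} {e : Eu n} (h : HalfDens A e)
    (he : ‖e‖ = 1) : ¬ ∀ᶠ x in 𝓝 (0 : Eu n), x ∉ A := by
  intro hA
  have := h.eq_of_subset he (e' := -e) (by rwa [norm_neg]) fun ε hε => by
    filter_upwards [hA] with x hx hxA
    exact absurd hxA hx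
  have h0 : e = 0 := by
    have h2 : (2 : ℝ) • e = 0 := by rw [two_smul]; nth_rw 1 [this]; exact neg_add_cancel e
    simpa using h2
  rw [h0, norm_zero] at he
  exact zero_ne_one he

theorem IsConformal.hasBlowUps (G : IsGeometry M b K) (T : IsConformal M τ θ D ρ) :
    HasBlowUps M where
  ball_subset p hp W hW hpW := by
    obtain ⟨C, hC, hCle⟩ := T.exists_norm_sub_le
    have hc : ContinuousAt θ (τ p) := (T.inv_smooth _ (T.mem p hp) (T.norm_eq p hp)).continuousAt
    have hW' : W ∈ 𝓝 (θ (τ p)) := by rw [T.left_inv p hp]; exact hW.mem_nhds hpW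
    obtain ⟨r, hr, hball⟩ := Metric.eventually_nhds_iff_ball.1 (hc.eventually hW')
    refine ⟨r / C, by positivity, fun y hy => ?_⟩
    rw [← T.left_inv y hy.1]
    refine hball _ ?_
    rw [mem_ball_iff_norm]
    refine (hCle y hy.1 p hp).trans_lt ?_
    have := (lt_div_iff₀ hC).1 hy.2
    linarith
  subset_closure U hU p hp := by
    by_contra hcl
    have hpM : p ∈ M.carrier := by obtain ⟨ν, h⟩ := hp; exact h.1
    obtain ⟨Λ, hΛ, hΛs⟩ := exists_isometry_orth (T.norm_eq p hpM)
    obtain ⟨δ, C, -⟩ := T.exists_isPointedChart G hpM hΛ hΛs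
    obtain ⟨e, he, h⟩ := (C.mem_reducedBoundary_iff G hpM).1 hp
    refine h.not_eventually_notMem he ?_
    have hc := C.differentiableAt.continuousAt
    have hmem : (closure U)ᶜ ∈ 𝓝 p := isClosed_closure.isOpen_compl.mem_nhds hcl
    rw [← C.map_zero] at hmem
    filter_upwards [hc.eventually hmem] with x hx hxU
    exact hx (subset_closure hxU)
  normal_eq U p ν ν' hν hν'T hν'1 hU := by
    obtain ⟨A, hA⟩ := hU
    have hpM : p ∈ M.carrier := hν.1
    obtain ⟨Λ, hΛ, hΛs⟩ := exists_isometry_orth (T.norm_eq p hpM)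
    obtain ⟨δ, C, -⟩ := T.exists_isPointedChart G hpM hΛ hΛs
    set f := fun x => θ (sphChart (τ p) Λ.toContinuousLinearMap x) with hf
    set s := (ρ p)⁻¹ with hs'
    have hs : 0 < s := C.scale_pos
    obtain ⟨e, he, rfl⟩ := C.exists_unit hν.2.1 hν.2.2.1
    obtain ⟨e', he', rfl⟩ := C.exists_unit hν'T hν'1
    have h := C.halfDens_of_isOuterNormal G he hν
    have : e = e' := by
      refine h.eq_of_subset he he' fun ε hε => ?_
      -- In the chart the quadratic error is at most B ‖x‖², hence below any ε ‖x‖ near the origin,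
      -- as `HalfDens.eq_of_subset` requires.
      obtain ⟨B, hB0, hB⟩ : ∃ B > 0, |A| * (4 * s) ^ 2 ≤ B := ⟨|A| * (4 * s) ^ 2 + 1, by positivity, by linarith⟩
      filter_upwards [C.eventually_unit G e' (half_pos hε), Metric.ball_mem_nhds _ C.radius_pos,
        Metric.ball_mem_nhds (0 : Eu n) (ε := ε * s / (2 * B)) (by positivity)] with x hx hxδ hxB hxU
      have h1 := hA (f x) hxU
      have h2 : M.form (f x - p) (f x - p) = M.chord (f x) p ^ 2 := by
        rw [ModelSpace.chord, Real.sq_sqrt]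
        rw [T.form_eq (C.mapsTo x hxδ) hpM]
        have h3 := T.factor_pos _ (C.mapsTo x hxδ)
        have h4 := T.factor_pos _ hpM
        positivity
      have h3 : M.chord (f x) p ≤ 4 * s * ‖x‖ := by
        have := C.chord_le x hxδ 0 (Metric.mem_ball_self C.radius_pos)
        rwa [C.map_zero, dist_zero_right] at this
      have h4 : A * M.form (f x - p) (f x - p) ≤ B * ‖x‖ ^ 2 := by
        rw [h2]
        calc A * M.chord (f x) p ^ 2 ≤ |A| * (4 * s * ‖x‖) ^ 2 := by
              gcongr
              · exact le_abs_self A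
              · exact Real.sqrt_nonneg _
          _ = (|A| * (4 * s) ^ 2) * ‖x‖ ^ 2 := by ring
          _ ≤ _ := by gcongr
      have h5 : s⁻¹ * M.form (f x - p) (s⁻¹ • fderiv ℝ f 0 e') ≤ ε / 2 * ‖x‖ := by
        rw [mem_ball_zero_iff, lt_div_iff₀ (by positivity)] at hxB
        calc s⁻¹ * M.form (f x - p) (s⁻¹ • fderiv ℝ f 0 e') ≤ s⁻¹ * (B * ‖x‖ ^ 2) := by
              gcongr
              exact h1.trans h4
          _ = s⁻¹ * ((‖x‖ * (2 * B)) * ‖x‖ / 2) := by ring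
          _ ≤ s⁻¹ * ((ε * s) * ‖x‖ / 2) := by gcongr
          _ = ε / 2 * ‖x‖ := by field_simp
      have h6 := (abs_le.1 hx).1
      linarith
    rw [this]

end BlowUp

/-! ### Transport of reduced boundaries to the sphere. -/

section Transport

variable {n N : ℕ} {M : ModelSpace n N} {b : Eu N →L[ℝ] Eu N →L[ℝ] ℝ} {K : ℝ}
  {τ : Eu N → Eu (n + 1)} {θ : Eu (n + 1) → Eu N} {D : Set (Eu (n + 1))} {ρ : Eu N → ℝ}

/-- Reduced boundaries are determined by the images in the sphere. -/
theorem IsConformal.mem_reducedBoundary_iff (G : IsGeometry M b K) (T : IsConformal M τ θ D ρ)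
    {p : Eu N} (hp : p ∈ M.carrier) {Λ : Eu n →ₗᵢ[ℝ] Eu (n + 1)}
    (hΛ : ∀ v, inner ℝ (τ p) (Λ v) = 0) (hΛs : ∀ w, inner ℝ (τ p) w = 0 → ∃ v, Λ v = w)
    {U : Set (Eu N)} {U' : Set (Eu (n + 1))} (hU : ∀ x ∈ M.carrier, x ∈ U ↔ τ x ∈ U') :
    p ∈ reducedBoundary M U ↔
      ∃ e, ‖e‖ = 1 ∧ HalfDens (sphChart (τ p) Λ.toContinuousLinearMap ⁻¹' U') e := by
  obtain ⟨δ, C, hCD⟩ := T.exists_isPointedChart G hp hΛ hΛs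
  rw [C.mem_reducedBoundary_iff G hp]
  have h : ∀ᶠ x in 𝓝 (0 : Eu n),
      (x ∈ (fun x => θ (sphChart (τ p) Λ.toContinuousLinearMap x)) ⁻¹' U ↔
        x ∈ sphChart (τ p) Λ.toContinuousLinearMap ⁻¹' U') := by
    filter_upwards [Metric.ball_mem_nhds _ C.radius_pos] with x hx
    rw [mem_preimage, mem_preimage, hU _ (C.mapsTo x hx),
      T.right_inv _ (hCD x hx) (norm_sphChart (T.norm_eq p hp) hΛ x)]
  exact ⟨fun ⟨e, he, h1⟩ => ⟨e, he, h1.congr h⟩,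
    fun ⟨e, he, h1⟩ => ⟨e, he, h1.congr (h.mono fun _ h => h.symm)⟩⟩

/-- Both memberships are the same half-space density statement in the central projection about τ p.
-/
theorem IsConformal.reducedBoundary_iff_image {b' : Eu (n + 1) →L[ℝ] Eu (n + 1) →L[ℝ] ℝ} {K' : ℝ}
    {D' : Set (Eu (n + 1))} {ρ' : Eu (n + 1) → ℝ}
    (G : IsGeometry M b K) (T : IsConformal M τ θ D ρ) (G' : IsGeometry (sphere n) b' K')
    (T' : IsConformal (sphere n) id id D' ρ')
    {U : Set (Eu N)} {U' : Set (Eu (n + 1))} (hU : ∀ x ∈ M.carrier, x ∈ U ↔ τ x ∈ U') {p : Eu N}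
    (hp : p ∈ M.carrier) : p ∈ reducedBoundary M U ↔ τ p ∈ reducedBoundary (sphere n) U' := by
  obtain ⟨Λ, hΛ, hΛs⟩ := exists_isometry_orth (T.norm_eq p hp)
  rw [T.mem_reducedBoundary_iff G hp hΛ hΛs hU]
  exact (T'.mem_reducedBoundary_iff G' (p := τ p) (T.norm_eq p hp) hΛ hΛs
    (fun x _ => Iff.rfl)).symm

end Transport

/-! ### Möbius maps as Lorentz transformations, and concurrent spheres. -/

section Moebius

variable {N : ℕ}

/-- The Lorentz form of `ℝ^N × ℝ`. -/
def lor (z w : Eu N × ℝ) : ℝ := inner ℝ z.1 w.1 - z.2 * w.2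

/-- `T` is the action on the unit sphere of the Lorentz transformation `A`, with inverse `S`. -/
structure IsLorentzAction (T S : Eu N → Eu N) (A : (Eu N × ℝ) ≃ₗ[ℝ] (Eu N × ℝ)) : Prop where
  lor_map : ∀ z w, lor (A z) (A w) = lor z w
  pos : ∀ p, ‖p‖ = 1 → 0 < (A (p, 1)).2
  map_eq : ∀ p, ‖p‖ = 1 → (A (p, 1)).1 = (A (p, 1)).2 • T p
  norm_map : ∀ p, ‖p‖ = 1 → ‖T p‖ = 1
  norm_inv : ∀ p, ‖p‖ = 1 → ‖S p‖ = 1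
  left_inv : ∀ p, ‖p‖ = 1 → S (T p) = p
  right_inv : ∀ p, ‖p‖ = 1 → T (S p) = p
  smooth : ∀ p, ‖p‖ = 1 → ContDiffAt ℝ ∞ T p
  inv_smooth : ∀ p, ‖p‖ = 1 → ContDiffAt ℝ ∞ S p

namespace IsLorentzAction

variable {T S : Eu N → Eu N} {A : (Eu N × ℝ) ≃ₗ[ℝ] (Eu N × ℝ)}

theorem apply_eq (h : IsLorentzAction T S A) {p : Eu N} (hp : ‖p‖ = 1) :
    A (p, 1) = (A (p, 1)).2 • (T p, (1 : ℝ)) :=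
  Prod.ext (by simpa using h.map_eq p hp) (by simp)

theorem symm_apply (h : IsLorentzAction T S A) {p : Eu N} (hp : ‖p‖ = 1) :
    A.symm (p, 1) = (A (S p, 1)).2⁻¹ • (S p, (1 : ℝ)) := by
  have h1 := h.apply_eq (h.norm_inv p hp)
  rw [h.right_inv p hp] at h1
  rw [LinearEquiv.symm_apply_eq, map_smul]
  nth_rw 2 [h1]
  rw [smul_smul, inv_mul_cancel₀ (h.pos _ (h.norm_inv p hp)).ne', one_smul]

theorem symm (h : IsLorentzAction T S A) : IsLorentzAction S T A.symm where
  lor_map z w := by rw [← h.lor_map]; simp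
  pos p hp := by
    rw [h.symm_apply hp]
    simpa using h.pos _ (h.norm_inv p hp)
  map_eq p hp := by
    rw [h.symm_apply hp]
    simp
  norm_map := h.norm_inv
  norm_inv := h.norm_map
  left_inv := h.right_inv
  right_inv := h.left_inv
  smooth := h.inv_smooth
  inv_smooth := h.smooth

theorem comp {T' S' : Eu N → Eu N} {A' : (Eu N × ℝ) ≃ₗ[ℝ] (Eu N × ℝ)}
    (h' : IsLorentzAction T' S' A') (h : IsLorentzAction T S A) :
    IsLorentzAction (T' ∘ T) (S ∘ S') (A.trans A') where
  lor_map z w := by simp [h'.lor_map, h.lor_map]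
  pos p hp := by
    rw [LinearEquiv.trans_apply, h.apply_eq hp, map_smul]
    exact mul_pos (h.pos p hp) (h'.pos _ (h.norm_map p hp))
  map_eq p hp := by
    rw [LinearEquiv.trans_apply, h.apply_eq hp, map_smul, Prod.smul_fst, Prod.smul_snd,
      h'.map_eq _ (h.norm_map p hp), smul_smul, smul_eq_mul, Function.comp_apply]
  norm_map p hp := h'.norm_map _ (h.norm_map p hp)
  norm_inv p hp := h.norm_inv _ (h'.norm_inv p hp)
  left_inv p hp := by simp [h'.left_inv _ (h.norm_map p hp), h.left_inv p hp]
  right_inv p hp := by simp [h.right_inv _ (h'.norm_inv p hp), h'.right_inv p hp]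
  smooth p hp := (h'.smooth _ (h.norm_map p hp)).comp p (h.smooth p hp)
  inv_smooth p hp := (h.inv_smooth _ (h'.norm_inv p hp)).comp p (h'.inv_smooth p hp)

theorem isometry (L : Eu N ≃ₗᵢ[ℝ] Eu N) :
    IsLorentzAction L L.symm (L.toLinearEquiv.prodCongr (LinearEquiv.refl ℝ ℝ)) where
  lor_map z w := by simp [lor]
  pos p hp := by simp
  map_eq p hp := by simp
  norm_map p hp := by simpa using hp
  norm_inv p hp := by simpa using hp
  left_inv p _ := by simp
  right_inv p _ := by simp
  smooth p _ := L.toContinuousLinearEquiv.contDiff.contDiffAt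
  inv_smooth p _ := L.symm.toContinuousLinearEquiv.contDiff.contDiffAt

/-- The Lorentz form as a linear map in the first argument. -/
def lorLeft (w : Eu N × ℝ) : (Eu N × ℝ) →ₗ[ℝ] ℝ where
  toFun z := lor z w
  map_add' x y := by simp only [lor, Prod.fst_add, Prod.snd_add, inner_add_left]; ring
  map_smul' c x := by
    simp only [lor, Prod.smul_fst, Prod.smul_snd, real_inner_smul_left, smul_eq_mul,
      RingHom.id_apply]
    ring

@[simp] theorem lorLeft_apply (w z : Eu N × ℝ) : lorLeft w z = lor z w := rfl

theorem lor_comm (z w : Eu N × ℝ) : lor z w = lor w z := by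
  rw [lor, lor, real_inner_comm, mul_comm]

theorem lor_sub_smul (z w u : Eu N × ℝ) (t : ℝ) : lor (z - t • w) u = lor z u - t * lor w u := by
  rw [← lorLeft_apply, map_sub, map_smul]; rfl

theorem lor_sub_smul_right (z w u : Eu N × ℝ) (t : ℝ) :
    lor u (z - t • w) = lor u z - t * lor u w := by
  rw [lor_comm, lor_sub_smul, lor_comm z, lor_comm w]

/-- The reflection in the Lorentz orthogonal complement of `w`. -/
def lorReflection (w : Eu N × ℝ) : (Eu N × ℝ) →ₗ[ℝ] (Eu N × ℝ) :=
  LinearMap.id - (((2 / lor w w) • lorLeft w).smulRight w)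

theorem lorReflection_apply (w z : Eu N × ℝ) :
    lorReflection w z = z - (2 / lor w w * lor z w) • w := rfl

theorem lorReflection_involutive {w : Eu N × ℝ} (hw : lor w w ≠ 0) :
    Function.Involutive (lorReflection w) := by
  intro z
  rw [lorReflection_apply, lorReflection_apply, lor_sub_smul, sub_sub, ← add_smul]
  have : 2 / lor w w * lor z w + 2 / lor w w * (lor z w - 2 / lor w w * lor z w * lor w w) = 0 := by
    field_simp; ring
  rw [this, zero_smul, sub_zero]

/-- The sphere about a of radius √(‖a‖² - 1) is orthogonal to the unit sphere, and inversion in it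
is the projective action of the Lorentz reflection in the spacelike vector (a, 1). -/
theorem inversion {a : Eu N} (ha : 1 < ‖a‖) :
    IsLorentzAction (EuclideanGeometry.inversion a (√(‖a‖ ^ 2 - 1)))
      (EuclideanGeometry.inversion a (√(‖a‖ ^ 2 - 1)))
      (LinearEquiv.ofInvolutive (lorReflection (a, 1))
        (lorReflection_involutive (w := (a, 1)) (by
          simp only [lor, real_inner_self_eq_norm_sq]; nlinarith))) := by
  have hr : 0 < ‖a‖ ^ 2 - 1 := by nlinarith
  have hw : lor (a, 1) (a, 1) = ‖a‖ ^ 2 - 1 := by simp [lor]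
  set A := LinearEquiv.ofInvolutive (lorReflection (a, 1)) _
  have hA : ∀ z, A z = z - (2 / lor (a, 1) (a, 1) * lor z (a, 1)) • (a, (1 : ℝ)) := fun z => rfl
  have hlor : ∀ z w, lor (A z) (A w) = lor z w := by
    intro z w
    rw [hA, hA, lor_sub_smul, lor_sub_smul_right, lor_sub_smul_right, hw, lor_comm (a, 1) w]
    field_simp
    ring
  have hne : ∀ p : Eu N, ‖p‖ = 1 → p ≠ a := by
    rintro p hp rfl
    exact ha.ne' hp
  have h2 : ∀ p : Eu N, ‖p‖ = 1 → (A (p, 1)).2 = ‖p - a‖ ^ 2 / (‖a‖ ^ 2 - 1) := by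
    intro p hp
    rw [hA, hw]
    simp only [lor, Prod.snd_sub, Prod.smul_snd, smul_eq_mul, mul_one]
    rw [norm_sub_sq_real, hp]
    field_simp
    ring
  have hpos : ∀ p, ‖p‖ = 1 → 0 < (A (p, 1)).2 := by
    intro p hp
    rw [h2 p hp]
    have := norm_pos_iff.2 (sub_ne_zero.2 (hne p hp))
    positivity
  have hmap : ∀ p, ‖p‖ = 1 → (A (p, 1)).1 =
      (A (p, 1)).2 • EuclideanGeometry.inversion a (√(‖a‖ ^ 2 - 1)) p := by
    intro p hp
    have hn := norm_pos_iff.2 (sub_ne_zero.2 (hne p hp))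
    have h3 : 2 / (‖a‖ ^ 2 - 1) * lor (p, 1) (a, 1) = 1 - (A (p, 1)).2 := by
      rw [hA, hw]; simp
    have h4 : (A (p, 1)).2 * (√(‖a‖ ^ 2 - 1) / dist p a) ^ 2 = 1 := by
      rw [h2 p hp, div_pow, Real.sq_sqrt hr.le, dist_eq_norm]
      field_simp
    rw [EuclideanGeometry.inversion, vsub_eq_sub, vadd_eq_add, smul_add, smul_smul, h4, one_smul]
    nth_rw 1 [hA]
    rw [hw, h3, Prod.fst_sub, Prod.smul_fst, sub_smul, one_smul]
    abel
  have hnorm : ∀ p, ‖p‖ = 1 → ‖EuclideanGeometry.inversion a (√(‖a‖ ^ 2 - 1)) p‖ = 1 := by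
    intro p hp
    have h3 := hlor (p, 1) (p, 1)
    rw [lor, lor, hmap p hp, real_inner_self_eq_norm_sq, real_inner_self_eq_norm_sq, norm_smul, hp,
      Real.norm_of_nonneg (hpos p hp).le, mul_pow] at h3
    have h4 := hpos p hp
    have h5 : ‖EuclideanGeometry.inversion a (√(‖a‖ ^ 2 - 1)) p‖ ^ 2 = 1 := by
      have : (A (p, 1)).2 ^ 2 * (‖EuclideanGeometry.inversion a (√(‖a‖ ^ 2 - 1)) p‖ ^ 2 - 1) = 0 := by
        linarith
      rcases mul_eq_zero.1 this with h | h
      · exact absurd h (by positivity)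
      · linarith
    exact (pow_eq_one_iff_of_nonneg (norm_nonneg _) (by norm_num)).1 h5
  have hinv : ∀ p : Eu N, EuclideanGeometry.inversion a (√(‖a‖ ^ 2 - 1))
      (EuclideanGeometry.inversion a (√(‖a‖ ^ 2 - 1)) p) = p := fun p =>
    EuclideanGeometry.inversion_inversion a (Real.sqrt_pos.2 hr).ne' p
  have hsm : ∀ p, ‖p‖ = 1 →
      ContDiffAt ℝ ∞ (EuclideanGeometry.inversion a (√(‖a‖ ^ 2 - 1))) p := fun p hp =>
    ContDiffAt.inversion contDiffAt_const contDiffAt_const contDiffAt_id (hne p hp)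
  exact ⟨hlor, hpos, hmap, hnorm, hnorm, fun p _ => hinv p, fun p _ => hinv p, hsm, hsm⟩

/-- For unit vectors the Lorentz product of (x, 1) and (y, 1) is -‖x - y‖²/2, so invariance of the
form is conformality for chords, with factor the inverse of the last component. -/
theorem norm_sub_sq (h : IsLorentzAction T S A) {x y : Eu N} (hx : ‖x‖ = 1) (hy : ‖y‖ = 1) :
    ‖T x - T y‖ ^ 2 = (A (x, 1)).2⁻¹ * (A (y, 1)).2⁻¹ * ‖x - y‖ ^ 2 := by
  have h1 := h.lor_map (x, 1) (y, 1)
  have hx' := h.pos x hx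
  have hy' := h.pos y hy
  rw [lor, lor, h.map_eq x hx, h.map_eq y hy, real_inner_smul_left, real_inner_smul_right] at h1
  rw [norm_sub_sq_real, norm_sub_sq_real, hx, hy, h.norm_map x hx, h.norm_map y hy]
  field_simp
  linear_combination -2 * h1

theorem continuous_factor (A : (Eu N × ℝ) ≃ₗ[ℝ] (Eu N × ℝ)) :
    Continuous fun p : Eu N => (A (p, 1)).2 := by
  have h1 : Continuous A := A.toLinearMap.continuous_of_finiteDimensional
  exact continuous_snd.comp (h1.comp (by fun_prop))

end IsLorentzAction

theorem IsMobius.exists_isLorentzAction {n : ℕ} {T : Eu (n + 1) → Eu (n + 1)} (h : IsMobius T) :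
    ∃ S A, IsMobius S ∧ IsLorentzAction T S A := by
  induction h with
  | isometry L => exact ⟨_, _, .isometry L.symm, IsLorentzAction.isometry L⟩
  | inversion a ha => exact ⟨_, _, .inversion a ha, IsLorentzAction.inversion ha⟩
  | comp _ _ h1 h2 =>
    obtain ⟨S1, A1, hS1, h1⟩ := h1
    obtain ⟨S2, A2, hS2, h2⟩ := h2
    exact ⟨_, _, hS2.comp hS1, h1.comp h2⟩

theorem IsConformal.comp_lorentz {n N : ℕ} {M : ModelSpace n N} {τ : Eu N → Eu (n + 1)}
    {θ : Eu (n + 1) → Eu N} {D : Set (Eu (n + 1))} {ρ : Eu N → ℝ} (C : IsConformal M τ θ D ρ)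
    {T S : Eu (n + 1) → Eu (n + 1)} {A : (Eu (n + 1) × ℝ) ≃ₗ[ℝ] (Eu (n + 1) × ℝ)}
    (h : IsLorentzAction T S A) :
    -- S is controlled only on the unit sphere, so the preimage of D need not be open. Its interior
    -- still contains all relevant unit vectors.
    IsConformal M (T ∘ τ) (θ ∘ S) (interior (S ⁻¹' D)) fun x => ρ x * (A (τ x, 1)).2⁻¹ := by
  have hD : ∀ P, ‖P‖ = 1 → S P ∈ D → P ∈ interior (S ⁻¹' D) := fun P hP hS =>
    mem_interior_iff_mem_nhds.2 ((h.inv_smooth P hP).continuousAt (C.isOpen.mem_nhds hS))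
  have hD' : ∀ P ∈ interior (S ⁻¹' D), S P ∈ D := fun P hP =>
    interior_subset (s := S ⁻¹' D) hP
  refine ⟨isOpen_interior, fun x hx => h.norm_map _ (C.norm_eq x hx), fun x hx => ?_, fun x hx => ?_,
    fun P hP h1 => ?_, fun P hP h1 => ?_, fun x hx => ?_, fun P hP h1 => ?_, fun x hx y hy => ?_,
    fun x hx => ?_, ?_, ?_⟩
  · refine hD _ (h.norm_map _ (C.norm_eq x hx)) ?_
    rw [Function.comp_apply, h.left_inv _ (C.norm_eq x hx)]
    exact C.mem x hx
  · exact (h.smooth _ (C.norm_eq x hx)).comp x (C.smooth x hx)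
  · exact C.inv_mem _ (hD' P hP) (h.norm_inv P h1)
  · exact (C.inv_smooth _ (hD' P hP) (h.norm_inv P h1)).comp P (h.inv_smooth P h1)
  · simp [h.left_inv _ (C.norm_eq x hx), C.left_inv x hx]
  · simp [C.right_inv _ (hD' P hP) (h.norm_inv P h1), h.right_inv P h1]
  · rw [Function.comp_apply, Function.comp_apply, h.norm_sub_sq (C.norm_eq x hx) (C.norm_eq y hy),
      C.factor x hx y hy]
    ring
  · exact mul_pos (C.factor_pos x hx) (inv_pos.2 (h.pos _ (C.norm_eq x hx)))
  · refine C.factor_continuousOn.mul (ContinuousOn.inv₀ ?_ fun x hx =>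
      (h.pos _ (C.norm_eq x hx)).ne')
    exact (IsLorentzAction.continuous_factor A).comp_continuousOn C.continuousOn
  · obtain ⟨B, hB⟩ := C.factor_bounded
    have hcont : ContinuousOn (fun P => (A (P, 1)).2⁻¹) (Metric.sphere (0 : Eu (n + 1)) 1) :=
      (IsLorentzAction.continuous_factor A).continuousOn.inv₀ fun P hP =>
        (h.pos _ (by simpa using hP)).ne'
    -- The new factor is a continuous function on the compact unit sphere.
    obtain ⟨B', hB'⟩ := ((isCompact_sphere (0 : Eu (n + 1)) 1).image_of_continuousOn hcont).bddAbove
    refine ⟨B * B', fun x hx => ?_⟩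
    have h1 := C.norm_eq x hx
    have h2 : (A (τ x, 1)).2⁻¹ ≤ B' := hB' (mem_image_of_mem _ (by simpa using h1))
    have h3 := inv_pos.2 (h.pos _ h1)
    have h4 := C.factor_pos x hx
    exact mul_le_mul (hB x hx) h2 h3.le (h4.le.trans (hB x hx))

/-- The two defining conditions decouple into the linear equation ⟨c, p⟩ + κ = 0 and the condition
that (c, -κ) is a unit spacelike vector, independent of p. -/
theorem mem_genSphere_sphere {n : ℕ} {c p : Eu (n + 1)} {κ : ℝ} :
    p ∈ genSphere (sphere n) c κ ↔ ‖p‖ = 1 ∧ inner ℝ c p + κ = 0 ∧ ‖c‖ ^ 2 - κ ^ 2 = 1 := by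
  simp only [genSphere, sphere, mem_ofPred_eq]
  refine and_congr_right fun hp => ?_
  rw [inner_add_right, real_inner_smul_right, real_inner_self_eq_norm_sq,
    real_inner_self_eq_norm_sq, norm_add_sq_real, norm_smul, real_inner_smul_right, hp,
    real_inner_comm, mul_one, Real.norm_eq_abs, sq_abs]
  constructor
  · rintro ⟨h1, h2⟩
    have : inner ℝ c p = -κ := by linarith
    rw [this] at h2
    exact ⟨by linarith, by linarith⟩
  · rintro ⟨h1, h2⟩
    have : inner ℝ c p = -κ := by linarith
    rw [this]
    exact ⟨by linarith, by linarith⟩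

theorem exists_ne_zero_orth {n : ℕ} (hn : 2 ≤ n) (c p : Eu (n + 1)) :
    ∃ u : Eu (n + 1), u ≠ 0 ∧ inner ℝ c u = 0 ∧ inner ℝ p u = 0 := by
  let f : Eu (n + 1) →ₗ[ℝ] (ℝ × ℝ) := (innerₛₗ ℝ c).prod (innerₛₗ ℝ p)
  have hf : LinearMap.ker f ≠ ⊥ := LinearMap.ker_ne_bot_of_finrank_lt (by simp; omega)
  obtain ⟨u, hu, hu0⟩ := (Submodule.ne_bot_iff _).1 hf
  have := Prod.ext_iff.1 (LinearMap.mem_ker.1 hu)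
  exact ⟨u, hu0, this.1, this.2⟩

/-- A Lorentz vector that is orthogonal to an open part of a generalized sphere is a multiple of
the Lorentz vector of the sphere. -/
theorem exists_eq_smul_of_isRelOpen {n : ℕ} (hn : 2 ≤ n) {A : Set (Eu (n + 1))} {c w : Eu (n + 1)}
    {κ s : ℝ} (hA : IsRelOpen A (genSphere (sphere n) c κ)) (hne : A.Nonempty)
    (h : ∀ p ∈ A, inner ℝ p w = s) : ∃ t : ℝ, w = t • c ∧ s = -(t * κ) := by
  obtain ⟨W, hW, rfl⟩ := hA
  obtain ⟨p, hpS, hpW⟩ := hne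
  obtain ⟨hp, hcp, hc⟩ := mem_genSphere_sphere.1 hpS
  have hc0 : 0 < ‖c‖ ^ 2 := by nlinarith [sq_nonneg κ]
  have hcn : ‖c‖ ≠ 0 := fun h0 => by rw [h0] at hc0; norm_num at hc0
  -- The projection of p to the complement of c; u + ε e will serve as reflection vectors.
  set e := p + (κ / ‖c‖ ^ 2) • c with he
  have hce : inner ℝ c e = 0 := by
    rw [he, inner_add_right, real_inner_smul_right, real_inner_self_eq_norm_sq]
    field_simp
    linarith
  have hpe : inner ℝ p e = (‖c‖ ^ 2)⁻¹ := by
    rw [he, inner_add_right, real_inner_smul_right, real_inner_self_eq_norm_sq, hp,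
      real_inner_comm, show inner ℝ c p = -κ by linarith]
    field_simp
    linarith
  have hpw := h p ⟨hpS, hpW⟩
  -- The reflection of p in the hyperplane orthogonal to v stays on the sphere because v ⟂ c. If it
  -- also stays in W, comparing ⟨·, w⟩ at the two points gives ⟨v, w⟩ = 0.
  have key : ∀ v, inner ℝ c v = 0 → inner ℝ p v ≠ 0 → p - (2 * inner ℝ p v / ‖v‖ ^ 2) • v ∈ W →
      inner ℝ v w = 0 := by
    intro v hcv hpv hv
    have hv0 : v ≠ 0 := by rintro rfl; simp at hpv
    have hv1 := norm_pos_iff.2 hv0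
    have h1 : p - (2 * inner ℝ p v / ‖v‖ ^ 2) • v ∈ genSphere (sphere n) c κ := by
      refine mem_genSphere_sphere.2 ⟨?_, ?_, hc⟩
      · have : ‖p - (2 * inner ℝ p v / ‖v‖ ^ 2) • v‖ ^ 2 = 1 := by
          rw [norm_sub_sq_real, norm_smul, real_inner_smul_right, hp, mul_pow, Real.norm_eq_abs,
            sq_abs]
          field_simp
          ring
        exact (pow_eq_one_iff_of_nonneg (norm_nonneg _) (by norm_num)).1 this
      · rw [inner_sub_right, real_inner_smul_right, hcv]
        linarith
    have h2 := h _ ⟨h1, hv⟩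
    rw [inner_sub_left, real_inner_smul_left, hpw] at h2
    have h3 : 2 * inner ℝ p v / ‖v‖ ^ 2 ≠ 0 := by positivity
    have h4 : 2 * inner ℝ p v / ‖v‖ ^ 2 * inner ℝ v w = 0 := by linarith
    exact (mul_eq_zero.1 h4).resolve_left h3
  -- For u ⟂ c, p the vectors u + ε e move p when ε ≠ 0, and only slightly when ε is small. Letting
  -- ε → 0 separates the conclusions for u and for e.
  have key2 : ∀ u, u ≠ 0 → inner ℝ c u = 0 → inner ℝ p u = 0 →
      inner ℝ u w = 0 ∧ inner ℝ e w = 0 := by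
    intro u hu hcu hpu
    have hcont : ContinuousAt (fun ε : ℝ => p - (2 * inner ℝ p (u + ε • e) / ‖u + ε • e‖ ^ 2) •
        (u + ε • e)) 0 := by
      have h0 : ‖u + (0 : ℝ) • e‖ ^ 2 ≠ 0 := by simpa using hu
      have h1 : ContinuousAt (fun ε : ℝ => 2 * inner ℝ p (u + ε • e) / ‖u + ε • e‖ ^ 2) 0 :=
        ContinuousAt.div (Continuous.continuousAt (by fun_prop))
          (Continuous.continuousAt (by fun_prop)) h0
      exact continuousAt_const.sub (h1.smul (Continuous.continuousAt (by fun_prop)))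
    have hmem : ∀ᶠ ε in 𝓝 (0 : ℝ), p - (2 * inner ℝ p (u + ε • e) / ‖u + ε • e‖ ^ 2) •
        (u + ε • e) ∈ W := hcont.eventually (hW.mem_nhds (by simpa [hpu] using hpW))
    have hz : ∀ᶠ ε in 𝓝[≠] (0 : ℝ), inner ℝ (u + ε • e) w = 0 := by
      filter_upwards [nhdsWithin_le_nhds hmem, self_mem_nhdsWithin] with ε h1 h2
      refine key _ ?_ ?_ h1
      · rw [inner_add_right, real_inner_smul_right, hcu, hce]; simp
      · rw [inner_add_right, real_inner_smul_right, hpu, hpe, zero_add]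
        exact mul_ne_zero h2 (by positivity)
    have hlim : Tendsto (fun ε : ℝ => inner ℝ (u + ε • e) w) (𝓝[≠] 0) (𝓝 (inner ℝ u w)) := by
      have : Continuous fun ε : ℝ => inner ℝ (u + ε • e) w := by fun_prop
      have h2 := this.tendsto 0
      simp only [zero_smul, add_zero] at h2
      exact h2.mono_left nhdsWithin_le_nhds
    have hu0 : inner ℝ u w = 0 :=
      tendsto_nhds_unique hlim (tendsto_const_nhds.congr' (hz.mono fun ε h => h.symm))
    obtain ⟨ε, h1, h2⟩ := (hz.and self_mem_nhdsWithin).exists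
    rw [inner_add_left, real_inner_smul_left, hu0, zero_add] at h1
    exact ⟨hu0, (mul_eq_zero.1 h1).resolve_left h2⟩
  -- Some u ≠ 0 is needed to conclude for e; it exists because n + 1 ≥ 3.
  obtain ⟨u₀, hu₀, hcu₀, hpu₀⟩ := exists_ne_zero_orth hn c p
  have hew := (key2 u₀ hu₀ hcu₀ hpu₀).2
  set t := inner ℝ c w / ‖c‖ ^ 2 with ht
  have hwt : w = t • c := by
    set z := w - t • c with hz
    have hcz : inner ℝ c z = 0 := by
      rw [hz, inner_sub_right, real_inner_smul_right, real_inner_self_eq_norm_sq, ht]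
      field_simp
      ring
    set y := z - (‖c‖ ^ 2 * inner ℝ p z) • e with hy
    have hcy : inner ℝ c y = 0 := by
      rw [hy, inner_sub_right, real_inner_smul_right, hcz, hce]; simp
    have hpy : inner ℝ p y = 0 := by
      rw [hy, inner_sub_right, real_inner_smul_right, hpe]
      field_simp
      ring
    have hyw : inner ℝ y w = 0 := by
      by_cases hy0 : y = 0
      · simp [hy0]
      · exact (key2 y hy0 hcy hpy).1
    have hzw : inner ℝ z w = 0 := by
      have : z = y + (‖c‖ ^ 2 * inner ℝ p z) • e := by rw [hy]; abel
      rw [this, inner_add_left, real_inner_smul_left, hyw, hew]; simp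
    have hzz : inner ℝ z z = 0 := by
      nth_rw 2 [hz]
      rw [inner_sub_right, real_inner_smul_right, hzw, real_inner_comm, hcz]; simp
    exact sub_eq_zero.1 (inner_self_eq_zero.1 hzz)
  refine ⟨t, hwt, ?_⟩
  rw [← hpw, hwt, real_inner_smul_right, real_inner_comm, show inner ℝ c p = -κ by linarith]
  ring

/-- The point of the open ball at which the spheres of a Möbius-flat family are concurrent. -/
theorem IsMobius.exists_flatVector {n : ℕ} (hn : 2 ≤ n) {T : Eu (n + 1) → Eu (n + 1)}
    (hT : IsMobius T) : ∃ ξ : Eu (n + 1), ‖ξ‖ < 1 ∧ ∀ (A : Set (Eu (n + 1))) c κ, A.Nonempty →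
      IsRelOpen A (genSphere (sphere n) c κ) →
      (∃ v, IsRelOpen (T '' A) (genSphere (sphere n) v 0)) → inner ℝ c ξ + κ = 0 := by
  obtain ⟨S, L, -, h⟩ := hT.exists_isLorentzAction
  -- Great spheres are those whose Lorentz vector is orthogonal to (0, 1). Its preimage y is
  -- timelike, which makes y.1 / y.2 a point of the open ball.
  obtain ⟨y, hy⟩ : ∃ y, L.symm (0, 1) = y := ⟨_, rfl⟩
  have hyy : ‖y.1‖ ^ 2 - y.2 ^ 2 = -1 := by
    have := h.symm.lor_map (0, 1) (0, 1)
    rw [hy] at this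
    simp only [lor, inner_zero_left, real_inner_self_eq_norm_sq] at this
    linarith
  have hy2 : y.2 ≠ 0 := by
    intro h0
    rw [h0] at hyy
    nlinarith [sq_nonneg ‖y.1‖]
  refine ⟨y.2⁻¹ • y.1, ?_, fun A c κ hne hA ⟨v, hv⟩ => ?_⟩
  · rw [norm_smul, norm_inv, inv_mul_lt_iff₀ (norm_pos_iff.2 hy2), mul_one]
    refine abs_lt_of_sq_lt_sq' ?_ (norm_nonneg _) |>.2
    rw [Real.norm_eq_abs, sq_abs]
    linarith
  obtain ⟨w, hw⟩ : ∃ w, L.symm (v, 0) = w := ⟨_, rfl⟩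
  have hv1 : ‖v‖ ^ 2 = 1 := by
    obtain ⟨W, -, hW⟩ := hv
    obtain ⟨p, hp⟩ := hne
    have := (mem_genSphere_sphere.1 (hW.subset (mem_image_of_mem T hp)).1).2.2
    linarith
  -- The pulled back vector of the great sphere is orthogonal to (p, 1) for all p in A, hence is
  -- proportional to the Lorentz vector (c, -κ) of the original sphere.
  obtain ⟨t, ht1, ht2⟩ := exists_eq_smul_of_isRelOpen hn hA hne (w := w.1) (s := w.2) fun p hp => by
    obtain ⟨W, -, hW⟩ := hv
    obtain ⟨W', -, hW'⟩ := hA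
    have hp1 := (mem_genSphere_sphere.1 (hW'.subset hp).1).1
    have h1 := (mem_genSphere_sphere.1 (hW.subset (mem_image_of_mem T hp)).1).2.1
    have h2 := h.lor_map (p, 1) w
    rw [← hw, LinearEquiv.apply_symm_apply, hw, lor, lor, h.map_eq p hp1, real_inner_smul_left,
      real_inner_comm] at h2
    rw [add_zero] at h1
    rw [h1] at h2
    linarith
  have h3 : lor w y = 0 := by
    rw [← hw, ← hy, h.symm.lor_map]
    simp [lor]
  have h4 : t ≠ 0 := by
    rintro rfl
    have h5 : w = 0 := Prod.ext (by simpa using ht1) (by simpa using ht2)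
    have h6 : (v, (0 : ℝ)) = 0 := by rw [← L.symm.map_eq_zero_iff, hw, h5]
    have h7 : v = 0 := congrArg Prod.fst h6
    rw [h7, norm_zero] at hv1
    norm_num at hv1
  rw [lor, ht1, ht2, real_inner_smul_left] at h3
  have h5 : t * (inner ℝ c y.1 + κ * y.2) = 0 := by linarith
  have h6 := (mul_eq_zero.1 h5).resolve_left h4
  rw [real_inner_smul_right]
  field_simp
  linarith

end Moebius

/-! ### Splitting off the last coordinate; the Minkowski form. -/

section Coordinates

variable {n : ℕ}

@[simp] theorem lowerPart_apply (y : Eu (n + 1)) (i : Fin n) : lowerPart y i = y i.castSucc := rfl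

@[simp] theorem pairVec_castSucc (u : Eu n) (t : ℝ) (i : Fin n) : pairVec u t i.castSucc = u i := by
  simp [pairVec]

@[simp] theorem pairVec_last (u : Eu n) (t : ℝ) : pairVec u t (Fin.last n) = t := by
  simp [pairVec]

@[simp] theorem lowerPart_pairVec (u : Eu n) (t : ℝ) : lowerPart (pairVec u t) = u := by
  ext i; simp

theorem ext_lowerPart {x y : Eu (n + 1)} (h : lowerPart x = lowerPart y)
    (h' : x (Fin.last n) = y (Fin.last n)) : x = y := by
  ext i
  refine Fin.lastCases h' (fun i => ?_) i
  exact congrArg (fun z : Eu n => z i) h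

@[simp] theorem lowerPart_sub (x y : Eu (n + 1)) : lowerPart (x - y) = lowerPart x - lowerPart y :=
  rfl

@[simp] theorem lowerPart_smul (t : ℝ) (x : Eu (n + 1)) : lowerPart (t • x) = t • lowerPart x := rfl

theorem inner_eq_lowerPart (x y : Eu (n + 1)) :
    inner ℝ x y = inner ℝ (lowerPart x) (lowerPart y) + x (Fin.last n) * y (Fin.last n) := by
  simp only [PiLp.inner_apply, Fin.sum_univ_castSucc, lowerPart_apply]
  simp [mul_comm]

theorem norm_sq_eq_lowerPart (x : Eu (n + 1)) : ‖x‖ ^ 2 = ‖lowerPart x‖ ^ 2 + x (Fin.last n) ^ 2 := by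
  rw [← real_inner_self_eq_norm_sq, inner_eq_lowerPart, real_inner_self_eq_norm_sq, sq (x _)]

theorem mink_eq_lowerPart (x y : Eu (n + 1)) :
    mink x y = inner ℝ (lowerPart x) (lowerPart y) - x (Fin.last n) * y (Fin.last n) := by
  simp only [mink, PiLp.inner_apply, lowerPart_apply]
  simp [mul_comm]

theorem contDiff_apply_last : ContDiff ℝ ∞ fun x : Eu (n + 1) => x (Fin.last n) := by fun_prop

theorem contDiff_lowerPart : ContDiff ℝ ∞ (lowerPart : Eu (n + 1) → Eu n) := by
  rw [contDiff_euclidean]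
  intro i
  simp only [lowerPart_apply]
  fun_prop

theorem contDiff_pairVec : ContDiff ℝ ∞ fun z : Eu n × ℝ => pairVec z.1 z.2 := by
  rw [contDiff_euclidean]
  intro i
  refine Fin.lastCases ?_ (fun i => ?_) i
  · simp only [pairVec_last]; fun_prop
  · simp only [pairVec_castSucc]; fun_prop

/-- The Minkowski form as a continuous bilinear map. -/
def minkL (n : ℕ) : Eu (n + 1) →L[ℝ] Eu (n + 1) →L[ℝ] ℝ :=
  innerSL ℝ - (2 : ℝ) • (EuclideanSpace.proj (Fin.last n)).smulRight
    (EuclideanSpace.proj (Fin.last n) : Eu (n + 1) →L[ℝ] ℝ)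

theorem minkL_apply (x y : Eu (n + 1)) : minkL n x y = mink x y := by
  have : minkL n x y = inner ℝ x y - 2 * (x (Fin.last n) * y (Fin.last n)) := rfl
  rw [this, inner_eq_lowerPart, mink_eq_lowerPart]
  ring

theorem mink_comm (x y : Eu (n + 1)) : mink x y = mink y x := by
  rw [mink_eq_lowerPart, mink_eq_lowerPart, real_inner_comm, mul_comm]

end Coordinates

/-! ### The three model spaces as space forms with conformal maps to the sphere. -/

section Geometries

variable (n : ℕ)

theorem isGeometry_sphere : IsGeometry (sphere n) (innerSL ℝ) 1 where
  form_eq _ _ := rfl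
  symm x y := real_inner_comm y x
  abs_le v := by
    rw [innerSL_apply_apply, real_inner_self_eq_norm_sq, abs_of_nonneg (sq_nonneg _)]
  isClosed := isClosed_eq continuous_norm continuous_const
  cube := by norm_num
  tangent_iff p v := by rw [one_mul]; rfl
  level p hp := by
    have : ‖p‖ = 1 := hp
    rw [innerSL_apply_apply, real_inner_self_eq_norm_sq, this]
    norm_num
  pos p _ v _ hv := by
    rw [innerSL_apply_apply, real_inner_self_eq_norm_sq]
    have := norm_pos_iff.2 hv
    positivity
  finrank_ker p hp := by
    have h1 : ‖p‖ = 1 := hp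
    have h : ((1 : ℝ) • innerSL ℝ p).toLinearMap ≠ 0 := by
      intro h0
      have := LinearMap.congr_fun h0 p
      simp [h1] at this
    have := Module.Dual.finrank_ker_add_one_of_ne_zero (f := ((1 : ℝ) • innerSL ℝ p).toLinearMap) h
    rw [finrank_euclideanSpace, Fintype.card_fin] at this
    exact Nat.succ_injective this

theorem isGeometry_euclid : IsGeometry (euclid n) (innerSL ℝ) 0 where
  form_eq _ _ := rfl
  symm x y := real_inner_comm y x
  abs_le v := by
    rw [innerSL_apply_apply, real_inner_self_eq_norm_sq, abs_of_nonneg (sq_nonneg _)]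
  isClosed := isClosed_univ
  cube := by norm_num
  tangent_iff p v := by simp [euclid]
  level p hp := by simp
  pos p _ v _ hv := by
    rw [innerSL_apply_apply, real_inner_self_eq_norm_sq]
    have := norm_pos_iff.2 hv
    positivity
  finrank_ker p hp := by
    have : ((0 : ℝ) • innerSL ℝ p : Eu n →L[ℝ] ℝ).ker = ⊤ := by
      rw [zero_smul]; exact LinearMap.ker_zero
    rw [this, finrank_top, finrank_euclideanSpace, Fintype.card_fin]

variable {n}

theorem mem_hyperbolic {y : Eu (n + 1)} :
    y ∈ (hyperbolic n).carrier ↔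
      ‖lowerPart y‖ ^ 2 = y (Fin.last n) ^ 2 - 1 ∧ 0 < y (Fin.last n) := by
  refine and_congr_left fun _ => ?_
  rw [mink_eq_lowerPart, real_inner_self_eq_norm_sq]
  constructor <;> intro h <;> linarith

theorem one_le_last {y : Eu (n + 1)} (hy : y ∈ (hyperbolic n).carrier) : 1 ≤ y (Fin.last n) := by
  obtain ⟨h1, h2⟩ := mem_hyperbolic.1 hy
  nlinarith [sq_nonneg ‖lowerPart y‖]

variable (n)

theorem isGeometry_hyperbolic : IsGeometry (hyperbolic n) (minkL n) (-1) where
  form_eq _ _ := (minkL_apply _ _).symm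
  symm x y := by rw [minkL_apply, minkL_apply, mink_comm]
  abs_le v := by
    rw [minkL_apply, mink_eq_lowerPart, norm_sq_eq_lowerPart, real_inner_self_eq_norm_sq, abs_le]
    constructor <;> nlinarith [sq_nonneg ‖lowerPart v‖, sq_nonneg (v (Fin.last n))]
  isClosed := by
    -- The condition 0 < y_0 is not closed, but on the hyperboloid it is equivalent to 1 ≤ y_0.
    have h : (hyperbolic n).carrier = {y | minkL n y y = -1 ∧ 1 ≤ y (Fin.last n)} := by
      ext y
      refine ⟨fun hy => ⟨by rw [minkL_apply]; exact hy.1, one_le_last hy⟩, fun hy => ⟨?_, ?_⟩⟩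
      · rw [← minkL_apply]; exact hy.1
      · linarith [hy.2]
    rw [h]
    exact (isClosed_eq ((minkL n).continuous.clm_apply continuous_id) continuous_const).inter
      (isClosed_le continuous_const contDiff_apply_last.continuous)
  cube := by norm_num
  tangent_iff p v := by simp [hyperbolic, minkL_apply]
  level p hp := by
    rw [minkL_apply, hp.1]; norm_num
  pos p hp v hv hv0 := by
    have hv' : mink p v = 0 := hv
    obtain ⟨h1, h2⟩ := mem_hyperbolic.1 hp
    rw [minkL_apply]
    rw [mink_eq_lowerPart] at hv' ⊢
    rw [real_inner_self_eq_norm_sq]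
    -- For tangent v, Cauchy-Schwarz on the first n coordinates gives p_0² v_0² ≤ (p_0² - 1) |v̲|²,
    -- whence positivity once v̲ ≠ 0.
    have h3 := real_inner_mul_inner_self_le (lowerPart p) (lowerPart v)
    rw [real_inner_self_eq_norm_sq, real_inner_self_eq_norm_sq, h1,
      show inner ℝ (lowerPart p) (lowerPart v) = p (Fin.last n) * v (Fin.last n) by linarith] at h3
    have h4 : 0 < ‖lowerPart v‖ ^ 2 := by
      by_contra hcon
      have h5 : ‖lowerPart v‖ = 0 := by nlinarith [sq_nonneg ‖lowerPart v‖, norm_nonneg (lowerPart v)]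
      have h6 : lowerPart v = 0 := norm_eq_zero.1 h5
      rw [h6, inner_zero_right] at hv'
      have h7 : v (Fin.last n) = 0 := by
        have : p (Fin.last n) * v (Fin.last n) = 0 := by linarith
        exact (mul_eq_zero.1 this).resolve_left h2.ne'
      exact hv0 (ext_lowerPart (by rw [h6]; rfl) (by rw [h7]; rfl))
    have h5 : 0 < p (Fin.last n) ^ 2 := by positivity
    have h6 : 0 < p (Fin.last n) ^ 2 * (‖lowerPart v‖ ^ 2 - v (Fin.last n) * v (Fin.last n)) := by
      nlinarith
    exact (pos_iff_pos_of_mul_pos h6).1 h5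
  finrank_ker p hp := by
    have h : ((-1 : ℝ) • minkL n p).toLinearMap ≠ 0 := by
      intro h0
      have h1 := LinearMap.congr_fun h0 p
      have h2 : -1 * minkL n p p = 0 := h1
      rw [minkL_apply, hp.1] at h2
      norm_num at h2
    have := Module.Dual.finrank_ker_add_one_of_ne_zero (f := ((-1 : ℝ) • minkL n p).toLinearMap) h
    rw [finrank_euclideanSpace, Fintype.card_fin] at this
    exact Nat.succ_injective this

theorem isConformal_sphere : IsConformal (sphere n) id id univ (fun _ => 1) where
  isOpen := isOpen_univ
  norm_eq _ hx := hx
  mem _ _ := mem_univ _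
  smooth _ _ := contDiffAt_id
  inv_mem _ _ hP := hP
  inv_smooth _ _ _ := contDiffAt_id
  left_inv _ _ := rfl
  right_inv _ _ _ := rfl
  factor x _ y _ := by simp [sphere]
  factor_pos _ _ := one_pos
  factor_continuousOn := continuousOn_const
  factor_bounded := ⟨1, fun _ _ => le_rfl⟩

variable {n}

/-- The inverse of `stereoR`. -/
def stereoRInv (P : Eu (n + 1)) : Eu n := (1 - P (Fin.last n))⁻¹ • lowerPart P

@[simp] theorem lowerPart_stereoR (x : Eu n) : lowerPart (stereoR x) = (2 / (‖x‖ ^ 2 + 1)) • x := by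
  simp [stereoR]

@[simp] theorem stereoR_last (x : Eu n) :
    stereoR x (Fin.last n) = (‖x‖ ^ 2 - 1) / (‖x‖ ^ 2 + 1) := by
  simp [stereoR]

theorem norm_stereoR (x : Eu n) : ‖stereoR x‖ = 1 := by
  have : ‖stereoR x‖ ^ 2 = 1 := by
    rw [norm_sq_eq_lowerPart, lowerPart_stereoR, stereoR_last, norm_smul, mul_pow,
      Real.norm_eq_abs, sq_abs]
    field_simp
    ring
  exact (pow_eq_one_iff_of_nonneg (norm_nonneg _) (by norm_num)).1 this

theorem inner_stereoR (c : Eu (n + 1)) (x : Eu n) : inner ℝ c (stereoR x) * (‖x‖ ^ 2 + 1) =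
    2 * inner ℝ (lowerPart c) x + c (Fin.last n) * (‖x‖ ^ 2 - 1) := by
  rw [inner_eq_lowerPart, lowerPart_stereoR, stereoR_last, real_inner_smul_right]
  field_simp

theorem contDiff_stereoR : ContDiff ℝ ∞ (stereoR : Eu n → Eu (n + 1)) := by
  have h : ∀ x : Eu n, ‖x‖ ^ 2 + 1 ≠ 0 := fun x => by positivity
  have h1 : ContDiff ℝ ∞ fun x : Eu n => ‖x‖ ^ 2 := contDiff_norm_sq ℝ
  have h2 : ContDiff ℝ ∞ fun x : Eu n => 2 / (‖x‖ ^ 2 + 1) :=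
    contDiff_const.div (h1.add contDiff_const) h
  exact contDiff_pairVec.comp ((h2.smul contDiff_id).prodMk
    ((h1.sub contDiff_const).div (h1.add contDiff_const) h))

theorem isConformal_euclid : IsConformal (euclid n) stereoR stereoRInv
    {P | P (Fin.last n) < 1} (fun x => 2 / (‖x‖ ^ 2 + 1)) where
  isOpen := isOpen_lt contDiff_apply_last.continuous continuous_const
  norm_eq x _ := norm_stereoR x
  mem x _ := by
    rw [mem_ofPred_eq, stereoR_last, div_lt_one (by positivity)]
    linarith
  smooth _ _ := contDiff_stereoR.contDiffAt
  inv_mem _ _ _ := mem_univ _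
  inv_smooth P hP _ := by
    have hP' : P (Fin.last n) < 1 := hP
    have h0 : 1 - P (Fin.last n) ≠ 0 := by linarith
    exact ((contDiffAt_const.sub contDiff_apply_last.contDiffAt).inv h0).smul
      contDiff_lowerPart.contDiffAt
  left_inv x _ := by
    rw [stereoRInv, lowerPart_stereoR, stereoR_last, smul_smul]
    have : (1 - (‖x‖ ^ 2 - 1) / (‖x‖ ^ 2 + 1))⁻¹ * (2 / (‖x‖ ^ 2 + 1)) = 1 := by
      have h : 1 - (‖x‖ ^ 2 - 1) / (‖x‖ ^ 2 + 1) = 2 / (‖x‖ ^ 2 + 1) := by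
        field_simp; ring
      rw [h]
      exact inv_mul_cancel₀ (by positivity)
    rw [this, one_smul]
  right_inv P hP h1 := by
    have hP' : 0 < 1 - P (Fin.last n) := by
      have : P (Fin.last n) < 1 := hP
      linarith
    have h2 := norm_sq_eq_lowerPart P
    rw [h1] at h2
    have h3 : ‖stereoRInv P‖ ^ 2 + 1 = 2 / (1 - P (Fin.last n)) := by
      rw [stereoRInv, norm_smul, mul_pow, show ‖lowerPart P‖ ^ 2 =
        (1 - P (Fin.last n)) * (1 + P (Fin.last n)) by linarith, norm_inv,
        Real.norm_of_nonneg hP'.le]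
      field_simp
      ring
    refine ext_lowerPart ?_ ?_
    · rw [lowerPart_stereoR, h3, stereoRInv, smul_smul, div_div_cancel₀ two_ne_zero,
        mul_inv_cancel₀ hP'.ne', one_smul]
    · rw [stereoR_last, h3, show ‖stereoRInv P‖ ^ 2 - 1 = 2 / (1 - P (Fin.last n)) - 2 by linarith]
      field_simp
      ring
  factor x _ y _ := by
    rw [norm_sub_sq_real, norm_stereoR, norm_stereoR]
    have h1 := inner_stereoR (stereoR x) y
    rw [lowerPart_stereoR, stereoR_last, real_inner_smul_left] at h1
    have h2 : (euclid n).form (x - y) (x - y) = ‖x‖ ^ 2 - 2 * inner ℝ x y + ‖y‖ ^ 2 := by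
      rw [← norm_sub_sq_real, ← real_inner_self_eq_norm_sq]; rfl
    have h3 : inner ℝ (stereoR x) (stereoR y) = (4 * inner ℝ x y + (‖x‖ ^ 2 - 1) * (‖y‖ ^ 2 - 1)) /
        ((‖x‖ ^ 2 + 1) * (‖y‖ ^ 2 + 1)) := by
      rw [eq_div_iff (by positivity), mul_comm (‖x‖ ^ 2 + 1), ← mul_assoc, h1]
      field_simp
      ring
    rw [h2, h3]
    field_simp
    ring
  factor_pos x _ := by positivity
  factor_continuousOn := by
    refine Continuous.continuousOn (continuous_const.div (by fun_prop) fun x => by positivity)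
  factor_bounded := ⟨2, fun x _ => by
    rw [div_le_iff₀ (by positivity)]
    nlinarith [sq_nonneg ‖x‖]⟩

@[simp] theorem lowerPart_stereoH (y : Eu (n + 1)) :
    lowerPart (stereoH y) = (y (Fin.last n))⁻¹ • lowerPart y := by
  simp [stereoH]

@[simp] theorem stereoH_last (y : Eu (n + 1)) : stereoH y (Fin.last n) = (y (Fin.last n))⁻¹ := by
  simp [stereoH]

/-- This projection is its own inverse, between the hyperboloid and the open Northern hemisphere. -/
theorem stereoH_stereoH {y : Eu (n + 1)} (hy : y (Fin.last n) ≠ 0) : stereoH (stereoH y) = y := by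
  refine ext_lowerPart ?_ (by simp)
  rw [lowerPart_stereoH, lowerPart_stereoH, stereoH_last, inv_inv, smul_smul, mul_inv_cancel₀ hy,
    one_smul]

theorem contDiffAt_stereoH {y : Eu (n + 1)} (hy : y (Fin.last n) ≠ 0) :
    ContDiffAt ℝ ∞ (stereoH : Eu (n + 1) → Eu (n + 1)) y :=
  (contDiff_apply_last.contDiffAt.inv hy).smul
    (contDiff_pairVec.comp (contDiff_lowerPart.prodMk contDiff_const)).contDiffAt

theorem norm_stereoH {y : Eu (n + 1)} (hy : y ∈ (hyperbolic n).carrier) : ‖stereoH y‖ = 1 := by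
  obtain ⟨h1, h2⟩ := mem_hyperbolic.1 hy
  have : ‖stereoH y‖ ^ 2 = 1 := by
    rw [norm_sq_eq_lowerPart, lowerPart_stereoH, stereoH_last, norm_smul, mul_pow, h1, norm_inv,
      Real.norm_of_nonneg h2.le]
    field_simp
    ring
  exact (pow_eq_one_iff_of_nonneg (norm_nonneg _) (by norm_num)).1 this

theorem stereoH_mem {P : Eu (n + 1)} (hP : 0 < P (Fin.last n)) (h1 : ‖P‖ = 1) :
    stereoH P ∈ (hyperbolic n).carrier := by
  have h2 := norm_sq_eq_lowerPart P
  rw [h1] at h2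
  refine mem_hyperbolic.2 ⟨?_, by rw [stereoH_last]; positivity⟩
  rw [lowerPart_stereoH, stereoH_last, norm_smul, mul_pow,
    show ‖lowerPart P‖ ^ 2 = 1 - P (Fin.last n) ^ 2 by linarith, norm_inv, Real.norm_of_nonneg hP.le]
  field_simp

theorem isConformal_hyperbolic : IsConformal (hyperbolic n) stereoH stereoH
    {P | 0 < P (Fin.last n)} (fun y => (y (Fin.last n))⁻¹) where
  isOpen := isOpen_lt continuous_const contDiff_apply_last.continuous
  norm_eq x hx := norm_stereoH hx
  mem x hx := by
    have := (mem_hyperbolic.1 hx).2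
    rw [mem_ofPred_eq, stereoH_last]
    positivity
  smooth x hx := contDiffAt_stereoH (mem_hyperbolic.1 hx).2.ne'
  inv_mem P hP h1 := stereoH_mem hP h1
  inv_smooth P hP _ := contDiffAt_stereoH (ne_of_gt hP)
  left_inv x hx := stereoH_stereoH (mem_hyperbolic.1 hx).2.ne'
  right_inv P hP _ := stereoH_stereoH (ne_of_gt hP)
  factor x hx y hy := by
    obtain ⟨h1, h2⟩ := mem_hyperbolic.1 hx
    obtain ⟨h3, h4⟩ := mem_hyperbolic.1 hy
    have h5 : (hyperbolic n).form (x - y) (x - y) = mink (x - y) (x - y) := rfl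
    rw [norm_sub_sq_real, norm_stereoH hx, norm_stereoH hy, inner_eq_lowerPart, h5,
      mink_eq_lowerPart, lowerPart_stereoH, lowerPart_stereoH, stereoH_last, stereoH_last,
      real_inner_smul_left, real_inner_smul_right, lowerPart_sub, real_inner_self_eq_norm_sq,
      norm_sub_sq_real, h1, h3, PiLp.sub_apply]
    field_simp
    ring
  factor_pos x hx := inv_pos.2 (mem_hyperbolic.1 hx).2
  factor_continuousOn := contDiff_apply_last.continuous.continuousOn.inv₀ fun x hx =>
    (mem_hyperbolic.1 hx).2.ne'
  factor_bounded := ⟨1, fun x hx => inv_le_one_of_one_le₀ (one_le_last hx)⟩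

end Geometries

/-! ### The three potentials: Hessians and positivity. -/

section Potentials

variable {n : ℕ}

theorem hasFDerivAt_potentialS (ξ p : Eu (n + 1)) :
    HasFDerivAt (potentialS ξ) (-innerSL ℝ ξ) p := by
  have h := ((innerSL ℝ ξ).hasFDerivAt (x := p)).const_sub 1
  refine h.congr_of_eventuallyEq (Eventually.of_forall fun x => ?_)
  rw [potentialS, real_inner_comm]; rfl

theorem isPotential_potentialS (ξ : Eu (n + 1)) :
    IsPotential (sphere n) (innerSL ℝ) 1 (potentialS ξ) 1 := by
  have hf : fderiv ℝ (potentialS ξ) = fun _ => -innerSL ℝ ξ :=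
    funext fun p => (hasFDerivAt_potentialS ξ p).fderiv
  refine ⟨?_, 0, fun p u v => ?_, fun p hp => ?_⟩
  · exact contDiff_const.sub (contDiff_id.inner ℝ contDiff_const)
  · rw [hf]; simp
  · rw [hf, one_smul, potentialS, real_inner_comm]
    simp

theorem hasFDerivAt_potentialR (ξ : Eu (n + 1)) (p : Eu n) : HasFDerivAt (potentialR ξ)
    (innerSL ℝ (p - (1 - ξ (Fin.last n))⁻¹ • lowerPart ξ)) p := by
  set θ := (1 - ξ (Fin.last n))⁻¹ • lowerPart ξ with hθ
  have h1 := (hasStrictFDerivAt_norm_sq p).hasFDerivAt.const_mul (1 / 2)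
  have h2 := ((h1.sub ((innerSL ℝ θ).hasFDerivAt (x := p))).add_const
    ((1 / 2) * ((1 + ξ (Fin.last n)) / (1 - ξ (Fin.last n)))))
  refine (h2.congr_of_eventuallyEq (Eventually.of_forall fun x => ?_)).congr_fderiv ?_
  · rw [potentialR, ← hθ, real_inner_comm]
    simp only [Pi.sub_apply, innerSL_apply_apply]
    ring
  · ext v
    simp

theorem isPotential_potentialR (ξ : Eu (n + 1)) :
    IsPotential (euclid n) (innerSL ℝ) 0 (potentialR ξ) 1 := by
  set θ := (1 - ξ (Fin.last n))⁻¹ • lowerPart ξ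
  have hf : fderiv ℝ (potentialR ξ) = fun p => innerSL ℝ (p - θ) :=
    funext fun p => (hasFDerivAt_potentialR ξ p).fderiv
  refine ⟨?_, 1, fun p u v => ?_, fun p hp => ?_⟩
  · exact (((contDiff_norm_sq ℝ).div_const 2).sub (contDiff_id.inner ℝ contDiff_const)).add
      contDiff_const
  · rw [hf]
    have h : HasFDerivAt (fun p : Eu n => (innerSL ℝ : Eu n →L[ℝ] Eu n →L[ℝ] ℝ) (p - θ))
        (innerSL ℝ : Eu n →L[ℝ] Eu n →L[ℝ] ℝ) p :=
      (innerSL ℝ : Eu n →L[ℝ] Eu n →L[ℝ] ℝ).hasFDerivAt.comp p ((hasFDerivAt_id p).sub_const θ)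
    rw [h.fderiv, one_mul]
  · simp

theorem hasFDerivAt_potentialH (ξ p : Eu (n + 1)) :
    HasFDerivAt (potentialH ξ) (-minkL n (pairVec (lowerPart ξ) 1)) p := by
  have h := ((minkL n (pairVec (lowerPart ξ) 1)).hasFDerivAt (x := p)).const_sub (-ξ (Fin.last n))
  refine h.congr_of_eventuallyEq (Eventually.of_forall fun x => ?_)
  rw [potentialH, mink_comm, ← minkL_apply]

theorem isPotential_potentialH (ξ : Eu (n + 1)) :
    IsPotential (hyperbolic n) (minkL n) (-1) (potentialH ξ) (ξ (Fin.last n)) := by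
  have hf : fderiv ℝ (potentialH ξ) = fun _ => -minkL n (pairVec (lowerPart ξ) 1) :=
    funext fun p => (hasFDerivAt_potentialH ξ p).fderiv
  refine ⟨?_, 0, fun p u v => ?_, fun p hp => ?_⟩
  · have : potentialH ξ = fun y => -ξ (Fin.last n) - minkL n (pairVec (lowerPart ξ) 1) y := by
      funext y; rw [potentialH, mink_comm, minkL_apply]
    rw [this]
    fun_prop
  · rw [hf]; simp
  · rw [hf, potentialH, mink_comm, ← minkL_apply]
    simp

variable {N : ℕ} {M : ModelSpace n N} {b : Eu N →L[ℝ] Eu N →L[ℝ] ℝ} {K : ℝ} {V : Eu N → ℝ} {t : ℝ}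

theorem IsPotential.div_const (P : IsPotential M b K V t) (s : ℝ) :
    IsPotential M b K (fun p => V p / s) (t / s) := by
  obtain ⟨hs, t₀, h1, h2⟩ := P
  have hV : ∀ p, fderiv ℝ (fun p => V p / s) p = s⁻¹ • fderiv ℝ V p := fun p => by
    simp_rw [div_eq_inv_mul]
    exact fderiv_const_mul (hs.differentiable (by simp) p) _
  have hf : fderiv ℝ (fun p => V p / s) = fun p => s⁻¹ • fderiv ℝ V p := funext hV
  refine ⟨hs.div_const s, t₀ / s, fun p u v => ?_, fun p hp => ?_⟩
  · rw [hf]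
    have hd : DifferentiableAt ℝ (fderiv ℝ V) p :=
      (hs.fderiv_right (m := ∞) (by simp)).differentiable (by simp) p
    rw [fderiv_fun_const_smul hd]
    simp only [smul_apply, smul_eq_mul, h1]
    ring
  · rw [hV, smul_apply, h2 p hp, smul_eq_mul]
    ring

theorem IsAdapted.div_const {ι : Type*} {Ω : ι → Set (Eu N)} {a : ι → Eu N} {k : ι → ℝ}
    {L : ι → Eu N → ℝ} (A : IsAdapted M Ω a k L V) (hs : ContDiff ℝ ∞ V) (s : ℝ) :
    IsAdapted M Ω a k L (fun p => V p / s) := by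
  intro i j hij hne p hp hL
  have hV : fderiv ℝ (fun p => V p / s) p = s⁻¹ • fderiv ℝ V p := by
    simp_rw [div_eq_inv_mul]
    exact fderiv_const_mul (hs.differentiable (by simp) p) _
  rw [hV, smul_apply, A i j hij hne p hp hL, smul_eq_mul]
  ring

theorem potentialS_pos {ξ : Eu (n + 1)} (hξ : ‖ξ‖ < 1) {p : Eu (n + 1)} (hp : ‖p‖ = 1) :
    0 < potentialS ξ p := by
  have h := real_inner_le_norm p ξ
  rw [hp, one_mul] at h
  rw [potentialS]
  linarith

theorem last_lt_one {ξ : Eu (n + 1)} (hξ : ‖ξ‖ < 1) : ξ (Fin.last n) < 1 :=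
  (le_abs_self _).trans_lt ((PiLp.norm_apply_le ξ (Fin.last n)).trans_lt hξ)

/-- Up to a positive constant and the factor ‖x‖² + 1, this is the spherical potential at the
projected point. -/
theorem potentialR_pos {ξ : Eu (n + 1)} (hξ : ‖ξ‖ < 1) (x : Eu n) : 0 < potentialR ξ x := by
  have h := potentialS_pos hξ (norm_stereoR x)
  have h1 : 0 < 1 - ξ (Fin.last n) := by linarith [last_lt_one hξ]
  have h2 := inner_stereoR ξ x
  rw [potentialS, real_inner_comm] at h
  have h3 : potentialR ξ x * (2 * (1 - ξ (Fin.last n))) =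
      (1 - inner ℝ ξ (stereoR x)) * (‖x‖ ^ 2 + 1) := by
    rw [sub_mul, h2, potentialR, real_inner_smul_right, real_inner_comm]
    field_simp
    ring
  have h4 : 0 < potentialR ξ x * (2 * (1 - ξ (Fin.last n))) := by rw [h3]; positivity
  exact (pos_iff_pos_of_mul_pos h4).2 (by positivity)

/-- This is y_0 times the spherical potential at the projected point. -/
theorem potentialH_pos {ξ : Eu (n + 1)} (hξ : ‖ξ‖ < 1) {y : Eu (n + 1)}
    (hy : y ∈ (hyperbolic n).carrier) : 0 < potentialH ξ y := by
  have h := potentialS_pos hξ (norm_stereoH hy)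
  have h1 := (mem_hyperbolic.1 hy).2
  have h2 : potentialH ξ y = y (Fin.last n) * potentialS ξ (stereoH y) := by
    rw [potentialH, potentialS, mink_eq_lowerPart, inner_eq_lowerPart, lowerPart_stereoH,
      stereoH_last, real_inner_smul_left, lowerPart_pairVec, pairVec_last]
    field_simp
    ring
  rw [h2]
  positivity

end Potentials

/-! ### Voronoi partitions of the model spaces and their potentials. -/

section VoronoiPotentials

variable {n : ℕ} {ι : Type*}

theorem hasBlowUps_sphere (n : ℕ) : HasBlowUps (sphere n) :=
  (isConformal_sphere n).hasBlowUps (isGeometry_sphere n)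

theorem hasBlowUps_euclid (n : ℕ) : HasBlowUps (euclid n) :=
  isConformal_euclid.hasBlowUps (isGeometry_euclid n)

theorem hasBlowUps_hyperbolic (n : ℕ) : HasBlowUps (hyperbolic n) :=
  isConformal_hyperbolic.hasBlowUps (isGeometry_hyperbolic n)

theorem genSphere_sphere_def {c p : Eu (n + 1)} {κ : ℝ} (h : p ∈ genSphere (sphere n) c κ) :
    c + κ • p ∈ (sphere n).tangent p ∧ inner ℝ (c + κ • p) (c + κ • p) = 1 := h.2

theorem IsVoronoiS.norm_sq {Ω : ι → Set (Eu (n + 1))} {c : ι → Eu (n + 1)} {κ : ι → ℝ}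
    (h : IsVoronoiS Ω c κ) {i j : ι} (hij : i ≠ j) (hne : (interface (sphere n) Ω i j).Nonempty) :
    ‖c i - c j‖ ^ 2 - (κ i - κ j) ^ 2 = 1 := by
  obtain ⟨W, -, hW⟩ := h.spherical i j hij hne
  obtain ⟨p, hp⟩ := hne
  exact (mem_genSphere_sphere.1 (hW.subset hp).1).2.2

theorem IsVoronoiS.isVoronoiLike {Ω : ι → Set (Eu (n + 1))} {c : ι → Eu (n + 1)} {κ : ι → ℝ}
    (h : IsVoronoiS Ω c κ) :
    IsVoronoiLike (sphere n) (innerSL ℝ) Ω c κ (fun i p => inner ℝ (c i) p + κ i) where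
  continuousOn i := by fun_prop
  expand i x hx p hp := by
    have hx' : ‖x‖ = 1 := hx
    have hp' : ‖p‖ = 1 := hp
    rw [innerSL_apply_apply, innerSL_apply_apply, real_inner_self_eq_norm_sq, norm_sub_sq_real, inner_sub_left, inner_add_right,
      inner_add_right, real_inner_smul_right, real_inner_smul_right, real_inner_self_eq_norm_sq,
      hx', hp', real_inner_comm x (c i), real_inner_comm p (c i)]
    ring
  subset := h.subset
  lt i x hx j hj := by
    rw [h.voronoi i] at hx
    exact hx.2 j hj
  normal i j hij hne p hp hL := by
    refine genSphere_sphere_def (mem_genSphere_sphere.2 ⟨hp, ?_, h.norm_sq hij hne⟩)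
    rw [inner_sub_left]
    linarith

theorem sphere_isAdapted {Ω : ι → Set (Eu (n + 1))} {c : ι → Eu (n + 1)} {κ : ι → ℝ}
    {ξ : Eu (n + 1)} (hξ : IsFlatVectorS Ω c κ ξ) :
    IsAdapted (sphere n) Ω c κ (fun i p => inner ℝ (c i) p + κ i) (potentialS ξ) := by
  intro i j hij hne p hp hL
  have h1 := hξ.2 i j hij hne
  rw [(hasFDerivAt_potentialS ξ p).fderiv, potentialS, real_inner_comm]
  simp only [neg_apply, innerSL_apply_apply, inner_add_right, real_inner_smul_right]
  rw [real_inner_comm] at h1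
  linarith

theorem IsVoronoiS.exists_isFlatVectorS (hn : 2 ≤ n) {Ω : ι → Set (Eu (n + 1))}
    {c : ι → Eu (n + 1)} {κ : ι → ℝ} (h : IsVoronoiS Ω c κ) (hF : IsMobiusFlatS Ω) :
    ∃ ξ, IsFlatVectorS Ω c κ ξ := by
  obtain ⟨T, hT, hTF⟩ := hF
  obtain ⟨ξ, hξ, H⟩ := hT.exists_flatVector hn
  exact ⟨ξ, hξ, fun i j hij hne => H _ _ _ hne (h.spherical i j hij hne)
    (hTF _ ⟨hne, i, j, hij, rfl⟩)⟩

theorem IsVoronoiS.isFlattening (hn : 2 ≤ n) {Ω : ι → Set (Eu (n + 1))}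
    {c : ι → Eu (n + 1)} {κ : ι → ℝ} (R : IsRegular (sphere n) Ω) (h : IsVoronoiS Ω c κ)
    {ξ : Eu (n + 1)} (hξ : IsFlatVectorS Ω c κ ξ) :
    IsFlattening (sphere n) Ω (potentialS ξ) ∧ IsGood (sphere n) Ω (potentialS ξ) := by
  have hn1 : 1 ≤ n := by omega
  have hV : ∀ p ∈ (sphere n).carrier, 0 < potentialS ξ p := fun p hp => potentialS_pos hξ.1 hp
  have B := hasBlowUps_sphere n
  have G := isGeometry_sphere n
  have P := isPotential_potentialS ξ
  have A := sphere_isAdapted hξ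
  have VL := h.isVoronoiLike
  refine ⟨VL.isFlattening B G P A hn R hV, VL.jacobiSatisfies B G P A hn1 (by ring), ?_⟩
  have := VL.ricciVEq B G P A hn1 hV
  rwa [mul_one] at this

theorem IsVoronoiR.nonempty_interface {Ω : ι → Set (Eu n)} {ΩS : ι → Set (Eu (n + 1))}
    {c : ι → Eu (n + 1)} {κ : ι → ℝ} (h : IsVoronoiR Ω ΩS c κ) {i j : ι}
    (hne : (interface (euclid n) Ω i j).Nonempty) : (interface (sphere n) ΩS i j).Nonempty := by
  obtain ⟨p, hp⟩ := hne
  have key : ∀ i, p ∈ reducedBoundary (euclid n) (Ω i) →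
      stereoR p ∈ reducedBoundary (sphere n) (ΩS i) := fun i hi =>
    (isConformal_euclid.reducedBoundary_iff_image (isGeometry_euclid n) (isGeometry_sphere n)
      (isConformal_sphere n) (fun x _ => by rw [h.pull_back i]; rfl) (mem_univ p)).1 hi
  exact ⟨_, key i hp.1, key j hp.2⟩

/-- The function L i is ⟨c i, ·⟩ + κ i at the projected point, multiplied by the positive factor
(‖x‖² + 1)/2 to make it a quadratic polynomial. Its quadratic coefficient gives the Euclidean
curvature c_0 + κ. -/
theorem IsVoronoiR.isVoronoiLike {Ω : ι → Set (Eu n)} {ΩS : ι → Set (Eu (n + 1))}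
    {c : ι → Eu (n + 1)} {κ : ι → ℝ} (h : IsVoronoiR Ω ΩS c κ) :
    IsVoronoiLike (euclid n) (innerSL ℝ) Ω (fun i => lowerPart (c i))
      (fun i => c i (Fin.last n) + κ i) (fun i x => inner ℝ (lowerPart (c i)) x +
        (c i (Fin.last n) + κ i) * ‖x‖ ^ 2 / 2 + (κ i - c i (Fin.last n)) / 2) where
  continuousOn i := by fun_prop
  expand i x hx p hp := by
    rw [innerSL_apply_apply, innerSL_apply_apply, real_inner_self_eq_norm_sq, norm_sub_sq_real, inner_sub_left, inner_add_right,
      inner_add_right, real_inner_smul_right, real_inner_smul_right, real_inner_self_eq_norm_sq,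
      real_inner_comm x (lowerPart (c i)), real_inner_comm p (lowerPart (c i))]
    ring
  subset i := subset_univ _
  lt i x hx j hj := by
    rw [h.pull_back i, mem_preimage, h.voronoi.voronoi i] at hx
    have h1 := hx.2 j hj
    have h2 : (0 : ℝ) < ‖x‖ ^ 2 + 1 := by positivity
    have h3 := mul_lt_mul_of_pos_right h1 h2
    rw [add_mul, add_mul, inner_stereoR, inner_stereoR] at h3
    linarith
  normal i j hij hne p hp hL := by
    refine ⟨mem_univ _, ?_⟩
    have h1 := h.voronoi.norm_sq hij (h.nonempty_interface hne)
    rw [norm_sq_eq_lowerPart, lowerPart_sub, PiLp.sub_apply] at h1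
    rw [innerSL_apply_apply, real_inner_self_eq_norm_sq, norm_add_sq_real, norm_smul,
      real_inner_smul_right, mul_pow, Real.norm_eq_abs, sq_abs, inner_sub_left]
    linear_combination h1 + 2 * (c i (Fin.last n) + κ i - (c j (Fin.last n) + κ j)) * hL

theorem euclid_isAdapted {Ω : ι → Set (Eu n)} {ΩS : ι → Set (Eu (n + 1))}
    {c : ι → Eu (n + 1)} {κ : ι → ℝ} (h : IsVoronoiR Ω ΩS c κ) {ξ : Eu (n + 1)}
    (hξ : IsFlatVectorS ΩS c κ ξ) :
    IsAdapted (euclid n) Ω (fun i => lowerPart (c i))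
      (fun i => c i (Fin.last n) + κ i) (fun i x => inner ℝ (lowerPart (c i)) x +
        (c i (Fin.last n) + κ i) * ‖x‖ ^ 2 / 2 + (κ i - c i (Fin.last n)) / 2)
      (potentialR ξ) := by
  intro i j hij hne p hp hL
  have h1 := hξ.2 i j hij (h.nonempty_interface hne)
  have h2 : 0 < 1 - ξ (Fin.last n) := by linarith [last_lt_one hξ.1]
  rw [inner_eq_lowerPart, lowerPart_sub, PiLp.sub_apply, inner_sub_left] at h1
  rw [(hasFDerivAt_potentialR ξ p).fderiv, potentialR]
  simp only [innerSL_apply_apply, inner_add_right, inner_sub_left, inner_sub_right,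
    real_inner_smul_right, real_inner_smul_left, real_inner_self_eq_norm_sq]
  rw [real_inner_comm (lowerPart (c i)) p, real_inner_comm (lowerPart (c j)) p,
    real_inner_comm (lowerPart (c i)) (lowerPart ξ), real_inner_comm (lowerPart (c j)) (lowerPart ξ),
    real_inner_comm p (lowerPart ξ)]
  field_simp
  -- After clearing 1 - ξ_0, the claim is a combination of the equation of the sphere at p and of
  -- the concurrency condition for ξ.
  linear_combination 2 * (1 - ξ (Fin.last n)) * hL - 2 * h1

theorem IsVoronoiR.isFlattening (hn : 2 ≤ n) {Ω : ι → Set (Eu n)} {ΩS : ι → Set (Eu (n + 1))}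
    {c : ι → Eu (n + 1)} {κ : ι → ℝ} (R : IsRegular (euclid n) Ω) (h : IsVoronoiR Ω ΩS c κ)
    {ξ : Eu (n + 1)} (hξ : IsFlatVectorS ΩS c κ ξ) :
    IsFlattening (euclid n) Ω (potentialR ξ) ∧ IsGood (euclid n) Ω (potentialR ξ) := by
  have hn1 : 1 ≤ n := by omega
  have hV : ∀ p ∈ (euclid n).carrier, 0 < potentialR ξ p := fun p _ => potentialR_pos hξ.1 p
  have B := hasBlowUps_euclid n
  have G := isGeometry_euclid n
  have P := isPotential_potentialR ξ
  have A := euclid_isAdapted h hξ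
  have VL := h.isVoronoiLike
  refine ⟨VL.isFlattening B G P A hn R hV, VL.jacobiSatisfies B G P A hn1 (by ring), ?_⟩
  have := VL.ricciVEq B G P A hn1 hV
  rwa [mul_one] at this

theorem mem_genSphere_hyperbolic {c p : Eu (n + 1)} {κ : ℝ} :
    p ∈ genSphere (hyperbolic n) c κ ↔
      p ∈ (hyperbolic n).carrier ∧ mink c p - κ = 0 ∧ mink c c + κ ^ 2 = 1 := by
  refine and_congr_right fun hp => ?_
  have hp1 : mink p p = -1 := hp.1
  have e1 : c + κ • p ∈ (hyperbolic n).tangent p ↔ minkL n p (c + κ • p) = 0 := by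
    rw [minkL_apply]; rfl
  have e2 : (hyperbolic n).form (c + κ • p) (c + κ • p) = minkL n (c + κ • p) (c + κ • p) :=
    (minkL_apply _ _).symm
  rw [e1, e2]
  simp only [map_add, map_smul, add_apply, smul_apply, smul_eq_mul, minkL_apply, hp1,
    mink_comm p c]
  constructor
  · rintro ⟨h1, h2⟩
    have : mink c p = κ := by linarith
    rw [this] at h2
    exact ⟨by linarith, by linarith⟩
  · rintro ⟨h1, h2⟩
    have : mink c p = κ := by linarith
    rw [this]
    exact ⟨by linarith, by linarith⟩

theorem mink_sub_left (x y z : Eu (n + 1)) : mink (x - y) z = mink x z - mink y z := by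
  simp only [← minkL_apply, map_sub, sub_apply]

theorem IsVoronoiH.isVoronoiLike {Ω : ι → Set (Eu (n + 1))} {c : ι → Eu (n + 1)} {κ : ι → ℝ}
    (h : IsVoronoiH Ω c κ) :
    IsVoronoiLike (hyperbolic n) (minkL n) Ω c κ (fun i p => mink (c i) p - κ i) where
  continuousOn i := by
    simp only [← minkL_apply]
    fun_prop
  expand i x hx p hp := by
    have hx' : mink x x = -1 := hx.1
    have hp' : mink p p = -1 := hp.1
    simp only [map_add, map_smul, map_sub, sub_apply, smul_eq_mul, minkL_apply, hx', hp', mink_comm x p, mink_comm _ (c i)]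
    ring
  subset := h.subset
  lt i x hx j hj := by
    rw [h.voronoi i] at hx
    exact hx.2 j hj
  normal i j hij hne p hp hL := by
    obtain ⟨W, -, hW⟩ := h.spherical i j hij hne
    obtain ⟨p', hp'⟩ := hne
    have h1 := (mem_genSphere_hyperbolic.1 (hW.subset hp').1).2.2
    have h2 : p ∈ genSphere (hyperbolic n) (c i - c j) (κ i - κ j) :=
      mem_genSphere_hyperbolic.2 ⟨hp, by rw [mink_sub_left]; linarith, h1⟩
    exact ⟨h2.2.1, by rw [minkL_apply]; exact h2.2.2⟩

theorem hyperbolic_isAdapted {Ω : ι → Set (Eu (n + 1))} {c : ι → Eu (n + 1)} {κ : ι → ℝ}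
    {ξ : Eu (n + 1)} (hξ : IsFlatVectorH Ω c κ ξ) :
    IsAdapted (hyperbolic n) Ω c κ (fun i p => mink (c i) p - κ i) (potentialH ξ) := by
  intro i j hij hne p hp hL
  have h1 := hξ.2 i j hij hne
  rw [(hasFDerivAt_potentialH ξ p).fderiv, potentialH, mink_comm p]
  simp only [neg_apply, map_add, map_smul, smul_eq_mul]
  rw [minkL_apply, minkL_apply, mink_comm _ (c i - c j)]
  linarith

/-- Division by y_0 exchanges the roles of last coordinate and curvature, so (c, κ) becomes ((c̲,
-κ), -c_0). Thereby the concurrency condition on the sphere turns into the hyperbolic one. -/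
theorem isRelOpen_image_stereoH {A : Set (Eu (n + 1))} {c : Eu (n + 1)} {κ : ℝ}
    (hA : IsRelOpen A (genSphere (hyperbolic n) c κ)) :
    IsRelOpen (stereoH '' A) (genSphere (sphere n) (pairVec (lowerPart c) (-κ)) (-c (Fin.last n))) := by
  obtain ⟨W, hW, rfl⟩ := hA
  have hc : ContinuousOn (stereoH : Eu (n + 1) → Eu (n + 1)) {P | 0 < P (Fin.last n)} := fun P hP =>
    (contDiffAt_stereoH (ne_of_gt hP)).continuousAt.continuousWithinAt
  have hD : IsOpen {P : Eu (n + 1) | 0 < P (Fin.last n)} := isConformal_hyperbolic.isOpen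
  have key : ∀ y ∈ (hyperbolic n).carrier, y ∈ genSphere (hyperbolic n) c κ ↔
      stereoH y ∈ genSphere (sphere n) (pairVec (lowerPart c) (-κ)) (-c (Fin.last n)) := by
    intro y hy
    have hy0 := (mem_hyperbolic.1 hy).2
    rw [mem_genSphere_hyperbolic, mem_genSphere_sphere, mink_eq_lowerPart, mink_eq_lowerPart,
      inner_eq_lowerPart, norm_sq_eq_lowerPart, real_inner_self_eq_norm_sq, lowerPart_stereoH,
      stereoH_last, lowerPart_pairVec, pairVec_last, real_inner_smul_right]
    have e : (y (Fin.last n))⁻¹ * inner ℝ (lowerPart c) (lowerPart y) + -κ * (y (Fin.last n))⁻¹ +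
        -c (Fin.last n) = (y (Fin.last n))⁻¹ * (inner ℝ (lowerPart c) (lowerPart y) -
          c (Fin.last n) * y (Fin.last n) - κ) := by
      field_simp
      ring
    rw [e]
    constructor
    · rintro ⟨-, h1, h2⟩
      exact ⟨norm_stereoH hy, by rw [h1, mul_zero], by linarith⟩
    · rintro ⟨-, h1, h2⟩
      exact ⟨hy, (mul_eq_zero.1 h1).resolve_left (inv_pos.2 hy0).ne', by linarith⟩
  refine ⟨_, hc.isOpen_inter_preimage hD hW, Subset.antisymm ?_ ?_⟩
  · rintro _ ⟨y, ⟨hy, hyW⟩, rfl⟩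
    have hyM := (mem_genSphere_hyperbolic.1 hy).1
    refine ⟨(key y hyM).1 hy, isConformal_hyperbolic.mem y hyM, ?_⟩
    rw [mem_preimage, stereoH_stereoH (mem_hyperbolic.1 hyM).2.ne']
    exact hyW
  · rintro P ⟨hP, hPD, hPW⟩
    have hPD' : P (Fin.last n) ≠ 0 := ne_of_gt hPD
    have h1 := stereoH_mem hPD (mem_genSphere_sphere.1 hP).1
    refine ⟨stereoH P, ⟨(key _ h1).2 ?_, hPW⟩, stereoH_stereoH hPD'⟩
    rwa [stereoH_stereoH hPD']

theorem IsVoronoiH.exists_isFlatVectorH (hn : 2 ≤ n) {Ω : ι → Set (Eu (n + 1))}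
    {c : ι → Eu (n + 1)} {κ : ι → ℝ} (h : IsVoronoiH Ω c κ) (hF : IsMobiusFlatH Ω) :
    ∃ ξ, IsFlatVectorH Ω c κ ξ := by
  obtain ⟨T, hT, hTF⟩ := hF
  obtain ⟨ξ, hξ, H⟩ := hT.exists_flatVector hn
  refine ⟨ξ, hξ, fun i j hij hne => ?_⟩
  have := H _ _ _ (hne.image _) (isRelOpen_image_stereoH (h.spherical i j hij hne))
    (hTF _ (mem_image_of_mem _ ⟨hne, i, j, hij, rfl⟩))
  rw [inner_eq_lowerPart, lowerPart_pairVec, pairVec_last] at this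
  rw [mink_eq_lowerPart, lowerPart_pairVec, pairVec_last]
  linarith

theorem IsVoronoiH.isFlattening (hn : 2 ≤ n) {Ω : ι → Set (Eu (n + 1))}
    {c : ι → Eu (n + 1)} {κ : ι → ℝ} (R : IsRegular (hyperbolic n) Ω) (h : IsVoronoiH Ω c κ)
    {ξ : Eu (n + 1)} (hξ : IsFlatVectorH Ω c κ ξ) :
    IsFlattening (hyperbolic n) Ω (potentialH ξ) ∧
      JacobiSatisfies (hyperbolic n) Ω (potentialH ξ)
        (fun l => l = ((n : ℝ) - 1) * ξ (Fin.last n)) ∧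
      RicciVEq (hyperbolic n) Ω (potentialH ξ) (((n : ℝ) - 2) * ξ (Fin.last n)) ∧
      (0 < ξ (Fin.last n) →
        IsFlattening (hyperbolic n) Ω (fun y => potentialH ξ y / ξ (Fin.last n)) ∧
        IsGood (hyperbolic n) Ω (fun y => potentialH ξ y / ξ (Fin.last n))) ∧
      (ξ (Fin.last n) ≤ 0 →
        JacobiSatisfies (hyperbolic n) Ω (potentialH ξ) (fun l => l ≤ 0)) := by
  have hn1 : 1 ≤ n := by omega
  have hn' : (1 : ℝ) ≤ n := by exact_mod_cast hn1
  have hV : ∀ p ∈ (hyperbolic n).carrier, 0 < potentialH ξ p := fun p hp => potentialH_pos hξ.1 hp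
  have B := hasBlowUps_hyperbolic n
  have G := isGeometry_hyperbolic n
  have P := isPotential_potentialH ξ
  have A := hyperbolic_isAdapted hξ
  have VL := h.isVoronoiLike
  refine ⟨VL.isFlattening B G P A hn R hV, VL.jacobiSatisfies B G P A hn1 rfl,
    VL.ricciVEq B G P A hn1 hV, fun h0 => ?_,
    fun h0 => VL.jacobiSatisfies B G P A hn1 (mul_nonpos_of_nonneg_of_nonpos (by linarith) h0)⟩
  -- Dividing V by ξ_0 > 0 normalizes the constant t = ξ_0 to one.
  have P' := P.div_const (ξ (Fin.last n))
  rw [div_self h0.ne'] at P'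
  have A' := A.div_const P.smooth (ξ (Fin.last n))
  have hV' : ∀ p ∈ (hyperbolic n).carrier, 0 < potentialH ξ p / ξ (Fin.last n) := fun p hp =>
    div_pos (hV p hp) h0
  refine ⟨VL.isFlattening B G P' A' hn R hV', VL.jacobiSatisfies B G P' A' hn1 (by ring), ?_⟩
  have := VL.ricciVEq B G P' A' hn1 hV'
  rwa [mul_one] at this

theorem IsVoronoiH.exists_isFlattening (hn : 2 ≤ n) {Ω : ι → Set (Eu (n + 1))}
    {c : ι → Eu (n + 1)} {κ : ι → ℝ} (R : IsRegular (hyperbolic n) Ω) (h : IsVoronoiH Ω c κ)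
    (hF : IsMobiusFlatH Ω) : ∃ V, IsFlattening (hyperbolic n) Ω V ∧
      (IsGood (hyperbolic n) Ω V ∨ JacobiSatisfies (hyperbolic n) Ω V (fun l => l ≤ 0)) := by
  obtain ⟨ξ, hξ⟩ := h.exists_isFlatVectorH hn hF
  obtain ⟨h1, -, -, h2, h3⟩ := h.isFlattening hn R hξ
  rcases le_or_gt (ξ (Fin.last n)) 0 with h0 | h0
  · exact ⟨_, h1, Or.inr (h3 h0)⟩
  · exact ⟨_, (h2 h0).1, Or.inl (h2 h0).2⟩

end VoronoiPotentials

/-! ### Simplices and the indices tied for the minimum. -/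

/-- The `c i` are equidistant points on a sphere about the origin. -/
structure IsSimplex {q N : ℕ} (c : Fin q → Eu N) (R d : ℝ) : Prop where
  radius_pos : 0 < R
  side_pos : 0 < d
  norm_eq : ∀ i, ‖c i‖ = R
  dist_eq : ∀ i j, i ≠ j → dist (c i) (c j) = d

open Classical in
/-- The indices for which `⟨P, c i⟩` is minimal. -/
def minSet {q N : ℕ} (c : Fin q → Eu N) (P : Eu N) : Finset (Fin q) :=
  Finset.univ.filter fun i => ∀ j, inner ℝ P (c i) ≤ inner ℝ P (c j)

/-- The cells of `M` on which `⟨τ x, c i⟩` is the smallest. -/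
def cell {n N q N' : ℕ} (M : ModelSpace n N) (τ : Eu N → Eu N') (c : Fin q → Eu N') (i : Fin q) :
    Set (Eu N) :=
  {x ∈ M.carrier | ∀ j, j ≠ i → inner ℝ (τ x) (c i) < inner ℝ (τ x) (c j)}

section MinSet

variable {q N : ℕ} {c : Fin q → Eu N} {P Q : Eu N}

theorem mem_minSet {i : Fin q} : i ∈ minSet c P ↔ ∀ j, inner ℝ P (c i) ≤ inner ℝ P (c j) := by
  simp [minSet]

theorem minSet_nonempty [NeZero q] (c : Fin q → Eu N) (P : Eu N) : (minSet c P).Nonempty := by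
  obtain ⟨i, -, hi⟩ := Finset.exists_min_image Finset.univ (fun i => inner ℝ P (c i))
    ⟨0, Finset.mem_univ _⟩
  exact ⟨i, mem_minSet.2 fun j => hi j (Finset.mem_univ j)⟩

theorem inner_eq_of_mem_minSet {i j : Fin q} (hi : i ∈ minSet c P) (hj : j ∈ minSet c P) :
    inner ℝ P (c i) = inner ℝ P (c j) :=
  le_antisymm (mem_minSet.1 hi j) (mem_minSet.1 hj i)

theorem inner_lt_of_notMem_minSet {i j : Fin q} (hi : i ∈ minSet c P) (hj : j ∉ minSet c P) :
    inner ℝ P (c i) < inner ℝ P (c j) := by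
  rw [mem_minSet] at hj
  push Not at hj
  obtain ⟨k, hk⟩ := hj
  exact (mem_minSet.1 hi k).trans_lt hk

theorem minSet_eq_singleton {i : Fin q} :
    minSet c P = {i} ↔ ∀ j, j ≠ i → inner ℝ P (c i) < inner ℝ P (c j) := by
  constructor
  · intro h j hj
    exact inner_lt_of_notMem_minSet (h ▸ Finset.mem_singleton_self i) (by rw [h]; simpa using hj)
  · intro h
    ext j
    rw [Finset.mem_singleton]
    constructor
    · intro hj
      by_contra hji
      exact absurd (mem_minSet.1 hj i) (not_le.2 (h j hji))
    · rintro rfl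
      refine mem_minSet.2 fun k => ?_
      by_cases hk : k = j
      · rw [hk]
      · exact (h k hk).le

theorem minSet_smul {a : ℝ} (ha : 0 < a) (P : Eu N) : minSet c (a • P) = minSet c P := by
  ext i
  simp only [mem_minSet, real_inner_smul_left]
  exact forall_congr' fun j => mul_le_mul_iff_of_pos_left ha

theorem minSet_sphChart {F : Type*} [NormedAddCommGroup F] [NormedSpace ℝ F] (P : Eu N)
    (Λ : F →L[ℝ] Eu N) (x : F) : minSet c (sphChart P Λ x) = minSet c (P + Λ x) :=
  minSet_smul (sphFactor_pos Λ x) _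

/-- The strict inequalities against indices that are not minimal at P persist nearby, so indices can
only drop out. -/
theorem eventually_minSet_subset [NeZero q] (c : Fin q → Eu N) (P : Eu N) :
    ∀ᶠ Q in 𝓝 P, minSet c Q ⊆ minSet c P := by
  obtain ⟨i, hi⟩ := minSet_nonempty c P
  have h : ∀ j, ∀ᶠ Q in 𝓝 P, j ∉ minSet c P → inner ℝ Q (c i) < inner ℝ Q (c j) := by
    intro j
    by_cases hj : j ∈ minSet c P
    · simp [hj]
    · have h1 : Continuous fun Q : Eu N => inner ℝ Q (c i) := by fun_prop
      have h2 : Continuous fun Q : Eu N => inner ℝ Q (c j) := by fun_prop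
      exact (h1.continuousAt.eventually_lt h2.continuousAt
        (inner_lt_of_notMem_minSet hi hj)).mono fun Q hQ _ => hQ
  filter_upwards [eventually_all.2 h] with Q hQ j hj
  by_contra hjP
  exact absurd (mem_minSet.1 hj i) (not_le.2 (hQ j hjP))

/-- Near P only the indices that are minimal at P compete. -/
theorem mem_minSet_iff_of_subset [NeZero q] (h : minSet c Q ⊆ minSet c P) {i : Fin q} :
    i ∈ minSet c Q ↔ i ∈ minSet c P ∧ ∀ j ∈ minSet c P, inner ℝ Q (c i) ≤ inner ℝ Q (c j) := by
  refine ⟨fun hi => ⟨h hi, fun j _ => mem_minSet.1 hi j⟩, fun ⟨_, hi⟩ => mem_minSet.2 fun j => ?_⟩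
  obtain ⟨k, hk⟩ := minSet_nonempty c Q
  exact (hi k (h hk)).trans (mem_minSet.1 hk j)

theorem inner_add_le_iff {v : Eu N} {i j : Fin q} (hi : i ∈ minSet c P) (hj : j ∈ minSet c P) :
    inner ℝ (P + v) (c i) ≤ inner ℝ (P + v) (c j) ↔ inner ℝ v (c i) ≤ inner ℝ v (c j) := by
  rw [inner_add_left, inner_add_left, inner_eq_of_mem_minSet hi hj, add_le_add_iff_left]

end MinSet

namespace IsSimplex

variable {q N : ℕ} {c : Fin q → Eu N} {R d : ℝ} (C : IsSimplex c R d)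
include C

theorem inner_self (i : Fin q) : inner ℝ (c i) (c i) = R ^ 2 := by
  rw [real_inner_self_eq_norm_sq, C.norm_eq]

theorem inner_ne {i j : Fin q} (h : i ≠ j) : inner ℝ (c i) (c j) = R ^ 2 - d ^ 2 / 2 := by
  have h1 := C.dist_eq i j h
  rw [dist_eq_norm] at h1
  have h2 := norm_sub_sq_real (c i) (c j)
  rw [h1, C.norm_eq, C.norm_eq] at h2
  linarith

theorem norm_sub {i j : Fin q} (h : i ≠ j) : ‖c i - c j‖ = d := by
  rw [← dist_eq_norm, C.dist_eq i j h]

/-- The Gram matrix of a simplex is a multiple of the all-ones matrix plus (d²/2) times the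
identity, and the first part is killed by coefficients of sum zero. -/
theorem inner_sum {t : Fin q → ℝ} (ht : ∑ k, t k = 0) (i : Fin q) :
    inner ℝ (∑ k, t k • c k) (c i) = t i * (d ^ 2 / 2) := by
  rw [sum_inner]
  have h : ∀ k, inner ℝ (t k • c k) (c i) =
      t k * (R ^ 2 - d ^ 2 / 2) + if k = i then t k * (d ^ 2 / 2) else 0 := by
    intro k
    rw [real_inner_smul_left]
    split_ifs with hk
    · rw [hk, C.inner_self]; ring
    · rw [C.inner_ne hk]; ring
  simp_rw [h]
  rw [Finset.sum_add_distrib, ← Finset.sum_mul, ht, zero_mul, zero_add,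
    Finset.sum_ite_eq' Finset.univ i, if_pos (Finset.mem_univ i)]

omit C in
theorem inner_sum_eq_zero {P : Eu N} {t : Fin q → ℝ} (ht : ∑ k, t k = 0)
    (hs : ∀ k, k ∉ minSet c P → t k = 0) : inner ℝ P (∑ k, t k • c k) = 0 := by
  rw [_root_.inner_sum]
  by_cases hne : (minSet c P).Nonempty
  · obtain ⟨i, hi⟩ := hne
    have h : ∀ k, inner ℝ P (t k • c k) = t k * inner ℝ P (c i) := by
      intro k
      rw [real_inner_smul_right]
      by_cases hk : k ∈ minSet c P
      · rw [inner_eq_of_mem_minSet hk hi]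
      · rw [hs k hk, zero_mul, zero_mul]
    simp_rw [h]
    rw [← Finset.sum_mul, ht, zero_mul]
  · rw [Finset.not_nonempty_iff_eq_empty] at hne
    refine Finset.sum_eq_zero fun k _ => ?_
    rw [hs k (by rw [hne]; simp), zero_smul, inner_zero_right]

/-- A tangential direction along which the indices of `I` become the minimal ones. -/
theorem exists_direction {P : Eu N} {I : Finset (Fin q)} (hI : I.Nonempty) (hIJ : I ⊆ minSet c P) :
    ∃ w, inner ℝ P w = 0 ∧ ∀ i ∈ I, ∀ j ∈ minSet c P,
      (j ∈ I → inner ℝ w (c i) = inner ℝ w (c j)) ∧ (j ∉ I → inner ℝ w (c i) < inner ℝ w (c j)) := by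
  classical
  have hJ : 0 < ((minSet c P).card : ℝ) := by exact_mod_cast (hI.mono hIJ).card_pos
  -- The coefficients are 0 on I and 1 on the other tied indices, lowered by their mean a so that
  -- the sum vanishes. That makes the direction tangential and the differences computable.
  set a : ℝ := (∑ k ∈ minSet c P, if k ∈ I then (0 : ℝ) else 1) / (minSet c P).card with ha
  set t : Fin q → ℝ := fun k => if k ∈ minSet c P then (if k ∈ I then 0 else 1) - a else 0 with ht
  have hsum : ∑ k, t k = 0 := by
    simp only [ht]
    rw [Finset.sum_ite_mem, Finset.univ_inter, Finset.sum_sub_distrib, Finset.sum_const,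
      nsmul_eq_mul, ha]
    field_simp
    ring
  have hd : 0 < d ^ 2 / 2 := by have := C.side_pos; positivity
  refine ⟨∑ k, t k • c k, inner_sum_eq_zero hsum fun k hk => by simp [ht, hk], fun i hi j hj => ?_⟩
  rw [C.inner_sum hsum, C.inner_sum hsum]
  have hti : t i = 0 - a := by simp [ht, hIJ hi, hi]
  constructor
  · intro hjI
    have htj : t j = 0 - a := by simp [ht, hj, hjI]
    rw [hti, htj]
  · intro hjI
    have htj : t j = 1 - a := by simp [ht, hj, hjI]
    rw [hti, htj]
    nlinarith

end IsSimplex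

/-! ### Topology and reduced boundaries of the cells. -/

section Cells

variable {n N q : ℕ} {M : ModelSpace n N} {b : Eu N →L[ℝ] Eu N →L[ℝ] ℝ} {K : ℝ}
  {τ : Eu N → Eu (n + 1)} {θ : Eu (n + 1) → Eu N} {D : Set (Eu (n + 1))} {ρ : Eu N → ℝ}
  {c : Fin q → Eu (n + 1)} {R d : ℝ}

theorem mem_cell {i : Fin q} {x : Eu N} :
    x ∈ cell M τ c i ↔ x ∈ M.carrier ∧ minSet c (τ x) = {i} := by
  rw [minSet_eq_singleton]; rfl

namespace IsConformal

variable (T : IsConformal M τ θ D ρ)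
include T

theorem exists_isOpen_inter_eq (i : Fin q) : ∃ W, IsOpen W ∧ cell M τ c i = M.carrier ∩ W := by
  have h : IsOpen {P : Eu (n + 1) | ∀ j, j ≠ i → inner ℝ P (c i) < inner ℝ P (c j)} := by
    simp only [ofPred_forall]
    refine isOpen_iInter_of_finite fun j => isOpen_iInter_of_finite fun _ => ?_
    exact isOpen_lt (by fun_prop) (by fun_prop)
  obtain ⟨W, hW, hWM⟩ := (continuousOn_iff'.1 T.continuousOn) _ h
  refine ⟨W, hW, ?_⟩
  rw [inter_comm, ← hWM, inter_comm]
  rfl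

variable [NeZero q]

theorem eventually_minSet_subset (c : Fin q → Eu (n + 1)) {p : Eu N} (hp : p ∈ M.carrier) :
    ∀ᶠ y in 𝓝[M.carrier] p, minSet c (τ y) ⊆ minSet c (τ p) :=
  (T.continuousOn p hp).eventually (Bubble.eventually_minSet_subset c (τ p))

/-- Every nonempty subset of the indices tied at p is the exact tie set of points arbitrarily near
p, reached along the central projection of a ray in the direction from `IsSimplex.exists_direction`.
-/
theorem exists_minSet_eq (C : IsSimplex c R d) {p : Eu N} (hp : p ∈ M.carrier)
    {I : Finset (Fin q)} (hI : I.Nonempty) (hIJ : I ⊆ minSet c (τ p)) {W : Set (Eu N)}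
    (hW : W ∈ 𝓝 p) : ∃ y ∈ M.carrier ∩ W, minSet c (τ y) = I := by
  obtain ⟨w, hw, hwI⟩ := C.exists_direction hI hIJ
  set Λ : ℝ →L[ℝ] Eu (n + 1) := ContinuousLinearMap.toSpanSingleton ℝ w with hΛ
  have hP := T.norm_eq p hp
  have hΛP : ∀ s, inner ℝ (τ p) (Λ s) = 0 := fun s => by
    rw [hΛ, ContinuousLinearMap.toSpanSingleton_apply, real_inner_smul_right, hw, mul_zero]
  have hD := T.eventually_mem (T.mem p hp) Λ
  have hsc : ContinuousAt (sphChart (τ p) Λ) 0 := (contDiff_sphChart _ _).continuous.continuousAt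
  have hc : ContinuousAt (fun s => θ (sphChart (τ p) Λ s)) 0 :=
    (T.contDiffAt_chart hP hΛP hD.self_of_nhds).continuousAt
  have hW' : ∀ᶠ s in 𝓝 (0 : ℝ), θ (sphChart (τ p) Λ s) ∈ W := by
    refine hc.eventually_mem ?_
    simp only [sphChart_zero, T.left_inv p hp]
    exact hW
  have hsub : ∀ᶠ s in 𝓝 (0 : ℝ), minSet c (sphChart (τ p) Λ s) ⊆ minSet c (τ p) := by
    refine hsc.eventually (p := fun Q => minSet c Q ⊆ minSet c (τ p)) ?_
    rw [sphChart_zero]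
    exact Bubble.eventually_minSet_subset c (τ p)
  have hall : ∀ᶠ s in 𝓝[>] (0 : ℝ), _ := nhdsWithin_le_nhds ((hD.and hW').and hsub)
  obtain ⟨s, ⟨⟨hsD, hsW⟩, hs⟩, hs0⟩ := (hall.and self_mem_nhdsWithin).exists
  have hs0' : 0 < s := hs0
  refine ⟨_, ⟨T.inv_mem _ hsD (norm_sphChart hP hΛP s), hsW⟩, ?_⟩
  rw [T.right_inv _ hsD (norm_sphChart hP hΛP s)]
  ext i
  rw [mem_minSet_iff_of_subset hs]
  have hΛs : Λ s = s • w := rfl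
  have key : ∀ i ∈ minSet c (τ p), ∀ j ∈ minSet c (τ p),
      (inner ℝ (sphChart (τ p) Λ s) (c i) ≤ inner ℝ (sphChart (τ p) Λ s) (c j) ↔
        inner ℝ w (c i) ≤ inner ℝ w (c j)) := by
    intro i hi j hj
    rw [sphChart, real_inner_smul_left, real_inner_smul_left,
      mul_le_mul_iff_of_pos_left (sphFactor_pos Λ s), inner_add_le_iff hi hj, hΛs,
      real_inner_smul_left, real_inner_smul_left, mul_le_mul_iff_of_pos_left hs0']
  constructor
  · rintro ⟨hi, h⟩
    by_contra hiI
    obtain ⟨k, hk⟩ := hI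
    exact absurd ((key i hi k (hIJ hk)).1 (h k (hIJ hk))) (not_le.2 ((hwI k hk i hi).2 hiI))
  · intro hi
    refine ⟨hIJ hi, fun j hj => (key i (hIJ hi) j hj).2 ?_⟩
    by_cases hjI : j ∈ I
    · exact ((hwI i hi j hj).1 hjI).le
    · exact ((hwI i hi j hj).2 hjI).le

theorem mem_closure_cell_iff (G : IsGeometry M b K) (C : IsSimplex c R d) {i : Fin q} {p : Eu N} :
    p ∈ closure (cell M τ c i) ↔ p ∈ M.carrier ∧ i ∈ minSet c (τ p) := by
  constructor
  · intro h
    have hp : p ∈ M.carrier := G.isClosed.closure_subset_iff.2 (fun x hx => hx.1) h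
    refine ⟨hp, ?_⟩
    have h1 := mem_closure_iff_nhdsWithin_neBot.1 h
    have h2 : ∀ᶠ y in 𝓝[cell M τ c i] p, minSet c (τ y) ⊆ minSet c (τ p) :=
      nhdsWithin_mono p (fun x hx => (mem_cell.1 hx).1) (T.eventually_minSet_subset c hp)
    obtain ⟨y, hy, hyc⟩ := (h2.and self_mem_nhdsWithin).exists
    refine hy ?_
    rw [(mem_cell.1 hyc).2]
    exact Finset.mem_singleton_self i
  · rintro ⟨hp, hi⟩
    rw [mem_closure_iff_nhds]
    intro W hW
    obtain ⟨y, ⟨hy, hyW⟩, hyi⟩ := T.exists_minSet_eq C hp (Finset.singleton_nonempty i)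
      (Finset.singleton_subset_iff.2 hi) hW
    exact ⟨y, hyW, mem_cell.2 ⟨hy, hyi⟩⟩

theorem mem_bdry_cell_iff (G : IsGeometry M b K) (C : IsSimplex c R d) {i : Fin q} {p : Eu N} :
    p ∈ bdry M (cell M τ c i) ↔ p ∈ M.carrier ∧ i ∈ minSet c (τ p) ∧ minSet c (τ p) ≠ {i} := by
  rw [bdry, mem_inter_iff, T.mem_closure_cell_iff G C, and_assoc]
  refine and_congr_right fun hp => and_congr_right fun hi => ?_
  constructor
  · intro h heq
    have h1 := mem_closure_iff_nhdsWithin_neBot.1 h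
    have h2 : ∀ᶠ y in 𝓝[M.carrier \ cell M τ c i] p, minSet c (τ y) ⊆ minSet c (τ p) :=
      nhdsWithin_mono p (sdiff_subset (s := M.carrier) (t := cell M τ c i))
      (T.eventually_minSet_subset c hp)
    obtain ⟨y, hy, hyc⟩ := (h2.and self_mem_nhdsWithin).exists
    refine hyc.2 (mem_cell.2 ⟨hyc.1, ?_⟩)
    rw [heq, Finset.subset_singleton_iff] at hy
    exact hy.resolve_left (minSet_nonempty c _).ne_empty
  · intro h
    exact subset_closure ⟨hp, fun hpc => h (mem_cell.1 hpc).2⟩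

theorem mem_sigma_cell_iff (G : IsGeometry M b K) (C : IsSimplex c R d) {p : Eu N} :
    p ∈ sigma M (cell M τ c) ↔ p ∈ M.carrier ∧ 2 ≤ (minSet c (τ p)).card := by
  simp only [sigma, mem_iUnion, T.mem_bdry_cell_iff G C]
  constructor
  · rintro ⟨i, hp, hi, hne⟩
    refine ⟨hp, ?_⟩
    by_contra hcard
    have h1 : (minSet c (τ p)).card = 1 := by
      have := Finset.card_pos.2 ⟨i, hi⟩
      omega
    obtain ⟨k, hk⟩ := Finset.card_eq_one.1 h1
    rw [hk, Finset.mem_singleton] at hi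
    exact hne (by rw [hk, hi])
  · rintro ⟨hp, hcard⟩
    obtain ⟨i, hi⟩ := minSet_nonempty c (τ p)
    refine ⟨i, hp, hi, fun h => ?_⟩
    rw [h, Finset.card_singleton] at hcard
    omega

/-- In the central projection the cell is near the origin the cone on which all ⟨x, e j⟩ < 0, for
tied j ≠ i. With a single such j it is a half-space. With two, both distinct e j would have to be
the normal, and with none the cell is a full neighbourhood. -/
theorem mem_reducedBoundary_cell_iff (G : IsGeometry M b K) (C : IsSimplex c R d) {i : Fin q}
    {p : Eu N} : p ∈ reducedBoundary M (cell M τ c i) ↔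
      p ∈ M.carrier ∧ i ∈ minSet c (τ p) ∧ (minSet c (τ p)).card = 2 := by
  by_cases hp : p ∈ M.carrier
  swap
  · exact ⟨fun ⟨ν, h⟩ => absurd h.1 hp, fun h => absurd h.1 hp⟩
  obtain ⟨Λ, hΛ, hΛs⟩ := exists_isometry_orth (T.norm_eq p hp)
  set Λ' := Λ.toContinuousLinearMap with hΛ'
  rw [T.mem_reducedBoundary_iff G hp hΛ hΛs (U' := {Q | minSet c Q = {i}}) (fun x hx => by
    rw [mem_cell]; exact and_iff_right hx)]
  set A : Set (Eu n) := sphChart (τ p) Λ' ⁻¹' {Q | minSet c Q = {i}} with hA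
  have hAmem : ∀ x, x ∈ A ↔ minSet c (τ p + Λ x) = {i} := fun x => by
    rw [hA, mem_preimage, mem_ofPred_eq, minSet_sphChart]; rfl
  have hsub : ∀ᶠ x in 𝓝 (0 : Eu n), minSet c (τ p + Λ x) ⊆ minSet c (τ p) := by
    have h1 : ContinuousAt (fun x : Eu n => τ p + Λ x) 0 :=
      (continuous_const.add Λ.continuous).continuousAt
    refine h1.eventually (p := fun Q => minSet c Q ⊆ minSet c (τ p)) ?_
    simp only [map_zero, add_zero]
    exact Bubble.eventually_minSet_subset c (τ p)
  have hd := C.side_pos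
  set e : Fin q → Eu n := fun j => d⁻¹ • (ContinuousLinearMap.adjoint Λ') (c i - c j) with he
  have hin : ∀ j x, inner ℝ x (e j) = d⁻¹ * (inner ℝ (Λ x) (c i) - inner ℝ (Λ x) (c j)) := by
    intro j x
    rw [he, real_inner_smul_right, ContinuousLinearMap.adjoint_inner_right, inner_sub_right]
    rfl
  have hlift : ∀ j ∈ minSet c (τ p), i ∈ minSet c (τ p) → Λ (e j) = d⁻¹ • (c i - c j) := by
    intro j hj hi
    have h1 : inner ℝ (τ p) (c i - c j) = 0 := by
      rw [inner_sub_right, inner_eq_of_mem_minSet hi hj, sub_self]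
    obtain ⟨v, hv⟩ := hΛs _ h1
    have h2 : (ContinuousLinearMap.adjoint Λ') (c i - c j) = v := by
      refine ext_inner_left ℝ fun x => ?_
      rw [ContinuousLinearMap.adjoint_inner_right, ← hv]
      exact Λ.inner_map_map x v
    simp only [he]
    rw [h2, map_smul, hv]
  have hnorm : ∀ j ∈ minSet c (τ p), i ∈ minSet c (τ p) → j ≠ i → ‖e j‖ = 1 := by
    intro j hj hi hji
    rw [← Λ.norm_map, hlift j hj hi, norm_smul, C.norm_sub hji.symm, norm_inv,
      Real.norm_of_nonneg hd.le, inv_mul_cancel₀ hd.ne']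
  have hneg : ∀ j ∈ minSet c (τ p), i ∈ minSet c (τ p) → j ≠ i → ∀ x ∈ A, inner ℝ x (e j) < 0 := by
    intro j hj hi hji x hx
    have h1 := minSet_eq_singleton.1 ((hAmem x).1 hx) j hji
    rw [inner_add_left, inner_add_left, inner_eq_of_mem_minSet hi hj, add_lt_add_iff_left] at h1
    rw [hin]
    have := inv_pos.2 hd
    nlinarith
  refine (⟨?_, ?_⟩ : _ ↔ _).trans (and_iff_right hp).symm
  · rintro ⟨e', he', hH⟩
    have hi : i ∈ minSet c (τ p) := by
      by_contra hi
      refine hH.not_eventually_notMem he' ?_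
      filter_upwards [hsub] with x hx hxA
      rw [hAmem] at hxA
      rw [hxA] at hx
      exact hi (hx (Finset.mem_singleton_self i))
    refine ⟨hi, ?_⟩
    have hne : minSet c (τ p) ≠ {i} := by
      intro heq
      -- If i alone is minimal, the complement of A is empty near the origin. Yet it inherits the
      -- opposite half-space density.
      have hH' : HalfDens Aᶜ (-e') := by
        refine Tendsto.congr (fun r => ?_) hH
        congr 2
        ext x
        simp only [mem_compl_iff, not_not, inner_neg_right, Left.neg_pos_iff, Left.neg_neg_iff,
          mem_ofPred_eq]
        tauto
      refine hH'.not_eventually_notMem (by rwa [norm_neg]) ?_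
      filter_upwards [hsub] with x hx
      rw [mem_compl_iff, not_not, hAmem]
      rw [heq, Finset.subset_singleton_iff] at hx
      exact hx.resolve_left (minSet_nonempty c _).ne_empty
    have huniq : ∀ j ∈ minSet c (τ p), j ≠ i → e' = e j := fun j hj hji =>
      hH.eq_of_subset he' (hnorm j hj hi hji) fun ε hε => Eventually.of_forall fun x hx =>
        (hneg j hj hi hji x hx).le.trans (by positivity)
    obtain ⟨j, hj, hji⟩ : ∃ j ∈ minSet c (τ p), j ≠ i := by
      by_contra hcon
      push Not at hcon
      exact hne (Finset.eq_singleton_iff_unique_mem.2 ⟨hi, hcon⟩)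
    have hpair : minSet c (τ p) = {i, j} := by
      ext k
      rw [Finset.mem_insert, Finset.mem_singleton]
      refine ⟨fun hk => ?_, ?_⟩
      · by_contra hcon
        push Not at hcon
        have h1 : e j = e k := (huniq j hj hji).symm.trans (huniq k hk hcon.1)
        have h2 := congrArg Λ h1
        rw [hlift j hj hi, hlift k hk hi] at h2
        have h3 : c j = c k := by
          have := smul_right_injective _ (inv_ne_zero hd.ne') h2
          simpa using this
        have h4 := C.dist_eq k j hcon.2
        rw [h3, dist_self] at h4
        exact hd.ne h4
      · rintro (rfl | rfl) <;> assumption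
    rw [hpair, Finset.card_pair hji.symm]
  · rintro ⟨hi, hcard⟩
    obtain ⟨j, hji, hpair⟩ : ∃ j, j ≠ i ∧ minSet c (τ p) = {i, j} := by
      obtain ⟨k, l, hkl, hkl'⟩ := Finset.card_eq_two.1 hcard
      rw [hkl', Finset.mem_insert, Finset.mem_singleton] at hi
      rcases hi with rfl | rfl
      · exact ⟨l, hkl.symm, hkl'⟩
      · exact ⟨k, hkl, by rw [hkl', Finset.pair_comm]⟩
    have hj : j ∈ minSet c (τ p) := by rw [hpair]; simp
    refine ⟨e j, hnorm j hj hi hji, ?_⟩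
    have hiff : ∀ᶠ x in 𝓝 (0 : Eu n), x ∈ {x : Eu n | inner ℝ x (e j) < 0} ↔ x ∈ A := by
      filter_upwards [hsub] with x hx
      refine ⟨fun hlt => ?_, hneg j hj hi hji x⟩
      replace hlt : inner ℝ x (e j) < 0 := hlt
      rw [hin] at hlt
      have h1 : inner ℝ (Λ x) (c i) < inner ℝ (Λ x) (c j) := by
        by_contra hcon
        have := mul_nonneg (inv_pos.2 hd).le (sub_nonneg.2 (not_lt.1 hcon))
        linarith
      rw [hAmem]
      ext k
      rw [mem_minSet_iff_of_subset hx, Finset.mem_singleton]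
      constructor
      · rintro ⟨hk, hk'⟩
        by_contra hki
        rw [hpair, Finset.mem_insert, Finset.mem_singleton] at hk
        have hkj := hk.resolve_left hki
        rw [hkj] at hk'
        exact absurd ((inner_add_le_iff hj hi).1 (hk' i hi)) (not_le.2 h1)
      · rintro rfl
        refine ⟨hi, fun l hl => (inner_add_le_iff hi hl).2 ?_⟩
        rw [hpair, Finset.mem_insert, Finset.mem_singleton] at hl
        rcases hl with rfl | rfl
        · exact le_rfl
        · exact h1.le
    refine HalfDens.congr (A := {x : Eu n | inner ℝ x (e j) < 0}) ?_ hiff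
    rw [HalfDens]
    have h0 : ∀ r : ℝ, {x ∈ Metric.ball (0 : Eu n) r |
        (x ∈ {x : Eu n | inner ℝ x (e j) < 0} ∧ 0 < inner ℝ x (e j)) ∨
        (x ∉ {x : Eu n | inner ℝ x (e j) < 0} ∧ inner ℝ x (e j) < 0)} = ∅ := by
      intro r
      ext x
      simp only [mem_ofPred_eq, mem_empty_iff_false, iff_false]
      rintro ⟨-, ⟨h1, h2⟩ | ⟨h1, h2⟩⟩
      · linarith
      · exact h1 h2
    simp only [h0, measure_empty, ENNReal.zero_div]
    exact tendsto_const_nhds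

theorem mem_interface_cell_iff (G : IsGeometry M b K) (C : IsSimplex c R d) {i j : Fin q}
    (hij : i ≠ j) {p : Eu N} : p ∈ interface M (cell M τ c) i j ↔
      p ∈ M.carrier ∧ minSet c (τ p) = {i, j} := by
  rw [interface, mem_inter_iff, T.mem_reducedBoundary_cell_iff G C,
    T.mem_reducedBoundary_cell_iff G C]
  constructor
  · rintro ⟨⟨hp, hi, hcard⟩, -, hj, -⟩
    refine ⟨hp, (Finset.eq_of_subset_of_card_le ?_ ?_).symm⟩
    · intro k hk
      rw [Finset.mem_insert, Finset.mem_singleton] at hk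
      rcases hk with rfl | rfl <;> assumption
    · rw [hcard, Finset.card_pair hij]
  · rintro ⟨hp, h⟩
    rw [h]
    simp [hp, Finset.card_pair hij]

theorem mem_sigmaOne_cell_iff (G : IsGeometry M b K) (C : IsSimplex c R d) {p : Eu N} :
    p ∈ sigmaOne M (cell M τ c) ↔ p ∈ M.carrier ∧ (minSet c (τ p)).card = 2 := by
  constructor
  · rintro ⟨i, j, hij, h⟩
    obtain ⟨hp, h⟩ := (T.mem_interface_cell_iff G C hij).1 h
    exact ⟨hp, by rw [h, Finset.card_pair hij]⟩
  · rintro ⟨hp, h⟩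
    obtain ⟨i, j, hij, h⟩ := Finset.card_eq_two.1 h
    exact ⟨i, j, hij, (T.mem_interface_cell_iff G C hij).2 ⟨hp, h⟩⟩

theorem isClosed_le_card (G : IsGeometry M b K) (c : Fin q → Eu (n + 1)) (k : ℕ) :
    IsClosed {p ∈ M.carrier | k ≤ (minSet c (τ p)).card} := by
  refine isClosed_iff_frequently.2 fun p hp => ?_
  have hpM : p ∈ M.carrier := by
    refine G.isClosed.closure_eq ▸ mem_closure_iff_frequently.2 (hp.mono fun y hy => hy.1)
  have h1 : ∀ᶠ y in 𝓝 p, y ∈ M.carrier → minSet c (τ y) ⊆ minSet c (τ p) :=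
    eventually_nhdsWithin_iff.1 (T.eventually_minSet_subset c hpM)
  obtain ⟨y, ⟨hy, hyk⟩, hy'⟩ := (hp.and_eventually h1).exists
  exact ⟨hpM, hyk.trans (Finset.card_le_card (hy' hy))⟩

theorem closure_reducedBoundary_cell (G : IsGeometry M b K) (C : IsSimplex c R d) (i : Fin q) :
    closure (reducedBoundary M (cell M τ c i)) = bdry M (cell M τ c i) := by
  refine Subset.antisymm (closure_minimal (fun p hp => ?_) ?_) fun p hp => ?_
  · obtain ⟨hp, hi, hcard⟩ := (T.mem_reducedBoundary_cell_iff G C).1 hp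
    refine (T.mem_bdry_cell_iff G C).2 ⟨hp, hi, fun h => ?_⟩
    rw [h, Finset.card_singleton] at hcard
    omega
  · exact isClosed_closure.inter isClosed_closure
  · obtain ⟨hpM, hi, hne⟩ := (T.mem_bdry_cell_iff G C).1 hp
    obtain ⟨j, hj, hji⟩ : ∃ j ∈ minSet c (τ p), j ≠ i := by
      by_contra hcon
      push Not at hcon
      exact hne (Finset.eq_singleton_iff_unique_mem.2 ⟨hi, hcon⟩)
    rw [mem_closure_iff_nhds]
    intro W hW
    obtain ⟨y, ⟨hy, hyW⟩, hyi⟩ := T.exists_minSet_eq C hpM (I := {i, j}) (by simp)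
      (by intro k hk; rw [Finset.mem_insert, Finset.mem_singleton] at hk
          rcases hk with rfl | rfl <;> assumption) hW
    refine ⟨y, hyW, (T.mem_reducedBoundary_cell_iff G C).2 ⟨hy, ?_⟩⟩
    rw [hyi]
    exact ⟨by simp, Finset.card_pair hji.symm⟩

end IsConformal

end Cells

/-! ### Measure of the parts of M on linear subspaces. -/

theorem exists_isometry_inf_orth {N' m : ℕ} {L : Submodule ℝ (Eu N')}
    (hL : Module.finrank ℝ L = m + 1) {P : Eu N'} (hPL : P ∈ L) (hP : ‖P‖ = 1) :
    ∃ Λ : Eu m →ₗᵢ[ℝ] Eu N', (∀ v, inner ℝ P (Λ v) = 0 ∧ Λ v ∈ L) ∧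
      ∀ w ∈ L, inner ℝ P w = 0 → ∃ v, Λ v = w := by
  have hP0 : P ≠ 0 := by rintro rfl; simp at hP
  have hle : (ℝ ∙ P) ≤ L := (Submodule.span_singleton_le_iff_mem P L).2 hPL
  obtain ⟨Λ, hΛ⟩ := exists_isometry_range ((ℝ ∙ P)ᗮ ⊓ L)
    (Submodule.finrank_add_inf_finrank_orthogonal' (n := m) hle (by
      rw [finrank_span_singleton hP0, hL, add_comm]))
  refine ⟨Λ, fun v => ?_, fun w hw hPw => ?_⟩
  · have : Λ v ∈ (ℝ ∙ P)ᗮ ⊓ L := by rw [← hΛ]; exact ⟨v, rfl⟩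
    exact ⟨Submodule.mem_orthogonal_singleton_iff_inner_right.1 this.1, this.2⟩
  · have : w ∈ (ℝ ∙ P)ᗮ ⊓ L := ⟨Submodule.mem_orthogonal_singleton_iff_inner_right.2 hPw, hw⟩
    rw [← hΛ] at this
    exact this

section Linear

variable {n N m : ℕ} {M : ModelSpace n N} {b : Eu N →L[ℝ] Eu N →L[ℝ] ℝ} {K : ℝ}
  {τ : Eu N → Eu (n + 1)} {θ : Eu (n + 1) → Eu N} {D : Set (Eu (n + 1))} {ρ : Eu N → ℝ}

/-- The part of `M` that lies on the linear subspace `L` of the ambient space of the sphere. -/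
def linearPart (M : ModelSpace n N) (τ : Eu N → Eu (n + 1)) (L : Submodule ℝ (Eu (n + 1))) :
    Set (Eu N) := {y ∈ M.carrier | τ y ∈ L}

namespace IsConformal

variable (T : IsConformal M τ θ D ρ) (G : IsGeometry M b K)
include T G

/-- If τ p ∈ L, points of the slice near p are covered by one m-dimensional bilipschitz chart, and
the bounds are those of Euclidean balls. Otherwise the slice is empty near p, L being closed. -/
theorem exists_local_bound {L : Submodule ℝ (Eu (n + 1))} (hL : Module.finrank ℝ L = m + 1)
    {p : Eu N} (hp : p ∈ M.carrier) : ∃ ε > (0 : ℝ), ∃ C > (0 : ℝ),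
      (∀ x ∈ M.carrier, ‖τ x - τ p‖ < ε → ∀ r ∈ Ioo 0 ε,
        M.hausdorff m (linearPart M τ L ∩ M.ball x r) ≤ ENNReal.ofReal (C * r ^ m)) ∧
      (∀ k : ℝ, m < k → M.hausdorff k (linearPart M τ L ∩ {y | ‖τ y - τ p‖ < ε}) = 0) ∧
      M.hausdorff m (linearPart M τ L ∩ {y | ‖τ y - τ p‖ < ε}) < ⊤ := by
  obtain ⟨B, hB, hBle⟩ := T.exists_norm_sub_le
  by_cases hpL : τ p ∈ L
  swap
  · obtain ⟨ε, hε, hball⟩ := Metric.isOpen_iff.1 L.closed_of_finiteDimensional.isOpen_compl _ hpL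
    have hempty : linearPart M τ L ∩ {y | ‖τ y - τ p‖ < ε} = ∅ := by
      ext y
      simp only [mem_inter_iff, mem_empty_iff_false, iff_false, not_and]
      intro hy hyε
      exact hball (mem_ball_iff_norm.2 hyε) hy.2
    refine ⟨min (ε / 2) (ε / (2 * B)), by positivity, 1, one_pos, fun x hx hxε r hr => ?_,
      fun k hk => ?_, ?_⟩
    · have h : linearPart M τ L ∩ M.ball x r = ∅ := by
        ext y
        simp only [mem_inter_iff, mem_empty_iff_false, iff_false, not_and]
        rintro hy ⟨hyM, hyr⟩
        refine hball (mem_ball_iff_norm.2 ?_) hy.2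
        have h1 := hBle y hyM x hx
        have h2 : B * M.chord y x < ε / 2 := by
          have : M.chord y x < ε / (2 * B) := hyr.trans (hr.2.trans_le (min_le_right _ _))
          rw [lt_div_iff₀ (by positivity)] at this
          linarith
        have h3 := hxε.trans_le (min_le_left _ _)
        calc ‖τ y - τ p‖ = ‖(τ y - τ x) + (τ x - τ p)‖ := by rw [sub_add_sub_cancel]
          _ ≤ ‖τ y - τ x‖ + ‖τ x - τ p‖ := norm_add_le _ _
          _ < ε := by linarith
      rw [h, measure_empty]
      exact zero_le
    all_goals
      have h : linearPart M τ L ∩ {y | ‖τ y - τ p‖ < min (ε / 2) (ε / (2 * B))} = ∅ := by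
        refine subset_empty_iff.1 (hempty ▸ inter_subset_inter_right _ fun y hy => ?_)
        have : ‖τ y - τ p‖ < ε / 2 := lt_of_lt_of_le hy (min_le_left _ _)
        simp only [mem_ofPred_eq]
        linarith
      rw [h, measure_empty]
    exact ENNReal.zero_lt_top
  obtain ⟨Λ, hΛ, hΛs⟩ := exists_isometry_inf_orth hL hpL (T.norm_eq p hp)
  have hρ := T.factor_pos p hp
  obtain ⟨δ, hchart, hδD⟩ := T.exists_isMetricChart hp fun v => (hΛ v).1
  set g := fun x => θ (sphChart (τ p) Λ.toContinuousLinearMap x) with hg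
  set s := (ρ p)⁻¹ with hs
  have hs0 : 0 < s := inv_pos.2 hρ
  have hρc : ∀ᶠ v in 𝓝 (0 : Eu m), ρ p / 2 < ρ (g v) := by
    have hgc : ContinuousAt g 0 := (T.contDiffAt_chart (T.norm_eq p hp) (fun v => (hΛ v).1)
      (hδD 0 (Metric.mem_ball_self hchart.radius_pos))).continuousAt
    have hg0 : g 0 = p := by simp only [hg, sphChart_zero, T.left_inv p hp]
    have h1 : Tendsto g (𝓝 0) (𝓝[M.carrier] p) := by
      refine tendsto_nhdsWithin_iff.2 ⟨hg0 ▸ hgc, ?_⟩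
      filter_upwards [Metric.ball_mem_nhds _ hchart.radius_pos] with v hv
      exact hchart.mapsTo v hv
    exact h1.eventually ((T.factor_continuousOn p hp).eventually (lt_mem_nhds (half_lt_self hρ)))
  obtain ⟨δ₁, hδ₁, hρb⟩ := Metric.eventually_nhds_iff_ball.1 hρc
  set δ' := min δ δ₁ with hδ'
  have hδ'0 : 0 < δ' := lt_min hchart.radius_pos hδ₁
  have hchart' := hchart.mono hδ'0 (min_le_left _ _)
  obtain ⟨ε₂, hε₂, hpre'⟩ := T.exists_chart_preimage hp (fun v => (hΛ v).1) hδ'0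
  have hcover' : ∀ y ∈ linearPart M τ L, ‖τ y - τ p‖ < ε₂ → ∃ v ∈ Metric.ball 0 δ', g v = y := by
    intro y hy hyε
    obtain ⟨v, hv, -, h⟩ := hpre' y hy.1 hyε fun hpos => by
      obtain ⟨v, hv⟩ := hΛs ((inner ℝ (τ p) (τ y))⁻¹ • τ y - τ p)
        (L.sub_mem (L.smul_mem _ hy.2) hpL) (by
          rw [inner_sub_right, real_inner_smul_right, inv_mul_cancel₀ hpos.ne',
            real_inner_self_eq_norm_sq, T.norm_eq p hp]
          norm_num)
      exact ⟨v, hv.symm⟩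
    exact ⟨v, hv, h⟩
  -- Two slice points of the ball about x are within 2 B r after τ, so within 4 B r / ρ p in the
  -- chord and 16 B r / (s ρ p) in the chart. Adding 1 makes the inequality strict.
  set E := 16 * B / (s * ρ p) + 1 with hE
  have hE0 : 0 < E := by positivity
  set C := (4 * s * E) ^ m * (haus m (Metric.ball 0 1)).toReal + 1 with hC
  have hhaus : haus m (Metric.ball 0 1) ≠ ⊤ := (haus_ball_lt_top 1 0).ne
  set ε := min (ε₂ / 2) (ε₂ / (2 * B)) with hε
  have hsub : linearPart M τ L ∩ {y | ‖τ y - τ p‖ < ε} ⊆ g '' Metric.ball 0 δ' := by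
    rintro y ⟨hy, hyε⟩
    have : ‖τ y - τ p‖ < ε₂ / 2 := lt_of_lt_of_le hyε (min_le_left _ _)
    exact hcover' y hy (by linarith)
  refine ⟨ε, by positivity, C, by positivity, fun x hx hxε r hr => ?_, fun k hk => ?_, ?_⟩
  · obtain ⟨hr0, hrε⟩ := hr
    have hnear : ∀ y ∈ M.ball x r, ‖τ y - τ x‖ < B * r ∧ ‖τ y - τ p‖ < ε₂ := by
      rintro y ⟨hyM, hyr⟩
      have h1 := hBle y hyM x hx
      have h1' : ‖τ y - τ x‖ < B * r := h1.trans_lt (by gcongr)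
      have h2 : B * r < ε₂ / 2 := by
        have : r < ε₂ / (2 * B) := hrε.trans_le (min_le_right _ _)
        rw [lt_div_iff₀ (by positivity)] at this
        linarith
      have h3 := hxε.trans_le (min_le_left _ _)
      refine ⟨h1', ?_⟩
      calc ‖τ y - τ p‖ = ‖(τ y - τ x) + (τ x - τ p)‖ := by rw [sub_add_sub_cancel]
        _ ≤ ‖τ y - τ x‖ + ‖τ x - τ p‖ := norm_add_le _ _
        _ < ε₂ := by linarith
    -- The centre x need not lie on the slice, so the ball is recentred at some slice point in it.
    rcases (linearPart M τ L ∩ M.ball x r).eq_empty_or_nonempty with hemp | ⟨y₀, hy₀, hy₀r⟩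
    · rw [hemp, measure_empty]; exact zero_le
    obtain ⟨v₀, hv₀, rfl⟩ := hcover' y₀ hy₀ (hnear y₀ hy₀r).2
    have hsub2 : linearPart M τ L ∩ M.ball x r ⊆
        g '' (Metric.ball v₀ (E * r) ∩ Metric.ball 0 δ') := by
      rintro y ⟨hy, hyr⟩
      obtain ⟨v, hv, rfl⟩ := hcover' y hy (hnear y hyr).2
      refine ⟨v, ⟨?_, hv⟩, rfl⟩
      have h1 := hchart'.le_chord v hv v₀ hv₀
      have hv1 := hρb v (Metric.ball_subset_ball (min_le_right _ _) hv)
      have hv2 := hρb v₀ (Metric.ball_subset_ball (min_le_right _ _) hv₀)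
      have hsqrt : ρ p / 2 ≤ √(ρ (g v) * ρ (g v₀)) := by
        refine Real.le_sqrt_of_sq_le ?_
        rw [sq]
        exact mul_le_mul hv1.le hv2.le (by positivity) ((half_pos hρ).le.trans hv1.le)
      have h2 : M.chord (g v) (g v₀) ≤ (2 * B * r) / (ρ p / 2) := by
        rw [T.chord_eq hy.1 hy₀.1]
        have h3 : ‖τ (g v) - τ (g v₀)‖ ≤ 2 * B * r := by
          have h4 := (hnear _ hyr).1
          have h5 := (hnear _ hy₀r).1
          calc ‖τ (g v) - τ (g v₀)‖ = ‖(τ (g v) - τ x) - (τ (g v₀) - τ x)‖ := by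
                rw [sub_sub_sub_cancel_right]
            _ ≤ ‖τ (g v) - τ x‖ + ‖τ (g v₀) - τ x‖ := norm_sub_le _ _
            _ ≤ 2 * B * r := by linarith
        exact div_le_div₀ (by positivity) h3 (by positivity) hsqrt
      rw [Metric.mem_ball]
      calc dist v v₀ = (4 / s) * (s / 4 * dist v v₀) := by field_simp
        _ ≤ (4 / s) * ((2 * B * r) / (ρ p / 2)) := by gcongr; exact h1.trans h2
        _ = (16 * B / (s * ρ p)) * r := by field_simp; norm_num
        _ < E * r := by rw [hE]; nlinarith
    calc M.hausdorff m (linearPart M τ L ∩ M.ball x r)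
        ≤ M.hausdorff m (g '' (Metric.ball v₀ (E * r) ∩ Metric.ball 0 δ')) := measure_mono hsub2
      _ ≤ ENNReal.ofReal (4 * s) ^ (m : ℝ) * haus m (Metric.ball v₀ (E * r) ∩ Metric.ball 0 δ') :=
        hchart'.hausdorff_image_le G (Nat.cast_nonneg m) inter_subset_right
      _ ≤ ENNReal.ofReal (4 * s) ^ (m : ℝ) * haus m (Metric.ball v₀ (E * r)) := by
        gcongr; exact inter_subset_left
      _ = ENNReal.ofReal ((4 * s * E) ^ m * (haus m (Metric.ball 0 1)).toReal * r ^ m) := by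
        rw [haus_ball v₀ (by positivity), ENNReal.rpow_natCast,
          ← ENNReal.ofReal_pow (by positivity), ← ENNReal.ofReal_toReal hhaus,
          ← ENNReal.ofReal_mul (by positivity), ← ENNReal.ofReal_mul (by positivity),
          ENNReal.ofReal_toReal hhaus]
        congr 1
        ring_nf
      _ ≤ ENNReal.ofReal (C * r ^ m) := by
        refine ENNReal.ofReal_le_ofReal ?_
        have : 0 < r ^ m := by positivity
        rw [hC]
        nlinarith
  · refine measure_mono_null hsub (le_antisymm ?_ zero_le)
    have hk0 : 0 ≤ k := (Nat.cast_nonneg m).trans hk.le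
    refine (hchart'.hausdorff_image_le G hk0 Subset.rfl).trans ?_
    rw [Real.hausdorffMeasure_of_finrank_lt (by simpa using hk)]
    simp
  · refine (measure_mono hsub).trans_lt
      ((hchart'.hausdorff_image_le G (Nat.cast_nonneg m) Subset.rfl).trans_lt ?_)
    exact ENNReal.mul_lt_top (ENNReal.rpow_lt_top_of_nonneg (Nat.cast_nonneg m)
      ENNReal.ofReal_ne_top) (haus_ball_lt_top _ _)

omit G in
theorem setOf_norm_sub_lt_mem_nhdsWithin {p : Eu N} (hp : p ∈ M.carrier) {ε : ℝ} (hε : 0 < ε)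
    {S : Set (Eu N)} (hS : S ⊆ M.carrier) : {y | ‖τ y - τ p‖ < ε} ∈ 𝓝[S] p := by
  refine nhdsWithin_mono p hS ?_
  have h : ContinuousWithinAt (fun y => ‖τ y - τ p‖) M.carrier p :=
    ((T.continuousOn p hp).sub continuousWithinAt_const).norm
  exact h.eventually (gt_mem_nhds (by simpa using hε))

theorem hausdorff_linearPart_eq_zero {L : Submodule ℝ (Eu (n + 1))}
    (hL : Module.finrank ℝ L = m + 1) {k : ℝ} (hk : m < k) :
    M.hausdorff k (linearPart M τ L) = 0 := by
  refine measure_null_of_locally_null _ fun p hp => ?_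
  obtain ⟨ε, hε, C, -, -, h, -⟩ := T.exists_local_bound G hL hp.1
  exact ⟨_, inter_mem self_mem_nhdsWithin
    (T.setOf_norm_sub_lt_mem_nhdsWithin hp.1 hε fun y hy => hy.1), h k hk⟩

theorem hausdorff_linearPart_inter_lt_top {L : Submodule ℝ (Eu (n + 1))}
    (hL : Module.finrank ℝ L = m + 1) {S : Set (Eu N)} (hS : S ⊆ M.carrier) (hSc : IsCompact S) :
    M.hausdorff m (linearPart M τ L ∩ S) < ⊤ := by
  refine hSc.induction_on (p := fun S => M.hausdorff m (linearPart M τ L ∩ S) < ⊤) (by simp)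
    (fun s t hst ht => (measure_mono (inter_subset_inter_right _ hst)).trans_lt ht)
    (fun s t hs ht => ?_) fun p hp => ?_
  · rw [inter_union_distrib_left]
    exact measure_union_lt_top hs ht
  · obtain ⟨ε, hε, C, -, -, -, h⟩ := T.exists_local_bound G hL (hS hp)
    exact ⟨_, T.setOf_norm_sub_lt_mem_nhdsWithin (hS hp) hε hS, h⟩

theorem exists_density_bound {κ : Type*} [Fintype κ] {L : κ → Submodule ℝ (Eu (n + 1))}
    (hL : ∀ i, Module.finrank ℝ (L i) = m + 1) {S : Set (Eu N)} (hS : S ⊆ M.carrier)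
    (hSc : IsCompact S) : ∃ C > (0 : ℝ), ∃ R > (0 : ℝ), ∀ x ∈ S, ∀ r ∈ Ioo 0 R,
      M.hausdorff m ((⋃ i, linearPart M τ (L i)) ∩ M.ball x r) ≤ ENNReal.ofReal (C * r ^ m) := by
  have H : ∃ C > (0 : ℝ), ∃ R > (0 : ℝ), ∀ x ∈ S ∩ M.carrier, ∀ r ∈ Ioo 0 R,
      M.hausdorff m ((⋃ i, linearPart M τ (L i)) ∩ M.ball x r) ≤ ENNReal.ofReal (C * r ^ m) := by
    refine hSc.induction_on (p := fun S => ∃ C > (0 : ℝ), ∃ R > (0 : ℝ), ∀ x ∈ S ∩ M.carrier,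
      ∀ r ∈ Ioo 0 R, M.hausdorff m ((⋃ i, linearPart M τ (L i)) ∩ M.ball x r)
        ≤ ENNReal.ofReal (C * r ^ m)) ⟨1, one_pos, 1, one_pos, by simp⟩ ?_ ?_ fun p hp => ?_
    · rintro s t hst ⟨C, hC, R, hR, h⟩
      exact ⟨C, hC, R, hR, fun x hx => h x ⟨hst hx.1, hx.2⟩⟩
    · rintro s t ⟨C, hC, R, hR, h⟩ ⟨C', hC', R', hR', h'⟩
      refine ⟨max C C', by positivity, min R R', by positivity, ?_⟩
      rintro x ⟨hx | hx, hxM⟩ r ⟨hr0, hr⟩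
      · refine (h x ⟨hx, hxM⟩ r ⟨hr0, hr.trans_le (min_le_left _ _)⟩).trans ?_
        gcongr; exact le_max_left _ _
      · refine (h' x ⟨hx, hxM⟩ r ⟨hr0, hr.trans_le (min_le_right _ _)⟩).trans ?_
        gcongr; exact le_max_right _ _
    · choose ε hε C hC h _ _ using fun i => T.exists_local_bound G (hL i) (hS hp)
      obtain ⟨R, hR, hR0⟩ : ∃ R : ℝ, (∀ i, R < ε i) ∧ 0 < R := by
        have h1 : ∀ᶠ R in 𝓝[>] (0 : ℝ), ∀ i, R < ε i :=
          eventually_all.2 fun i => nhdsWithin_le_nhds (gt_mem_nhds (hε i))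
        exact (h1.and self_mem_nhdsWithin).exists
      refine ⟨_, T.setOf_norm_sub_lt_mem_nhdsWithin (hS hp) hR0 hS, (∑ i, C i) + 1,
        by have := Finset.sum_nonneg fun i (_ : i ∈ Finset.univ) => (hC i).le; positivity, R, hR0,
        fun x hx r hr => ?_⟩
      rw [iUnion_inter]
      calc M.hausdorff m (⋃ i, linearPart M τ (L i) ∩ M.ball x r)
          ≤ ∑ i, M.hausdorff m (linearPart M τ (L i) ∩ M.ball x r) := measure_iUnion_fintype_le _ _
        _ ≤ ∑ i, ENNReal.ofReal (C i * r ^ m) := Finset.sum_le_sum fun i _ =>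
          h i x hx.2 (lt_trans hx.1 (hR i)) r ⟨hr.1, hr.2.trans (hR i)⟩
        _ = ENNReal.ofReal (∑ i, C i * r ^ m) := by
          rw [ENNReal.ofReal_sum_of_nonneg fun i _ => by
            have := (hC i).le; have := hr.1; positivity]
        _ ≤ ENNReal.ofReal (((∑ i, C i) + 1) * r ^ m) := by
          refine ENNReal.ofReal_le_ofReal ?_
          have : 0 < r ^ m := by have := hr.1; positivity
          rw [← Finset.sum_mul]
          nlinarith
  obtain ⟨C, hC, R, hR, h⟩ := H
  exact ⟨C, hC, R, hR, fun x hx => h x ⟨hx, hS hx⟩⟩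

end IsConformal

end Linear

/-! ### Dimension of the subspaces of ties. -/

section TieSpace

variable {q N : ℕ} {c : Fin q → Eu N} {R d : ℝ}

/-- The subspace on which the functionals `⟨·, c i⟩`, `i ∈ I`, agree. -/
def tieSpace (c : Fin q → Eu N) (I : Finset (Fin q)) : Submodule ℝ (Eu N) where
  carrier := {w | ∀ i ∈ I, ∀ j ∈ I, inner ℝ w (c i) = inner ℝ w (c j)}
  add_mem' := by
    intro v w hv hw i hi j hj
    rw [inner_add_left, inner_add_left, hv i hi j hj, hw i hi j hj]
  zero_mem' := by intro i _ j _; simp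
  smul_mem' := by
    intro t w hw i hi j hj
    rw [real_inner_smul_left, real_inner_smul_left, hw i hi j hj]

theorem mem_tieSpace_of_subset_minSet {I : Finset (Fin q)} {P : Eu N} (h : I ⊆ minSet c P) :
    P ∈ tieSpace c I := fun _ hi _ hj => inner_eq_of_mem_minSet (h hi) (h hj)

/-- The tie space is the orthogonal complement of the card I - 1 differences c j - c i₀. These are
linearly independent, as products with c k show. -/
theorem IsSimplex.finrank_tieSpace (C : IsSimplex c R d) {I : Finset (Fin q)} (hI : I.Nonempty) :
    Module.finrank ℝ (tieSpace c I) + I.card = N + 1 := by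
  obtain ⟨i₀, hi₀⟩ := hI
  set u : {j // j ∈ I.erase i₀} → Eu N := fun j => c j - c i₀ with hu
  have hd := C.side_pos
  have hli : LinearIndependent ℝ u := by
    rw [Fintype.linearIndependent_iff]
    intro g hg k
    have h1 := congrArg (fun z => inner ℝ z (c k)) hg
    simp only [sum_inner, real_inner_smul_left, inner_zero_left, hu, inner_sub_left] at h1
    have hk0 : i₀ ≠ k := (Finset.ne_of_mem_erase k.2).symm
    have h2 : ∀ j : {j // j ∈ I.erase i₀}, g j * (inner ℝ (c j) (c k) - inner ℝ (c i₀) (c k)) =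
        if j = k then g j * (d ^ 2 / 2) else 0 := by
      intro j
      rw [C.inner_ne hk0]
      split_ifs with hjk
      · rw [hjk, C.inner_self]; ring
      · rw [C.inner_ne fun h => hjk (Subtype.ext h)]; ring
    simp_rw [h2] at h1
    rw [Finset.sum_ite_eq' Finset.univ k, if_pos (Finset.mem_univ k)] at h1
    exact (mul_eq_zero.1 h1).resolve_right (by positivity)
  have hspan : (Submodule.span ℝ (range u))ᗮ = tieSpace c I := by
    ext w
    rw [Submodule.mem_orthogonal]
    constructor
    · intro h
      have h1 : ∀ i ∈ I, inner ℝ w (c i) = inner ℝ w (c i₀) := by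
        intro i hi
        by_cases hii : i = i₀
        · rw [hii]
        · have := h (u ⟨i, Finset.mem_erase.2 ⟨hii, hi⟩⟩) (Submodule.subset_span ⟨_, rfl⟩)
          rw [real_inner_comm, hu, inner_sub_right] at this
          linarith
      exact fun i hi j hj => (h1 i hi).trans (h1 j hj).symm
    · intro h v hv
      induction hv using Submodule.span_induction with
      | mem v hv =>
        obtain ⟨j, rfl⟩ := hv
        rw [real_inner_comm, hu, inner_sub_right, h _ (Finset.mem_of_mem_erase j.2) _ hi₀, sub_self]
      | zero => exact inner_zero_left _
      | add x y _ _ hx hy => rw [inner_add_left, hx, hy, add_zero]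
      | smul a x _ hx => rw [real_inner_smul_left, hx, mul_zero]
  have h1 := Submodule.finrank_add_finrank_orthogonal (Submodule.span ℝ (range u))
  rw [hspan, finrank_span_eq_card hli, Fintype.card_coe, Finset.card_erase_of_mem hi₀,
    finrank_euclideanSpace, Fintype.card_fin] at h1
  have := Finset.card_pos.2 ⟨i₀, hi₀⟩
  omega

end TieSpace

/-! ### Plateau charts and strata of the cells. -/

theorem exists_left_inverse_orth {n : ℕ} {F : Type*} [NormedAddCommGroup F] [NormedSpace ℝ F]
    [FiniteDimensional ℝ F] (hF : Module.finrank ℝ F = n) {P : Eu (n + 1)} (hP : ‖P‖ = 1)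
    {Λ : F →L[ℝ] Eu (n + 1)} (hΛ : ∀ v, inner ℝ P (Λ v) = 0) (hinj : Function.Injective Λ) :
    ∃ Γ : Eu (n + 1) →L[ℝ] F, (∀ v, Γ (Λ v) = v) ∧ ∀ w, inner ℝ P w = 0 → Λ (Γ w) = w := by
  have hP0 : P ≠ 0 := by rintro rfl; simp at hP
  obtain ⟨Γ, hΓ⟩ := Λ.toLinearMap.exists_leftInverse_of_injective (LinearMap.ker_eq_bot.2 hinj)
  have hΓ' : ∀ v, Γ (Λ v) = v := fun v => LinearMap.congr_fun hΓ v
  have : Fact (Module.finrank ℝ (Eu (n + 1)) = n + 1) := ⟨by simp⟩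
  have hrange : LinearMap.range Λ.toLinearMap = (ℝ ∙ P)ᗮ := by
    refine Submodule.eq_of_le_of_finrank_eq ?_ ?_
    · rintro _ ⟨v, rfl⟩
      exact Submodule.mem_orthogonal_singleton_iff_inner_right.2 (hΛ v)
    · rw [LinearMap.finrank_range_of_inj hinj, hF,
        Submodule.finrank_orthogonal_span_singleton (n := n) hP0]
  refine ⟨LinearMap.toContinuousLinearMap Γ, hΓ', fun w hw => ?_⟩
  have hw' : w ∈ LinearMap.range Λ.toLinearMap := by
    rw [hrange]
    exact Submodule.mem_orthogonal_singleton_iff_inner_right.2 hw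
  obtain ⟨v, rfl⟩ := hw'
  exact congrArg Λ (hΓ' v)

theorem finrank_sumZero (k : ℕ) : Module.finrank ℝ (sumZero (k + 1)) = k := by
  set u : Eu (k + 1) := WithLp.toLp 2 fun _ => 1 with hu
  have hu0 : u ≠ 0 := fun h => by
    have := congrArg (fun z : Eu (k + 1) => z 0) h
    simp [hu] at this
  have h : sumZero (k + 1) = (ℝ ∙ u)ᗮ := by
    ext x
    rw [Submodule.mem_orthogonal_singleton_iff_inner_left, PiLp.inner_apply]
    simp [hu, sumZero]
  have : Fact (Module.finrank ℝ (Eu (k + 1)) = k + 1) := ⟨by simp⟩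
  rw [h]
  exact Submodule.finrank_orthogonal_span_singleton hu0

/-- The derivative of a smooth map is Lipschitz on compact sets, so the exponent one is available.
-/
theorem IsSmoothParam.isHolderParam {F : Type*} [NormedAddCommGroup F] [NormedSpace ℝ F] {N : ℕ}
    {O : Set F} {φ : F → Eu N} {S : Set (Eu N)} (h : IsSmoothParam O φ S) :
    IsHolderParam 1 O φ S := by
  refine ⟨h.1, fun K hKO hK => ?_⟩
  obtain ⟨C, hC⟩ := LocallyLipschitzOn.exists_lipschitzOnWith_of_compact (f := fderiv ℝ φ) hK
    fun x hx => by
      have h1 : ContDiffAt ℝ ∞ φ x := h.2.contDiffAt (h.1.isOpen_dom.mem_nhds (hKO hx))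
      have h2 : ContDiffAt ℝ 1 (fderiv ℝ φ) x := h1.fderiv_right (m := 1)
        (WithTop.coe_le_coe.2 (le_top : (1 + 1 : ℕ∞) ≤ ⊤))
      obtain ⟨C, t, ht, hC⟩ := h2.exists_lipschitzOnWith
      exact ⟨C, t, nhdsWithin_le_nhds ht, hC⟩
  exact ⟨C, holderOnWith_one.2 hC⟩

theorem IsSimplex.comp_injective {q k N : ℕ} {c : Fin q → Eu N} {R d : ℝ} (C : IsSimplex c R d)
    {e : Fin k → Fin q} (he : Function.Injective e) : IsSimplex (c ∘ e) R d where
  radius_pos := C.radius_pos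
  side_pos := C.side_pos
  norm_eq _ := C.norm_eq _
  dist_eq _ _ h := C.dist_eq _ _ (he.ne h)

section Plateau

variable {n N q k : ℕ} {M : ModelSpace n N} {b : Eu N →L[ℝ] Eu N →L[ℝ] ℝ} {K : ℝ}
  {τ : Eu N → Eu (n + 1)} {θ : Eu (n + 1) → Eu N} {D : Set (Eu (n + 1))} {ρ : Eu N → ℝ}
  {c : Fin q → Eu (n + 1)} {R d : ℝ}

/-- The tie space of the minimal indices contains P ≠ 0, so its dimension n + 2 - card is positive.
-/
theorem IsSimplex.card_minSet_le [NeZero q] (C : IsSimplex c R d) {P : Eu (n + 1)} (hP : ‖P‖ = 1) :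
    (minSet c P).card ≤ n + 1 := by
  have h1 := C.finrank_tieSpace (minSet_nonempty c P)
  have h2 : 0 < Module.finrank ℝ (tieSpace c (minSet c P)) := by
    rw [Module.finrank_pos_iff_exists_ne_zero]
    refine ⟨⟨P, mem_tieSpace_of_subset_minSet Subset.rfl⟩, fun h => ?_⟩
    rw [Submodule.mk_eq_zero] at h
    rw [h, norm_zero] at hP
    exact zero_ne_one hP
  omega

/-- The linear coordinates near a point at which `k` cells meet. -/
def plateauMap (d : ℝ) (c : Fin k → Eu (n + 1)) (E : Eu (n + 1 - k) →ₗᵢ[ℝ] Eu (n + 1)) :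
    (sumZero k × Eu (n + 1 - k)) →ₗ[ℝ] Eu (n + 1) :=
  ((-(2 / d ^ 2)) • ((Fintype.linearCombination ℝ c).comp
    ((WithLp.linearEquiv 2 ℝ (Fin k → ℝ)).toLinearMap.comp (sumZero k).subtype))).coprod E.toLinearMap

theorem plateauMap_apply (d : ℝ) (c : Fin k → Eu (n + 1)) (E : Eu (n + 1 - k) →ₗᵢ[ℝ] Eu (n + 1))
    (x : sumZero k × Eu (n + 1 - k)) :
    plateauMap d c E x = (-(2 / d ^ 2)) • (∑ l, x.1.1 l • c l) + E x.2 := by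
  simp [plateauMap, Fintype.linearCombination_apply]

namespace IsConformal

variable [NeZero q] (T : IsConformal M τ θ D ρ) (G : IsGeometry M b K) (C : IsSimplex c R d)
include T G C

/-- The tangent space at τ p splits into the span of the differences of the tied c l, parametrized
by `sumZero k`, and the tangent part of the tie space. The central projection of this splitting
straightens Σ. -/
theorem exists_plateauChart {p : Eu N} (hp : p ∈ M.carrier) (hk : (minSet c (τ p)).card = k) :
    ∃ O Ψ, IsSmoothParam O Ψ M.carrier ∧
      IsPlateauChart (n := n) (sigma M (cell M τ c)) k p O Ψ := by
  have hP := T.norm_eq p hp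
  set J := minSet c (τ p) with hJ
  have hkpos : 0 < k := hk ▸ (minSet_nonempty c (τ p)).card_pos
  have hkn : k ≤ n + 1 := hk ▸ C.card_minSet_le hP
  set e := (J.equivFinOfCardEq hk).symm with he
  have heJ : ∀ l, (e l : Fin q) ∈ J := fun l => (e l).2
  have heinj : Function.Injective fun l => (e l : Fin q) :=
    Subtype.val_injective.comp e.injective
  have hesurj : ∀ i ∈ J, ∃ l, (e l : Fin q) = i := fun i hi =>
    ⟨e.symm ⟨i, hi⟩, by rw [Equiv.apply_symm_apply]⟩
  have C' := C.comp_injective heinj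
  set c' : Fin k → Eu (n + 1) := c ∘ fun l => (e l : Fin q) with hc'
  have hd := C.side_pos
  have hfin : Module.finrank ℝ (tieSpace c J) = (n + 1 - k) + 1 := by
    have := C.finrank_tieSpace (minSet_nonempty c (τ p))
    rw [← hJ, hk] at this
    omega
  obtain ⟨E, hE, -⟩ := exists_isometry_inf_orth hfin
    (mem_tieSpace_of_subset_minSet hJ.subset) hP
  set Λ : (sumZero k × Eu (n + 1 - k)) →L[ℝ] Eu (n + 1) :=
    LinearMap.toContinuousLinearMap (plateauMap d c' E) with hΛ
  have hΛx : ∀ x, Λ x = (-(2 / d ^ 2)) • (∑ l, x.1.1 l • c' l) + E x.2 := plateauMap_apply d c' E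
  have hz : ∀ x : sumZero k, ∑ l, x.1 l = 0 := fun x => x.2
  -- The factor -2/d² in `plateauMap` is chosen for this: up to a term not depending on l, the
  -- product with c l is minus the l-th coordinate. Minimal products thus become maximal
  -- coordinates.
  have hin : ∀ x l, inner ℝ (Λ x) (c' l) = -x.1.1 l + inner ℝ (E x.2) (c' l) := by
    intro x l
    rw [hΛx, inner_add_left, real_inner_smul_left, C'.inner_sum (hz x.1)]
    field_simp
  have hEc : ∀ y l m, inner ℝ (E y) (c' l) = inner ℝ (E y) (c' m) := fun y l m =>
    (hE y).2 _ (heJ l) _ (heJ m)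
  have hΛP : ∀ x, inner ℝ (τ p) (Λ x) = 0 := by
    intro x
    have h1 : inner ℝ (τ p) (∑ l, x.1.1 l • c' l) = 0 := by
      refine IsSimplex.inner_sum_eq_zero (hz x.1) fun l hl => absurd ?_ hl
      exact mem_minSet.2 fun m => mem_minSet.1 (heJ l) _
    rw [hΛx, inner_add_right, real_inner_smul_right, h1, (hE x.2).1]
    simp
  have hΛinj : Function.Injective Λ := by
    refine (injective_iff_map_eq_zero Λ).2 fun x hx => ?_
    have h1 : ∀ l, x.1.1 l = inner ℝ (E x.2) (c' ⟨0, hkpos⟩) := by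
      intro l
      have := hin x l
      rw [hx, inner_zero_left, hEc x.2 l ⟨0, hkpos⟩] at this
      linarith
    have h2 := hz x.1
    simp_rw [h1] at h2
    rw [Finset.sum_const, Finset.card_univ, Fintype.card_fin, nsmul_eq_mul] at h2
    have h3 := (mul_eq_zero.1 h2).resolve_left (by positivity)
    have h4 : x.1 = 0 := by
      refine Subtype.ext (PiLp.ext fun l => ?_)
      rw [h1, h3]
      rfl
    have h5 := hΛx x
    rw [hx, h4] at h5
    have h6 : E x.2 = 0 := by simpa using h5.symm
    exact Prod.ext h4 (E.injective (h6.trans (map_zero E).symm))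
  have hF : Module.finrank ℝ (sumZero k × Eu (n + 1 - k)) = n := by
    obtain ⟨k', rfl⟩ : ∃ k', k = k' + 1 := ⟨k - 1, by omega⟩
    rw [Module.finrank_prod, finrank_sumZero, finrank_euclideanSpace, Fintype.card_fin]
    omega
  obtain ⟨Γ, hΓ, hΛΓ⟩ := exists_left_inverse_orth hF hP hΛP hΛinj
  have hsub : ∀ᶠ x in 𝓝 (0 : sumZero k × Eu (n + 1 - k)), minSet c (τ p + Λ x) ⊆ J := by
    have h1 : ContinuousAt (fun x => τ p + Λ x) 0 :=
      (continuous_const.add Λ.continuous).continuousAt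
    refine h1.eventually (p := fun Q => minSet c Q ⊆ J) ?_
    simp only [map_zero, add_zero]
    exact Bubble.eventually_minSet_subset c (τ p)
  obtain ⟨δ, hδ, hball⟩ := Metric.eventually_nhds_iff_ball.1
    ((T.eventually_mem (T.mem p hp) Λ).and hsub)
  refine ⟨Metric.ball 0 δ, fun x => θ (sphChart (τ p) Λ x),
    T.isSmoothParam hP hΛP hΓ hΛΓ Metric.isOpen_ball fun x hx => (hball x hx).1,
    Metric.mem_ball_self hδ, ?_, fun x hx => ?_⟩
  · simp only [sphChart_zero, T.left_inv p hp]
  obtain ⟨hxD, hxJ⟩ := hball x hx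
  have hn := norm_sphChart hP hΛP x
  rw [T.mem_sigma_cell_iff G C, T.right_inv _ hxD hn, minSet_sphChart]
  refine (and_iff_right (T.inv_mem _ hxD hn)).trans ?_
  have key : ∀ l, (e l : Fin q) ∈ minSet c (τ p + Λ x) ↔ ∀ m, x.1.1 m ≤ x.1.1 l := by
    intro l
    rw [mem_minSet_iff_of_subset hxJ]
    refine (and_iff_right (heJ l)).trans ?_
    have h1 : ∀ m, inner ℝ (τ p + Λ x) (c (e l)) ≤ inner ℝ (τ p + Λ x) (c (e m)) ↔
        x.1.1 m ≤ x.1.1 l := by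
      intro m
      rw [inner_add_le_iff (heJ l) (heJ m)]
      have h2 := hin x l
      have h3 := hin x m
      rw [hEc x.2 l m] at h2
      rw [show c (e l) = c' l from rfl, show c (e m) = c' m from rfl, h2, h3]
      constructor <;> intro h <;> linarith
    constructor
    · intro h m
      exact (h1 m).1 (h _ (heJ m))
    · intro h i hi
      obtain ⟨m, rfl⟩ := hesurj i hi
      exact (h1 m).2 (h m)
  have htwo : 2 ≤ (minSet c (τ p + Λ x)).card ↔ _ := Finset.one_lt_card
  rw [htwo]
  constructor
  · rintro ⟨i, hi, j, hj, hij⟩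
    obtain ⟨l, rfl⟩ := hesurj i (hxJ hi)
    obtain ⟨m, rfl⟩ := hesurj j (hxJ hj)
    have hl := (key l).1 hi
    have hm := (key m).1 hj
    exact ⟨l, m, fun h => hij (by rw [h]), le_antisymm (hm l) (hl m), hl⟩
  · rintro ⟨l, m, hlm, heq, hl⟩
    exact ⟨_, (key l).2 hl, _, (key m).2 fun r => heq ▸ hl r, fun h => hlm (heinj h)⟩

/-- All tied cells accumulate at p, and distinct ones occupy distinct chambers of any chart. -/
theorem card_minSet_le_of_plateauChart {p : Eu N} (hp : p ∈ M.carrier) (hk : 0 < k)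
    {O : Set (sumZero k × Eu (n + 1 - k))} {Ψ : sumZero k × Eu (n + 1 - k) → Eu N}
    (hΨ : IsParam O Ψ M.carrier)
    (hS : IsPlateauChart (n := n) (sigma M (cell M τ c)) k p O Ψ) :
    (minSet c (τ p)).card ≤ k := by
  obtain ⟨ε, -, -, f, hf, -⟩ := exists_chamber_injective hk hΨ hS
    (fun i => T.exists_isOpen_inter_eq i) fun i j hij => Set.disjoint_left.2 fun x hxi hxj => by
      have h := (mem_cell.1 hxi).2.symm.trans (mem_cell.1 hxj).2
      exact hij (Finset.singleton_injective h)
  have hcl : ∀ i ∈ minSet c (τ p), p ∈ closure (cell M τ c i) := fun i hi =>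
    (T.mem_closure_cell_iff G C).2 ⟨hp, hi⟩
  have := Fintype.card_le_of_injective
    (fun i : {i // i ∈ minSet c (τ p)} => f ⟨i.1, hcl i.1 i.2⟩) fun i j hij => by
      have := hf hij
      exact Subtype.ext (by simpa using this)
  simpa using this

/-- Points with 2, 3 or 4 tied indices belong to the first three strata by `exists_plateauChart`.
With five or more, a chart over 𝐘 or 𝐓 would have too few chambers. -/
theorem sigmaFour_cell : sigmaFour M (cell M τ c) 1 =
    {p ∈ M.carrier | 5 ≤ (minSet c (τ p)).card} := by
  ext p
  rw [sigmaFour, Set.mem_sdiff, T.mem_sigma_cell_iff G C]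
  constructor
  · rintro ⟨⟨hp, hcard⟩, h⟩
    refine ⟨hp, ?_⟩
    simp only [mem_union, not_or] at h
    obtain ⟨⟨h1, h2⟩, h3⟩ := h
    rw [T.mem_sigmaOne_cell_iff G C] at h1
    by_contra hcon
    have h4 : (minSet c (τ p)).card = 3 ∨ (minSet c (τ p)).card = 4 := by
      have : (minSet c (τ p)).card ≠ 2 := fun h => h1 ⟨hp, h⟩
      omega
    rcases h4 with h4 | h4
    · exact h2 (T.exists_plateauChart G C hp h4)
    · obtain ⟨O, Ψ, hΨ, hS⟩ := T.exists_plateauChart G C hp h4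
      exact h3 ⟨O, Ψ, hΨ.isHolderParam, hS⟩
  · rintro ⟨hp, hcard⟩
    refine ⟨⟨hp, by omega⟩, ?_⟩
    rintro ((h | ⟨O, Ψ, hΨ, hS⟩) | ⟨O, Ψ, hΨ, hS⟩)
    · rw [T.mem_sigmaOne_cell_iff G C] at h
      omega
    · have := T.card_minSet_le_of_plateauChart G C hp (by norm_num) hΨ.1 hS
      omega
    · have := T.card_minSet_le_of_plateauChart G C hp (by norm_num) hΨ.1 hS
      omega

omit [NeZero q] T G C in
theorem subset_iUnion_linearPart (k : ℕ) : {p ∈ M.carrier | k ≤ (minSet c (τ p)).card} ⊆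
    ⋃ I : {I : Finset (Fin q) // I.card = k}, linearPart M τ (tieSpace c I.1) := by
  rintro p ⟨hp, hcard⟩
  obtain ⟨I, hI, hIk⟩ := Finset.exists_subset_card_eq hcard
  exact mem_iUnion.2 ⟨⟨I, hIk⟩, hp, mem_tieSpace_of_subset_minSet hI⟩

omit [NeZero q] T G in
theorem _root_.Bubble.IsSimplex.finrank_tieSpace_eq {k m : ℕ} (hk : 0 < k) (hkm : m + k = n + 1)
    (I : {I : Finset (Fin q) // I.card = k}) : Module.finrank ℝ (tieSpace c I.1) = m + 1 := by
  have hne : I.1.Nonempty := Finset.card_pos.1 (by rw [I.2]; exact hk)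
  have := C.finrank_tieSpace hne
  rw [I.2] at this
  omega

omit [NeZero q] in
theorem hausdorff_le_card_eq_zero {k m : ℕ} (hk : 0 < k) (hkm : m + k = n + 1) {t : ℝ}
    (ht : m < t) : M.hausdorff t {p ∈ M.carrier | k ≤ (minSet c (τ p)).card} = 0 :=
  measure_mono_null (subset_iUnion_linearPart k) (measure_iUnion_null fun I =>
    T.hausdorff_linearPart_eq_zero G (C.finrank_tieSpace_eq hk hkm I) ht)

theorem hausdorff_sigmaFour_lt_top (hn : 3 ≤ n) {S : Set (Eu N)} (hS : S ⊆ M.carrier)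
    (hSc : IsCompact S) :
    M.hausdorff ((n : ℝ) - 4) (sigmaFour M (cell M τ c) 1 ∩ S) < ⊤ := by
  rw [T.sigmaFour_cell G C]
  -- For n = 3 the dimension n - 4 is negative, but at most four indices can tie and the set is
  -- empty.
  by_cases hn4 : n = 3
  · have : {p ∈ M.carrier | 5 ≤ (minSet c (τ p)).card} = ∅ := by
      ext p
      simp only [mem_ofPred_eq, mem_empty_iff_false, iff_false, not_and, not_le]
      intro hp
      have := C.card_minSet_le (T.norm_eq p hp)
      omega
    rw [this, empty_inter, measure_empty]
    exact ENNReal.zero_lt_top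
  · obtain ⟨m, rfl⟩ : ∃ m, n = m + 4 := ⟨n - 4, by omega⟩
    have hcast : ((m + 4 : ℕ) : ℝ) - 4 = m := by push_cast; ring
    rw [hcast]
    refine (measure_mono (inter_subset_inter_left S (subset_iUnion_linearPart 5))).trans_lt ?_
    rw [iUnion_inter]
    refine (measure_iUnion_fintype_le _ _).trans_lt (ENNReal.sum_lt_top.2 fun I _ => ?_)
    exact T.hausdorff_linearPart_inter_lt_top G
      (C.finrank_tieSpace_eq (by norm_num) (by omega) I) hS hSc

end IsConformal

end Plateau

/-! ### Locally finite perimeter of convex sets and of cells. -/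

theorem abs_setIntegral_deriv_le {f f' : ℝ → ℝ} (hf : ∀ t, HasDerivAt f (f' t) t)
    (hf' : Continuous f') {S : Set ℝ} (hS : S.OrdConnected) (hb : S ⊆ Icc 0 1)
    (h1 : ∀ t, |f t| ≤ 1) : |∫ t in S, f' t| ≤ 2 := by
  rcases S.eq_empty_or_nonempty with rfl | hne
  · simp
  have hbb : BddBelow S := bddBelow_Icc.mono hb
  have hba : BddAbove S := bddAbove_Icc.mono hb
  have hab : sInf S ≤ sSup S := csInf_le_csSup hne hbb hba
  have hIoo : Ioo (sInf S) (sSup S) ⊆ S := by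
    rintro t ⟨ht1, ht2⟩
    obtain ⟨s, hs, hst⟩ := exists_lt_of_csInf_lt hne ht1
    obtain ⟨u, hu, htu⟩ := exists_lt_of_lt_csSup hne ht2
    exact hS.out hs hu ⟨hst.le, htu.le⟩
  have hae : S =ᵐ[volume] Ioc (sInf S) (sSup S) := by
    refine EventuallyLE.antisymm ?_ ?_
    · exact (LE.le.eventuallyLE (fun t ht => ⟨csInf_le hbb ht, le_csSup hba ht⟩ :
        S ≤ Icc (sInf S) (sSup S))).trans Ioc_ae_eq_Icc.symm.le
    · exact Ioo_ae_eq_Ioc.symm.le.trans (LE.le.eventuallyLE hIoo)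
  rw [setIntegral_congr_set hae, ← intervalIntegral.integral_of_le hab,
    intervalIntegral.integral_eq_sub_of_hasDerivAt (fun t _ => hf t) (hf'.intervalIntegrable _ _)]
  refine (abs_sub _ _).trans ?_
  linarith [h1 (sSup S), h1 (sInf S)]

/-- The integral is invariant under translation, so it equals its average over translates by t • e,
t ∈ [0, 1]. After exchanging the integrals, the inner one runs over a segment of a line parallel to
e, which the convex A meets in an interval. There the fundamental theorem of calculus bounds it by
2. -/
theorem abs_setIntegral_fderiv_le {F : Type*} [NormedAddCommGroup F] [NormedSpace ℝ F]
    [FiniteDimensional ℝ F] [MeasurableSpace F] [BorelSpace F] (μ : Measure F) [μ.IsAddHaarMeasure]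
    {A : Set F} (hA : Convex ℝ A) (hAm : MeasurableSet A) {f : F → ℝ} (hf : ContDiff ℝ 1 f) {r : ℝ}
    (hr : tsupport f ⊆ Metric.closedBall 0 r) (h1 : ∀ x, |f x| ≤ 1) {e : F} (he : ‖e‖ ≤ 1) :
    |∫ x in A, fderiv ℝ f x e ∂μ| ≤ 2 * μ.real (Metric.closedBall 0 (r + 1)) := by
  set B : Set F := Metric.closedBall 0 (r + 1) with hB
  have hcont : Continuous fun x => fderiv ℝ f x e :=
    (hf.continuous_fderiv (by simp)).clm_apply continuous_const
  set h : F → ℝ := A.indicator fun x => fderiv ℝ f x e with hh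
  have hhm : Measurable h := hcont.measurable.indicator hAm
  have hsupp : ∀ x, x ∉ Metric.closedBall (0 : F) r → fderiv ℝ f x e = 0 := by
    intro x hx
    have : fderiv ℝ f x = 0 := by
      by_contra hne
      exact hx (hr (support_fderiv_subset ℝ hne))
    rw [this]
    rfl
  have hcpt : HasCompactSupport fun x => fderiv ℝ f x e :=
    HasCompactSupport.intro (isCompact_closedBall 0 r) hsupp
  obtain ⟨c, hc⟩ := hcpt.exists_bound_of_continuous hcont
  have hhc : ∀ x, ‖h x‖ ≤ c := fun x => (norm_indicator_le_norm_self _ _).trans (hc x)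
  have hBfin : IsFiniteMeasure (μ.restrict B) := ⟨by
    rw [Measure.restrict_apply_univ]
    exact (isCompact_closedBall 0 (r + 1)).measure_lt_top⟩
  have hIfin : IsFiniteMeasure (volume.restrict (Icc (0 : ℝ) 1)) := ⟨by simp⟩
  -- Radius r + 1 suffices for B since translation moves the support by at most ‖e‖ ≤ 1.
  have hshift : ∀ t ∈ Icc (0 : ℝ) 1, ∫ x in B, h (x + t • e) ∂μ = ∫ x in A, fderiv ℝ f x e ∂μ := by
    intro t ht
    rw [← integral_indicator hAm, ← integral_add_right_eq_self (μ := μ) h (t • e)]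
    refine setIntegral_eq_integral_of_forall_compl_eq_zero fun x hx => ?_
    have : x + t • e ∉ Metric.closedBall (0 : F) r := by
      intro hxr
      refine hx ?_
      rw [hB, mem_closedBall_zero_iff]
      rw [mem_closedBall_zero_iff] at hxr
      have h2 : ‖t • e‖ ≤ 1 := by
        rw [norm_smul, Real.norm_of_nonneg ht.1]
        exact mul_le_one₀ ht.2 (norm_nonneg _) he
      calc ‖x‖ = ‖(x + t • e) - t • e‖ := by rw [add_sub_cancel_right]
        _ ≤ _ := norm_sub_le _ _
        _ ≤ r + 1 := add_le_add hxr h2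
    simp [hh, indicator, hsupp _ this]
  have hconst : ∫ t in Icc (0 : ℝ) 1, ∫ x in B, h (x + t • e) ∂μ =
      ∫ x in A, fderiv ℝ f x e ∂μ := by
    rw [setIntegral_congr_fun measurableSet_Icc hshift]
    simp
  have hswap : ∫ t in Icc (0 : ℝ) 1, ∫ x in B, h (x + t • e) ∂μ =
      ∫ x in B, (∫ t in Icc (0 : ℝ) 1, h (x + t • e)) ∂μ := by
    refine integral_integral_swap ?_
    refine Integrable.of_bound (C := c) ?_ (.of_forall fun z => hhc _)
    have : Measurable fun z : ℝ × F => z.2 + z.1 • e := by fun_prop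
    exact (hhm.comp this).aestronglyMeasurable
  rw [← hconst, hswap, ← Real.norm_eq_abs]
  refine norm_setIntegral_le_of_norm_le_const (isCompact_closedBall 0 (r + 1)).measure_lt_top
    fun x _ => ?_
  rw [Real.norm_eq_abs]
  set S : Set ℝ := (fun t : ℝ => x + t • e) ⁻¹' A with hS
  have hline : Continuous fun t : ℝ => x + t • e := by fun_prop
  have hSm : MeasurableSet S := hline.measurable hAm
  have heq : ∫ t in Icc (0 : ℝ) 1, h (x + t • e) =
      ∫ t in S ∩ Icc 0 1, fderiv ℝ f (x + t • e) e := by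
    rw [← Measure.restrict_restrict hSm, ← integral_indicator hSm]
    rfl
  rw [heq]
  refine abs_setIntegral_deriv_le (f := fun t => f (x + t • e)) (fun t => ?_) (hcont.comp hline)
    ?_ inter_subset_right fun t => h1 _
  · have h2 := (hf.differentiable (by simp) (x + t • e)).hasFDerivAt
    have h3 : HasDerivAt (fun t : ℝ => x + t • e) e t := by
      simpa using ((hasDerivAt_id t).smul_const e).const_add x
    exact h2.comp_hasDerivAt t h3
  · refine (Convex.ordConnected ?_).inter ordConnected_Icc
    intro s hs t ht a b ha hb hab
    have := hA hs ht ha hb hab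
    have h4 : x + (a • s + b • t) • e = a • (x + s • e) + b • (x + t • e) := by
      have : x = (a + b) • x := by rw [hab, one_smul]
      nth_rewrite 1 [this]
      simp only [smul_eq_mul]
      module
    rw [hS, mem_preimage, h4]
    exact this

theorem exists_setIntegral_divergence_le {n : ℕ} {A : Set (Eu n)} (hA : Convex ℝ A)
    (hAm : MeasurableSet A) {K : Set (Eu n)} (hK : IsCompact K) :
    ∃ C : ℝ, ∀ X : Eu n → Eu n, ContDiff ℝ 1 X → tsupport X ⊆ K → (∀ x, ‖X x‖ ≤ 1) →
      ∫ x in A, ∑ i, (pd i X x) i ≤ C := by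
  obtain ⟨r, hr⟩ := hK.isBounded.subset_closedBall 0
  refine ⟨n * (2 * (volume : Measure (Eu n)).real (Metric.closedBall 0 (r + 1))),
    fun X hX hXK hX1 => ?_⟩
  have hXi : ∀ i, ContDiff ℝ 1 fun x => X x i := fun i => by fun_prop
  have hsub : ∀ i, tsupport (fun x => X x i) ⊆ tsupport X := fun i =>
    closure_mono fun x hx h0 => hx (by simp only [h0]; rfl)
  have hpd : ∀ i x, (pd i X x) i = fderiv ℝ (fun x => X x i) x (EuclideanSpace.single i 1) := by
    intro i x
    have h := (EuclideanSpace.proj (𝕜 := ℝ) i).hasFDerivAt.comp x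
      (hX.differentiable (by simp) x).hasFDerivAt
    have h2 : HasFDerivAt (fun x => X x i)
      ((EuclideanSpace.proj (𝕜 := ℝ) i).comp (fderiv ℝ X x)) x := h
    rw [h2.fderiv]
    rfl
  simp_rw [hpd]
  have hint : ∀ i, Integrable (fun x => fderiv ℝ (fun x => X x i) x (EuclideanSpace.single i 1))
      ((volume : Measure (Eu n)).restrict A) := fun i => by
    have hc : Continuous fun x => fderiv ℝ (fun x => X x i) x (EuclideanSpace.single i 1) :=
      ((hXi i).continuous_fderiv (by simp)).clm_apply continuous_const
    refine (hc.integrable_of_hasCompactSupport ?_).integrableOn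
    refine HasCompactSupport.intro hK fun x hx => ?_
    have : fderiv ℝ (fun x => X x i) x = 0 := by
      by_contra hne
      exact hx (hXK (hsub i (support_fderiv_subset ℝ hne)))
    rw [this]
    rfl
  rw [integral_finsetSum _ fun i _ => hint i]
  calc _ ≤ ∑ _i : Fin n, 2 * (volume : Measure (Eu n)).real (Metric.closedBall 0 (r + 1)) := by
        refine Finset.sum_le_sum fun i _ => (le_abs_self _).trans ?_
        refine abs_setIntegral_fderiv_le volume hA hAm (hXi i) ((hsub i).trans (hXK.trans hr))
          (fun x => ?_) (by simp)
        exact (PiLp.norm_apply_le (X x) i).trans (hX1 x)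
    _ = _ := by simp

section

variable {n N q : ℕ} {M : ModelSpace n N} {τ : Eu N → Eu (n + 1)} {θ : Eu (n + 1) → Eu N}
  {D : Set (Eu (n + 1))} {ρ : Eu N → ℝ} {c : Fin q → Eu (n + 1)}

/-- In the central projection the cell is an intersection of half-spaces within the chart ball,
hence convex there. -/
theorem IsConformal.locallyFinitePerimeter_cell [NeZero q] (T : IsConformal M τ θ D ρ) (i : Fin q) :
    LocallyFinitePerimeter M (cell M τ c i) := by
  intro p hp
  have hP := T.norm_eq p hp
  obtain ⟨Λ, hΛP, -⟩ := exists_isometry_orth hP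
  obtain ⟨Γ, hΓ, hΛΓ⟩ := exists_left_inverse_orth (F := Eu n) (by simp) hP
    (Λ := Λ.toContinuousLinearMap) hΛP Λ.injective
  obtain ⟨δ, hδ, hball⟩ := Metric.eventually_nhds_iff_ball.1
    (T.eventually_mem (T.mem p hp) Λ.toContinuousLinearMap)
  refine ⟨Metric.ball 0 δ, fun x => θ (sphChart (τ p) Λ.toContinuousLinearMap x),
    T.isSmoothParam hP hΛP hΓ hΛΓ Metric.isOpen_ball hball,
    ⟨0, Metric.mem_ball_self hδ, by simp only [sphChart_zero, T.left_inv p hp]⟩, fun K hKO hK => ?_⟩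
  set A : Set (Eu n) := {x | ∀ j, j ≠ i → inner ℝ (τ p + Λ x) (c i) < inner ℝ (τ p + Λ x) (c j)}
    with hA
  have hcell : ∀ x ∈ Metric.ball (0 : Eu n) δ,
      θ (sphChart (τ p) Λ.toContinuousLinearMap x) ∈ cell M τ c i ↔ x ∈ A := by
    intro x hx
    have hn := norm_sphChart (Λ := Λ.toContinuousLinearMap) hP hΛP x
    rw [mem_cell, T.right_inv _ (hball x hx) hn, minSet_sphChart, minSet_eq_singleton]
    exact and_iff_right (T.inv_mem _ (hball x hx) hn)
  have hAo : IsOpen A := by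
    simp only [hA, ofPred_forall]
    refine isOpen_iInter_of_finite fun j => isOpen_iInter_of_finite fun _ => ?_
    exact isOpen_lt (by fun_prop) (by fun_prop)
  have hAc : Convex ℝ A := by
    intro x hx y hy a b ha hb hab j hj
    have h1 := hx j hj
    have h2 := hy j hj
    have h3 : τ p + Λ (a • x + b • y) = a • (τ p + Λ x) + b • (τ p + Λ y) := by
      have : τ p = (a + b) • τ p := by rw [hab, one_smul]
      nth_rewrite 1 [this]
      rw [map_add, map_smul, map_smul]
      module
    rw [h3]
    simp only [inner_add_left (_ • _) _, real_inner_smul_left]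
    rcases ha.eq_or_lt with rfl | ha
    · rw [zero_add] at hab
      subst hab
      linarith
    · have := mul_lt_mul_of_pos_left h1 ha
      have := mul_le_mul_of_nonneg_left h2.le hb
      linarith
  obtain ⟨C, hC⟩ := exists_setIntegral_divergence_le hAc hAo.measurableSet hK
  refine ⟨C, fun X hX hXK hX1 => ?_⟩
  have heq : {x ∈ Metric.ball (0 : Eu n) δ |
      θ (sphChart (τ p) Λ.toContinuousLinearMap x) ∈ cell M τ c i} = A ∩ Metric.ball 0 δ := by
    ext x
    exact ⟨fun h => ⟨(hcell x h.1).1 h.2, h.1⟩, fun h => ⟨h.2, (hcell x h.2).2 h.1⟩⟩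
  rw [heq]
  -- X is supported in the chart ball, so the integral may be extended to all of A.
  refine le_of_eq_of_le (setIntegral_eq_of_subset_of_forall_sdiff_eq_zero hAo.measurableSet
    inter_subset_left fun x hx => ?_).symm (hC X hX hXK hX1)
  have : fderiv ℝ X x = 0 := by
    by_contra hne
    exact hx.2 ⟨hx.1, hKO (hXK (support_fderiv_subset ℝ hne))⟩
  simp [pd, this]

end

/-! ### Volume bounds in pointed charts. -/

section Pointed

variable {n N : ℕ} {M : ModelSpace n N} {b : Eu N →L[ℝ] Eu N →L[ℝ] ℝ} {K : ℝ} {p : Eu N}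
  {f : Eu n → Eu N} {δ s : ℝ}

theorem IsPointedChart.hausdorff_ball_le (G : IsGeometry M b K) (h : IsPointedChart M p f δ s)
    {r : ℝ} (hr : 0 < r) (hrδ : M.ball p r ⊆ f '' Metric.ball 0 δ) :
    M.hausdorff n (M.ball p r) ≤ ENNReal.ofReal ((16 * r) ^ n) * haus n (Metric.ball 0 1) := by
  have hs := h.scale_pos
  have h0 : (0 : Eu n) ∈ Metric.ball 0 δ := Metric.mem_ball_self h.radius_pos
  have hsub : M.ball p r ⊆ f '' (Metric.ball 0 (4 * r / s) ∩ Metric.ball 0 δ) := by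
    intro y hy
    obtain ⟨x, hx, rfl⟩ := hrδ hy
    refine ⟨x, ⟨?_, hx⟩, rfl⟩
    have h1 := h.le_chord x hx 0 h0
    have h2 : M.chord (f x) p < r := hy.2
    rw [h.map_zero] at h1
    rw [Metric.mem_ball, lt_div_iff₀ hs]
    linarith
  refine (measure_mono hsub).trans ((h.hausdorff_image_le G (Nat.cast_nonneg n)
    inter_subset_right).trans ?_)
  rw [ENNReal.rpow_natCast]
  refine (mul_le_mul_right (measure_mono inter_subset_left) _).trans ?_
  have := haus_ball (n := n) 0 (r := 4 * r / s) (by positivity)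
  rw [haus] at this ⊢
  rw [this, ← mul_assoc, ← ENNReal.ofReal_pow (by positivity), ← ENNReal.ofReal_mul (by positivity),
    ← mul_pow]
  refine le_of_eq ?_
  congr 3
  field_simp
  ring

theorem IsPointedChart.le_hausdorff_image_ball (G : IsGeometry M b K)
    (h : IsPointedChart M p f δ s) {x : Eu n} {r : ℝ} (hr : 0 < r)
    (hsub : Metric.ball x r ⊆ Metric.ball 0 δ) :
    ENNReal.ofReal ((s / 4 * r) ^ n) * haus n (Metric.ball 0 1) ≤
      M.hausdorff n (f '' Metric.ball x r) := by
  have hs := h.scale_pos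
  have h1 := h.le_hausdorff_image G (Nat.cast_nonneg n) hsub
  rw [ENNReal.rpow_natCast] at h1
  have := haus_ball (n := n) x hr
  rw [haus] at this ⊢
  rw [this] at h1
  calc _ = ENNReal.ofReal (s / 4) ^ n * (ENNReal.ofReal (r ^ n) * μH[n] (Metric.ball (0 : Eu n) 1)) := by
        rw [mul_pow, ENNReal.ofReal_mul (by positivity), ENNReal.ofReal_pow (by positivity), mul_assoc]
    _ ≤ ENNReal.ofReal (s / 4) ^ n * (ENNReal.ofReal (4 / s) ^ n *
          M.hausdorff n (f '' Metric.ball x r)) := by gcongr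
    _ = _ := by
        rw [← mul_assoc, ← mul_pow, ← ENNReal.ofReal_mul (by positivity)]
        have : s / 4 * (4 / s) = 1 := by field_simp
        rw [this]
        simp

end Pointed

/-! ### Lower density bound for components of cells. -/

section Infiltration

variable {n N q : ℕ} {M : ModelSpace n N} {b : Eu N →L[ℝ] Eu N →L[ℝ] ℝ} {K : ℝ}
  {τ : Eu N → Eu (n + 1)} {θ : Eu (n + 1) → Eu N} {D : Set (Eu (n + 1))} {ρ : Eu N → ℝ}
  {c : Fin q → Eu (n + 1)} {R d : ℝ}

theorem minSet_eq_singleton_iff_of_subset {m : ℕ} [NeZero q] {c : Fin q → Eu m} {P v : Eu m}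
    {i : Fin q} (hi : i ∈ minSet c P) (h : minSet c (P + v) ⊆ minSet c P) :
    minSet c (P + v) = {i} ↔ ∀ j ∈ minSet c P, j ≠ i → inner ℝ v (c i) < inner ℝ v (c j) := by
  constructor
  · intro heq j hj hji
    by_contra! hcon
    have h1 := (inner_add_le_iff (v := v) hj hi).2 hcon
    have h2 : i ∈ minSet c (P + v) := heq ▸ Finset.mem_singleton_self i
    have h3 : j ∈ minSet c (P + v) := mem_minSet.2 fun k => h1.trans (mem_minSet.1 h2 k)
    rw [heq, Finset.mem_singleton] at h3
    exact hji h3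
  · intro hlt
    have hsub : minSet c (P + v) ⊆ {i} := by
      intro j hj
      rw [Finset.mem_singleton]
      by_contra hji
      have h1 := (inner_add_le_iff (v := v) (h hj) hi).1 (mem_minSet.1 hj i)
      exact absurd h1 (not_le.2 (hlt j (h hj) hji))
    exact (Finset.subset_singleton_iff.1 hsub).resolve_left (minSet_nonempty c _).ne_empty

/-- Near a closure point p of a component, the cell is the image of a convex cone A, which is
connected and so lies in that component. The cone contains balls of radius proportional to r at
distance of order r, by amounts depending on the simplex only. -/
theorem IsConformal.infiltration_cell [NeZero q] (T : IsConformal M τ θ D ρ) (G : IsGeometry M b K)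
    (C : IsSimplex c R d) : ∃ ε > (0 : ENNReal), ∀ p ∈ M.carrier, ∀ i, ∀ x ∈ cell M τ c i,
    liminf (fun r : ℝ => M.hausdorff n (connectedComponentIn (cell M τ c i) x ∩ M.ball p r)
        / M.hausdorff n (M.ball p r)) (𝓝[>] 0) < ε →
      p ∉ closure (connectedComponentIn (cell M τ c i) x) := by
  have hd := C.side_pos
  have hR := C.radius_pos
  -- With t as below, the inner ball has chart radius r d / (16 s (R + d/2)). The lower bound
  -- multiplies this by s/4 and the upper bound for the ball about p is 16 r, giving 1024 = 64 · 16.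
  refine ⟨ENNReal.ofReal ((d / (1024 * (R + d / 2))) ^ n), by positivity,
    fun p hp i x hx hlim hcl => ?_⟩
  refine absurd hlim (not_lt.2 ?_)
  clear hlim
  have hi : i ∈ minSet c (τ p) :=
    ((T.mem_closure_cell_iff G C).1 (closure_mono (connectedComponentIn_subset _ _) hcl)).2
  have hP := T.norm_eq p hp
  obtain ⟨Λ, hΛ, hΛs⟩ := exists_isometry_orth hP
  have hΛ' : ∀ v, inner ℝ (τ p) (Λ.toContinuousLinearMap v) = 0 := hΛ
  obtain ⟨δ₁, F₁, hD⟩ := T.exists_isPointedChart G hp hΛ hΛs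
  set s := (ρ p)⁻¹ with hsdef
  set f : Eu n → Eu N := fun x => θ (sphChart (τ p) Λ.toContinuousLinearMap x) with hf
  have hsubev : ∀ᶠ x in 𝓝 (0 : Eu n), minSet c (τ p + Λ x) ⊆ minSet c (τ p) := by
    have h1 : ContinuousAt (fun x => τ p + Λ x) 0 :=
      (continuous_const.add Λ.continuous).continuousAt
    refine h1.eventually (p := fun Q => minSet c Q ⊆ minSet c (τ p)) ?_
    simp only [map_zero, add_zero]
    exact Bubble.eventually_minSet_subset c (τ p)
  obtain ⟨δ₂, hδ₂, hJ⟩ := Metric.eventually_nhds_iff_ball.1 hsubev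
  set δ := min δ₁ δ₂ with hδdef
  have hδ : 0 < δ := lt_min F₁.radius_pos hδ₂
  have F : IsPointedChart M p f δ s :=
    { F₁ with toIsMetricChart := F₁.toIsMetricChart.mono hδ (min_le_left _ _) }
  have hs := F.scale_pos
  set A : Set (Eu n) := {x ∈ Metric.ball 0 δ |
    ∀ j ∈ minSet c (τ p), j ≠ i → inner ℝ (Λ x) (c i) < inner ℝ (Λ x) (c j)} with hA
  have hcell : ∀ x ∈ Metric.ball (0 : Eu n) δ, f x ∈ cell M τ c i ↔
      ∀ j ∈ minSet c (τ p), j ≠ i → inner ℝ (Λ x) (c i) < inner ℝ (Λ x) (c j) := by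
    intro x hx
    have hxD := hD x (Metric.ball_subset_ball (min_le_left _ _) hx)
    have hn := norm_sphChart hP hΛ' x
    rw [mem_cell, T.right_inv _ hxD hn, minSet_sphChart]
    exact (and_iff_right (T.inv_mem _ hxD hn)).trans (minSet_eq_singleton_iff_of_subset hi
      (hJ x (Metric.ball_subset_ball (min_le_right _ _) hx)))
  have hAc : Convex ℝ A := by
    refine (convex_ball 0 δ).inter ?_
    intro x hx y hy a b ha hb hab j hj hji
    have h1 := hx j hj hji
    have h2 := hy j hj hji
    simp only [map_add, map_smul, inner_add_left, real_inner_smul_left]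
    rcases ha.eq_or_lt with rfl | ha
    · rw [zero_add] at hab
      subst hab
      linarith
    · have := mul_lt_mul_of_pos_left h1 ha
      have := mul_le_mul_of_nonneg_left h2.le hb
      linarith
  have hAcell : f '' A ⊆ cell M τ c i := by
    rintro _ ⟨y, hy, rfl⟩
    exact (hcell y hy.1).2 hy.2
  obtain ⟨r₁, hr₁, hr₁sub⟩ := F.ball_subset δ hδ
  have hAcomp : f '' A ⊆ connectedComponentIn (cell M τ c i) x := by
    -- A point of the component close to p lies in the image of A, so this image meets the component
    -- and is contained in it.
    obtain ⟨y, hyp, hy⟩ := Metric.mem_closure_iff.1 hcl r₁ hr₁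
    have hyc := connectedComponentIn_subset _ _ hyp
    have hyb : y ∈ M.ball p r₁ := ⟨hyc.1, (G.chord_le y p).trans_lt (by rwa [dist_comm])⟩
    obtain ⟨a, ha, rfl⟩ := hr₁sub hyb
    rw [connectedComponentIn_eq hyp]
    obtain ⟨L, hL⟩ := F.lipschitz
    exact (hAc.isPreconnected.image f (hL.continuousOn.mono fun z hz => hz.1)
      ).subset_connectedComponentIn ⟨a, ⟨ha, (hcell a ha).1 hyc⟩, rfl⟩ hAcell
  -- The tangential part of c i. Moving by -t v makes ⟨·, c i⟩ smaller than each tied ⟨·, c j⟩ by t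
  -- d²/2, which leaves room for a ball of radius t d/2.
  obtain ⟨v, hv⟩ := hΛs (c i - inner ℝ (τ p) (c i) • τ p) (by
    rw [inner_sub_right, real_inner_smul_right, real_inner_self_eq_norm_sq, hP]
    ring)
  have hvR : ‖v‖ ≤ R := by
    rw [← Λ.norm_map, hv]
    refine abs_le_of_sq_le_sq' ?_ hR.le |>.2
    rw [norm_sub_sq_real, norm_smul, hP, real_inner_smul_right, C.norm_eq, real_inner_comm,
      Real.norm_eq_abs, mul_one, sq_abs]
    nlinarith [sq_nonneg (inner ℝ (τ p) (c i))]
  have hcone : ∀ t > 0, t * (R + d / 2) ≤ δ →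
      Metric.ball (-(t • v)) (t * (d / 2)) ⊆ A := by
    intro t ht htδ y hy
    rw [Metric.mem_ball, dist_eq_norm, sub_neg_eq_add] at hy
    refine ⟨?_, fun j hj hji => ?_⟩
    · rw [mem_ball_zero_iff]
      calc ‖y‖ = ‖(y + t • v) - t • v‖ := by rw [add_sub_cancel_right]
        _ ≤ ‖y + t • v‖ + ‖t • v‖ := norm_sub_le _ _
        _ < t * (d / 2) + t * R := by
            refine add_lt_add_of_lt_of_le hy ?_
            rw [norm_smul, Real.norm_of_nonneg ht.le]
            exact mul_le_mul_of_nonneg_left hvR ht.le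
        _ ≤ δ := by linarith
    · have h1 : inner ℝ (Λ v) (c i - c j) = d ^ 2 / 2 := by
        rw [hv, inner_sub_left, real_inner_smul_left, inner_sub_right, inner_sub_right, C.inner_self,
          C.inner_ne hji.symm, inner_eq_of_mem_minSet hi hj]
        ring
      have h2 : inner ℝ (Λ (y + t • v)) (c i - c j) < t * (d / 2) * d := by
        refine (real_inner_le_norm _ _).trans_lt ?_
        rw [Λ.norm_map, C.norm_sub hji.symm]
        exact mul_lt_mul_of_pos_right hy hd
      rw [map_add, map_smul, inner_add_left, real_inner_smul_left, h1, inner_sub_right] at h2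
      linarith
  refine le_liminf_of_le (by isBoundedDefault) ?_
  have hS : 0 < R + d / 2 := by positivity
  filter_upwards [Ioo_mem_nhdsGT (lt_min hr₁ (show 0 < 8 * s * δ by positivity))] with r hr
  have hr0 := hr.1
  have hrr₁ : r < r₁ := hr.2.trans_le (min_le_left _ _)
  have hrδ : r < 8 * s * δ := hr.2.trans_le (min_le_right _ _)
  set t := r / (8 * s * (R + d / 2)) with ht
  have ht0 : 0 < t := by positivity
  have htS : t * (R + d / 2) = r / (8 * s) := by
    rw [ht]
    field_simp
  have htδ : t * (R + d / 2) ≤ δ := by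
    rw [htS, div_le_iff₀ (by positivity)]
    linarith
  have hballA := hcone t ht0 htδ
  have hsubr : f '' Metric.ball (-(t • v)) (t * (d / 2)) ⊆
      connectedComponentIn (cell M τ c i) x ∩ M.ball p r := by
    rintro _ ⟨y, hy, rfl⟩
    have hyA := hballA hy
    refine ⟨hAcomp ⟨y, hyA, rfl⟩, F.mapsTo y hyA.1, ?_⟩
    have h1 := F.chord_le y hyA.1 0 (Metric.mem_ball_self hδ)
    rw [F.map_zero, dist_zero_right] at h1
    refine h1.trans_lt ?_
    rw [Metric.mem_ball, dist_eq_norm, sub_neg_eq_add] at hy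
    have h2 : ‖y‖ ≤ t * (R + d / 2) := by
      calc ‖y‖ = ‖(y + t • v) - t • v‖ := by rw [add_sub_cancel_right]
        _ ≤ ‖y + t • v‖ + ‖t • v‖ := norm_sub_le _ _
        _ ≤ t * (d / 2) + t * R := by
            refine add_le_add hy.le ?_
            rw [norm_smul, Real.norm_of_nonneg ht0.le]
            exact mul_le_mul_of_nonneg_left hvR ht0.le
        _ = _ := by ring
    rw [htS, le_div_iff₀ (by positivity)] at h2
    nlinarith
  have hup := F.hausdorff_ball_le G hr0 fun y hy => hr₁sub ⟨hy.1, hy.2.trans hrr₁⟩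
  have hlow := (F.le_hausdorff_image_ball G (mul_pos ht0 (half_pos hd))
    (hballA.trans fun y hy => hy.1)).trans (measure_mono hsubr)
  have hω : haus n (Metric.ball 0 1) ≠ 0 := (haus_ball_pos one_pos 0).ne'
  have hω' : haus n (Metric.ball 0 1) ≠ ⊤ := (haus_ball_lt_top 1 0).ne
  have hne : M.hausdorff n (connectedComponentIn (cell M τ c i) x ∩ M.ball p r) ≠ 0 := by
    refine ((ENNReal.mul_pos ?_ hω).trans_le hlow).ne'
    rw [Ne, ENNReal.ofReal_eq_zero, not_le]
    positivity
  have htop : M.hausdorff n (M.ball p r) ≠ ⊤ :=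
    (hup.trans_lt (ENNReal.mul_lt_top ENNReal.ofReal_lt_top hω'.lt_top)).ne
  rw [ENNReal.le_div_iff_mul_le (Or.inr hne) (Or.inl htop)]
  refine (mul_le_mul_right hup _).trans (le_of_eq_of_le ?_ hlow)
  rw [← mul_assoc, ← ENNReal.ofReal_mul (by positivity), ← mul_pow]
  congr 3
  rw [ht]
  field_simp
  norm_num

end Infiltration

/-! ### The cells form a regular partition with flat interfaces. -/

section RegularCells

variable {n N q : ℕ} {M : ModelSpace n N} {b : Eu N →L[ℝ] Eu N →L[ℝ] ℝ} {K : ℝ}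
  {τ : Eu N → Eu (n + 1)} {θ : Eu (n + 1) → Eu N} {D : Set (Eu (n + 1))} {ρ : Eu N → ℝ}
  {c : Fin q → Eu (n + 1)} {R d : ℝ}

theorem minSet_eq_pair_iff {P : Eu (n + 1)} {i j : Fin q} :
    minSet c P = {i, j} ↔ inner ℝ P (c i) = inner ℝ P (c j) ∧
      ∀ k, k ≠ i → k ≠ j → inner ℝ P (c i) < inner ℝ P (c k) := by
  constructor
  · intro h
    have hi : i ∈ minSet c P := by rw [h]; simp
    have hj : j ∈ minSet c P := by rw [h]; simp
    refine ⟨inner_eq_of_mem_minSet hi hj, fun k hki hkj => inner_lt_of_notMem_minSet hi ?_⟩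
    rw [h]
    simp [hki, hkj]
  · rintro ⟨heq, hlt⟩
    have hle : ∀ k, inner ℝ P (c i) ≤ inner ℝ P (c k) := by
      intro k
      by_cases hki : k = i
      · rw [hki]
      by_cases hkj : k = j
      · rw [hkj, heq]
      exact (hlt k hki hkj).le
    ext k
    rw [mem_minSet, Finset.mem_insert, Finset.mem_singleton]
    constructor
    · intro hk
      by_contra! hcon
      exact absurd (hk i) (not_le.2 (hlt k hcon.1 hcon.2))
    · rintro (rfl | rfl)
      · exact hle
      · exact fun k => heq ▸ hle k

namespace IsConformal

variable [NeZero q] (T : IsConformal M τ θ D ρ) (G : IsGeometry M b K) (C : IsSimplex c R d)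
include T G C

theorem isPartition_cell (hn : 1 ≤ n) : IsPartition M (cell M τ c) where
  subset i x hx := hx.1
  measurable i := by
    obtain ⟨W, hW, h⟩ := T.exists_isOpen_inter_eq (c := c) i
    rw [h]
    exact G.isClosed.measurableSet.inter hW.measurableSet
  perimeter i := T.locallyFinitePerimeter_cell i
  disjoint i j hij := Set.disjoint_left.2 fun x hxi hxj =>
    hij (Finset.singleton_injective ((mem_cell.1 hxi).2.symm.trans (mem_cell.1 hxj).2))
  null := by
    obtain ⟨m, rfl⟩ : ∃ m, n = m + 1 := ⟨n - 1, by omega⟩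
    refine measure_mono_null (fun p hp => ?_) (T.hausdorff_le_card_eq_zero G C (k := 2) (m := m)
      (by norm_num) rfl (t := ((m + 1 : ℕ) : ℝ)) (by push_cast; linarith))
    refine ⟨hp.1, ?_⟩
    by_contra hcard
    have h1 := (minSet_nonempty c (τ p)).card_pos
    obtain ⟨i, hi⟩ := Finset.card_eq_one.1 (show (minSet c (τ p)).card = 1 by omega)
    exact hp.2 (mem_iUnion.2 ⟨i, mem_cell.2 ⟨hp.1, hi⟩⟩)
  locallyFinite _ _ _ := Set.toFinite _

theorem isRegular_cell (hn : 3 ≤ n) : IsRegular M (cell M τ c) where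
  toIsPartition := T.isPartition_cell G C (by omega)
  isOpen i := T.exists_isOpen_inter_eq i
  closure_reduced i := T.closure_reducedBoundary_cell G C i
  null_bdry i := by
    obtain ⟨m, rfl⟩ : ∃ m, n = m + 2 := ⟨n - 2, by omega⟩
    -- Outside the reduced boundary at least three indices tie, which happens on slices of dimension
    -- n - 2.
    refine measure_mono_null (fun p hp => ?_) (T.hausdorff_le_card_eq_zero G C (k := 3) (m := m)
      (by norm_num) rfl (t := ((m + 2 : ℕ) : ℝ) - 1) (by push_cast; linarith))
    obtain ⟨hpM, hi, hne⟩ := (T.mem_bdry_cell_iff G C).1 hp.1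
    refine ⟨hpM, ?_⟩
    by_contra hcard
    have h1 : (minSet c (τ p)).card ≠ 2 := fun h =>
      hp.2 ((T.mem_reducedBoundary_cell_iff G C).2 ⟨hpM, hi, h⟩)
    have h2 := Finset.card_pos.2 ⟨i, hi⟩
    obtain ⟨k, hk⟩ := Finset.card_eq_one.1 (show (minSet c (τ p)).card = 1 by omega)
    rw [hk, Finset.mem_singleton] at hi
    exact hne (by rw [hk, hi])
  flat p hp := by
    obtain ⟨hpM, hcard⟩ := (T.mem_sigmaOne_cell_iff G C).1 hp
    exact T.exists_plateauChart G C hpM hcard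
  strata := by
    refine ⟨1, one_pos, ?_, fun S hS hSc => T.hausdorff_sigmaFour_lt_top G C hn hS hSc⟩
    rw [T.sigmaFour_cell G C]
    exact T.isClosed_le_card G c 5
  density S hS hSc := by
    obtain ⟨m, rfl⟩ : ∃ m, n = m + 1 := ⟨n - 1, by omega⟩
    obtain ⟨B, hB, r₀, hr₀, h⟩ := T.exists_density_bound G
      (C.finrank_tieSpace_eq (k := 2) (m := m) (by norm_num) rfl) hS hSc
    refine ⟨B, hB, r₀, hr₀, fun x hx r hr => ?_⟩
    have hcast : ((m + 1 : ℕ) : ℝ) - 1 = m := by push_cast; ring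
    rw [hcast]
    refine (measure_mono (inter_subset_inter_left _ fun p hp => ?_)).trans (h x hx.2 r hr)
    exact subset_iUnion_linearPart 2 ((T.mem_sigma_cell_iff G C).1 hp)
  infiltration := T.infiltration_cell G C

theorem isRelOpen_image_interface_cell {i j : Fin q} (hij : i ≠ j) :
    IsRelOpen (τ '' interface M (cell M τ c) i j)
      (genSphere (sphere n) (d⁻¹ • (c i - c j)) 0) := by
  have hd := C.side_pos
  refine ⟨D ∩ {Q | ∀ k, k ≠ i → k ≠ j → inner ℝ Q (c i) < inner ℝ Q (c k)},
    T.isOpen.inter ?_, ?_⟩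
  · simp only [ofPred_forall]
    exact isOpen_iInter_of_finite fun k => isOpen_iInter_of_finite fun _ =>
      isOpen_iInter_of_finite fun _ => isOpen_lt (by fun_prop) (by fun_prop)
  have key : ∀ Q, Q ∈ genSphere (sphere n) (d⁻¹ • (c i - c j)) 0 ↔
      ‖Q‖ = 1 ∧ inner ℝ Q (c i) = inner ℝ Q (c j) := by
    intro Q
    rw [mem_genSphere_sphere, norm_smul, C.norm_sub hij, real_inner_smul_left, inner_sub_left,
      real_inner_comm, real_inner_comm Q (c j), Real.norm_of_nonneg (inv_pos.2 hd).le,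
      inv_mul_cancel₀ hd.ne']
    constructor
    · rintro ⟨h1, h2, -⟩
      rw [add_zero] at h2
      exact ⟨h1, sub_eq_zero.1 ((mul_eq_zero.1 h2).resolve_left (inv_pos.2 hd).ne')⟩
    · rintro ⟨h1, h2⟩
      exact ⟨h1, by rw [h2]; ring, by norm_num⟩
  ext Q
  rw [mem_inter_iff, key]
  constructor
  · rintro ⟨x, hx, rfl⟩
    obtain ⟨hxM, hxJ⟩ := (T.mem_interface_cell_iff G C hij).1 hx
    obtain ⟨h1, h2⟩ := minSet_eq_pair_iff.1 hxJ
    exact ⟨⟨T.norm_eq x hxM, h1⟩, T.mem x hxM, h2⟩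
  · rintro ⟨⟨h1, h2⟩, h3, h4⟩
    refine ⟨θ Q, (T.mem_interface_cell_iff G C hij).2 ⟨T.inv_mem Q h3 h1, ?_⟩, T.right_inv Q h3 h1⟩
    rw [T.right_inv Q h3 h1]
    exact minSet_eq_pair_iff.2 ⟨h2, h4⟩

end IsConformal

end RegularCells

/-! ### Standard partitions as Voronoi partitions. -/

section Standard

variable {n q : ℕ} {c : Fin q → Eu (n + 1)} {R d : ℝ} {T S : Eu (n + 1) → Eu (n + 1)}
  {A : (Eu (n + 1) × ℝ) ≃ₗ[ℝ] (Eu (n + 1) × ℝ)}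

/-- The parameters of the transformed cells are the Lorentz images of the vectors (c i / d, 0).
Invariance of the form turns their products with (x, 1) into a positive multiple of ⟨S x, c i⟩, the
same multiple for all i, so comparisons are preserved. -/
theorem IsLorentzAction.exists_lor_apply_eq (h : IsLorentzAction T S A) {x : Eu (n + 1)}
    (hx : ‖x‖ = 1) (d : ℝ) (hd : 0 < d) : ∃ μ > 0, ∀ w : Eu (n + 1),
      inner ℝ (A (d⁻¹ • w, 0)).1 x - (A (d⁻¹ • w, 0)).2 = μ * inner ℝ (S x) w := by
  have h1 := h.symm.pos x hx
  refine ⟨(A.symm (x, 1)).2 * d⁻¹, by positivity, fun w => ?_⟩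
  have h2 := h.lor_map (A.symm (x, 1)) (d⁻¹ • w, 0)
  rw [A.apply_symm_apply, h.symm.apply_eq hx] at h2
  simp only [lor, Prod.smul_mk, real_inner_smul_left, real_inner_smul_right, mul_zero, sub_zero,
    one_mul] at h2
  rw [real_inner_comm, h2]
  ring

/-- Division by the side length d makes the differences unit spacelike vectors, as generalized
spheres require. -/
theorem IsLorentzAction.norm_sub_sq_sub_sq (h : IsLorentzAction T S A) (C : IsSimplex c R d)
    {i j : Fin q} (hij : i ≠ j) :
    ‖(A (d⁻¹ • c i, 0)).1 - (A (d⁻¹ • c j, 0)).1‖ ^ 2 -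
      ((A (d⁻¹ • c i, 0)).2 - (A (d⁻¹ • c j, 0)).2) ^ 2 = 1 := by
  have hd := C.side_pos
  have h1 := h.lor_map (d⁻¹ • c i - d⁻¹ • c j, 0) (d⁻¹ • c i - d⁻¹ • c j, 0)
  have h2 : A (d⁻¹ • c i - d⁻¹ • c j, 0) = A (d⁻¹ • c i, 0) - A (d⁻¹ • c j, 0) := by
    rw [← map_sub]
    simp
  rw [h2] at h1
  simp only [lor, Prod.fst_sub, Prod.snd_sub, mul_zero, sub_zero, real_inner_self_eq_norm_sq] at h1
  rw [← smul_sub, norm_smul, C.norm_sub hij, Real.norm_of_nonneg (inv_pos.2 hd).le,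
    inv_mul_cancel₀ hd.ne'] at h1
  linarith

theorem IsLorentzAction.isVoronoiS [NeZero q] (hn : 3 ≤ n) (h : IsLorentzAction T S A)
    (C : IsSimplex c R d) : IsVoronoiS (cell (sphere n) (S ∘ id) c)
      (fun i => (A (d⁻¹ • c i, 0)).1) (fun i => -(A (d⁻¹ • c i, 0)).2) := by
  have G := isGeometry_sphere n
  have F := (isConformal_sphere n).comp_lorentz h.symm
  have hd := C.side_pos
  have hR := C.radius_pos
  refine { (F.isPartition_cell G C (by omega)).toIsGeneralizedPartition with
    nonempty := fun i => ?_, spherical := fun i j hij _ => ?_, voronoi := fun i => ?_ }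
  · have h1 : ‖-(R⁻¹ • c i)‖ = 1 := by
      rw [norm_neg, norm_smul, C.norm_eq, Real.norm_of_nonneg (inv_pos.2 hR).le,
        inv_mul_cancel₀ hR.ne']
    refine ⟨T (-(R⁻¹ • c i)), mem_cell.2 ⟨h.norm_map _ h1, ?_⟩⟩
    simp only [Function.comp_apply, id]
    rw [h.left_inv _ h1, minSet_eq_singleton]
    intro j hj
    rw [inner_neg_left, inner_neg_left, real_inner_smul_left, real_inner_smul_left, C.inner_self,
      C.inner_ne hj.symm, neg_lt_neg_iff]
    exact mul_lt_mul_of_pos_left (by nlinarith) (inv_pos.2 hR)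
  · refine ⟨{x | ∀ k, k ≠ i → k ≠ j → inner ℝ (A (d⁻¹ • c i, 0)).1 x - (A (d⁻¹ • c i, 0)).2 <
      inner ℝ (A (d⁻¹ • c k, 0)).1 x - (A (d⁻¹ • c k, 0)).2}, ?_, ?_⟩
    · simp only [ofPred_forall]
      exact isOpen_iInter_of_finite fun k => isOpen_iInter_of_finite fun _ =>
        isOpen_iInter_of_finite fun _ => isOpen_lt (by fun_prop) (by fun_prop)
    ext x
    rw [F.mem_interface_cell_iff G C hij, mem_inter_iff, mem_genSphere_sphere, minSet_eq_pair_iff]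
    refine ⟨fun ⟨hx, h1, h2⟩ => ?_, fun ⟨⟨hx, h1, _⟩, h2⟩ => ?_⟩
    · obtain ⟨μ, hμ, H⟩ := h.exists_lor_apply_eq hx d hd
      refine ⟨⟨hx, ?_, ?_⟩, fun k hki hkj => ?_⟩
      · rw [inner_sub_left]
        have h3 := H (c i)
        have h4 := H (c j)
        have h5 : inner ℝ (S x) (c i) = inner ℝ (S x) (c j) := h1
        rw [h5] at h3
        linarith
      · rw [← h.norm_sub_sq_sub_sq C hij]
        ring
      · rw [H, H]
        exact mul_lt_mul_of_pos_left (h2 k hki hkj) hμ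
    · obtain ⟨μ, hμ, H⟩ := h.exists_lor_apply_eq hx d hd
      refine ⟨hx, ?_, fun k hki hkj => ?_⟩
      · rw [inner_sub_left] at h1
        have h3 := H (c i)
        have h4 := H (c j)
        exact mul_left_cancel₀ hμ.ne' (by simp only [Function.comp_apply, id]; linarith)
      · have h3 := h2 k hki hkj
        rw [H, H] at h3
        exact lt_of_mul_lt_mul_left h3 hμ.le
  · ext x
    rw [mem_cell, minSet_eq_singleton]
    refine and_congr_right fun hx => forall₂_congr fun j _ => ?_
    obtain ⟨μ, hμ, H⟩ := h.exists_lor_apply_eq hx d hd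
    rw [← sub_eq_add_neg, ← sub_eq_add_neg, H, H]
    exact (mul_lt_mul_iff_right₀ hμ).symm

/-- Together with the next identity this inverts the exchange of last coordinate and curvature in
`isRelOpen_image_stereoH`, providing hyperbolic parameters from spherical ones. -/
theorem mink_pairVec_eq {y : Eu (n + 1)} (hy : 0 < y (Fin.last n)) (w : Eu (n + 1)) (s : ℝ) :
    mink (pairVec (lowerPart w) s) y - -w (Fin.last n) =
      y (Fin.last n) * (inner ℝ w (stereoH y) - s) := by
  rw [mink_eq_lowerPart, lowerPart_pairVec, pairVec_last, inner_eq_lowerPart, lowerPart_stereoH,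
    stereoH_last, real_inner_smul_right]
  field_simp
  ring

theorem mink_self_pairVec_add (v w : Eu (n + 1)) (s t : ℝ) :
    mink (pairVec (lowerPart v) s - pairVec (lowerPart w) t)
        (pairVec (lowerPart v) s - pairVec (lowerPart w) t) +
      (-v (Fin.last n) - -w (Fin.last n)) ^ 2 = ‖v - w‖ ^ 2 - (s - t) ^ 2 := by
  rw [mink_eq_lowerPart, lowerPart_sub, lowerPart_pairVec, lowerPart_pairVec, PiLp.sub_apply,
    pairVec_last, pairVec_last, norm_sq_eq_lowerPart, lowerPart_sub, PiLp.sub_apply,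
    real_inner_self_eq_norm_sq]
  ring

theorem IsLorentzAction.isVoronoiH [NeZero q] (hn : 3 ≤ n) (h : IsLorentzAction T S A)
    (C : IsSimplex c R d) (hne : ∀ i, (cell (hyperbolic n) (S ∘ stereoH) c i).Nonempty) :
    IsVoronoiH (cell (hyperbolic n) (S ∘ stereoH) c)
      (fun i => pairVec (lowerPart (A (d⁻¹ • c i, 0)).1) (A (d⁻¹ • c i, 0)).2)
      (fun i => -(A (d⁻¹ • c i, 0)).1 (Fin.last n)) := by
  have G := isGeometry_hyperbolic n
  have F := (isConformal_hyperbolic (n := n)).comp_lorentz h.symm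
  have hd := C.side_pos
  have H : ∀ y ∈ (hyperbolic n).carrier, ∃ μ > 0, ∀ i,
      mink (pairVec (lowerPart (A (d⁻¹ • c i, 0)).1) (A (d⁻¹ • c i, 0)).2) y -
        -(A (d⁻¹ • c i, 0)).1 (Fin.last n) = μ * inner ℝ (S (stereoH y)) (c i) := by
    intro y hy
    obtain ⟨μ, hμ, H⟩ := h.exists_lor_apply_eq (norm_stereoH hy) d hd
    have hy0 := (mem_hyperbolic.1 hy).2
    refine ⟨y (Fin.last n) * μ, by positivity, fun i => ?_⟩
    rw [mink_pairVec_eq hy0, H, mul_assoc]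
  refine { F.isPartition_cell G C (by omega) with
    nonempty := hne, spherical := fun i j hij _ => ?_, voronoi := fun i => ?_ }
  · refine ⟨{y | ∀ k, k ≠ i → k ≠ j →
      mink (pairVec (lowerPart (A (d⁻¹ • c i, 0)).1) (A (d⁻¹ • c i, 0)).2) y -
        -(A (d⁻¹ • c i, 0)).1 (Fin.last n) <
      mink (pairVec (lowerPart (A (d⁻¹ • c k, 0)).1) (A (d⁻¹ • c k, 0)).2) y -
        -(A (d⁻¹ • c k, 0)).1 (Fin.last n)}, ?_, ?_⟩
    · simp only [ofPred_forall, ← minkL_apply]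
      exact isOpen_iInter_of_finite fun k => isOpen_iInter_of_finite fun _ =>
        isOpen_iInter_of_finite fun _ => isOpen_lt (by fun_prop) (by fun_prop)
    ext x
    rw [F.mem_interface_cell_iff G C hij, mem_inter_iff, mem_genSphere_hyperbolic,
      minSet_eq_pair_iff]
    refine ⟨fun ⟨hx, h1, h2⟩ => ?_, fun ⟨⟨hx, h1, _⟩, h2⟩ => ?_⟩
    · obtain ⟨μ, hμ, H⟩ := H x hx
      refine ⟨⟨hx, ?_, ?_⟩, fun k hki hkj => ?_⟩
      · rw [mink_sub_left]
        have h3 := H i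
        have h4 := H j
        have h5 : inner ℝ (S (stereoH x)) (c i) = inner ℝ (S (stereoH x)) (c j) := h1
        rw [h5] at h3
        linarith
      · rw [mink_self_pairVec_add, h.norm_sub_sq_sub_sq C hij]
      · rw [H, H]
        exact mul_lt_mul_of_pos_left (h2 k hki hkj) hμ
    · obtain ⟨μ, hμ, H⟩ := H x hx
      refine ⟨hx, ?_, fun k hki hkj => ?_⟩
      · rw [mink_sub_left] at h1
        have h3 := H i
        have h4 := H j
        exact mul_left_cancel₀ hμ.ne' (by simp only [Function.comp_apply]; linarith)
      · have h3 := h2 k hki hkj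
        rw [H, H] at h3
        exact lt_of_mul_lt_mul_left h3 hμ.le
  · ext x
    rw [mem_cell, minSet_eq_singleton]
    refine and_congr_right fun hx => forall₂_congr fun j _ => ?_
    obtain ⟨μ, hμ, H⟩ := H x hx
    rw [H, H]
    exact (mul_lt_mul_iff_right₀ hμ).symm

/-- The image under T is the preimage under its inverse S, which brings all standard partitions into
the form `cell`. The map S is also the one that flattens the interfaces. -/
theorem IsStandardS.exists_eq_cell {Ω : Fin q → Set (Eu (n + 1))} (h : IsStandardS Ω) :
    ∃ T S A c R d, IsMobius S ∧ IsLorentzAction (N := n + 1) T S A ∧ IsSimplex c R d ∧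
      Ω = cell (sphere n) (S ∘ id) c := by
  obtain ⟨T, c, R, d, hT, hR, hd, hcR, hcd, hΩ⟩ := h
  obtain ⟨S, A, hS, hA⟩ := hT.exists_isLorentzAction
  refine ⟨T, S, A, c, R, d, hS, hA, ⟨hR, hd, hcR, hcd⟩, ?_⟩
  ext i x
  rw [hΩ, mem_cell, minSet_eq_singleton]
  constructor
  · rintro ⟨p, ⟨hp, hlt⟩, rfl⟩
    have hp' : ‖p‖ = 1 := hp
    refine ⟨hA.norm_map p hp', ?_⟩
    simp only [Function.comp_apply, id]
    rwa [hA.left_inv p hp']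
  · rintro ⟨hx, hlt⟩
    exact ⟨S x, ⟨hA.norm_inv x hx, hlt⟩, hA.right_inv x hx⟩

theorem IsStandardS.isRegular_and_isVoronoiS (hn : 3 ≤ n) (hq : 2 ≤ q)
    {Ω : Fin q → Set (Eu (n + 1))} (h : IsStandardS Ω) :
    IsRegular (sphere n) Ω ∧ (∃ c κ, IsVoronoiS Ω c κ) ∧ IsMobiusFlatS Ω := by
  have : NeZero q := ⟨by omega⟩
  obtain ⟨T, S, A, c, R, d, hS, hA, C, rfl⟩ := h.exists_eq_cell
  have G := isGeometry_sphere n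
  have F := (isConformal_sphere n).comp_lorentz hA.symm
  refine ⟨F.isRegular_cell G C hn, ⟨_, _, hA.isVoronoiS hn C⟩, S, hS, ?_⟩
  rintro _ ⟨-, i, j, hij, rfl⟩
  exact ⟨_, F.isRelOpen_image_interface_cell G C hij⟩

theorem IsStandardR.isRegular_and_isVoronoiR (hn : 3 ≤ n) (hq : 2 ≤ q)
    {Ω : Fin q → Set (Eu n)} (h : IsStandardR Ω) :
    IsRegular (euclid n) Ω ∧ ∃ ΩS c κ, IsVoronoiR Ω ΩS c κ ∧ IsMobiusFlatS ΩS := by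
  have : NeZero q := ⟨by omega⟩
  obtain ⟨ΩS, hΩS, hΩ⟩ := h
  obtain ⟨-, ⟨c', κ', V⟩, hF⟩ := hΩS.isRegular_and_isVoronoiS hn hq
  obtain ⟨T, S, A, c, R, d, -, hA, C, hcell⟩ := hΩS.exists_eq_cell
  have G := isGeometry_euclid n
  have F := (isConformal_euclid (n := n)).comp_lorentz hA.symm
  have hΩ' : Ω = cell (euclid n) (S ∘ stereoR) c := by
    ext i x
    rw [hΩ, hcell, mem_preimage, mem_cell, mem_cell]
    exact and_congr_left fun _ => ⟨fun _ => mem_univ x, fun _ => norm_stereoR x⟩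
  have hreg : IsRegular (euclid n) Ω := by
    rw [hΩ']
    exact F.isRegular_cell G C hn
  exact ⟨hreg, ΩS, c', κ', { hreg.toIsPartition with voronoi := V, pull_back := hΩ }, hF⟩

theorem IsStandardH.isRegular_and_isVoronoiH (hn : 3 ≤ n) (hq : 2 ≤ q)
    {Ω : Fin q → Set (Eu (n + 1))} (h : IsStandardH Ω) :
    IsRegular (hyperbolic n) Ω ∧ (∃ c κ, IsVoronoiH Ω c κ) ∧ IsMobiusFlatH Ω := by
  have : NeZero q := ⟨by omega⟩
  obtain ⟨ΩS, hΩS, hΩ⟩ := h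
  obtain ⟨T, S, A, c, R, d, hS, hA, C, hcell⟩ := hΩS.exists_eq_cell
  have G := isGeometry_hyperbolic n
  have F := (isConformal_hyperbolic (n := n)).comp_lorentz hA.symm
  obtain rfl : Ω = cell (hyperbolic n) (S ∘ stereoH) c := by
    ext i x
    rw [(hΩ i).1, hcell, mem_inter_iff, mem_preimage, mem_cell, mem_cell]
    exact and_congr_right fun hx => and_iff_right (norm_stereoH hx)
  refine ⟨F.isRegular_cell G C hn, ⟨_, _, hA.isVoronoiH hn C fun i => (hΩ i).2⟩, S, hS, ?_⟩
  rintro _ ⟨_, ⟨-, i, j, hij, rfl⟩, rfl⟩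
  have := F.isRelOpen_image_interface_cell G C hij
  rw [image_comp] at this
  exact ⟨_, this⟩

end Standard

end Bubble

end

/-! ### The main theorem. -/

open Bubble in
theorem mainTheorem2 (n : ℕ) (hn : 3 ≤ n) :
    -- the sphere
    (∀ (ι : Type*) [Countable ι] [Nontrivial ι] (Ω : ι → Set (Eu (n + 1)))
        (c : ι → Eu (n + 1)) (κ : ι → ℝ),
      IsRegular (sphere n) Ω → IsVoronoiS Ω c κ → IsMobiusFlatS Ω →
      (∃ ξ, IsFlatVectorS Ω c κ ξ) ∧
      ∀ ξ, IsFlatVectorS Ω c κ ξ →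
        IsFlattening (sphere n) Ω (potentialS ξ) ∧ IsGood (sphere n) Ω (potentialS ξ)) ∧
    -- Euclidean space
    (∀ (ι : Type*) [Countable ι] [Nontrivial ι] (Ω : ι → Set (Eu n)) (ΩS : ι → Set (Eu (n + 1)))
        (c : ι → Eu (n + 1)) (κ : ι → ℝ),
      IsRegular (euclid n) Ω → IsVoronoiR Ω ΩS c κ → IsMobiusFlatS ΩS →
      (∃ ξ, IsFlatVectorS ΩS c κ ξ) ∧
      ∀ ξ, IsFlatVectorS ΩS c κ ξ →
        IsFlattening (euclid n) Ω (potentialR ξ) ∧ IsGood (euclid n) Ω (potentialR ξ)) ∧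
    -- hyperbolic space
    (∀ (ι : Type*) [Countable ι] [Nontrivial ι] (Ω : ι → Set (Eu (n + 1)))
        (c : ι → Eu (n + 1)) (κ : ι → ℝ),
      IsRegular (hyperbolic n) Ω → IsVoronoiH Ω c κ → IsMobiusFlatH Ω →
      (∃ ξ, IsFlatVectorH Ω c κ ξ) ∧
      (∀ ξ, IsFlatVectorH Ω c κ ξ →
        IsFlattening (hyperbolic n) Ω (potentialH ξ) ∧
        JacobiSatisfies (hyperbolic n) Ω (potentialH ξ)
          (fun l => l = ((n : ℝ) - 1) * ξ (Fin.last n)) ∧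
        RicciVEq (hyperbolic n) Ω (potentialH ξ) (((n : ℝ) - 2) * ξ (Fin.last n)) ∧
        (0 < ξ (Fin.last n) →
          IsFlattening (hyperbolic n) Ω (fun y => potentialH ξ y / ξ (Fin.last n)) ∧
          IsGood (hyperbolic n) Ω (fun y => potentialH ξ y / ξ (Fin.last n))) ∧
        (ξ (Fin.last n) ≤ 0 →
          JacobiSatisfies (hyperbolic n) Ω (potentialH ξ) (fun l => l ≤ 0))) ∧
      ∃ V, IsFlattening (hyperbolic n) Ω V ∧
        (IsGood (hyperbolic n) Ω V ∨ JacobiSatisfies (hyperbolic n) Ω V (fun l => l ≤ 0))) ∧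
    -- standard partitions
    (∀ q : ℕ, 2 ≤ q → q ≤ n + 2 →
      (∀ Ω : Fin q → Set (Eu (n + 1)), IsStandardS Ω →
        IsRegular (sphere n) Ω ∧ (∃ c κ, IsVoronoiS Ω c κ) ∧ IsMobiusFlatS Ω ∧
        ∃ V, IsFlattening (sphere n) Ω V ∧ IsGood (sphere n) Ω V) ∧
      (∀ Ω : Fin q → Set (Eu n), IsStandardR Ω →
        IsRegular (euclid n) Ω ∧ (∃ ΩS c κ, IsVoronoiR Ω ΩS c κ ∧ IsMobiusFlatS ΩS) ∧
        ∃ V, IsFlattening (euclid n) Ω V ∧ IsGood (euclid n) Ω V) ∧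
      (∀ Ω : Fin q → Set (Eu (n + 1)), IsStandardH Ω →
        IsRegular (hyperbolic n) Ω ∧ (∃ c κ, IsVoronoiH Ω c κ) ∧ IsMobiusFlatH Ω ∧
        ∃ V, IsFlattening (hyperbolic n) Ω V ∧
          (IsGood (hyperbolic n) Ω V ∨
            JacobiSatisfies (hyperbolic n) Ω V (fun l => l ≤ 0)))) := by
  have hn2 : 2 ≤ n := by omega
  refine ⟨fun ι _ _ Ω c κ R V F => ⟨V.exists_isFlatVectorS hn2 F, fun ξ hξ => V.isFlattening hn2 R hξ⟩,
    fun ι _ _ Ω ΩS c κ R V F => ⟨V.voronoi.exists_isFlatVectorS hn2 F,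
      fun ξ hξ => V.isFlattening hn2 R hξ⟩,
    fun ι _ _ Ω c κ R V F => ⟨V.exists_isFlatVectorH hn2 F, fun ξ hξ => V.isFlattening hn2 R hξ,
      V.exists_isFlattening hn2 R F⟩, fun q hq _ => ⟨fun Ω h => ?_, fun Ω h => ?_, fun Ω h => ?_⟩⟩
  · obtain ⟨R, ⟨c, κ, V⟩, F⟩ := h.isRegular_and_isVoronoiS hn hq
    obtain ⟨ξ, hξ⟩ := V.exists_isFlatVectorS hn2 F
    exact ⟨R, ⟨c, κ, V⟩, F, _, V.isFlattening hn2 R hξ⟩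
  · obtain ⟨R, ΩS, c, κ, V, F⟩ := h.isRegular_and_isVoronoiR hn hq
    obtain ⟨ξ, hξ⟩ := V.voronoi.exists_isFlatVectorS hn2 F
    exact ⟨R, ⟨ΩS, c, κ, V, F⟩, _, V.isFlattening hn2 R hξ⟩
  · obtain ⟨R, ⟨c, κ, V⟩, F⟩ := h.isRegular_and_isVoronoiH hn hq
    exact ⟨R, ⟨c, κ, V⟩, F, V.exists_isFlattening hn2 R F⟩
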